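/- **Setting.** Let $N,m_*\in\mathbb N$ with $m_*\ge 36(N+10)$, and let $g$ be a $C^{m_*}$ Riemannian metric near the origin of the plane whose Gaussian curvature vanishes there to finite order $N$. Let $y=(y^1,y^2)$ be coordinates obtained by a $C^{m_*}$ change of coordinates fixing the origin in which, near the origin, the Gaussian curvature $K$ is positive in the sector $0<y^2<y^1$ and zero on its two bounding rays. Write $g_{ij},\Gamma_{ij}^k,\nabla_{ij},|g|=\det(g_{ij})$ in these coordinates and $\Phi[z]=\det\nabla_{ij}z-K|g|(1-|\nabla_gz|^2)$. Let $z_0=\frac a2(y^1)^2+\sum_{n=3}^{m_*}p_n(y)$ with $a>0$, $p_n$ a homogeneous polynomial of degree $n$, and $\partial^\alpha\Phi[z_0](0)=0$ for $|\alpha|\le m_*-2$. For $\varepsilon>0$ put $y=\varepsilon^2x$. For $w=w(x)$ smooth on $\{|x|<1\}$ with $|w|_{C^4}<1$ (the supremum of all partial derivatives of order at most $4$) let $z=z_0+\varepsilon^5w$, $\Phi(w)=\Phi[z]$, $\mathcal L(w)u=\frac d{dt}\Phi(w+tu)|_{t=0}$, and let $(a^{ij})$ be the cofactor matrix of $(\nabla_{ij}z)$.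 The operator $L(w)$ is defined by $$\varepsilon^{-1}\mathcal L(w)u=a^{22}L(w)u+(a^{22})^{-1}\Phi(w)\bigl[\partial_{x^1}^2u-\partial_{x^1}\log(a^{22}\sqrt{|g|})\,\partial_{x^1}u\bigr].$$ For $\sigma,\delta>0$ let $\xi=(\xi^1(x),x^2)$ be the $C^{m_*-2}$ change of coordinates with $a^{12}\xi^1_{x^1}+a^{22}\xi^1_{x^2}=0$ and $\xi^1(t,t)=t/\tan\delta$ for $0\le t\le\sigma\tan\delta$, from an open subset of $\{|x|<1\}$ onto a neighbourhood of the closed triangle $0\le\xi^1\le\sigma$, $0\le\xi^2\le\xi^1\tan\delta$. In these coordinates $L(w)u=\partial_{\xi^1}(k\,\partial_{\xi^1}u)+\partial_{\xi^2}^2u+c\,\partial_{\xi^1}u+d\,\partial_{\xi^2}u$ for some functions $k,c,d$. With $\xi^1=r\cos\theta$, $\xi^2=r\sin\theta$, write it as $\mathcal Ku_{rr}+\mathcal Au_{r\theta}+\mathcal Bu_{\theta\theta}+\mathcal Cu_r+\mathcal Du_\theta$ on $\Omega=\{0<r<\sigma,\ 0<\theta<\delta\}$. Let $\varphi\in C^\infty([0,\infty))$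 be nonnegative, equal to $1$ for $0<r<\sigma/2$ and to $0$ for $r>\sigma$, and set $$Lu=\varphi^2\mathcal Ku_{rr}+\varphi\mathcal Au_{r\theta}+\mathcal Bu_{\theta\theta}+\varphi\mathcal Cu_r+\varphi\mathcal Du_\theta .$$ For $\lambda,\gamma>0$ let $\overline C^\infty(\Omega)$ be the functions smooth up to $\partial\Omega$ that vanish near $r=0$, let $H^{(m,l,\gamma)}(\Omega)$ be its closure in the norm $$\|u\|^2_{(m,l,\gamma)}=\int_\Omega\ \sum_{\substack{0\le s\le m,\ 0\le t\le l\\ s+t\le\max(m,l)}}\lambda^{-s}r^{-\gamma+2s}(\partial_r^s\partial_\theta^tu)^2\,dr\,d\theta ,$$ and let $\widehat C^\infty(\Omega)$ be the set of $v\in\overline C^\infty(\Omega)$ with $v(r,0)=v(r,\delta)=0$. Given $f\in H^{(m,1,\gamma)}(\Omega)$, a weak solution in $H^{(m,1,\gamma)}(\Omega)$ of the boundary value problem $$Lu=f\ \text{ in }\Omega,\qquad u(r,0)=u(r,\delta)=0,\qquad \partial_r^su(0,\theta)=0\quad(0\le s\le s_0)$$ is a function $u\in H^{(m,1,\gamma)}(\Omega)$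 with $(u,L^*v)=(f,v)$ for all $v\in\widehat C^\infty(\Omega)$, where $(\cdot,\cdot)$ is the $L^2(\Omega;dr\,d\theta)$ inner product and $L^*$ the formal adjoint of $L$ (the conditions at $r=0$ are expressed through the weight of the space). **Theorem 3.1.** Let $g$, the coordinates $y$, $z_0$, $\sigma,\lambda,\gamma>0$, $\varphi$ and an integer $m$ with $1\le m\le m_*-4$ be given. There is $\delta_0>0$ such that for every $\delta\in(0,\delta_0)$ there is $\varepsilon_0>0$ such that for every $\varepsilon\in(0,\varepsilon_0)$ and every smooth $w$ with $|w|_{C^4}<1$: a coordinate change $\xi$ as above exists, and for every such $\xi$ and every $f\in H^{(m,1,\gamma)}(\Omega)$ the boundary value problem has a weak solution $u\in H^{(m,1,\gamma)}(\Omega)$. -/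

import Mathlib

open Set Filter Topology MeasureTheory
open scoped ContDiff

noncomputable section

namespace EllipticSector

/-- The coordinate plane.  Coordinates are numbered `0, 1` (the paper's upper indices `1, 2`). -/
abbrev Plane : Type := Fin 2 → ℝ

/-- Partial derivative in the `i`-th coordinate of the plane. -/
def pd (i : Fin 2) (f : Plane → ℝ) : Plane → ℝ :=
  fun y => fderiv ℝ f y (Pi.single i 1)

/-! ### Riemannian metrics on the plane and the Darboux operator -/

/-- A metric is given by its coefficient matrix `(g_ij)`. -/
abbrev Metric2 : Type := Plane → Matrix (Fin 2) (Fin 2) ℝ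

/-- `g` is a Riemannian metric of class `C^n` on a neighbourhood of the origin. -/
def IsMetricNearZero (n : ℕ) (g : Metric2) : Prop :=
  (∀ i j, ContDiffAt ℝ (n : ℕ∞) (fun y => g y i j) 0) ∧ ∀ᶠ y in 𝓝 (0 : Plane), (g y).PosDef

/-- Christoffel symbols `Γ^k_ij`. -/
def christoffel (g : Metric2) (k i j : Fin 2) (y : Plane) : ℝ :=
  (1 / 2) * ∑ l, (g y)⁻¹ k l *
    (pd i (fun q => g q j l) y + pd j (fun q => g q i l) y - pd l (fun q => g q i j) y)

/-- Components of the curvature tensor: `R(∂_i, ∂_j) ∂_k = ∑ l, riemann g l k i j ∂_l`. -/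
def riemann (g : Metric2) (l k i j : Fin 2) (y : Plane) : ℝ :=
  pd i (christoffel g l j k) y - pd j (christoffel g l i k) y
    + ∑ q, (christoffel g l i q y * christoffel g q j k y
        - christoffel g l j q y * christoffel g q i k y)

/-- Gaussian curvature `⟨R(∂_1, ∂_2) ∂_2, ∂_1⟩ / det g`. -/
def gaussCurvature (g : Metric2) (y : Plane) : ℝ :=
  (∑ l, g y 0 l * riemann g l 1 0 1 y) / (g y).det

/-- The pull-back `Ψ^* g` of a metric. -/
def pullback (Ψ : Plane → Plane) (g : Metric2) : Metric2 := fun y =>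
  Matrix.of fun i j => ∑ a, ∑ b,
    g (Ψ y) a b * pd i (fun q => Ψ q a) y * pd j (fun q => Ψ q b) y

/-- Covariant Hessian `∇_ij z`. -/
def covHess (g : Metric2) (z : Plane → ℝ) (y : Plane) : Matrix (Fin 2) (Fin 2) ℝ :=
  Matrix.of fun i j => pd i (pd j z) y - ∑ k, christoffel g k i j y * pd k z y

/-- `z^l = g^{li} ∂_i z`. -/
def gradUp (g : Metric2) (z : Plane → ℝ) (l : Fin 2) (y : Plane) : ℝ :=
  ∑ i, (g y)⁻¹ l i * pd i z y

/-- `⟨∇_g z, ∇_g u⟩`. -/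
def gradInner (g : Metric2) (z u : Plane → ℝ) (y : Plane) : ℝ :=
  ∑ l, gradUp g z l y * pd l u y

/-- The Darboux operator `det ∇_ij z - K |g| (1 - |∇_g z|^2)`. -/
def darboux (K : Plane → ℝ) (g : Metric2) (z : Plane → ℝ) (y : Plane) : ℝ :=
  (covHess g z y).det - K y * (g y).det * (1 - gradInner g z z y)

/-- `K` vanishes at the origin to the finite order `N`. -/
def VanishesToOrder (N : ℕ) (K : Plane → ℝ) : Prop :=
  (∀ j < N, iteratedFDeriv ℝ j K 0 = 0) ∧ iteratedFDeriv ℝ N K 0 ≠ 0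

/-- `Ψ` is a `C^n` coordinate system `y ↦ Ψ y` around the origin in which the sector
`0 < y² < y¹` is (near the origin) an elliptic region: the curvature `K` of `g` is positive
there and vanishes on the two bounding rays.  (If `K⁻¹(0)` consists of two `C^n` curves crossing
transversally, each component of `K > 0` is straightened in this way.) -/
def IsSectorChart (n : ℕ) (g : Metric2) (Ψ : Plane → Plane) : Prop :=
  Ψ 0 = 0 ∧ ContDiffAt ℝ (n : ℕ∞) Ψ 0 ∧ (fderiv ℝ Ψ 0).det ≠ 0 ∧
  (∀ᶠ y in 𝓝 (0 : Plane), 0 < y 1 → y 1 < y 0 → 0 < gaussCurvature g (Ψ y)) ∧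
  (∀ᶠ y in 𝓝 (0 : Plane), 0 ≤ y 0 → (y 1 = 0 ∨ y 1 = y 0) → gaussCurvature g (Ψ y) = 0)

/-- The polynomial `(a/2) (y¹)² + ∑_{n=3}^{ms} p_n(y)`. -/
def approxPoly (a : ℝ) (ms : ℕ) (p : ℕ → MvPolynomial (Fin 2) ℝ) (y : Plane) : ℝ :=
  a / 2 * y 0 ^ 2 + ∑ n ∈ Finset.Icc 3 ms, MvPolynomial.eval y (p n)

/-- The polynomial is an approximate solution: the `p_n` are homogeneous of degree `n`, `a > 0`,
and all derivatives of order at most `ms - 2` of the Darboux expression vanish at the origin. -/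
def IsApproxSolution (K : Plane → ℝ) (g : Metric2) (a : ℝ) (ms : ℕ)
    (p : ℕ → MvPolynomial (Fin 2) ℝ) : Prop :=
  0 < a ∧ (∀ n, (p n).IsHomogeneous n) ∧
  ∀ j ≤ ms - 2, iteratedFDeriv ℝ j (darboux K g (approxPoly a ms p)) 0 = 0

/-! ### The modified linearized operator in the rescaled coordinates `x = y / ε²` -/

/-- The function `z = z₀ + ε⁵ w`, in the coordinates `y`, for `w` a function of `x = y / ε²`. -/
def perturb (ε : ℝ) (z₀ w : Plane → ℝ) (y : Plane) : ℝ :=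
  z₀ y + ε ^ 5 * w ((ε ^ 2)⁻¹ • y)

/-- The matrix `a^{ij}` at the point `x`: the cofactor matrix of the covariant Hessian of `z`. -/
def cof (g : Metric2) (ε : ℝ) (z : Plane → ℝ) (i j : Fin 2) (x : Plane) : ℝ :=
  (covHess g z (ε ^ 2 • x)).adjugate i j

/-- Second order coefficients, in the coordinates `x`, of `ε⁻¹ 𝓛(w)`, the scaled linearization
of the Darboux operator, are `cof`; these are its first order coefficients. -/
def linFirst (K : Plane → ℝ) (g : Metric2) (ε : ℝ) (z : Plane → ℝ) (l : Fin 2) (x : Plane) : ℝ :=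
  -ε ^ 2 * ((∑ i, ∑ j, cof g ε z i j x * christoffel g l i j (ε ^ 2 • x))
    - 2 * K (ε ^ 2 • x) * (g (ε ^ 2 • x)).det * gradUp g z l (ε ^ 2 • x))

/-- Second order coefficients, in the coordinates `x`, of the operator `L(w)` determined by
`ε⁻¹ 𝓛(w) u = a²² L(w) u + (a²²)⁻¹ Φ(w) [∂₁² u - ∂₁ log (a²² √|g|) ∂₁ u]`. -/
def opSecond (K : Plane → ℝ) (g : Metric2) (ε : ℝ) (z : Plane → ℝ) (i j : Fin 2) (x : Plane) : ℝ :=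
  (cof g ε z 1 1 x)⁻¹ * (cof g ε z i j x -
    if i = 0 ∧ j = 0 then (cof g ε z 1 1 x)⁻¹ * darboux K g z (ε ^ 2 • x) else 0)

/-- First order coefficients of the same operator. -/
def opFirst (K : Plane → ℝ) (g : Metric2) (ε : ℝ) (z : Plane → ℝ) (l : Fin 2) (x : Plane) : ℝ :=
  (cof g ε z 1 1 x)⁻¹ * (linFirst K g ε z l x +
    if l = 0 then (cof g ε z 1 1 x)⁻¹ * darboux K g z (ε ^ 2 • x) *
      pd 0 (fun q => Real.log (cof g ε z 1 1 q * √((g (ε ^ 2 • q)).det))) x else 0)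

/-- The open unit disc of the rescaled coordinates. -/
def unitDisc : Set Plane := {x | x 0 ^ 2 + x 1 ^ 2 < 1}

/-- `w` is smooth on the unit disc, with `|w|_{C^4} < 1` (supremum of all partial derivatives of
order at most four). -/
def IsAdmissible (w : Plane → ℝ) : Prop :=
  ContDiffOn ℝ ∞ w unitDisc ∧
  ∃ c < 1, ∀ x ∈ unitDisc, ∀ i j : ℕ, i + j ≤ 4 → |((pd 0)^[i] ((pd 1)^[j] w)) x| ≤ c

/-! ### The coordinates `ξ` -/

/-- First component of a coordinate change `x ↦ ξ`. -/
def comp0 (ξ : OpenPartialHomeomorph Plane Plane) (x : Plane) : ℝ := ξ x 0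

/-- `ξ = (ξ¹(x), x²)` is the `C^n` coordinate change with
`a¹² ∂₁ξ¹ + a²² ∂₂ξ¹ = 0` and `ξ¹(t, t) = t / tan δ`, on a neighbourhood of the closed triangle
`0 ≤ ξ¹ ≤ σ`, `0 ≤ ξ² ≤ ξ¹ tan δ` (which contains the sector `0 < θ < δ`, `0 < r < σ`). -/
def IsCanonicalChart (n : ℕ) (σ δ : ℝ) (g : Metric2) (ε : ℝ) (z : Plane → ℝ)
    (ξ : OpenPartialHomeomorph Plane Plane) : Prop :=
  ξ.source ⊆ unitDisc ∧
  ContDiffOn ℝ (n : ℕ∞) ξ ξ.source ∧ ContDiffOn ℝ (n : ℕ∞) ξ.symm ξ.target ∧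
  {q : Plane | 0 ≤ q 0 ∧ q 0 ≤ σ ∧ 0 ≤ q 1 ∧ q 1 ≤ q 0 * Real.tan δ} ⊆ ξ.target ∧
  (∀ x ∈ ξ.source, ξ x 1 = x 1) ∧
  (∀ x ∈ ξ.source,
    cof g ε z 0 1 x * pd 0 (comp0 ξ) x + cof g ε z 1 1 x * pd 1 (comp0 ξ) x = 0) ∧
  (∀ t ∈ Icc 0 (σ * Real.tan δ), ![t, t] ∈ ξ.source ∧ ξ ![t, t] 0 = t / Real.tan δ)

/-! In the coordinates `ξ` the operator is
`L(w) u = k ∂₁² u + ∂₂² u + b ∂₁ u + d ∂₂ u` (so `b = c + ∂₁ k` when it is written as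
`∂₁ (k ∂₁ u) + ∂₂² u + c ∂₁ u + d ∂₂ u`).  The coefficients are given as functions of `x`. -/

/-- The coefficient `k`. -/
def coefk (K : Plane → ℝ) (g : Metric2) (ε : ℝ) (z : Plane → ℝ)
    (ξ : OpenPartialHomeomorph Plane Plane) (x : Plane) : ℝ :=
  ∑ i, ∑ j, opSecond K g ε z i j x * pd i (comp0 ξ) x * pd j (comp0 ξ) x

/-- The coefficient `b = c + ∂k/∂ξ¹`: the operator applied to the function `ξ¹`. -/
def coefb (K : Plane → ℝ) (g : Metric2) (ε : ℝ) (z : Plane → ℝ)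
    (ξ : OpenPartialHomeomorph Plane Plane) (x : Plane) : ℝ :=
  (∑ i, ∑ j, opSecond K g ε z i j x * pd i (pd j (comp0 ξ)) x)
    + ∑ i, opFirst K g ε z i x * pd i (comp0 ξ) x

/-- The coefficient `d`: the operator applied to the function `ξ² = x²`. -/
def coefd (K : Plane → ℝ) (g : Metric2) (ε : ℝ) (z : Plane → ℝ) (x : Plane) : ℝ :=
  opFirst K g ε z 1 x

/-! ### Polar coordinates, the cut-off operator and its formal adjoint -/

/-- The point `x` with `ξ(x) = (r cos θ, r sin θ)`. -/
def polarPoint (ξ : OpenPartialHomeomorph Plane Plane) (q : ℝ × ℝ) : Plane :=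
  ξ.symm ![q.1 * Real.cos q.2, q.1 * Real.sin q.2]

/-- `φ ∈ C^∞([0,∞))` is a nonnegative cut-off function. -/
def IsCutoff (σ : ℝ) (φ : ℝ → ℝ) : Prop :=
  ContDiffOn ℝ ∞ φ (Ici 0) ∧ (∀ r, 0 ≤ r → 0 ≤ φ r) ∧
  (∀ r, 0 < r → r < σ / 2 → φ r = 1) ∧ (∀ r, σ < r → φ r = 0)

/-- The coefficients of
`L u = K̄ u_rr + Ā u_rθ + B̄ u_θθ + C̄ u_r + D̄ u_θ`, functions of `(r, θ)`. -/
structure PolarOperator where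
  (K A B C D : ℝ × ℝ → ℝ)

/-- The cut-off operator `L` obtained from
`k ∂₁² + ∂₂² + b ∂₁ + d ∂₂`, the coefficients `k b d` being functions of `(r, θ)`. -/
def polarOperator (φ : ℝ → ℝ) (k b d : ℝ × ℝ → ℝ) : PolarOperator where
  K := fun q => φ q.1 ^ 2 * (k q * Real.cos q.2 ^ 2 + Real.sin q.2 ^ 2)
  A := fun q => φ q.1 * (2 * (1 - k q) * (Real.sin q.2 * Real.cos q.2 / q.1))
  B := fun q => k q * (Real.sin q.2 ^ 2 / q.1 ^ 2) + Real.cos q.2 ^ 2 / q.1 ^ 2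
  C := fun q => φ q.1 * (k q * (Real.sin q.2 ^ 2 / q.1) + Real.cos q.2 ^ 2 / q.1
    + b q * Real.cos q.2 + d q * Real.sin q.2)
  D := fun q => φ q.1 * (2 * (k q - 1) * (Real.sin q.2 * Real.cos q.2 / q.1 ^ 2)
    - b q * (Real.sin q.2 / q.1) + d q * (Real.cos q.2 / q.1))

/-- The operator `L` attached to the data. -/
def theOperator (φ : ℝ → ℝ) (K : Plane → ℝ) (g : Metric2) (ε : ℝ) (z : Plane → ℝ)
    (ξ : OpenPartialHomeomorph Plane Plane) : PolarOperator :=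
  polarOperator φ (fun q => coefk K g ε z ξ (polarPoint ξ q))
    (fun q => coefb K g ε z ξ (polarPoint ξ q)) (fun q => coefd K g ε z (polarPoint ξ q))

/-- `∂/∂r`. -/
def dr (v : ℝ × ℝ → ℝ) : ℝ × ℝ → ℝ := fun q => deriv (fun r => v (r, q.2)) q.1

/-- `∂/∂θ`. -/
def dθ (v : ℝ × ℝ → ℝ) : ℝ × ℝ → ℝ := fun q => deriv (fun θ => v (q.1, θ)) q.2

/-- The formal adjoint
`L^* v = (K̄v)_rr + (Āv)_rθ + (B̄v)_θθ - (C̄v)_r - (D̄v)_θ` with respect to `dr dθ`. -/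
def PolarOperator.adjoint (P : PolarOperator) (v : ℝ × ℝ → ℝ) : ℝ × ℝ → ℝ := fun q =>
  dr (dr (P.K * v)) q + dr (dθ (P.A * v)) q + dθ (dθ (P.B * v)) q - dr (P.C * v) q - dθ (P.D * v) q

/-! ### Function spaces on the rectangle -/

/-- The rectangle `0 < r < σ`, `0 < θ < δ`. -/
def rect (σ δ : ℝ) : Set (ℝ × ℝ) := Ioo 0 σ ×ˢ Ioo 0 δ

/-- Functions smooth up to the boundary of the rectangle which vanish in a neighbourhood
of `r = 0`. -/
def CBar (σ δ : ℝ) : Set (ℝ × ℝ → ℝ) :=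
  {v | ContDiff ℝ ∞ v ∧ ∃ r₀ > 0, ∀ q ∈ rect σ δ, q.1 < r₀ → v q = 0}

/-- Test functions: elements of `CBar` vanishing for `θ = 0` and `θ = δ`. -/
def CHat (σ δ : ℝ) : Set (ℝ × ℝ → ℝ) :=
  {v | v ∈ CBar σ δ ∧ ∀ r ∈ Ioo 0 σ, v (r, 0) = 0 ∧ v (r, δ) = 0}

/-- The square of the norm `‖·‖_{(m,l,γ)}`. -/
def normSq (σ δ lam γ : ℝ) (m l : ℕ) (v : ℝ × ℝ → ℝ) : ENNReal :=
  ∫⁻ q in rect σ δ, ENNReal.ofReal (∑ s ∈ Finset.range (m + 1), ∑ t ∈ Finset.range (l + 1),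
    if s + t ≤ max m l then (lam⁻¹) ^ s * q.1 ^ (-γ + 2 * (s : ℝ)) * (dr^[s] (dθ^[t] v) q) ^ 2
    else 0)

/-- Membership in `H^{(m,l,γ)}`, the closure of `CBar` in the norm `‖·‖_{(m,l,γ)}`: `u` is the
limit, in the weighted `L²` norm `‖·‖_{(0,0,γ)}`, of a sequence in `CBar` which is a Cauchy
sequence for `‖·‖_{(m,l,γ)}`. -/
def MemH (σ δ lam γ : ℝ) (m l : ℕ) (u : ℝ × ℝ → ℝ) : Prop :=
  AEStronglyMeasurable u (volume.restrict (rect σ δ)) ∧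
  ∃ v : ℕ → ℝ × ℝ → ℝ, (∀ n, v n ∈ CBar σ δ) ∧
    Tendsto (fun n : ℕ × ℕ => normSq σ δ lam γ m l (v n.1 - v n.2)) atTop (𝓝 0) ∧
    Tendsto (fun n => normSq σ δ lam γ 0 0 (v n - u)) atTop (𝓝 0)

/-- `u` is a weak solution: `(u, L^* v) = (f, v)` for all test functions `v`. -/
def IsWeakSolution (σ δ : ℝ) (P : PolarOperator) (f u : ℝ × ℝ → ℝ) : Prop :=
  ∀ v ∈ CHat σ δ, ∫ q in rect σ δ, u q * P.adjoint v q = ∫ q in rect σ δ, f q * v q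

end EllipticSector

end

/-!
The rescaled Hessian of `z` tends to `diag (a, 0)` as `ε → 0`, uniformly in `w`.  Three consequences
are needed on the polar sector `Ω`: the chart `ξ` exists, the coefficients of the operator in the
coordinates `ξ` are small, and its leading coefficient `k` is nonnegative.

* *Chart.*  The coordinate `ξ¹` is constant along the integral curves of `dx¹/dx² = a¹²/a²²`, a slope of
  size `O(ε)`.  After extending the slope to the plane these curves form a global flow, whence
  `exists_chart`; `IsSlopeChart` isolates what is used of `ξ` afterwards.

* *Coefficients.*  `k`, `c` and `d` involve derivatives of `z` that the bound `|w|_{C⁴} < 1` controls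
  only if no derivative is wasted, so `Dom.FC` keeps apart the regularity of a family of functions and
  the number of derivatives that are bounded uniformly in the family.  The critical quantity is the
  Jacobian `J = ∂x¹/∂ξ¹`.  By a Codazzi identity the third derivatives of `w` cancel in the derivative
  of `log (J a²²)` along the curves, which becomes a function `P` of lower order
  (`LocalGeometry.FC_codazzi`), so integration from the diagonal bounds `J` in `C²` (`SlopeData.FC_jac_two`).
  This gives coefficients that are `O(ε)` (`exists_polarCoef`).

* *Sign.*  By the definition of `Φ`, the determinant of the Hessian is `Φ` plus a positive multiple
  of `K`; subtracting the multiple of `Φ` in the definition of `L(w)` leaves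
  `k = K |g| (1 - |∇z|²)` up to a positive factor, and `K ≥ 0` in the sector.

In polar coordinates the operator is, up to a factor and terms of lower order, `X² + Z k Z`, where
`X` and `Z` are the derivatives in the directions `ξ²` and `ξ¹`, multiplied by `r / cos θ` and with the
cut-off `φ` on the radial part; see `DegenerateOperator.M`.  It degenerates where `k = 0` and for `r ≥ σ`.
Regularity in `r` is obtained together with existence, by commuting with `A ^ (n + 1)`, where
`A = r ∂_r + ν` and `n + 1 = m`: for large `ν` the powers of `A` control all weighted radial derivatives, and
the commutators of `A ^ (n + 1)` with the coefficients are bounded through `√k`, because the first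
derivative of a nonnegative function is bounded by its square root (`dist_mul_abs_deriv_le`).
The Poincaré inequality in `θ` has constant `O(δ)`, so for `δ` small the remaining errors are absorbed by
`‖X A ^ (n + 1) w‖²`.  The result is the coercivity estimate `DegenerateOperator.energy` for
`-(A ^ (n + 1) M w, A ^ (n + 1) w)` in the weighted space.

Coercivity and a projection argument of Lions–Lax–Milgram type (`exists_inner_eq`) produce `u` in
`H^{(m,1,γ)}` satisfying the weak equation for the test functions `(A ^ (n + 1))ᵗ G`, where `G` vanishes to
order `n + 1` on `r = σ`; here `A ^ (n + 1) w = G` is solved by integration from the vertex.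
Every test function is reached from these: `(A ^ j)ᵗ G` differs from such a function only by a
contribution of a thin shell around the vertex, whose size tends to zero
(`DegenerateOperator.eq_zero_of_cls`).  This gives `DegenerateOperator.exists_weak`, and, in terms of
the polar operator, `exists_isWeakSolution`.
-/

noncomputable section

namespace EllipticSector

local notation "ℱ" => ℝ × ℝ → ℝ

variable {a f g F G : ℱ}
open Real

/-! ### Partial derivatives on the half-strip -/

lemma _root_.ContDiff.of_nat {E F : Type*} [NormedAddCommGroup E] [NormedSpace ℝ E]
    [NormedAddCommGroup F] [NormedSpace ℝ F] {m n : ℕ} {f : E → F} (h : ContDiff ℝ n f)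
    (hmn : m ≤ n) : ContDiff ℝ m f := h.of_le (by exact_mod_cast hmn)

lemma _root_.ContDiffOn.of_nat {E F : Type*} [NormedAddCommGroup E] [NormedSpace ℝ E]
    [NormedAddCommGroup F] [NormedSpace ℝ F] {m n : ℕ} {f : E → F} {s : Set E}
    (h : ContDiffOn ℝ n f s) (hmn : m ≤ n) : ContDiffOn ℝ m f s := h.of_le (by exact_mod_cast hmn)

lemma dr_eq_fderiv {q : ℝ × ℝ} (hf : DifferentiableAt ℝ f q) :
    dr f q = fderiv ℝ f q (1, 0) := by
  have h1 : HasDerivAt (fun r : ℝ => (r, q.2)) ((1 : ℝ), (0 : ℝ)) q.1 :=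
    (hasDerivAt_id q.1).prodMk (hasDerivAt_const q.1 q.2)
  exact (HasFDerivAt.comp_hasDerivAt (x := q.1) (f := fun r : ℝ => (r, q.2))
    (l := f) (by exact hf.hasFDerivAt) h1).deriv

lemma dθ_eq_fderiv {q : ℝ × ℝ} (hf : DifferentiableAt ℝ f q) :
    dθ f q = fderiv ℝ f q (0, 1) := by
  have h1 : HasDerivAt (fun t : ℝ => (q.1, t)) ((0 : ℝ), (1 : ℝ)) q.2 :=
    (hasDerivAt_const q.2 q.1).prodMk (hasDerivAt_id q.2)
  exact (HasFDerivAt.comp_hasDerivAt (x := q.2) (f := fun t : ℝ => (q.1, t))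
    (l := f) (by exact hf.hasFDerivAt) h1).deriv

lemma hasDerivAt_dr {q : ℝ × ℝ} (hf : DifferentiableAt ℝ f q) :
    HasDerivAt (fun r => f (r, q.2)) (dr f q) q.1 := by
  have h1 : DifferentiableAt ℝ (fun r : ℝ => (r, q.2)) q.1 := by fun_prop
  exact (DifferentiableAt.comp (f := fun r : ℝ => (r, q.2)) q.1 hf h1).hasDerivAt

lemma hasDerivAt_dθ {q : ℝ × ℝ} (hf : DifferentiableAt ℝ f q) :
    HasDerivAt (fun t => f (q.1, t)) (dθ f q) q.2 := by
  have h1 : DifferentiableAt ℝ (fun t : ℝ => (q.1, t)) q.2 := by fun_prop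
  exact (DifferentiableAt.comp (f := fun t : ℝ => (q.1, t)) q.2 hf h1).hasDerivAt

lemma dr_eq_fderiv_fun (hf : Differentiable ℝ f) :
    dr f = fun q => fderiv ℝ f q (1, 0) := funext fun q => dr_eq_fderiv (hf q)

lemma dθ_eq_fderiv_fun (hf : Differentiable ℝ f) :
    dθ f = fun q => fderiv ℝ f q (0, 1) := funext fun q => dθ_eq_fderiv (hf q)

lemma _root_.ContDiff.diff {n : ℕ} (hf : ContDiff ℝ n f) (hn : 1 ≤ n) :
    Differentiable ℝ f :=
  hf.differentiable (by norm_cast; omega)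

lemma contDiff_dr {n : ℕ} (hf : ContDiff ℝ (n + 1 : ℕ) f) :
    ContDiff ℝ n (dr f) := by
  rw [dr_eq_fderiv_fun (hf.diff (by omega))]
  exact (hf.fderiv_right (by norm_cast)).clm_apply contDiff_const

lemma contDiff_dθ {n : ℕ} (hf : ContDiff ℝ (n + 1 : ℕ) f) :
    ContDiff ℝ n (dθ f) := by
  rw [dθ_eq_fderiv_fun (hf.diff (by omega))]
  exact (hf.fderiv_right (by norm_cast)).clm_apply contDiff_const

lemma dr_dθ_comm (hf : ContDiff ℝ (2 : ℕ) f) : dr (dθ f) = dθ (dr f) := by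
  have hd := hf.diff (by norm_num)
  have h1 : ContDiff ℝ (1 : ℕ) (dr f) := contDiff_dr hf
  have h2 : ContDiff ℝ (1 : ℕ) (dθ f) := contDiff_dθ hf
  funext q
  rw [dr_eq_fderiv (h2.diff le_rfl q),
    dθ_eq_fderiv (h1.diff le_rfl q), dr_eq_fderiv_fun hd, dθ_eq_fderiv_fun hd]
  have h3 : ContDiff ℝ (1 : ℕ) (fderiv ℝ f) := hf.fderiv_right (m := (1 : ℕ)) (by norm_cast)
  have h4 : DifferentiableAt ℝ (fderiv ℝ f) q := h3.differentiable (by norm_num) q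
  have hs : IsSymmSndFDerivAt ℝ f q := by
    apply ContDiffAt.isSymmSndFDerivAt (by exact_mod_cast hf.contDiffAt)
    simp [minSmoothness_of_isRCLikeNormedField]
  rw [fderiv_clm_apply h4 (by fun_prop), fderiv_clm_apply h4 (by fun_prop)]
  simp [hs.eq (1, 0) (0, 1)]

lemma dr_mul (hf : Differentiable ℝ f) (hg : Differentiable ℝ g) :
    dr (f * g) = dr f * g + f * dr g := by
  funext q
  exact ((hasDerivAt_dr (hf q)).mul (hasDerivAt_dr (hg q))).deriv

lemma dθ_mul (hf : Differentiable ℝ f) (hg : Differentiable ℝ g) :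
    dθ (f * g) = dθ f * g + f * dθ g := by
  funext q
  exact ((hasDerivAt_dθ (hf q)).mul (hasDerivAt_dθ (hg q))).deriv

lemma dr_add (hf : Differentiable ℝ f) (hg : Differentiable ℝ g) :
    dr (f + g) = dr f + dr g := by
  funext q
  exact ((hasDerivAt_dr (hf q)).add (hasDerivAt_dr (hg q))).deriv

lemma dθ_add (hf : Differentiable ℝ f) (hg : Differentiable ℝ g) :
    dθ (f + g) = dθ f + dθ g := by
  funext q
  exact ((hasDerivAt_dθ (hf q)).add (hasDerivAt_dθ (hg q))).deriv

lemma dr_sub (hf : Differentiable ℝ f) (hg : Differentiable ℝ g) :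
    dr (f - g) = dr f - dr g := by
  funext q
  exact ((hasDerivAt_dr (hf q)).sub (hasDerivAt_dr (hg q))).deriv

lemma dθ_sub (hf : Differentiable ℝ f) (hg : Differentiable ℝ g) :
    dθ (f - g) = dθ f - dθ g := by
  funext q
  exact ((hasDerivAt_dθ (hf q)).sub (hasDerivAt_dθ (hg q))).deriv

lemma dr_smul (c : ℝ) (f : ℱ) : dr (c • f) = c • dr f := by
  funext q
  simp only [dr, Pi.smul_apply, smul_eq_mul]
  exact deriv_const_mul_field c

lemma dθ_smul (c : ℝ) (f : ℱ) : dθ (c • f) = c • dθ f := by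
  funext q
  simp only [dθ, Pi.smul_apply, smul_eq_mul]
  exact deriv_const_mul_field c

/-- The Euler operator `r ∂/∂r`. -/
def euler (f : ℱ) : ℱ := fun q => q.1 * dr f q

lemma euler_mul (hf : Differentiable ℝ f) (hg : Differentiable ℝ g) :
    euler (f * g) = euler f * g + f * euler g := by
  funext q
  simp only [euler, dr_mul hf hg, Pi.add_apply, Pi.mul_apply]
  ring

lemma euler_add (hf : Differentiable ℝ f) (hg : Differentiable ℝ g) :
    euler (f + g) = euler f + euler g := by
  funext q
  simp only [euler, dr_add hf hg, Pi.add_apply]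
  ring

lemma euler_smul (c : ℝ) (f : ℱ) : euler (c • f) = c • euler f := by
  funext q
  simp only [euler, dr_smul, Pi.smul_apply, smul_eq_mul]
  ring

lemma contDiff_euler {n : ℕ} (hf : ContDiff ℝ (n + 1 : ℕ) f) :
    ContDiff ℝ n (euler f) :=
  contDiff_fst.mul (contDiff_dr hf)

lemma euler_dθ_comm (hf : ContDiff ℝ (2 : ℕ) f) :
    euler (dθ f) = dθ (euler f) := by
  funext q
  have h1 : ContDiff ℝ (1 : ℕ) (dr f) := contDiff_dr hf
  have h2 := congrFun (dr_dθ_comm hf) q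
  simp only [euler]
  rw [h2]
  have := ((hasDerivAt_dθ (h1.diff le_rfl q)).const_mul q.1).deriv
  exact this.symm

lemma contDiff_euler_iterate {n : ℕ} (i : ℕ) (hf : ContDiff ℝ (n + i : ℕ) f) :
    ContDiff ℝ n (euler^[i] f) := by
  induction i generalizing f with
  | zero => simpa using hf
  | succ i ih =>
    rw [Function.iterate_succ_apply]
    exact ih (contDiff_euler hf)

/-- Functions of class `C^n` on the plane which vanish near `{r ≤ 0}`. -/
structure TF (n : ℕ) (f : ℱ) : Prop where
  cd : ContDiff ℝ n f
  zero : ∃ r₀ > 0, ∀ q : ℝ × ℝ, q.1 < r₀ → f q = 0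

namespace TF

variable {n : ℕ}

lemma of_le {m : ℕ} (hf : TF n f) (h : m ≤ n) : TF m f :=
  ⟨hf.cd.of_nat h, hf.zero⟩

lemma diff (hf : TF n f) (hn : 1 ≤ n) : Differentiable ℝ f := hf.cd.diff hn

lemma cont (hf : TF n f) : Continuous f := hf.cd.continuous

lemma add (hf : TF n f) (hg : TF n g) : TF n (f + g) := by
  obtain ⟨a, ha, h1⟩ := hf.zero
  obtain ⟨b, hb, h2⟩ := hg.zero
  refine ⟨hf.cd.add hg.cd, min a b, lt_min ha hb, fun q hq => ?_⟩
  simp [h1 q (hq.trans_le (min_le_left _ _)), h2 q (hq.trans_le (min_le_right _ _))]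

lemma cmul (ha : ContDiff ℝ n a) (hf : TF n f) : TF n (a * f) := by
  obtain ⟨b, hb, h1⟩ := hf.zero
  refine ⟨ha.mul hf.cd, b, hb, fun q hq => ?_⟩
  simp [h1 q hq]

lemma mul (hf : TF n f) (hg : TF n g) : TF n (f * g) := cmul hf.cd hg

lemma smul (c : ℝ) (hf : TF n f) : TF n (c • f) := by
  obtain ⟨b, hb, h1⟩ := hf.zero
  refine ⟨hf.cd.const_smul c, b, hb, fun q hq => ?_⟩
  simp [h1 q hq]

lemma neg (hf : TF n f) : TF n (-f) := by
  have := hf.smul (-1)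
  simpa using this

lemma sub (hf : TF n f) (hg : TF n g) : TF n (f - g) := by
  rw [sub_eq_add_neg]
  exact hf.add hg.neg

lemma zero_fun : TF n (0 : ℱ) := ⟨contDiff_const, 1, one_pos, fun _ _ => rfl⟩

lemma sum {ι : Type*} (s : Finset ι) {F : ι → ℱ} (h : ∀ i ∈ s, TF n (F i)) :
    TF n (∑ i ∈ s, F i) := by
  classical
  induction s using Finset.induction_on with
  | empty => simpa using zero_fun
  | insert a s ha ih =>
    rw [Finset.sum_insert ha]
    exact (h a (by simp)).add (ih fun i hi => h i (by simp [hi]))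

lemma dr (hf : TF (n + 1) f) : TF n (dr f) := by
  obtain ⟨b, hb, h1⟩ := hf.zero
  refine ⟨contDiff_dr hf.cd, b, hb, fun q hq => ?_⟩
  have : (fun r => f (r, q.2)) =ᶠ[𝓝 q.1] fun _ => 0 := by
    filter_upwards [Iio_mem_nhds hq] with r hr using h1 _ hr
  simp only [EllipticSector.dr]
  rw [this.deriv_eq]
  simp

lemma dθ (hf : TF (n + 1) f) : TF n (dθ f) := by
  obtain ⟨b, hb, h1⟩ := hf.zero
  refine ⟨contDiff_dθ hf.cd, b, hb, fun q hq => ?_⟩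
  have : (fun t => f (q.1, t)) = fun _ => 0 := funext fun t => h1 _ hq
  simp only [EllipticSector.dθ]
  rw [this]
  simp

lemma euler (hf : TF (n + 1) f) : TF n (euler f) := cmul contDiff_fst hf.dr

/-- Multiplication by a function which is smooth for `r > 0` only. -/
lemma mul_of_contDiffOn (ha : ContDiffOn ℝ n a {q | 0 < q.1}) (hf : TF n f) :
    TF n (a * f) := by
  obtain ⟨b, hb, h1⟩ := hf.zero
  refine ⟨contDiff_iff_contDiffAt.2 fun q => ?_, b, hb, fun q hq => by simp [h1 q hq]⟩
  rcases lt_or_ge 0 q.1 with hq | hq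
  · have : {q : ℝ × ℝ | 0 < q.1} ∈ 𝓝 q := (isOpen_lt continuous_const continuous_fst).mem_nhds hq
    exact (ha.contDiffAt this).mul hf.cd.contDiffAt
  · have : a * f =ᶠ[𝓝 q] fun _ => 0 := by
      have h2 : {q : ℝ × ℝ | q.1 < b} ∈ 𝓝 q :=
        (isOpen_lt continuous_fst continuous_const).mem_nhds (hq.trans_lt hb)
      filter_upwards [h2] with p hp
      simp [h1 p hp]
    exact contDiffAt_const.congr_of_eventuallyEq this

lemma rpow_mul (s : ℝ) (hf : TF n f) : TF n ((fun q => q.1 ^ s) * f) := by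
  refine mul_of_contDiffOn ?_ hf
  intro q hq
  have hq' : q.1 ≠ 0 := ne_of_gt hq
  exact ((contDiffAt_rpow_const_of_ne hq').comp q contDiffAt_fst).contDiffWithinAt

end TF

/-! ### The weighted inner product -/

/-- The parameters of the rectangle `(0, σ) × (0, δ)` with the weight `r ^ (-γ)`. -/
structure Strip where
  (σ δ γ : ℝ)
  hσ : 0 < σ
  hδ : 0 < δ

lemma measurableSet_rect (σ δ : ℝ) : MeasurableSet (rect σ δ) :=
  measurableSet_Ioo.prod measurableSet_Ioo

lemma isOpen_rect (σ δ : ℝ) : IsOpen (rect σ δ) := isOpen_Ioo.prod isOpen_Ioo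

lemma rect_subset (σ δ : ℝ) : rect σ δ ⊆ Icc 0 σ ×ˢ Icc 0 δ :=
  prod_mono Ioo_subset_Icc_self Ioo_subset_Icc_self

lemma integrableOn_rect (hf : Continuous f) (σ δ : ℝ) :
    IntegrableOn f (rect σ δ) :=
  (hf.continuousOn.integrableOn_compact (isCompact_Icc.prod isCompact_Icc)).mono_set
    (rect_subset σ δ)

lemma integral_rect_dθ {σ δ : ℝ} (hδ : 0 < δ) (hF : ContDiff ℝ (1 : ℕ) F) :
    ∫ q in rect σ δ, dθ F q = ∫ r in Ioo 0 σ, (F (r, δ) - F (r, 0)) := by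
  have hc : Continuous (dθ F) := (contDiff_dθ hF).continuous
  have hd := hF.diff le_rfl
  have hi := integrableOn_rect hc σ δ
  rw [rect, Measure.volume_eq_prod] at *
  rw [setIntegral_prod _ hi]
  refine setIntegral_congr_fun measurableSet_Ioo fun r _ => ?_
  rw [← integral_Ioc_eq_integral_Ioo, ← intervalIntegral.integral_of_le hδ.le]
  refine intervalIntegral.integral_eq_sub_of_hasDerivAt (f := fun t => F (r, t)) (fun t _ => ?_) ?_
  · exact hasDerivAt_dθ (q := (r, t)) (hd _)
  · exact (Continuous.comp hc (by fun_prop : Continuous fun t : ℝ => (r, t))).intervalIntegrable _ _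

lemma integral_rect_dr {σ δ : ℝ} (hσ : 0 < σ) (hF : TF 1 F) :
    ∫ q in rect σ δ, dr F q = ∫ t in Ioo 0 δ, F (σ, t) := by
  have hc : Continuous (dr F) := (contDiff_dr (n := 0) hF.cd).continuous
  have hd := hF.cd.diff le_rfl
  have hi : IntegrableOn (fun z : ℝ × ℝ => dr F z.swap) (rect δ σ) :=
    integrableOn_rect (hc.comp continuous_swap) δ σ
  have hsw := setIntegral_prod_swap (μ := (volume : Measure ℝ)) (ν := (volume : Measure ℝ))
    (Ioo 0 σ) (Ioo 0 δ) (dr F)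
  rw [rect, Measure.volume_eq_prod] at *
  rw [← hsw, setIntegral_prod _ hi]
  refine setIntegral_congr_fun measurableSet_Ioo fun t _ => ?_
  rw [← integral_Ioc_eq_integral_Ioo, ← intervalIntegral.integral_of_le hσ.le]
  have h0 : F (0, t) = 0 := by
    obtain ⟨b, hb, h⟩ := hF.zero
    exact h _ hb
  have := intervalIntegral.integral_eq_sub_of_hasDerivAt (f := fun r => F (r, t))
    (f' := fun r => dr F (r, t)) (a := 0) (b := σ) (fun r _ => hasDerivAt_dr (q := (r, t)) (hd _))
    ((Continuous.comp hc (by fun_prop : Continuous fun r : ℝ => (r, t))).intervalIntegrable _ _)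
  exact this.trans (by rw [h0, sub_zero])

local notation "Ω(" S ")" => rect (Strip.σ S) (Strip.δ S)

namespace Strip

variable (S : Strip)

/-- The weighted inner product `∫ f g r ^ (-γ) dr dθ`. -/
def ip (f g : ℱ) : ℝ := ∫ q in Ω(S), q.1 ^ (-S.γ) * (f q * g q)

/-- The norm of the weighted inner product. -/
def nn (f : ℱ) : ℝ := √(S.ip f f)

variable {S} {h : ℱ}

lemma integrable (hf : TF 0 f) (hg : Continuous g) :
    IntegrableOn (fun q => q.1 ^ (-S.γ) * (f q * g q)) Ω(S) := by
  have h1 : TF 0 (g * f) := TF.cmul (by exact_mod_cast contDiff_zero.2 hg) hf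
  have := (h1.rpow_mul (-S.γ)).cont
  refine integrableOn_rect (this.congr fun q => ?_) _ _
  simp only [Pi.mul_apply]
  ring

lemma ip_comm (f g : ℱ) : S.ip f g = S.ip g f := by
  simp only [ip, mul_comm (f _)]

lemma ip_add_left (hf : TF 0 f) (hg : TF 0 g) (hh : TF 0 h) :
    S.ip (f + g) h = S.ip f h + S.ip g h := by
  rw [ip, ip, ip, ← integral_add (integrable hf hh.cont) (integrable hg hh.cont)]
  congr 1
  funext q
  simp only [Pi.add_apply]
  ring

lemma ip_smul_left (c : ℝ) : S.ip (c • f) h = c * S.ip f h := by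
  rw [ip, ip, ← integral_const_mul]
  congr 1
  funext q
  simp only [Pi.smul_apply, smul_eq_mul]
  ring

lemma ip_neg_left : S.ip (-f) h = -S.ip f h := by
  have := S.ip_smul_left (f := f) (h := h) (-1)
  simpa using this

lemma ip_sub_left (hf : TF 0 f) (hg : TF 0 g) (hh : TF 0 h) :
    S.ip (f - g) h = S.ip f h - S.ip g h := by
  rw [sub_eq_add_neg, ip_add_left hf hg.neg hh, ip_neg_left, sub_eq_add_neg]

lemma ip_add_right (hf : TF 0 f) (hg : TF 0 g) (hh : TF 0 h) :
    S.ip h (f + g) = S.ip h f + S.ip h g := by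
  rw [ip_comm, ip_add_left hf hg hh, ip_comm f, ip_comm g]

lemma ip_smul_right (c : ℝ) : S.ip h (c • f) = c * S.ip h f := by
  rw [ip_comm, ip_smul_left, ip_comm]

lemma ip_neg_right : S.ip h (-f) = -S.ip h f := by rw [ip_comm, ip_neg_left, ip_comm]

lemma ip_sub_right (hf : TF 0 f) (hg : TF 0 g) (hh : TF 0 h) :
    S.ip h (f - g) = S.ip h f - S.ip h g := by
  rw [ip_comm, ip_sub_left hf hg hh, ip_comm f, ip_comm g]

/-- Coefficients can be moved from one factor to the other. -/
lemma ip_mul_left (a f g : ℱ) : S.ip (a * f) g = S.ip f (a * g) := by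
  simp only [ip, Pi.mul_apply]
  congr 1
  funext q
  ring

lemma ip_mono (hf : TF 0 f) (hg : TF 0 g) {f' g' : ℱ} (hf' : TF 0 f') (hg' : TF 0 g')
    (hle : ∀ q ∈ Ω(S), f q * g q ≤ f' q * g' q) : S.ip f g ≤ S.ip f' g' := by
  refine setIntegral_mono_on (integrable hf hg.cont) (integrable hf' hg'.cont)
    (measurableSet_rect _ _) fun q hq => ?_
  exact mul_le_mul_of_nonneg_left (hle q hq) (rpow_nonneg hq.1.1.le _)

lemma ip_nonneg (hfg : ∀ q ∈ Ω(S), 0 ≤ f q * g q) : 0 ≤ S.ip f g :=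
  setIntegral_nonneg (measurableSet_rect _ _) fun q hq =>
    mul_nonneg (rpow_nonneg hq.1.1.le _) (hfg q hq)

lemma ip_self_nonneg (f : ℱ) : 0 ≤ S.ip f f := ip_nonneg fun _ _ => mul_self_nonneg _

lemma nn_nonneg (f : ℱ) : 0 ≤ S.nn f := sqrt_nonneg _

lemma nn_sq (f : ℱ) : S.nn f ^ 2 = S.ip f f := sq_sqrt (ip_self_nonneg f)

lemma ip_congr {f' g' : ℱ} (hle : ∀ q ∈ Ω(S), f q * g q = f' q * g' q) :
    S.ip f g = S.ip f' g' :=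
  setIntegral_congr_fun (measurableSet_rect _ _) fun q hq => by simp only [hle q hq]

lemma cauchy (hf : TF 0 f) (hg : TF 0 g) : S.ip f g ≤ S.nn f * S.nn g := by
  have h1 : ∀ t : ℝ, 0 ≤ S.ip g g * (t * t) + (2 * S.ip f g) * t + S.ip f f := fun t => by
    have := S.ip_self_nonneg (f + t • g)
    rw [ip_add_left hf (hg.smul t) (hf.add (hg.smul t)), ip_add_right hf (hg.smul t) hf,
      ip_add_right hf (hg.smul t) (hg.smul t), ip_smul_left, ip_smul_left, ip_smul_right,
      ip_smul_right, ip_comm g f] at this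
    linarith
  have h2 := discrim_le_zero h1
  rw [discrim] at h2
  apply le_of_abs_le
  apply abs_le_of_sq_le_sq _ (mul_nonneg (nn_nonneg f) (nn_nonneg g))
  rw [mul_pow, nn_sq, nn_sq]
  nlinarith

lemma abs_ip_le (hf : TF 0 f) (hg : TF 0 g) : |S.ip f g| ≤ S.nn f * S.nn g := by
  refine abs_le.2 ⟨?_, cauchy hf hg⟩
  have := S.cauchy hf.neg hg
  rw [ip_neg_left] at this
  have h2 : S.nn (-f) = S.nn f := by rw [nn, nn, ip_neg_left, ip_neg_right, neg_neg]
  rw [h2] at this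
  linarith

lemma nn_neg : S.nn (-f) = S.nn f := by rw [nn, nn, ip_neg_left, ip_neg_right, neg_neg]

lemma nn_add_le (hf : TF 0 f) (hg : TF 0 g) : S.nn (f + g) ≤ S.nn f + S.nn g := by
  apply le_of_sq_le_sq _ (add_nonneg (nn_nonneg f) (nn_nonneg g))
  rw [nn_sq, ip_add_left hf hg (hf.add hg), ip_add_right hf hg hf, ip_add_right hf hg hg,
    ip_comm g f, ← nn_sq, ← nn_sq]
  nlinarith [S.cauchy hf hg]

lemma nn_sub_le (hf : TF 0 f) (hg : TF 0 g) : S.nn (f - g) ≤ S.nn f + S.nn g := by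
  rw [sub_eq_add_neg, ← S.nn_neg (f := g)]
  exact nn_add_le hf hg.neg

lemma nn_smul (c : ℝ) : S.nn (c • f) = |c| * S.nn f := by
  rw [nn, ip_smul_left, ip_smul_right, ← mul_assoc, sqrt_mul (mul_self_nonneg c),
    sqrt_mul_self_eq_abs, nn]

lemma nn_le_of_abs_le (hf : TF 0 f) (hg : TF 0 g) {C : ℝ} (hC : 0 ≤ C)
    (hle : ∀ q ∈ Ω(S), |f q| ≤ C * |g q|) : S.nn f ≤ C * S.nn g := by
  apply le_of_sq_le_sq _ (mul_nonneg hC (nn_nonneg g))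
  rw [mul_pow, nn_sq, nn_sq, sq, mul_assoc, ← ip_smul_left, ← ip_smul_left]
  refine ip_mono hf hf ((hg.smul C).smul C) hg fun q hq => ?_
  have := mul_self_le_mul_self (abs_nonneg _) (hle q hq)
  rw [abs_mul_abs_self] at this
  simp only [Pi.smul_apply, smul_eq_mul]
  have e : C * |g q| * (C * |g q|) = C * (C * g q) * g q := by
    rw [show C * |g q| * (C * |g q|) = C * C * (|g q| * |g q|) by ring, abs_mul_abs_self]
    ring
  rwa [e] at this

lemma nn_cmul_le (ha : Continuous a) (hf : TF 0 f) {C : ℝ} (hC : 0 ≤ C)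
    (hle : ∀ q ∈ Ω(S), |a q| ≤ C) : S.nn (a * f) ≤ C * S.nn f := by
  refine nn_le_of_abs_le (TF.cmul (by exact_mod_cast contDiff_zero.2 ha) hf) hf hC fun q hq => ?_
  rw [Pi.mul_apply, abs_mul]
  exact mul_le_mul_of_nonneg_right (hle q hq) (abs_nonneg _)

lemma nn_sum_le {ι : Type*} (s : Finset ι) {F : ι → ℱ} (hF : ∀ i ∈ s, TF 0 (F i)) :
    S.nn (∑ i ∈ s, F i) ≤ ∑ i ∈ s, S.nn (F i) := by
  classical
  induction s using Finset.induction_on with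
  | empty => simp [nn, ip]
  | insert a s ha ih =>
    rw [Finset.sum_insert ha, Finset.sum_insert ha]
    have h1 : TF 0 (∑ i ∈ s, F i) := TF.sum s fun i hi => hF i (by simp [hi])
    exact (nn_add_le (hF a (by simp)) h1).trans
      (add_le_add le_rfl (ih fun i hi => hF i (by simp [hi])))

/-! ### Integration by parts -/

/-- Integration by parts for `r ∂/∂r`: the divergence theorem in the variable `r`. -/
lemma integral_euler (hf : TF 1 f) :
    ∫ q in Ω(S), q.1 ^ (-S.γ) * (euler f q + (1 - S.γ) * f q)
      = S.σ ^ (1 - S.γ) * ∫ t in Ioo 0 S.δ, f (S.σ, t) := by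
  rw [← integral_const_mul]
  rw [show (fun t => S.σ ^ (1 - S.γ) * f (S.σ, t))
    = fun t => ((fun q : ℝ × ℝ => q.1 ^ (1 - S.γ)) * f) (S.σ, t) from rfl]
  rw [← integral_rect_dr S.hσ (hf.rpow_mul (1 - S.γ))]
  refine setIntegral_congr_fun (measurableSet_rect _ _) fun q hq => ?_
  have hq : 0 < q.1 := hq.1.1
  have h1 : HasDerivAt (fun r : ℝ => r ^ (1 - S.γ)) ((1 - S.γ) * q.1 ^ (1 - S.γ - 1)) q.1 :=
    hasDerivAt_rpow_const (Or.inl hq.ne')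
  have h2 := (h1.mul (hasDerivAt_dr (hf.diff le_rfl q))).deriv
  rw [dr]
  simp only [Pi.mul_apply]
  rw [show (fun r : ℝ => r ^ (1 - S.γ) * f (r, q.2))
    = (fun r : ℝ => r ^ (1 - S.γ)) * fun r => f (r, q.2) from rfl, h2]
  have h3 : q.1 ^ (1 - S.γ) = q.1 ^ (-S.γ) * q.1 := by
    rw [sub_eq_add_neg, add_comm, rpow_add_one hq.ne']
  rw [show 1 - S.γ - 1 = -S.γ by ring, h3, euler]
  ring

lemma integral_dθ_eq_zero (hf : TF 1 f) (h : ∀ r ∈ Ioo 0 S.σ, f (r, S.δ) = 0 ∧ f (r, 0) = 0) :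
    ∫ q in Ω(S), q.1 ^ (-S.γ) * dθ f q = 0 := by
  have h1 := integral_rect_dθ (σ := S.σ) S.hδ (hf.rpow_mul (-S.γ)).cd
  have h2 : dθ ((fun q : ℝ × ℝ => q.1 ^ (-S.γ)) * f) = fun q => q.1 ^ (-S.γ) * dθ f q := by
    funext q
    exact ((hasDerivAt_dθ (hf.diff le_rfl q)).const_mul (q.1 ^ (-S.γ))).deriv
  rw [h2] at h1
  rw [h1]
  have : ∀ r ∈ Ioo 0 S.σ, ((fun q : ℝ × ℝ => q.1 ^ (-S.γ)) * f) (r, S.δ)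
      - ((fun q : ℝ × ℝ => q.1 ^ (-S.γ)) * f) (r, 0) = 0 := fun r hr => by simp [h r hr]
  rw [setIntegral_congr_fun measurableSet_Ioo this]
  simp

lemma ip_dθ (hf : TF 1 f) (hg : TF 1 g)
    (h : ∀ r ∈ Ioo 0 S.σ, f (r, S.δ) * g (r, S.δ) = 0 ∧ f (r, 0) * g (r, 0) = 0) :
    S.ip (dθ f) g = -S.ip f (dθ g) := by
  have h1 := S.integral_dθ_eq_zero (hf.mul hg) h
  rw [dθ_mul (hf.diff le_rfl) (hg.diff le_rfl)] at h1
  have h2 : ∫ q in Ω(S), q.1 ^ (-S.γ) * (dθ f * g + f * dθ g) q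
      = S.ip (dθ f) g + S.ip f (dθ g) := by
    rw [ip, ip, ← integral_add (integrable hf.dθ hg.cont)
      (integrable (hf.of_le zero_le_one) hg.dθ.cont)]
    congr 1
    funext q
    simp only [Pi.add_apply, Pi.mul_apply]
    ring
  linarith

lemma ip_euler (hf : TF 1 f) (hg : TF 1 g) :
    S.ip (euler f) g = -S.ip f (euler g) - (1 - S.γ) * S.ip f g
      + S.σ ^ (1 - S.γ) * ∫ t in Ioo 0 S.δ, f (S.σ, t) * g (S.σ, t) := by
  have h1 := S.integral_euler (hf.mul hg)
  rw [euler_mul (hf.diff le_rfl) (hg.diff le_rfl)] at h1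
  have hf0 := hf.of_le zero_le_one
  have h2 : ∫ q in Ω(S), q.1 ^ (-S.γ) * ((euler f * g + f * euler g) q
      + (1 - S.γ) * (f * g) q)
      = S.ip (euler f) g + S.ip f (euler g) + (1 - S.γ) * S.ip f g := by
    rw [ip, ip, ip, ← integral_add (integrable hf.euler hg.cont) (integrable hf0 hg.euler.cont),
      ← integral_const_mul, ← integral_add]
    · congr 1
      funext q
      simp only [Pi.add_apply, Pi.mul_apply]
      ring
    · exact (integrable hf.euler hg.cont).add (integrable hf0 hg.euler.cont)
    · exact (integrable hf0 hg.cont).const_mul _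
  rw [h2] at h1
  simp only [Pi.mul_apply] at h1
  linarith

end Strip

open Function
open Finset.HasAntidiagonal (antidiagonal mem_antidiagonal)

/-! ### The shifted Euler operator -/

/-- The operator `r ∂/∂r + ν`. -/
def shiftE (ν : ℝ) (f : ℱ) : ℱ := euler f + ν • f

lemma TF.shiftE {n : ℕ} (ν : ℝ) (hf : TF (n + 1) f) : TF n (shiftE ν f) :=
  hf.euler.add ((hf.of_le (Nat.le_succ n)).smul ν)

lemma TF.shiftE_iterate {n : ℕ} (ν : ℝ) (i : ℕ) (hf : TF (n + i) f) :
    TF n ((EllipticSector.shiftE ν)^[i] f) := by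
  induction i generalizing f with
  | zero => exact hf
  | succ i ih =>
    rw [iterate_succ_apply]
    exact ih (TF.shiftE ν hf)

lemma contDiff_shiftE {n : ℕ} (ν : ℝ) (hf : ContDiff ℝ (n + 1 : ℕ) f) :
    ContDiff ℝ n (shiftE ν f) :=
  (contDiff_euler hf).add ((hf.of_nat (Nat.le_succ n)).const_smul ν)

lemma contDiff_shiftE_iterate {n : ℕ} (ν : ℝ) (i : ℕ)
    (hf : ContDiff ℝ (n + i : ℕ) f) : ContDiff ℝ n ((shiftE ν)^[i] f) := by
  induction i generalizing f with
  | zero => exact hf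
  | succ i ih =>
    rw [iterate_succ_apply]
    exact ih (contDiff_shiftE ν hf)

lemma shiftE_add (ν : ℝ) (hf : Differentiable ℝ f) (hg : Differentiable ℝ g) :
    shiftE ν (f + g) = shiftE ν f + shiftE ν g := by
  rw [shiftE, shiftE, shiftE, euler_add hf hg, smul_add]
  abel

lemma shiftE_smul (ν c : ℝ) (f : ℱ) : shiftE ν (c • f) = c • shiftE ν f := by
  rw [shiftE, shiftE, euler_smul, smul_add, smul_comm]

lemma shiftE_sum {ι : Type*} (ν : ℝ) (s : Finset ι) {F : ι → ℱ}
    (hF : ∀ i ∈ s, Differentiable ℝ (F i)) :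
    shiftE ν (∑ i ∈ s, F i) = ∑ i ∈ s, shiftE ν (F i) := by
  classical
  induction s using Finset.induction_on with
  | empty =>
    funext q
    simp [shiftE, euler, dr]
  | insert a s ha ih =>
    rw [Finset.sum_insert ha, Finset.sum_insert ha, shiftE_add ν (hF a (by simp)), ih]
    · exact fun i hi => hF i (by simp [hi])
    · exact Differentiable.sum fun i hi => hF i (by simp [hi])

lemma shiftE_mul (ν : ℝ) (hf : Differentiable ℝ f) (hg : Differentiable ℝ g) :
    shiftE ν (f * g) = euler f * g + f * shiftE ν g := by
  rw [shiftE, shiftE, euler_mul hf hg, mul_add, mul_smul_comm, add_assoc]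

lemma shiftE_iterate_add (ν : ℝ) (n : ℕ) (hf : ContDiff ℝ n f)
    (hg : ContDiff ℝ n g) :
    (shiftE ν)^[n] (f + g) = (shiftE ν)^[n] f + (shiftE ν)^[n] g := by
  induction n generalizing f g with
  | zero => rfl
  | succ n ih =>
    rw [iterate_succ_apply, shiftE_add ν (hf.diff (by omega))
      (hg.diff (by omega)), ih (contDiff_shiftE ν hf) (contDiff_shiftE ν hg)]
    rfl

lemma shiftE_iterate_smul (ν c : ℝ) (n : ℕ) (f : ℱ) :
    (shiftE ν)^[n] (c • f) = c • (shiftE ν)^[n] f := by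
  induction n generalizing f with
  | zero => rfl
  | succ n ih => rw [iterate_succ_apply, shiftE_smul, ih]; rfl

lemma shiftE_iterate_sub (ν : ℝ) (n : ℕ) (hf : ContDiff ℝ n f)
    (hg : ContDiff ℝ n g) :
    (shiftE ν)^[n] (f - g) = (shiftE ν)^[n] f - (shiftE ν)^[n] g := by
  have h := shiftE_iterate_smul ν (-1) n g
  have h2 := shiftE_iterate_add ν n hf (hg.const_smul (-1 : ℝ))
  simp only [neg_smul, one_smul] at h h2
  rw [sub_eq_add_neg, sub_eq_add_neg, ← h]
  exact h2

/-- The Leibniz rule for powers of the shifted Euler operator. -/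
lemma shiftE_iterate_mul (ν : ℝ) (n : ℕ) (ha : ContDiff ℝ n a)
    (hf : ContDiff ℝ n f) :
    (shiftE ν)^[n] (a * f) = ∑ p ∈ antidiagonal n,
      (n.choose p.1 : ℝ) • (euler^[p.1] a * (shiftE ν)^[p.2] f) := by
  induction n with
  | zero => simp
  | succ n ih =>
    have hle : ((n : ℕ) : WithTop ℕ∞) ≤ ((n + 1 : ℕ) : WithTop ℕ∞) := by
      exact_mod_cast Nat.le_succ n
    have hd : ∀ p ∈ antidiagonal n, Differentiable ℝ (euler^[p.1] a) ∧
        Differentiable ℝ ((shiftE ν)^[p.2] f) := fun p hp => by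
      have hp' := mem_antidiagonal.1 hp
      refine ⟨(contDiff_euler_iterate _ (ha.of_le ?_)).diff le_rfl,
        (contDiff_shiftE_iterate ν _ (hf.of_le ?_)).diff le_rfl⟩
      · exact_mod_cast (by omega : 1 + p.1 ≤ n + 1)
      · exact_mod_cast (by omega : 1 + p.2 ≤ n + 1)
    rw [iterate_succ_apply', ih (ha.of_le hle) (hf.of_le hle), shiftE_sum]
    · have e : ∀ p ∈ antidiagonal n,
          shiftE ν ((n.choose p.1 : ℝ) • (euler^[p.1] a * (shiftE ν)^[p.2] f))
          = (n.choose p.1 : ℝ) • (euler^[p.1] a * (shiftE ν)^[p.2 + 1] f)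
            + (n.choose p.1 : ℝ) • (euler^[p.1 + 1] a * (shiftE ν)^[p.2] f) := fun p hp => by
        rw [shiftE_smul, shiftE_mul ν (hd p hp).1 (hd p hp).2, smul_add,
          iterate_succ_apply', iterate_succ_apply', add_comm]
      rw [Finset.sum_congr rfl e, Finset.sum_add_distrib]
      have key := Finset.sum_antidiagonal_choose_succ_nsmul
        (fun i j => euler^[i] a * (shiftE ν)^[j] f) n
      simp only [Nat.cast_smul_eq_nsmul]
      rw [key]
      congr 1
      refine Finset.sum_congr rfl fun p hp => ?_
      rw [Nat.choose_symm_of_eq_add (mem_antidiagonal.1 hp).symm]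
    · exact fun p hp => ((hd p hp).1.mul (hd p hp).2).const_smul _

lemma shiftE_euler_iterate (ν : ℝ) (n : ℕ) (hf : ContDiff ℝ (n + 1 : ℕ) f) :
    (shiftE ν)^[n] (euler f) = euler ((shiftE ν)^[n] f) := by
  induction n generalizing f with
  | zero => rfl
  | succ n ih =>
    rw [iterate_succ_apply, iterate_succ_apply, ← ih (contDiff_shiftE ν hf)]
    congr 1
    have h2 : ContDiff ℝ (2 : ℕ) f := hf.of_nat (by omega)
    rw [shiftE, shiftE, euler_add ((contDiff_euler h2).diff le_rfl)
      ((h2.diff (by omega)).const_smul ν), euler_smul]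

lemma shiftE_dθ_iterate (ν : ℝ) (n : ℕ) (hf : ContDiff ℝ (n + 1 : ℕ) f) :
    (shiftE ν)^[n] (dθ f) = dθ ((shiftE ν)^[n] f) := by
  induction n generalizing f with
  | zero => rfl
  | succ n ih =>
    rw [iterate_succ_apply, iterate_succ_apply, ← ih (contDiff_shiftE ν hf)]
    congr 1
    have h2 : ContDiff ℝ (2 : ℕ) f := hf.of_nat (by omega)
    rw [shiftE, shiftE, dθ_add ((contDiff_euler h2).diff le_rfl)
      ((h2.diff (by omega)).const_smul ν), dθ_smul, euler_dθ_comm h2]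

lemma euler_mul_angle (t : ℝ → ℝ) (f : ℱ) :
    euler ((fun q => t q.2) * f) = (fun q => t q.2) * euler f := by
  funext q
  have : dr ((fun q => t q.2) * f) q = t q.2 * dr f q := deriv_const_mul_field (t q.2)
  simp only [euler, Pi.mul_apply, this]
  ring

lemma shiftE_iterate_mul_angle (t : ℝ → ℝ) (f : ℱ) (ν : ℝ) (n : ℕ) :
    (shiftE ν)^[n] ((fun q => t q.2) * f) = (fun q => t q.2) * (shiftE ν)^[n] f := by
  induction n generalizing f with
  | zero => rfl
  | succ n ih =>
    rw [iterate_succ_apply, shiftE, euler_mul_angle, iterate_succ_apply, ← ih]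
    congr 1
    rw [shiftE, mul_add, mul_smul_comm]

namespace Strip
variable {S : Strip} {ν : ℝ}

/-- The part of the divergence theorem in `r` that carries a sign. -/
lemma ip_weight_euler_ge (ha : ContDiff ℝ (1 : ℕ) a)
    (h0 : ∀ q ∈ Ω(S), 0 ≤ a q) (hf : TF 1 f) :
    -(S.ip (euler a * f) f + (1 - S.γ) * S.ip (a * f) f) ≤ 2 * S.ip (a * euler f) f := by
  have h1 := S.ip_euler (TF.cmul ha hf) hf
  have hb : 0 ≤ ∫ t in Ioo 0 S.δ, (a * f) (S.σ, t) * f (S.σ, t) := by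
    refine setIntegral_nonneg measurableSet_Ioo fun t ht => ?_
    have : 0 ≤ a (S.σ, t) := by
      have hc : Continuous fun r : ℝ => a (r, t) := ha.continuous.comp (by fun_prop)
      have : (𝓝[Ioo 0 S.σ] S.σ).NeBot := by
        rw [← mem_closure_iff_nhdsWithin_neBot, closure_Ioo S.hσ.ne]
        exact ⟨S.hσ.le, le_rfl⟩
      refine ge_of_tendsto (hc.continuousWithinAt (s := Ioo 0 S.σ)).tendsto ?_
      filter_upwards [self_mem_nhdsWithin] with r hr using h0 (r, t) ⟨hr, ht⟩
    simp only [Pi.mul_apply]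
    rw [mul_assoc]
    exact mul_nonneg this (mul_self_nonneg _)
  have hσ : 0 ≤ S.σ ^ (1 - S.γ) := Real.rpow_nonneg S.hσ.le _
  have ha0 : ContDiff ℝ (0 : ℕ) a := ha.of_le (by norm_num)
  have hf0 := hf.of_le zero_le_one
  rw [euler_mul (ha.diff le_rfl) (hf.diff le_rfl),
    ip_add_left (TF.cmul (contDiff_euler ha) hf0) (TF.cmul ha0 hf.euler) hf0] at h1
  have h2 : S.ip (a * f) (euler f) = S.ip (a * euler f) f := by
    rw [ip_comm, ← ip_mul_left]
  have := mul_nonneg hσ hb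
  linarith

lemma nn_le_shiftE (_hν : 2 ≤ ν) (hγ : |1 - S.γ| ≤ ν) (hf : TF 1 f) :
    ν * S.nn f ≤ 2 * S.nn (shiftE ν f) := by
  have h1 := ip_weight_euler_ge (S := S) (a := fun _ => 1) contDiff_const
    (fun _ _ => zero_le_one) hf
  have e1 : euler (fun _ : ℝ × ℝ => (1 : ℝ)) = 0 := by funext q; simp [euler, dr]
  have e2 : (fun _ : ℝ × ℝ => (1 : ℝ)) = 1 := rfl
  rw [e1, e2, one_mul, one_mul, zero_mul] at h1
  have e3 : S.ip 0 f = 0 := by simp [ip]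
  rw [e3] at h1
  have hf0 := hf.of_le zero_le_one
  have h2 : S.ip (shiftE ν f) f = S.ip (euler f) f + ν * S.ip f f := by
    rw [shiftE, ip_add_left hf.euler (hf0.smul ν) hf0, ip_smul_left]
  have h3 := S.cauchy (hf.shiftE ν) hf0
  rw [h2, ← nn_sq] at h3
  rw [← nn_sq] at h1
  have h4 := le_abs_self (1 - S.γ)
  rcases eq_or_lt_of_le (S.nn_nonneg f) with h0 | h0
  · rw [← h0]
    simpa using S.nn_nonneg _
  · have : ν * S.nn f * S.nn f ≤ 2 * S.nn (shiftE ν f) * S.nn f := by nlinarith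
    exact le_of_mul_le_mul_right this h0

lemma nn_le_shiftE' (hν : 2 ≤ ν) (hγ : |1 - S.γ| ≤ ν) (hf : TF 1 f) :
    S.nn f ≤ S.nn (shiftE ν f) := by
  have := S.nn_le_shiftE hν hγ hf
  nlinarith [S.nn_nonneg f]

lemma nn_euler_le (hν : 2 ≤ ν) (hγ : |1 - S.γ| ≤ ν) (hf : TF 1 f) :
    S.nn (euler f) ≤ 3 * S.nn (shiftE ν f) := by
  have h1 := S.nn_le_shiftE hν hγ hf
  have e : euler f = shiftE ν f - ν • f := by rw [shiftE, add_sub_cancel_right]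
  have h2 := S.nn_sub_le (hf.shiftE ν) ((hf.of_le zero_le_one).smul ν)
  rw [← e, nn_smul, abs_of_nonneg (by linarith : (0 : ℝ) ≤ ν)] at h2
  linarith

lemma nn_iterate_le (hν : 2 ≤ ν) (hγ : |1 - S.γ| ≤ ν) {i n : ℕ} (hin : i ≤ n) (hf : TF n f) :
    S.nn ((shiftE ν)^[i] f) ≤ S.nn ((shiftE ν)^[n] f) := by
  induction n, hin using Nat.le_induction with
  | base => exact le_rfl
  | succ n hin ih =>
    refine (ih (hf.of_le (Nat.le_succ n))).trans ?_
    rw [Function.iterate_succ_apply']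
    exact nn_le_shiftE' hν hγ (TF.shiftE_iterate ν n (hf.of_le (by omega)))

lemma nn_iterate_lt (hν : 2 ≤ ν) (hγ : |1 - S.γ| ≤ ν) {i n : ℕ} (hin : i < n) (hf : TF n f) :
    ν * S.nn ((shiftE ν)^[i] f) ≤ 2 * S.nn ((shiftE ν)^[n] f) := by
  have h1 := nn_le_shiftE hν hγ
    (TF.shiftE_iterate ν i (hf.of_le (by omega)))
  rw [← Function.iterate_succ_apply' (shiftE ν)] at h1
  have h2 := nn_iterate_le hν hγ (Nat.succ_le_of_lt hin) hf
  linarith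

lemma nn_euler_iterate_le (hν : 2 ≤ ν) (hγ : |1 - S.γ| ≤ ν) {i n : ℕ} (hin : i < n)
    (hf : TF n f) : S.nn (euler ((shiftE ν)^[i] f)) ≤ 3 * S.nn ((shiftE ν)^[n] f) := by
  have h1 := nn_euler_le hν hγ
    (TF.shiftE_iterate ν i (hf.of_le (by omega)))
  rw [← Function.iterate_succ_apply' (shiftE ν)] at h1
  have h2 := nn_iterate_le hν hγ (Nat.succ_le_of_lt hin) hf
  linarith

end Strip

/-! ### Commutators with a coefficient -/

lemma sum_antidiagonal_shift_one (n : ℕ) (F : ℕ × ℕ → ℱ) :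
    ∑ p ∈ antidiagonal (n + 1), F p
      = F (0, n + 1) + ∑ p ∈ antidiagonal n, F (p.1 + 1, p.2) :=
  Finset.Nat.sum_antidiagonal_succ

lemma shiftE_comm_one (ν : ℝ) (n : ℕ) (ha : ContDiff ℝ (n + 1 : ℕ) a)
    (hf : ContDiff ℝ (n + 1 : ℕ) f) :
    (shiftE ν)^[n + 1] (a * f) = a * (shiftE ν)^[n + 1] f
      + ∑ p ∈ antidiagonal n, ((n + 1).choose (p.1 + 1) : ℝ) •
        (euler^[p.1 + 1] a * (shiftE ν)^[p.2] f) := by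
  rw [shiftE_iterate_mul ν (n + 1) ha hf, sum_antidiagonal_shift_one]
  simp

lemma shiftE_comm_two (ν : ℝ) (n : ℕ) (ha : ContDiff ℝ (n + 2 : ℕ) a)
    (hf : ContDiff ℝ (n + 2 : ℕ) f) :
    (shiftE ν)^[n + 2] (a * f) = a * (shiftE ν)^[n + 2] f
      + ((n + 2 : ℕ) : ℝ) • (euler a * (shiftE ν)^[n + 1] f)
      + ∑ p ∈ antidiagonal n, ((n + 2).choose (p.1 + 2) : ℝ) •
        (euler^[p.1 + 2] a * (shiftE ν)^[p.2] f) := by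
  rw [shiftE_comm_one ν (n + 1) ha hf, sum_antidiagonal_shift_one]
  simp [add_assoc]

lemma sum_choose_shift_le (n i : ℕ) :
    ∑ p ∈ antidiagonal n, ((n + i).choose (p.1 + i) : ℝ) ≤ 2 ^ (n + i) := by
  have h := Finset.Nat.sum_antidiagonal_eq_sum_range_succ_mk
    (fun p : ℕ × ℕ => ((n + i).choose (p.1 + i) : ℝ)) n
  rw [h]
  have h2 : ∑ k ∈ Finset.range (n + 1), ((n + i).choose (k + i) : ℝ)
      = ∑ k ∈ Finset.Ico i (n + i + 1), ((n + i).choose k : ℝ) := by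
    rw [Finset.sum_Ico_eq_sum_range]
    refine Finset.sum_congr (by congr 1; omega) fun k _ => by rw [add_comm k i]
  rw [h2]
  have h3 := Nat.sum_range_choose (n + i)
  have h4 : (∑ k ∈ Finset.range (n + i + 1), ((n + i).choose k : ℝ)) = 2 ^ (n + i) := by
    exact_mod_cast h3
  rw [← h4]
  refine Finset.sum_le_sum_of_subset_of_nonneg (fun k hk => ?_) fun _ _ _ => Nat.cast_nonneg _
  simp only [Finset.mem_Ico, Finset.mem_range] at *
  omega

namespace Strip
variable {S : Strip} {ν : ℝ}

lemma nn_weighted_sum_le {n i : ℕ} {F : ℕ × ℕ → ℱ} {B : ℝ}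
    (hF : ∀ p ∈ antidiagonal n, TF 0 (F p))
    (hB : ∀ p ∈ antidiagonal n, S.nn (F p) ≤ B) (hB0 : 0 ≤ B) :
    S.nn (∑ p ∈ antidiagonal n, ((n + i).choose (p.1 + i) : ℝ) • F p)
      ≤ 2 ^ (n + i) * B := by
  refine (nn_sum_le _ fun p hp => (hF p hp).smul _).trans ?_
  refine le_trans ?_ (mul_le_mul_of_nonneg_right (sum_choose_shift_le n i) hB0)
  rw [Finset.sum_mul]
  refine Finset.sum_le_sum fun p hp => ?_
  rw [nn_smul, abs_of_nonneg (Nat.cast_nonneg _)]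
  exact mul_le_mul_of_nonneg_left (hB p hp) (Nat.cast_nonneg _)

/-- The commutator of a power of `r ∂/∂r + ν` with a coefficient is of lower order. -/
lemma nn_comm_one_le (hν : 2 ≤ ν) (hγ : |1 - S.γ| ≤ ν) {n : ℕ} {C : ℝ} (hC : 0 ≤ C)
    (ha : ContDiff ℝ (n + 1 : ℕ) a) (hf : TF (n + 1) f)
    (hb : ∀ i, 1 ≤ i → i ≤ n + 1 → ∀ q ∈ Ω(S), |euler^[i] a q| ≤ C) :
    S.nn ((shiftE ν)^[n + 1] (a * f) - a * (shiftE ν)^[n + 1] f)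
      ≤ 2 ^ (n + 1) * (C * S.nn ((shiftE ν)^[n] f)) := by
  rw [shiftE_comm_one ν n ha hf.cd, add_sub_cancel_left]
  have hc : ∀ p ∈ antidiagonal n, ContDiff ℝ (0 : ℕ) (euler^[p.1 + 1] a) := fun p hp => by
    have := mem_antidiagonal.1 hp
    exact contDiff_euler_iterate _ (ha.of_le (by exact_mod_cast (by omega)))
  have ht : ∀ p ∈ antidiagonal n, TF 0 ((shiftE ν)^[p.2] f) := fun p hp => by
    have := mem_antidiagonal.1 hp
    exact TF.shiftE_iterate ν _ (hf.of_le (by omega))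
  refine nn_weighted_sum_le (fun p hp => TF.cmul (hc p hp) (ht p hp)) (fun p hp => ?_)
    (mul_nonneg hC (nn_nonneg _))
  have := mem_antidiagonal.1 hp
  refine (nn_cmul_le (hc p hp).continuous (ht p hp) hC (hb _ (by omega) (by omega))).trans ?_
  exact mul_le_mul_of_nonneg_left (nn_iterate_le hν hγ (by omega) (hf.of_le (by omega))) hC

/-- The remainder after two terms of the commutator of a power of `r ∂/∂r + ν` with `a`. -/
def rem (ν : ℝ) (n : ℕ) (a f : ℱ) : ℱ :=
  (shiftE ν)^[n + 1] (a * f) - a * (shiftE ν)^[n + 1] f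
    - ((n + 1 : ℕ) : ℝ) • (euler a * (shiftE ν)^[n] f)

lemma rem_zero (ha : ContDiff ℝ (1 : ℕ) a) (hf : ContDiff ℝ (1 : ℕ) f) : rem ν 0 a f = 0 := by
  rw [rem, shiftE_comm_one ν 0 ha hf]
  simp

lemma rem_succ {n : ℕ} (ha : ContDiff ℝ (n + 2 : ℕ) a) (hf : ContDiff ℝ (n + 2 : ℕ) f) :
    rem ν (n + 1) a f = ∑ p ∈ antidiagonal n, ((n + 2).choose (p.1 + 2) : ℝ) •
        (euler^[p.1 + 2] a * (shiftE ν)^[p.2] f) := by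
  rw [rem, shiftE_comm_two ν n ha hf]
  abel

lemma TF_rem {n k : ℕ} (ha : ContDiff ℝ (k + n + 1 : ℕ) a) (hf : TF (k + n + 1) f) :
    TF k (rem ν n a f) := by
  have h1 : ContDiff ℝ k (euler a) := (contDiff_euler (n := k + n) ha).of_le
    (by exact_mod_cast (by omega : k ≤ k + n))
  have h2 : TF k ((shiftE ν)^[n + 1] (a * f)) := TF.shiftE_iterate ν (n + 1) (TF.cmul ha hf)
  have h3 : TF k ((shiftE ν)^[n + 1] f) := TF.shiftE_iterate ν (n + 1) hf
  have h4 : TF k ((shiftE ν)^[n] f) := TF.shiftE_iterate ν n (hf.of_le (by omega))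
  have h5 : ContDiff ℝ k a := ha.of_nat (by omega)
  exact (h2.sub (TF.cmul h5 h3)).sub ((TF.cmul h1 h4).smul _)

lemma nn_zero : S.nn 0 = 0 := by simp [nn, ip]

/-- The remainder is bounded independently of the higher derivatives of the coefficient, if the
shift `ν` is large in comparison with these. -/
lemma nn_rem_le (hν : 2 ≤ ν) (hγ : |1 - S.γ| ≤ ν) {n : ℕ}
    (ha : ContDiff ℝ (n + 1 : ℕ) a) (hf : TF (n + 1) f)
    (hb : ∀ i, 2 ≤ i → i ≤ n + 1 → ∀ q ∈ Ω(S), |euler^[i] a q| ≤ ν) :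
    S.nn (rem ν n a f) ≤ 2 ^ (n + 1) * (2 * S.nn ((shiftE ν)^[n] f)) := by
  have hpos := S.nn_nonneg ((shiftE ν)^[n] f)
  cases n with
  | zero =>
    rw [rem_zero ha hf.cd, nn_zero]
    positivity
  | succ n =>
    rw [rem_succ ha hf.cd]
    have hc : ∀ p ∈ antidiagonal n, ContDiff ℝ (0 : ℕ) (euler^[p.1 + 2] a) :=
      fun p hp => by
        have := mem_antidiagonal.1 hp
        exact contDiff_euler_iterate _ (ha.of_le (by exact_mod_cast (by omega)))
    have ht : ∀ p ∈ antidiagonal n, TF 0 ((shiftE ν)^[p.2] f) := fun p hp => by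
      have := mem_antidiagonal.1 hp
      exact TF.shiftE_iterate ν _ (hf.of_le (by omega))
    refine nn_weighted_sum_le (fun p hp => TF.cmul (hc p hp) (ht p hp)) (fun p hp => ?_)
      (by positivity)
    have := mem_antidiagonal.1 hp
    refine (nn_cmul_le (hc p hp).continuous (ht p hp) (by linarith)
      (hb _ (by omega) (by omega))).trans ?_
    exact nn_iterate_lt hν hγ (by omega) (hf.of_le (by omega))

lemma nn_euler_rem_le (hν : 2 ≤ ν) (hγ : |1 - S.γ| ≤ ν) {n : ℕ} {C : ℝ} (hC : 0 ≤ C)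
    (ha : ContDiff ℝ (n + 2 : ℕ) a) (hf : TF (n + 2) f)
    (hb2 : ∀ q ∈ Ω(S), |euler^[2] a q| ≤ C)
    (hb : ∀ i, 2 ≤ i → i ≤ n + 2 → ∀ q ∈ Ω(S), |euler^[i] a q| ≤ ν) :
    S.nn (euler (rem ν n a f)) ≤ 2 ^ (n + 1) * ((8 + 3 * C) * S.nn ((shiftE ν)^[n] f)) := by
  have hpos := S.nn_nonneg ((shiftE ν)^[n] f)
  have ha' : ContDiff ℝ (n + 1 : ℕ) a := ha.of_nat (by omega)
  cases n with
  | zero =>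
    rw [rem_zero ha' (hf.cd.of_le (by norm_num))]
    have : euler (0 : ℱ) = 0 := by funext q; simp [euler, dr]
    rw [this, nn_zero]
    positivity
  | succ n =>
    rw [rem_succ ha' (hf.of_le (by omega)).cd]
    have hc : ∀ p ∈ antidiagonal n, ContDiff ℝ (1 : ℕ) (euler^[p.1 + 2] a) :=
      fun p hp => by
        have := mem_antidiagonal.1 hp
        exact contDiff_euler_iterate _ (ha.of_le (by exact_mod_cast (by omega)))
    have ht : ∀ p ∈ antidiagonal n, TF 1 ((shiftE ν)^[p.2] f) := fun p hp => by
      have := mem_antidiagonal.1 hp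
      exact TF.shiftE_iterate ν _ (hf.of_le (by omega))
    have e : euler (∑ p ∈ antidiagonal n, ((n + 2).choose (p.1 + 2) : ℝ) •
        (euler^[p.1 + 2] a * (shiftE ν)^[p.2] f))
        = ∑ p ∈ antidiagonal n, ((n + 2).choose (p.1 + 2) : ℝ) •
        (euler^[p.1 + 3] a * (shiftE ν)^[p.2] f + euler^[p.1 + 2] a * euler ((shiftE ν)^[p.2] f)) := by
      have h0 : ∀ g, shiftE 0 g = euler g := fun g => by rw [shiftE, zero_smul, add_zero]
      rw [← h0, shiftE_sum]
      · refine Finset.sum_congr rfl fun p hp => ?_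
        rw [shiftE_smul, h0, euler_mul ((hc p hp).diff le_rfl)
          ((ht p hp).diff le_rfl), ← Function.iterate_succ_apply' euler]
      · exact fun p hp => (((hc p hp).diff le_rfl).mul
          ((ht p hp).diff le_rfl)).const_smul _
    rw [e]
    have hc3 : ∀ p ∈ antidiagonal n, ContDiff ℝ (0 : ℕ) (euler^[p.1 + 3] a) :=
      fun p hp => by
        have := mem_antidiagonal.1 hp
        exact contDiff_euler_iterate _ (ha.of_le (by exact_mod_cast (by omega)))
    have hc2 : ∀ p ∈ antidiagonal n, ContDiff ℝ (0 : ℕ) (euler^[p.1 + 2] a) :=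
      fun p hp => (hc p hp).of_le (by norm_num)
    have ht0 : ∀ p ∈ antidiagonal n, TF 0 ((shiftE ν)^[p.2] f) :=
      fun p hp => (ht p hp).of_le (by norm_num)
    refine nn_weighted_sum_le (i := 2) (fun p hp => (TF.cmul (hc3 p hp) (ht0 p hp)).add
      (TF.cmul (hc2 p hp) (ht p hp).euler)) (fun p hp => ?_) (by positivity)
    have hpn := mem_antidiagonal.1 hp
    have hν0 : 0 ≤ ν := by linarith
    have b1 : S.nn (euler^[p.1 + 3] a * (shiftE ν)^[p.2] f)
        ≤ 2 * S.nn ((shiftE ν)^[n + 1] f) :=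
      (nn_cmul_le (hc3 p hp).continuous (ht0 p hp) hν0 (hb _ (by omega) (by omega))).trans
        (nn_iterate_lt hν hγ (by omega) (hf.of_le (by omega)))
    have b2 : S.nn (euler^[p.1 + 2] a * euler ((shiftE ν)^[p.2] f))
        ≤ (6 + 3 * C) * S.nn ((shiftE ν)^[n + 1] f) := by
      rcases Nat.eq_zero_or_pos p.1 with h0 | h0
      · have hx : ∀ q ∈ Ω(S), |euler^[p.1 + 2] a q| ≤ C := by rw [h0]; exact hb2
        have h1 := nn_cmul_le (S := S) (hc2 p hp).continuous (ht p hp).euler hC hx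
        have h2 := nn_euler_iterate_le (S := S) hν hγ (i := p.2) (n := n + 1) (f := f) (by omega)
          (hf.of_le (by omega))
        nlinarith
      · have h1 := nn_cmul_le (S := S) (hc2 p hp).continuous (ht p hp).euler hν0
          (hb _ (by omega) (by omega))
        have h2 := nn_euler_iterate_le (S := S) hν hγ (i := p.2) (n := p.2 + 1) (f := f) (by omega)
          (hf.of_le (by omega))
        have h3 := nn_iterate_lt (S := S) hν hγ (i := p.2 + 1) (n := n + 1) (f := f) (by omega)
          (hf.of_le (by omega))
        nlinarith
    have b3 := nn_add_le (S := S) (TF.cmul (hc3 p hp) (ht0 p hp))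
      (TF.cmul (hc2 p hp) (ht p hp).euler)
    linarith

end Strip

open Strip

/-! ### The degenerate operator and its energy inequality -/

/-- Functions of class `C^∞` on the plane which vanish near `{r ≤ 0}`. -/
def SF (f : ℱ) : Prop := ∀ N : ℕ, TF N f

/-- The data of the operator `X² + Z k Z + α D + β ∂_θ`, where `D = φ r ∂_r`,
`X = τ D + ∂_θ`, `Z = D - τ ∂_θ`, together with the bounds which the energy inequality needs: a
fixed constant `C` bounds a few derivatives of the coefficients, while the shift `ν` is allowed to
depend on all of them.  In the application `τ = tan θ` on the rectangle. -/
structure DegenerateOperator where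
  (S : Strip) (n : ℕ) (C ν : ℝ) (φ₀ τ₀ : ℝ → ℝ) (k α β : ℱ)
  hC : 1 ≤ C
  hν : 2 ≤ ν
  hγ : |1 - S.γ| ≤ ν
  hφ : ∀ N : ℕ, ContDiff ℝ N φ₀
  hτ : ∀ N : ℕ, ContDiff ℝ N τ₀
  hk : ContDiff ℝ (n + 2 : ℕ) k
  hα : ContDiff ℝ (n + 1 : ℕ) α
  hβ : ContDiff ℝ (n + 1 : ℕ) β
  φσ : φ₀ S.σ = 0
  bφ : ∀ i, i ≤ n + 1 → ∀ q ∈ Ω(S), |euler^[i] (fun q => φ₀ q.1) q| ≤ C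
  bτ : ∀ q ∈ Ω(S), |τ₀ q.2| ≤ 2 * S.δ
  bδ : 2 * S.δ ≤ 1
  bτ' : ∀ q ∈ Ω(S), |deriv τ₀ q.2| ≤ 2
  k0 : ∀ q ∈ Ω(S), 0 ≤ k q
  k1 : ∀ q ∈ Ω(S), k q ≤ 1
  bk1 : ∀ q ∈ Ω(S), |euler k q| ≤ C
  bk2 : ∀ q ∈ Ω(S), |euler^[2] k q| ≤ C
  bks : ∀ q ∈ Ω(S), |φ₀ q.1 * euler k q| ≤ C * √(k q)
  bα : ∀ q ∈ Ω(S), |α q| ≤ C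
  bα1 : ∀ q ∈ Ω(S), |euler α q| ≤ C
  bβ1 : ∀ q ∈ Ω(S), |euler β q| ≤ C
  bβθ : ∀ q ∈ Ω(S), |dθ β q| ≤ C
  bkν : ∀ i, 2 ≤ i → i ≤ n + 2 → ∀ q ∈ Ω(S), |euler^[i] k q| ≤ ν
  bαν : ∀ i, 2 ≤ i → i ≤ n + 1 → ∀ q ∈ Ω(S), |euler^[i] α q| ≤ ν
  bβν : ∀ i, 2 ≤ i → i ≤ n + 1 → ∀ q ∈ Ω(S), |euler^[i] β q| ≤ ν

lemma sf_diff (hf : SF f) : Differentiable ℝ f := (hf 1).diff le_rfl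

lemma SF.euler (hf : SF f) : SF (euler f) := fun N => (hf (N + 1)).euler

lemma SF.dθ (hf : SF f) : SF (dθ f) := fun N => (hf (N + 1)).dθ

lemma SF.add (hf : SF f) (hg : SF g) : SF (f + g) :=
  fun N => (hf N).add (hg N)

lemma SF.sub (hf : SF f) (hg : SF g) : SF (f - g) :=
  fun N => (hf N).sub (hg N)

lemma SF.cmul (ha : ∀ N : ℕ, ContDiff ℝ N a) (hf : SF f) : SF (a * f) :=
  fun N => TF.cmul (ha N) (hf N)

namespace DegenerateOperator

variable (E : DegenerateOperator)

/-- The cut-off function, as a function on the plane. -/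
def φ : ℱ := fun q => E.φ₀ q.1

/-- The function `τ`, as a function on the plane. -/
def τ : ℱ := fun q => E.τ₀ q.2

/-- The vector field `D = φ r ∂_r`. -/
def D (f : ℱ) : ℱ := E.φ * euler f

/-- The vector field `X = τ D + ∂_θ`. -/
def X (f : ℱ) : ℱ := E.τ * E.D f + dθ f

/-- The vector field `Z = D - τ ∂_θ`. -/
def Z (f : ℱ) : ℱ := E.D f - E.τ * dθ f

/-- The operator `M = X² + Z k Z + α D + β ∂_θ`. -/
def M (f : ℱ) : ℱ :=
  E.X (E.X f) + E.Z (E.k * E.Z f) + E.α * E.D f + E.β * dθ f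

/-- The powers of `r ∂_r + ν`. -/
def A (i : ℕ) (f : ℱ) : ℱ := (shiftE E.ν)^[i] f

/-- The divergence of `D` with respect to the weighted measure. -/
def dv : ℱ := (1 - E.S.γ) • E.φ + euler E.φ

/-- A constant, depending only on `C`, `γ` and the number of derivatives. -/
def K : ℝ := 3 * 2 ^ (E.n + 1) * E.C + (|1 - E.S.γ| + 1) * E.C + E.n + 1

variable {E} {w : ℱ}

local notation "nrm" => E.S.nn

lemma cφ (N : ℕ) : ContDiff ℝ N E.φ := (E.hφ N).comp contDiff_fst

lemma cτ (N : ℕ) : ContDiff ℝ N E.τ := (E.hτ N).comp contDiff_snd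

lemma ceφ (N : ℕ) : ContDiff ℝ N (euler E.φ) := contDiff_euler (cφ (N + 1))

lemma cdv (N : ℕ) : ContDiff ℝ N E.dv := ((cφ N).const_smul (1 - E.S.γ)).add (ceφ N)

lemma D_tf {N : ℕ} (hf : TF (N + 1) f) : TF N (E.D f) := TF.cmul (cφ N) hf.euler

lemma X_tf {N : ℕ} (hf : TF (N + 1) f) : TF N (E.X f) := (TF.cmul (cτ N) (D_tf hf)).add hf.dθ

lemma Z_tf {N : ℕ} (hf : TF (N + 1) f) : TF N (E.Z f) := (D_tf hf).sub (TF.cmul (cτ N) hf.dθ)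

lemma D_sf (hf : SF f) : SF (E.D f) := fun N => D_tf (hf (N + 1))

lemma X_sf (hf : SF f) : SF (E.X f) := fun N => X_tf (hf (N + 1))

lemma Z_sf (hf : SF f) : SF (E.Z f) := fun N => Z_tf (hf (N + 1))

lemma A_tf {N i : ℕ} (hf : TF (N + i) f) : TF N (E.A i f) := TF.shiftE_iterate _ _ hf

lemma A_sf (i : ℕ) (hf : SF f) : SF (E.A i f) := fun N => A_tf (hf (N + i))

lemma one_le_K1 : 3 ≤ 3 * 2 ^ (E.n + 1) * E.C := by
  have h1 : (1 : ℝ) ≤ 2 ^ (E.n + 1) := one_le_pow₀ (by norm_num)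
  have := mul_le_mul h1 E.hC zero_le_one (by positivity)
  nlinarith

lemma kd_nonneg : 0 ≤ (|1 - E.S.γ| + 1) * E.C := by
  have := E.hC
  positivity

lemma K1_le : 3 * 2 ^ (E.n + 1) * E.C ≤ E.K := by
  have := E.kd_nonneg
  rw [K]
  linarith

lemma Kd_le : (|1 - E.S.γ| + 1) * E.C ≤ E.K := by
  have := E.one_le_K1
  rw [K]
  linarith

lemma three_le_K : 3 ≤ E.K := E.one_le_K1.trans E.K1_le

lemma C_le_K : E.C ≤ E.K := by
  have h1 : (1 : ℝ) ≤ 2 ^ (E.n + 1) := one_le_pow₀ (by norm_num)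
  have := E.hC
  have h3 := E.K1_le
  nlinarith

lemma m_le_K : ((E.n + 1 : ℕ) : ℝ) ≤ E.K := by
  have := E.kd_nonneg
  have := E.one_le_K1
  rw [K]
  push_cast
  linarith

lemma two_pow_le_K : 3 * 2 ^ (E.n + 1) ≤ E.K := by
  have h1 : (1 : ℝ) ≤ 2 ^ (E.n + 1) := one_le_pow₀ (by norm_num)
  have := E.hC
  have h3 := E.K1_le
  nlinarith

lemma bφ0 (q : ℝ × ℝ) (hq : q ∈ Ω(E.S)) : |E.φ q| ≤ E.C := E.bφ 0 (by omega) q hq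

lemma bτ1 (q : ℝ × ℝ) (hq : q ∈ Ω(E.S)) : |E.τ q| ≤ 1 := (E.bτ q hq).trans E.bδ

lemma bdv (q : ℝ × ℝ) (hq : q ∈ Ω(E.S)) : |E.dv q| ≤ E.K := by
  refine le_trans ?_ E.Kd_le
  have h1 := bφ0 q hq
  have h2 := E.bφ 1 (by omega) q hq
  simp only [dv, Pi.add_apply, Pi.smul_apply, smul_eq_mul]
  refine (abs_add_le _ _).trans ?_
  rw [abs_mul, add_mul, one_mul]
  exact add_le_add (mul_le_mul_of_nonneg_left h1 (abs_nonneg _)) h2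

lemma abs_ip_cmul_le (ha : Continuous a) (hf : TF 0 f) (hg : TF 0 g) {C : ℝ}
    (hC : 0 ≤ C) (hle : ∀ q ∈ Ω(E.S), |a q| ≤ C) :
    |E.S.ip (a * f) g| ≤ C * nrm f * nrm g := by
  have h1 : TF 0 (a * f) := TF.cmul (by exact_mod_cast contDiff_zero.2 ha) hf
  refine (abs_ip_le h1 hg).trans ?_
  exact mul_le_mul_of_nonneg_right (nn_cmul_le ha hf hC hle) (nn_nonneg _)

lemma nn_τ_le (hf : TF 0 f) : nrm (E.τ * f) ≤ nrm f := by
  simpa using nn_cmul_le (cτ 0).continuous hf zero_le_one bτ1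

lemma ip_D (hf : TF 1 f) (hg : TF 1 g) :
    E.S.ip (E.D f) g = -E.S.ip f (E.D g) - E.S.ip f (E.dv * g) := by
  have hφg : TF 1 (E.φ * g) := TF.cmul (cφ 1) hg
  have hf0 := hf.of_le zero_le_one
  have hg0 := hg.of_le zero_le_one
  have h1 := E.S.ip_euler hf hφg
  have hb : ∀ t, f (E.S.σ, t) * (E.φ * g) (E.S.σ, t) = 0 := fun t => by
    simp [φ, E.φσ]
  simp only [hb, integral_zero, mul_zero, add_zero] at h1
  rw [euler_mul ((cφ 1).diff le_rfl) (hg.diff le_rfl),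
    ip_add_right (TF.cmul (ceφ 0) hg0) (TF.cmul (cφ 0) hg.euler) hf0] at h1
  have h2 : E.S.ip f (E.dv * g) = (1 - E.S.γ) * E.S.ip f (E.φ * g) + E.S.ip f (euler E.φ * g) := by
    rw [dv, add_mul, smul_mul_assoc, ip_add_right ((TF.cmul (cφ 0) hg0).smul _)
      (TF.cmul (ceφ 0) hg0) hf0, ip_smul_right]
  rw [D, ip_mul_left, ip_comm, ip_mul_left, ip_comm, ip_mul_left, h1,
    h2, D]
  ring

lemma D_cmul (ha : Differentiable ℝ a) (hf : Differentiable ℝ f) :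
    E.D (a * f) = E.D a * f + a * E.D f := by
  rw [D, euler_mul ha hf, D, D]
  ring

lemma D_angle (t : ℝ → ℝ) : E.D ((fun q => t q.2) * f) = (fun q => t q.2) * E.D f := by
  rw [D, euler_mul_angle, D]
  ring

lemma D_τ_mul : E.D (E.τ * f) = E.τ * E.D f := D_angle E.τ₀

/-- The boundary condition which makes the boundary terms at `θ = 0, δ` vanish. -/
def Bdry (E : DegenerateOperator) (f : ℱ) : Prop :=
  ∀ r ∈ Ioo 0 E.S.σ, f (r, E.S.δ) = 0 ∧ f (r, 0) = 0

lemma ip_X (hf : TF 1 f) (hg : TF 1 g) (hb : Bdry E (f * g)) :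
    E.S.ip (E.X f) g = -E.S.ip f (E.X g) - E.S.ip f (E.τ * (E.dv * g)) := by
  have hτg : TF 1 (E.τ * g) := TF.cmul (cτ 1) hg
  have hf0 := hf.of_le zero_le_one
  have hg0 := hg.of_le zero_le_one
  rw [X, ip_add_left (TF.cmul (cτ 0) (D_tf hf)) hf.dθ hg0, ip_mul_left,
    ip_D hf hτg, ip_dθ hf hg hb, D_τ_mul, X, ip_add_right (TF.cmul (cτ 0) (D_tf hg))
      hg.dθ hf0, mul_left_comm E.dv]
  ring

/-- The derivative of `τ`, as a function on the plane. -/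
def τ' (E : DegenerateOperator) : ℱ := fun q => deriv E.τ₀ q.2

lemma dθ_τ : dθ E.τ = E.τ' := rfl

lemma cτ' (N : ℕ) : ContDiff ℝ N E.τ' := contDiff_dθ (cτ (N + 1))

lemma ip_Z (hf : TF 1 f) (hg : TF 1 g) (hb : Bdry E (f * g)) :
    E.S.ip (E.Z f) g = -E.S.ip f (E.Z g) - E.S.ip f (E.dv * g) + E.S.ip f (E.τ' * g) := by
  have hτg : TF 1 (E.τ * g) := TF.cmul (cτ 1) hg
  have hf0 := hf.of_le zero_le_one
  have hg0 := hg.of_le zero_le_one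
  have hb' : Bdry E (f * (E.τ * g)) := fun r hr => by
    have := hb r hr
    simp only [Pi.mul_apply] at *
    constructor
    · rw [mul_left_comm, this.1, mul_zero]
    · rw [mul_left_comm, this.2, mul_zero]
  rw [Z, ip_sub_left (D_tf hf) (TF.cmul (cτ 0) hf.dθ) hg0, ip_mul_left,
    ip_D hf hg, ip_dθ hf hτg hb', dθ_mul ((cτ 1).diff le_rfl)
    (hg.diff le_rfl), dθ_τ, ip_add_right (TF.cmul (cτ' 0) hg0) (TF.cmul (cτ 0) hg.dθ) hf0,
    Z, ip_sub_right (D_tf hg) (TF.cmul (cτ 0) hg.dθ) hf0]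
  ring



lemma Bdry.mul_left (hb : Bdry E f) : Bdry E (f * g) := fun r hr => by
  simp [(hb r hr).1, (hb r hr).2]

lemma Bdry.mul_right (hb : Bdry E f) : Bdry E (g * f) := fun r hr => by
  simp [(hb r hr).1, (hb r hr).2]

lemma Bdry.A (i : ℕ) (hb : Bdry E f) : Bdry E (E.A i f) := by
  induction i generalizing f with
  | zero => exact hb
  | succ i ih =>
    rw [DegenerateOperator.A, Function.iterate_succ_apply]
    refine ih fun r hr => ?_
    have h0 : ∀ t, (∀ r ∈ Ioo 0 E.S.σ, f (r, t) = 0) → dr f (r, t) = 0 := fun t ht => by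
      have : (fun r => f (r, t)) =ᶠ[𝓝 r] fun _ => 0 := by
        filter_upwards [isOpen_Ioo.mem_nhds hr] with r' hr' using ht r' hr'
      rw [dr, this.deriv_eq]
      simp
    have h1 := h0 E.S.δ fun r hr => (hb r hr).1
    have h2 := h0 0 fun r hr => (hb r hr).2
    simp [shiftE, euler, h1, h2, hb r hr]

/-- A Poincaré inequality along the vector field `X`. -/
lemma poincare (hδ : E.S.δ * E.K ≤ 1 / 2) (hf : TF 1 f) (hb : Bdry E f) :
    nrm f ≤ 4 * E.S.δ * nrm (E.X f) := by
  have hf0 := hf.of_le zero_le_one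
  set t : ℱ := fun q => q.2 with ht
  have ct : ∀ N : ℕ, ContDiff ℝ N t := fun N => contDiff_snd
  have htf : TF 1 (t * f) := TF.cmul (ct 1) hf
  have h1 := ip_X hf htf hb.mul_left
  have e1 : E.X (t * f) = t * E.X f + f := by
    have : dθ t = 1 := by
      funext q
      simp [dθ, t]
    rw [X, D_angle (fun s => s), dθ_mul ((ct 1).diff le_rfl) (hf.diff le_rfl),
      this, X]
    ring
  have htX : TF 0 (t * E.X f) := TF.cmul (ct 0) (X_tf hf)
  rw [e1, ip_add_right htX hf0 hf0] at h1
  have e2 : E.S.ip (E.X f) (t * f) = E.S.ip f (t * E.X f) := by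
    rw [ip_comm, ip_mul_left]
  have hδ0 := E.S.hδ.le
  have b1 : |E.S.ip (t * E.X f) f| ≤ E.S.δ * nrm (E.X f) * nrm f := by
    refine abs_ip_cmul_le (ct 0).continuous (X_tf hf) hf0 hδ0 fun q hq => ?_
    rw [ht, abs_of_pos hq.2.1]
    exact hq.2.2.le
  have b2 : |E.S.ip ((E.τ * (E.dv * t)) * f) f| ≤ (E.S.δ * E.K) * nrm f * nrm f := by
    refine abs_ip_cmul_le ((cτ 0).mul ((cdv 0).mul (ct 0))).continuous hf0 hf0
      (mul_nonneg hδ0 (by linarith [E.three_le_K])) fun q hq => ?_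
    simp only [abs_mul, ht, abs_of_pos hq.2.1]
    have h1 := bτ1 q hq
    have h2 := bdv q hq
    have h3 : q.2 ≤ E.S.δ := hq.2.2.le
    have h4 : 0 < q.2 := hq.2.1
    calc |E.τ q| * (|E.dv q| * q.2) ≤ 1 * (E.K * E.S.δ) := by gcongr; linarith [E.three_le_K]
      _ = E.S.δ * E.K := by ring
  have e3 : E.S.ip f (E.τ * (E.dv * (t * f))) = E.S.ip ((E.τ * (E.dv * t)) * f) f := by
    rw [ip_comm]
    congr 1
    ring
  rw [e2, e3, ip_comm f (t * E.X f)] at h1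
  rw [← nn_sq] at h1
  have h5 := abs_le.1 b1
  have h6 := abs_le.1 b2
  have hn := E.S.nn_nonneg f
  rcases eq_or_lt_of_le hn with h0 | h0
  · rw [← h0]
    have := E.S.nn_nonneg (E.X f)
    positivity
  · have h7 : E.S.δ * E.K * nrm f * nrm f ≤ 1 / 2 * nrm f * nrm f := by gcongr
    have : nrm f * nrm f ≤ 4 * E.S.δ * nrm (E.X f) * nrm f := by nlinarith
    exact le_of_mul_le_mul_right this h0

/-! ### Commutators with the vector fields -/

/-- The commutator of `(r ∂_r + ν)^i` with `D`. -/
def R (E : DegenerateOperator) (i : ℕ) (f : ℱ) : ℱ :=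
  E.A i (E.D f) - E.D (E.A i f)

lemma R_tf {N i : ℕ} (hf : TF (N + i + 1) f) : TF N (E.R i f) :=
  (A_tf (D_tf hf)).sub (D_tf (A_tf (hf.of_le (by omega))))

lemma A_D (i : ℕ) (f : ℱ) : E.A i (E.D f) = E.D (E.A i f) + E.R i f := by
  rw [R]
  abel

lemma A_X {i : ℕ} (hf : TF (i + 1) f) : E.A i (E.X f) = E.X (E.A i f) + E.τ * E.R i f := by
  have h1 : TF i (E.τ * E.D f) := TF.cmul (cτ i) (D_tf hf)
  have h2 : E.A i (E.τ * E.D f) = E.τ * E.A i (E.D f) := shiftE_iterate_mul_angle E.τ₀ _ _ _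
  have h3 : E.A i (dθ f) = dθ (E.A i f) := shiftE_dθ_iterate _ _ hf.cd
  rw [X, A, shiftE_iterate_add _ _ h1.cd hf.dθ.cd]
  change E.A i _ + E.A i _ = _
  rw [h2, h3, A_D, X]
  ring

lemma A_Z {i : ℕ} (hf : TF (i + 1) f) : E.A i (E.Z f) = E.Z (E.A i f) + E.R i f := by
  have h1 : TF i (E.τ * dθ f) := TF.cmul (cτ i) hf.dθ
  have h2 : E.A i (E.τ * dθ f) = E.τ * E.A i (dθ f) := shiftE_iterate_mul_angle E.τ₀ _ _ _
  have h3 : E.A i (dθ f) = dθ (E.A i f) := shiftE_dθ_iterate _ _ hf.cd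
  rw [Z, A, shiftE_iterate_sub _ _ (D_tf hf).cd h1.cd]
  change E.A i _ - E.A i _ = _
  rw [h2, h3, A_D, Z]
  ring

lemma nn_R_le {i : ℕ} (hi : i ≤ E.n + 1) (hf : TF (i + 1) f) :
    nrm (E.R i f) ≤ E.K * nrm (E.A i f) := by
  have hpos := E.S.nn_nonneg (E.A i f)
  have hK := E.three_le_K
  cases i with
  | zero =>
    have : E.R 0 f = 0 := by
      rw [R]
      exact sub_self _
    rw [this, nn_zero]
    positivity
  | succ j =>
    have hef : TF (j + 1) (euler f) := hf.euler
    have h1 := nn_comm_one_le E.hν E.hγ (zero_le_one.trans E.hC)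
      (cφ (j + 1)) hef (fun i _ h2 => E.bφ i (by omega))
    have h2 : (shiftE E.ν)^[j + 1] (euler f) = euler ((shiftE E.ν)^[j + 1] f) :=
      shiftE_euler_iterate _ _ hf.cd
    have h3 : (shiftE E.ν)^[j] (euler f) = euler ((shiftE E.ν)^[j] f) :=
      shiftE_euler_iterate _ _ (hf.of_le (by omega)).cd
    rw [h2, h3] at h1
    have h4 := nn_euler_iterate_le E.hν E.hγ (Nat.lt_succ_self j)
      (hf.of_le (by omega))
    refine h1.trans ?_
    have hC := E.hC
    have h5 : (2 : ℝ) ^ (j + 1) ≤ 2 ^ (E.n + 1) := pow_le_pow_right₀ (by norm_num) hi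
    calc 2 ^ (j + 1) * (E.C * nrm (euler ((shiftE E.ν)^[j] f)))
        ≤ 2 ^ (E.n + 1) * (E.C * (3 * nrm (E.A (j + 1) f))) :=
          mul_le_mul h5 (mul_le_mul_of_nonneg_left h4 (by linarith))
            (mul_nonneg (by linarith) (nn_nonneg _)) (by positivity)
      _ = (3 * 2 ^ (E.n + 1) * E.C) * nrm (E.A (j + 1) f) := by ring
      _ ≤ _ := mul_le_mul_of_nonneg_right E.K1_le hpos

end DegenerateOperator

namespace DegenerateOperator

/-! ### The terms of the energy identity -/

variable {E : DegenerateOperator} {f g w F : ℱ}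

local notation "nrm" => E.S.nn
local notation "A₁" => E.A (E.n + 1)

/-- The square root of the degenerate coefficient. -/
def sk (E : DegenerateOperator) : ℱ := fun q => √(E.k q)

lemma csk : Continuous E.sk := E.hk.continuous.sqrt

lemma csk0 : ContDiff ℝ (0 : ℕ) E.sk := by exact_mod_cast contDiff_zero.2 csk

lemma sk_tf (hf : TF 0 f) : TF 0 (E.sk * f) := TF.cmul csk0 hf

lemma k_tf {N : ℕ} (hN : N ≤ E.n + 2) (hf : TF N f) : TF N (E.k * f) :=
  TF.cmul (E.hk.of_nat hN) hf

lemma ek_tf {N : ℕ} (hN : N ≤ E.n + 1) (hf : TF N f) : TF N (euler E.k * f) :=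
  TF.cmul ((contDiff_euler (n := E.n + 1) E.hk).of_nat hN) hf

lemma ip_k (f g : ℱ) : E.S.ip (E.k * f) g = E.S.ip (E.sk * f) (E.sk * g) := by
  refine ip_congr fun q hq => ?_
  simp only [Pi.mul_apply, sk]
  have := mul_self_sqrt (E.k0 q hq)
  calc E.k q * f q * g q = (√(E.k q) * √(E.k q)) * f q * g q := by rw [this]
    _ = _ := by ring

lemma nn_sk_le (hf : TF 0 f) : nrm (E.sk * f) ≤ nrm f := by
  refine (nn_cmul_le csk hf zero_le_one fun q hq => ?_).trans_eq (one_mul _)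
  rw [sk, abs_of_nonneg (sqrt_nonneg _)]
  exact sqrt_le_one.2 (E.k1 q hq)

lemma nn_k_le (hf : TF 0 f) : nrm (E.k * f) ≤ nrm (E.sk * f) := by
  refine (nn_le_of_abs_le (k_tf (by omega) hf) (sk_tf hf) zero_le_one fun q hq => ?_).trans_eq
    (one_mul _)
  simp only [Pi.mul_apply, sk, one_mul]
  have h0 := E.k0 q hq
  rw [abs_mul, abs_mul, abs_of_nonneg h0, abs_of_nonneg (sqrt_nonneg _)]
  refine mul_le_mul_of_nonneg_right ?_ (abs_nonneg _)
  have h1 := mul_self_sqrt h0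
  have h2 := sqrt_le_one.2 (E.k1 q hq)
  nlinarith [sqrt_nonneg (E.k q)]

lemma nn_φk1_le (hf : TF 0 f) : nrm (E.φ * (euler E.k * f)) ≤ E.C * nrm (E.sk * f) := by
  have hC := E.hC
  refine nn_le_of_abs_le (TF.cmul (cφ 0) (ek_tf (by omega) hf)) (sk_tf hf) (by linarith)
    fun q hq => ?_
  have h := E.bks q hq
  simp only [Pi.mul_apply, sk, φ]
  rw [← mul_assoc, abs_mul, abs_mul (√_), abs_of_nonneg (sqrt_nonneg _), ← mul_assoc]
  exact mul_le_mul_of_nonneg_right h (abs_nonneg _)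

lemma nn_φ_le (hf : TF 0 f) : nrm (E.φ * f) ≤ E.C * nrm f :=
  nn_cmul_le (cφ 0).continuous hf (zero_le_one.trans E.hC) bφ0

lemma A_succ (i : ℕ) (f : ℱ) : E.A (i + 1) f = shiftE E.ν (E.A i f) :=
  Function.iterate_succ_apply' _ _ _

lemma nn_ττ_le (hf : TF 0 f) : nrm (f + E.τ * (E.τ * f)) ≤ 2 * nrm f := by
  have h1 := nn_τ_le (E := E) hf
  have h2 := nn_τ_le (E := E) (TF.cmul (cτ (E := E) 0) hf)
  have h3 := nn_add_le (S := E.S) hf (TF.cmul (cτ (E := E) 0) (TF.cmul (cτ (E := E) 0) hf))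
  linarith

lemma nn_τδ_le (hf : TF 0 f) : nrm (E.τ * f) ≤ 2 * E.S.δ * nrm f :=
  nn_cmul_le (cτ 0).continuous hf (by linarith [E.S.hδ]) E.bτ

lemma Z_eq (f : ℱ) : E.Z f = (E.D f + E.τ * (E.τ * E.D f)) - E.τ * E.X f := by
  rw [Z, X]
  ring

/-- Pairing with `Z f`: the derivative along `D` is integrated by parts. -/
lemma abs_ip_Z_le (hF : TF 1 F) (hf : TF 1 f) :
    |E.S.ip F (E.Z f)| ≤ 2 * nrm (E.D F) * nrm f + 2 * E.K * nrm F * nrm f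
      + 2 * E.S.δ * nrm F * nrm (E.X f) := by
  have hF0 := hF.of_le zero_le_one
  have hf0 := hf.of_le zero_le_one
  set F' := F + E.τ * (E.τ * F) with hF'
  have tF' : TF 1 F' := hF.add (TF.cmul (cτ 1) (TF.cmul (cτ 1) hF))
  have hDf : TF 0 (E.D f) := D_tf hf
  have e1 : E.S.ip F (E.Z f) = E.S.ip F' (E.D f) - E.S.ip (E.τ * F) (E.X f) := by
    have a1 : TF 0 (E.τ * (E.τ * E.D f)) := TF.cmul (cτ 0) (TF.cmul (cτ 0) hDf)
    rw [Z_eq, ip_sub_right (hDf.add a1) (TF.cmul (cτ 0) (X_tf hf)) hF0,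
      ip_add_right hDf a1 hF0, hF',
      ip_add_left hF0 (TF.cmul (cτ 0) (TF.cmul (cτ 0) hF0)) hDf, ip_mul_left,
      ip_mul_left, ip_mul_left]
  have e2 : E.D F' = E.D F + E.τ * (E.τ * E.D F) := by
    have hd := (TF.cmul (cτ (E := E) 1) (TF.cmul (cτ (E := E) 1) hF)).diff le_rfl
    rw [hF', D, euler_add (hF.diff le_rfl) hd, mul_add]
    change E.D F + E.D (E.τ * (E.τ * F)) = _
    rw [D_τ_mul, D_τ_mul]
  have e3 := ip_D (E := E) tF' hf
  have b1 := abs_ip_le (S := E.S) (D_tf (E := E) tF') hf0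
  have b2 : |E.S.ip (E.dv * F') f| ≤ E.K * nrm F' * nrm f :=
    abs_ip_cmul_le (cdv 0).continuous (tF'.of_le zero_le_one) hf0 (by linarith [E.three_le_K]) bdv
  rw [← ip_mul_left] at e3
  rw [e2] at b1
  have b3 := nn_ττ_le (E := E) (D_tf (E := E) hF)
  have b4 := nn_ττ_le (E := E) hF0
  rw [← hF'] at b4
  have b5 := abs_ip_le (S := E.S) (TF.cmul (cτ (E := E) 0) hF0) (X_tf (E := E) hf)
  have b6 := nn_τδ_le (E := E) hF0
  have n1 := E.S.nn_nonneg f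
  have n2 := E.S.nn_nonneg (E.X f)
  have c1 : nrm (E.D F + E.τ * (E.τ * E.D F)) * nrm f ≤ 2 * nrm (E.D F) * nrm f :=
    mul_le_mul_of_nonneg_right b3 n1
  have c2 : E.K * nrm F' * nrm f ≤ 2 * E.K * nrm F * nrm f := by
    have := mul_le_mul_of_nonneg_right (mul_le_mul_of_nonneg_left b4
      (by linarith [E.three_le_K] : 0 ≤ E.K)) n1
    linarith
  have c3 := mul_le_mul_of_nonneg_right b6 n2
  rw [e2] at e3
  rw [e1, show E.S.ip F' (E.D f) = -E.S.ip (E.D F + E.τ * (E.τ * E.D F)) f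
    - E.S.ip (E.dv * F') f by linarith]
  rw [abs_le] at *
  constructor <;> linarith

section
variable (hw : SF w) (hb : Bdry E w)

lemma nn_A_X_le (hw : SF w) (hN : nrm (A₁ w) ≤ nrm (E.X (A₁ w))) :
    nrm (A₁ (E.X w)) ≤ 2 * E.K * nrm (E.X (A₁ w)) := by
  have h1 := nn_R_le le_rfl (hw (E.n + 1 + 1))
  have hR : TF 0 (E.R (E.n + 1) w) := R_tf (hw _)
  have h2 := nn_τ_le (E := E) hR
  have h3 := nn_add_le (S := E.S) (X_tf (E := E) (A_sf (E := E) (E.n + 1) hw 1)) (TF.cmul (cτ (E := E) 0) hR)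
  rw [← A_X (hw _)] at h3
  have hK := E.three_le_K
  have h4 := mul_le_mul_of_nonneg_left hN (by linarith : 0 ≤ E.K)
  have h5 := E.S.nn_nonneg (E.X (A₁ w))
  nlinarith

lemma energy_X (hw : SF w) (hb : Bdry E w)
    (hN : nrm (A₁ w) ≤ nrm (E.X (A₁ w))) :
    nrm (E.X (A₁ w)) ^ 2
      - 5 * E.K ^ 2 * nrm (E.X (A₁ w)) * nrm (A₁ w)
      ≤ -E.S.ip (A₁ (E.X (E.X w))) (A₁ w) := by
  have b1 := nn_A_X_le hw hN
  set W := A₁ w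
  have sW : SF W := A_sf _ hw
  set W1 := A₁ (E.X w)
  have sW1 : SF W1 := A_sf _ (X_sf hw)
  have hK := E.three_le_K
  have hR : TF 0 (E.R (E.n + 1) (E.X w)) := R_tf (X_sf hw _)
  have hR' : TF 0 (E.R (E.n + 1) w) := R_tf (hw _)
  have e1 : A₁ (E.X (E.X w)) = E.X W1 + E.τ * E.R (E.n + 1) (E.X w) :=
    A_X (X_sf hw _)
  have e2 : W1 = E.X W + E.τ * E.R (E.n + 1) w := A_X (hw _)
  have hbW : Bdry E W := hb.A _
  have e3 := ip_X (sW1 1) (sW 1) hbW.mul_right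
  have b2 := nn_R_le le_rfl (X_sf (E := E) hw (E.n + 1 + 1))
  have b2' := nn_R_le le_rfl (hw (E.n + 1 + 1))
  have b3 := nn_τ_le (E := E) hR
  have b3' := nn_τ_le (E := E) hR'
  have b4 := abs_ip_le (S := E.S) (TF.cmul (cτ (E := E) 0) hR) (sW 0)
  have b4' := abs_ip_le (S := E.S) (TF.cmul (cτ (E := E) 0) hR') (X_sf (E := E) sW 0)
  have b5 : |E.S.ip ((E.τ * E.dv) * W1) W| ≤ E.K * nrm W1 * nrm W := by
    refine abs_ip_cmul_le ((cτ 0).mul (cdv 0)).continuous (sW1 0) (sW 0) (by linarith)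
      fun q hq => ?_
    rw [abs_mul]
    have h1 := bτ1 q hq
    have h2 := bdv q hq
    calc |E.τ q| * |E.dv q| ≤ 1 * E.K := by gcongr
      _ = E.K := one_mul _
  have e4 : E.S.ip W1 (E.τ * (E.dv * W)) = E.S.ip ((E.τ * E.dv) * W1) W := by
    rw [ip_mul_left, mul_assoc]
  have e5 : E.S.ip W1 (E.X W) = nrm (E.X W) ^ 2 + E.S.ip (E.τ * E.R (E.n + 1) w) (E.X W) := by
    rw [e2, ip_add_left (X_sf sW 0) (TF.cmul (cτ 0) hR') (X_sf sW 0), nn_sq]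
  rw [e1, ip_add_left (X_sf sW1 0) (TF.cmul (cτ 0) hR) (sW 0), e3, e4, e5]
  have n0 := E.S.nn_nonneg W
  have n1 := E.S.nn_nonneg (E.X W)
  have c1 : nrm (E.τ * E.R (E.n + 1) (E.X w)) * nrm W ≤ 2 * E.K ^ 2 * nrm (E.X W) * nrm W := by
    refine mul_le_mul_of_nonneg_right ?_ n0
    have := mul_le_mul_of_nonneg_left b1 (by linarith : 0 ≤ E.K)
    nlinarith
  have c2 : nrm (E.τ * E.R (E.n + 1) w) * nrm (E.X W) ≤ E.K ^ 2 * nrm (E.X W) * nrm W := by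
    have h1 : E.K * nrm W ≤ E.K ^ 2 * nrm W := by gcongr; nlinarith
    have := mul_le_mul_of_nonneg_right ((b3'.trans b2').trans h1) n1
    linarith
  have c3 : E.K * nrm W1 * nrm W ≤ 2 * E.K ^ 2 * nrm (E.X W) * nrm W := by
    refine mul_le_mul_of_nonneg_right ?_ n0
    have := mul_le_mul_of_nonneg_left b1 (by linarith : 0 ≤ E.K)
    nlinarith
  rw [abs_le] at *
  linarith

lemma nn_DY_le (hw : SF w) : nrm (E.D (E.A E.n w)) ≤ 3 * E.K * nrm (A₁ w) := by
  have h1 := nn_φ_le (E := E) (SF.euler (A_sf (E := E) E.n hw) 0)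
  have h2 := nn_euler_le E.hν E.hγ (A_sf (E := E) E.n hw 1)
  rw [← A_succ] at h2
  have hC := E.hC
  have hK := E.C_le_K
  have := E.S.nn_nonneg (A₁ w)
  calc nrm (E.D (E.A E.n w)) ≤ E.C * (3 * nrm (A₁ w)) :=
        h1.trans (mul_le_mul_of_nonneg_left h2 (by linarith))
    _ ≤ E.K * (3 * nrm (A₁ w)) := by gcongr
    _ = _ := by ring

/-- Up to an error that is small for large `ν`, the function `(r ∂_r + ν)^n Z w` is a multiple of
`D (r ∂_r + ν)^n w`. -/
lemma A_Z_eq (hw : SF w) (hN : nrm (A₁ w) ≤ nrm (E.X (A₁ w))) :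
    ∃ ρ, SF ρ ∧ E.A E.n (E.Z w) = E.D (E.A E.n w) + E.τ * (E.τ * E.D (E.A E.n w)) + ρ ∧
      E.ν * nrm ρ ≤ 8 * E.K * nrm (E.X (A₁ w)) := by
  have sR : SF (E.R E.n w) := fun N => R_tf (hw _)
  have sAX : SF (E.A E.n (E.X w)) := A_sf _ (X_sf hw)
  have sτR : SF (E.τ * E.R E.n w) := SF.cmul (cτ) sR
  refine ⟨E.R E.n w + E.τ * (E.τ * E.R E.n w) - E.τ * E.A E.n (E.X w),
    (sR.add (SF.cmul (cτ) sτR)).sub (SF.cmul (cτ) sAX), ?_, ?_⟩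
  · rw [A_X (hw _), A_Z (hw _), Z, X]
    ring
  · have hK := E.three_le_K
    have hν := E.hν
    have h1 := nn_R_le (Nat.le_succ _) (hw (E.n + 1))
    have h2 : E.ν * nrm (E.A E.n w) ≤ 2 * nrm (A₁ w) :=
      nn_iterate_lt E.hν E.hγ (Nat.lt_succ_self _) (hw _)
    have h3 : E.ν * nrm (E.A E.n (E.X w)) ≤ 2 * nrm (A₁ (E.X w)) :=
      nn_iterate_lt E.hν E.hγ (Nat.lt_succ_self _) (X_sf hw _)
    have h4 := nn_A_X_le hw hN
    have h5 := nn_ττ_le (E := E) (sR 0)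
    have h6 := nn_τ_le (E := E) (sAX 0)
    have h7 := nn_sub_le (S := E.S) ((sR 0).add (SF.cmul (cτ (E := E)) sτR 0)) (SF.cmul (cτ (E := E)) sAX 0)
    have h8 : E.ν * nrm (E.R E.n w + E.τ * (E.τ * E.R E.n w) - E.τ * E.A E.n (E.X w))
        ≤ E.ν * (2 * (E.K * nrm (E.A E.n w)) + nrm (E.A E.n (E.X w))) :=
      mul_le_mul_of_nonneg_left (by linarith) (by linarith)
    have h9 := mul_le_mul_of_nonneg_left h2 (by linarith : 0 ≤ E.K)
    have h10 := mul_le_mul_of_nonneg_left hN (by linarith : 0 ≤ E.K)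
    linarith

lemma nn_AZ_le (hw : SF w) (hN : nrm (A₁ w) ≤ nrm (E.X (A₁ w))) :
    nrm (E.A E.n (E.Z w)) ≤ 10 * E.K * nrm (E.X (A₁ w)) := by
  obtain ⟨ρ, sρ, e, hρ⟩ := A_Z_eq hw hN
  have hY : SF (E.D (E.A E.n w)) := D_sf (A_sf _ hw)
  have h1 := nn_ττ_le (E := E) (hY 0)
  have h2 := nn_DY_le (E := E) hw
  have h3 := nn_add_le (S := E.S) ((hY 0).add (SF.cmul (cτ (E := E)) (SF.cmul (cτ (E := E)) hY) 0)) (sρ 0)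
  rw [← e] at h3
  have hν := E.hν
  have h4 : 2 * nrm ρ ≤ E.ν * nrm ρ := mul_le_mul_of_nonneg_right hν (E.S.nn_nonneg _)
  have h10 := mul_le_mul_of_nonneg_left hN (by linarith [E.three_le_K] : 0 ≤ E.K)
  linarith

/-- The estimate which exploits the nonnegativity of `k`: it controls `ν √k D (r ∂_r + ν)^n w`
uniformly in `ν`. -/
lemma nn_sk_DY_le (hw : SF w) :
    E.ν * nrm (E.sk * E.D (E.A E.n w)) ≤ 2 * nrm (E.sk * E.Z (A₁ w))
      + 2 * nrm (E.X (A₁ w)) + 9 * E.K * nrm (A₁ w) := by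
  set Y := E.A E.n w
  set W := A₁ w
  have sY : SF Y := A_sf _ hw
  have sW : SF W := A_sf _ hw
  have eW : W = shiftE E.ν Y := A_succ _ _
  set y := E.D Y with hy
  have sy : SF y := D_sf sY
  set h := euler E.φ * euler Y + E.D W with hh
  have s1 : SF (euler E.φ * euler Y) := SF.cmul (ceφ) sY.euler
  have sh : SF h := s1.add (D_sf sW)
  have e1 : euler y = h - E.ν • y := by
    have e2 : euler W = euler (euler Y) + E.ν • euler Y := by
      rw [eW, shiftE, euler_add (sf_diff sY.euler) ((sf_diff sY).const_smul _), euler_smul]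
    rw [hh, hy, D, D, e2, euler_mul ((cφ 1).diff le_rfl) (sf_diff sY.euler),
      mul_add, mul_smul_comm]
    abel
  have hC := E.hC
  have hν := E.hν
  have hCK := E.C_le_K
  have h1 := ip_weight_euler_ge
    (E.hk.of_le (by exact_mod_cast (by omega : 1 ≤ E.n + 2))) E.k0 (sy 1)
  have tkh : TF 0 (E.k * h) := k_tf (by omega) (sh 0)
  have tky : TF 0 (E.k * y) := k_tf (by omega) (sy 0)
  rw [e1, mul_sub, mul_smul_comm, ip_sub_left tkh (tky.smul _) (sy 0), ip_smul_left,
    ip_k y y, ← nn_sq, ip_k h y] at h1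
  have h2 := cauchy (S := E.S) (sk_tf (E := E) (sh 0)) (sk_tf (E := E) (sy 0))
  have h3 : |E.S.ip (euler E.k * y) y| ≤ 3 * E.C * nrm W * nrm (E.sk * y) := by
    have e3 : E.S.ip (euler E.k * y) y = E.S.ip (euler Y) (E.φ * (euler E.k * y)) := by
      rw [← ip_mul_left, ← ip_mul_left]
      congr 1
    rw [e3]
    refine (abs_ip_le (sY.euler 0) (TF.cmul (cφ 0) (ek_tf (by omega) (sy 0)))).trans ?_
    have b1 := nn_φk1_le (E := E) (sy 0)
    have b2 := nn_euler_le E.hν E.hγ (sY 1)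
    rw [← eW] at b2
    calc _ ≤ (3 * nrm W) * (E.C * nrm (E.sk * y)) :=
          mul_le_mul b2 b1 (nn_nonneg _) (by linarith [E.S.nn_nonneg W])
      _ = _ := by ring
  have h4 : nrm (E.sk * h) ≤ nrm (E.sk * E.Z W) + nrm (E.X W) + 3 * E.C * nrm W := by
    have b1 : nrm (E.sk * (euler E.φ * euler Y)) ≤ 3 * E.C * nrm W := by
      refine (nn_sk_le (s1 0)).trans ?_
      have b2 := nn_euler_le E.hν E.hγ (sY 1)
      rw [← eW] at b2
      have b3 := nn_cmul_le (ceφ 0).continuous (sY.euler 0)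
        (by linarith : 0 ≤ E.C) (E.bφ 1 (by omega))
      have := mul_le_mul_of_nonneg_left b2 (by linarith : 0 ≤ E.C)
      linarith
    have b2 : nrm (E.sk * E.D W) ≤ nrm (E.sk * E.Z W) + nrm (E.X W) := by
      have sZX : SF (E.Z W + E.τ * E.X W) := (Z_sf sW).add (SF.cmul (cτ) (X_sf sW))
      have c1 : nrm (E.sk * E.D W) ≤ 1 * nrm (E.sk * (E.Z W + E.τ * E.X W)) := by
        refine nn_le_of_abs_le (sk_tf (D_sf sW 0)) (sk_tf (sZX 0)) zero_le_one fun q _ => ?_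
        have : E.Z W + E.τ * E.X W = (1 + E.τ * E.τ) * E.D W := by
          rw [Z, X]
          ring
        rw [this, one_mul]
        simp only [Pi.mul_apply, Pi.add_apply, Pi.one_apply, abs_mul]
        have h1 : (1 : ℝ) ≤ |1 + E.τ q * E.τ q| := by
          rw [abs_of_nonneg (by nlinarith [mul_self_nonneg (E.τ q)])]
          nlinarith [mul_self_nonneg (E.τ q)]
        exact mul_le_mul_of_nonneg_left (le_mul_of_one_le_left (abs_nonneg _) h1) (abs_nonneg _)
      rw [mul_add] at c1
      have c2 := nn_add_le (S := E.S) (sk_tf (E := E) (Z_sf (E := E) sW 0))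
        (sk_tf (E := E) (SF.cmul (cτ (E := E)) (X_sf (E := E) sW) 0))
      have c3 := nn_sk_le (E := E) (SF.cmul (cτ (E := E)) (X_sf (E := E) sW) 0)
      have c4 := nn_τ_le (E := E) (X_sf (E := E) sW 0)
      linarith
    have b3 := nn_add_le (S := E.S) (sk_tf (E := E) (s1 0)) (sk_tf (E := E) (D_sf (E := E) sW 0))
    rw [hh, mul_add]
    linarith
  have n0 := E.S.nn_nonneg W
  have n1 := E.S.nn_nonneg (E.sk * y)
  have h5 := (abs_le.1 h3).1
  have h5' := (abs_le.1 h3).2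
  have h6 := le_abs_self (1 - E.S.γ)
  have h6' := E.hγ
  rcases eq_or_lt_of_le n1 with h0 | h0
  · rw [← h0, mul_zero]
    have := E.S.nn_nonneg (E.sk * E.Z W)
    have := E.S.nn_nonneg (E.X W)
    have : 0 ≤ E.K * nrm W := mul_nonneg (by linarith) n0
    linarith
  · have h7 : (1 - E.S.γ) * nrm (E.sk * y) ^ 2 ≤ E.ν * nrm (E.sk * y) ^ 2 :=
      mul_le_mul_of_nonneg_right (h6.trans h6') (sq_nonneg _)
    have h8 : E.ν * nrm (E.sk * y) * nrm (E.sk * y)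
        ≤ (2 * nrm (E.sk * h) + 3 * E.C * nrm W) * nrm (E.sk * y) := by nlinarith
    have h9 := le_of_mul_le_mul_right h8 h0
    have h10 : E.C * nrm W ≤ E.K * nrm W := mul_le_mul_of_nonneg_right hCK n0
    linarith

end
end DegenerateOperator

namespace DegenerateOperator

variable {E : DegenerateOperator} {f g w F : ℱ}

local notation "nrm" => E.S.nn
local notation "A₁" => E.A (E.n + 1)

lemma nn_A_n_le (hw : SF w) : nrm (E.A E.n w) ≤ nrm (A₁ w) :=
  nn_iterate_le E.hν E.hγ (Nat.le_succ _) (hw _)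

lemma nn_AD_le (hw : SF w) : nrm (E.A E.n (E.D w)) ≤ 4 * E.K * nrm (A₁ w) := by
  have h1 := nn_DY_le (E := E) hw
  have h2 := nn_R_le (Nat.le_succ _) (hw (E.n + 1))
  have h3 := nn_add_le (S := E.S) (D_sf (E := E) (A_sf (E := E) E.n hw) 0)
    (R_tf (E := E) (i := E.n) (hw _))
  rw [← A_D] at h3
  have h4 := mul_le_mul_of_nonneg_left (nn_A_n_le (E := E) hw) (by linarith [E.three_le_K] : 0 ≤ E.K)
  linarith

lemma nn_Adθ_le (hw : SF w) (hN : nrm (A₁ w) ≤ nrm (E.X (A₁ w))) :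
    nrm (E.A E.n (dθ w)) ≤ 6 * E.K * nrm (E.X (A₁ w)) := by
  have hK := E.three_le_K
  have e : E.A E.n (dθ w) = E.A E.n (E.X w) - E.τ * E.A E.n (E.D w) := by
    rw [A_X (hw _), A_D, X, A, A, shiftE_dθ_iterate _ _ (hw _).cd]
    ring
  have h1 := nn_A_X_le hw hN
  have h2 : nrm (E.A E.n (E.X w)) ≤ nrm (A₁ (E.X w)) :=
    nn_A_n_le (X_sf hw)
  have h3 := nn_AD_le (E := E) hw
  have s1 : SF (E.A E.n (E.D w)) := A_sf _ (D_sf hw)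
  have h4 := nn_τ_le (E := E) (s1 0)
  have h5 := nn_sub_le (S := E.S) (A_sf (E := E) E.n (X_sf (E := E) hw) 0)
    (TF.cmul (cτ (E := E) 0) (s1 0))
  rw [← e] at h5
  have h6 := mul_le_mul_of_nonneg_left hN (by linarith : 0 ≤ E.K)
  linarith

/-- Expansion of a power of `r ∂_r + ν` applied to a product. -/
lemma A_mul (a f : ℱ) : A₁ (a * f) = a * A₁ f
    + ((E.n + 1 : ℕ) : ℝ) • (euler a * E.A E.n f) + rem E.ν E.n a f := by
  rw [rem, A, A, A]
  abel

lemma abs_ip_lower_le {B : ℝ} (ha : ContDiff ℝ (E.n + 1 : ℕ) a) (hf : SF f)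
    (sW : SF w) (hB : nrm (E.A E.n f) ≤ B)
    (ha1 : ∀ q ∈ Ω(E.S), |euler a q| ≤ E.C)
    (ha2 : ∀ i, 2 ≤ i → i ≤ E.n + 1 → ∀ q ∈ Ω(E.S), |euler^[i] a q| ≤ E.ν) :
    |E.S.ip (A₁ (a * f)) w - E.S.ip (a * A₁ f) w|
      ≤ 2 * E.K ^ 2 * B * nrm w := by
  have hK := E.three_le_K
  have hC := E.hC
  have n0 := E.S.nn_nonneg w
  have nU := E.S.nn_nonneg (E.A E.n f)
  have sU : SF (E.A E.n f) := A_sf _ hf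
  have t0 : TF 0 (a * A₁ f) :=
    TF.cmul (ha.of_le (by exact_mod_cast Nat.zero_le _)) (A_sf _ hf 0)
  have ce : ContDiff ℝ (E.n : ℕ) (euler a) := contDiff_euler ha
  have ce0 : ContDiff ℝ (0 : ℕ) (euler a) := ce.of_le (by exact_mod_cast Nat.zero_le _)
  have t1 : TF 0 (euler a * E.A E.n f) := TF.cmul ce0 (sU 0)
  have t2 : TF 0 (rem E.ν E.n a f) := TF_rem (by simpa using ha) (hf _)
  have b1 := nn_cmul_le ce0.continuous (sU 0) (by linarith : 0 ≤ E.C) ha1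
  have b2 := nn_rem_le E.hν E.hγ ha (hf _) ha2
  rw [A_mul, ip_add_left (t0.add (t1.smul _)) t2 (sW 0),
    ip_add_left t0 (t1.smul _) (sW 0), ip_smul_left]
  have c1 := abs_ip_le (S := E.S) t1 (sW 0)
  have c2 := abs_ip_le (S := E.S) t2 (sW 0)
  have hm := E.m_le_K
  have hm0 : (0 : ℝ) ≤ ((E.n + 1 : ℕ) : ℝ) := Nat.cast_nonneg _
  have d1 : ((E.n + 1 : ℕ) : ℝ) * |E.S.ip (euler a * E.A E.n f) w| ≤ E.K ^ 2 * B * nrm w := by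
    calc _ ≤ E.K * ((E.C * nrm (E.A E.n f)) * nrm w) := by
          refine mul_le_mul hm (c1.trans (mul_le_mul_of_nonneg_right b1 n0)) (abs_nonneg _)
            (by linarith)
      _ ≤ E.K * ((E.K * B) * nrm w) := by
          have := E.C_le_K
          gcongr
      _ = _ := by ring
  have d2 : |E.S.ip (rem E.ν E.n a f) w| ≤ E.K ^ 2 * B * nrm w := by
    refine c2.trans (mul_le_mul_of_nonneg_right (b2.trans ?_) n0)
    have h3 := E.two_pow_le_K
    have hB0 : 0 ≤ B := nU.trans hB
    calc 2 ^ (E.n + 1) * (2 * nrm (E.A E.n f)) ≤ E.K / 3 * (2 * B) := by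
          gcongr; linarith
      _ ≤ E.K ^ 2 * B := by nlinarith [mul_nonneg (by linarith : 0 ≤ E.K) hB0]
  rw [abs_le] at d2 ⊢
  have d3 : |((E.n + 1 : ℕ) : ℝ) * E.S.ip (euler a * E.A E.n f) w| ≤ E.K ^ 2 * B * nrm w := by
    rwa [abs_mul, abs_of_nonneg hm0]
  rw [abs_le] at d3
  constructor <;> linarith [d3.1, d3.2, d2.1, d2.2]

lemma energy_α (hw : SF w) :
    |E.S.ip (A₁ (E.α * E.D w)) (A₁ w)|
      ≤ 10 * E.K ^ 3 * nrm (A₁ w) ^ 2 := by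
  have hK := E.three_le_K
  have hC := E.hC
  have hCK := E.C_le_K
  set W := A₁ w with hW
  have sW : SF W := A_sf _ hw
  have n0 := E.S.nn_nonneg W
  have h1 := abs_ip_lower_le E.hα (D_sf hw) sW (nn_AD_le hw) E.bα1 E.bαν
  have ca1 : ContDiff ℝ (1 : ℕ) E.α := E.hα.of_le (by exact_mod_cast (by omega : 1 ≤ E.n + 1))
  have ca0 : ContDiff ℝ (0 : ℕ) E.α := ca1.of_le (by exact_mod_cast zero_le_one)
  have tα : TF 1 (E.α * W) := TF.cmul ca1 (sW 1)
  have tDα : ContDiff ℝ (0 : ℕ) (E.D E.α) := (cφ 0).mul (contDiff_euler ca1)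
  have h2 := ip_D (E := E) (sW 1) tα
  have s1 : TF 0 (E.D E.α * W) := TF.cmul tDα (sW 0)
  have s2 : TF 0 (E.α * E.D W) := TF.cmul ca0 (D_sf sW 0)
  rw [D_cmul (ca1.diff le_rfl) (sf_diff sW), ip_add_right s1 s2 (sW 0),
    ip_comm W (E.D E.α * W), ip_comm W (E.α * E.D W), ← ip_mul_left,
    ip_comm W (E.dv * _), ← mul_assoc] at h2
  have b1 : |E.S.ip (E.D E.α * W) W| ≤ E.K ^ 2 * nrm W * nrm W := by
    refine abs_ip_cmul_le tDα.continuous (sW 0) (sW 0) (by positivity) fun q hq => ?_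
    rw [D, Pi.mul_apply, abs_mul, sq]
    exact mul_le_mul ((bφ0 q hq).trans hCK) ((E.bα1 q hq).trans hCK) (abs_nonneg _) (by linarith)
  have b2 : |E.S.ip ((E.dv * E.α) * W) W| ≤ E.K ^ 2 * nrm W * nrm W := by
    refine abs_ip_cmul_le ((cdv 0).mul ca0).continuous (sW 0) (sW 0) (by positivity) fun q hq => ?_
    rw [abs_mul, sq]
    exact mul_le_mul (bdv q hq) ((E.bα q hq).trans hCK) (abs_nonneg _) (by linarith)
  have h3 := nn_R_le le_rfl (hw (E.n + 1 + 1))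
  have tR : TF 0 (E.R (E.n + 1) w) := R_tf (hw _)
  have b3 : |E.S.ip (E.α * E.R (E.n + 1) w) W| ≤ E.K ^ 2 * nrm W * nrm W := by
    refine (abs_ip_cmul_le ca0.continuous tR (sW 0) (by linarith) E.bα).trans ?_
    rw [sq]
    have := E.S.nn_nonneg (E.R (E.n + 1) w)
    calc E.C * nrm (E.R (E.n + 1) w) * nrm W ≤ E.K * (E.K * nrm W) * nrm W := by gcongr
      _ = _ := by ring
  rw [A_D, mul_add, ip_add_left s2 (TF.cmul ca0 tR) (sW 0)] at h1
  rw [← hW] at *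
  rw [abs_le] at *
  constructor <;> nlinarith

lemma energy_β (hw : SF w) (hb : Bdry E w)
    (hN : nrm (A₁ w) ≤ nrm (E.X (A₁ w))) :
    |E.S.ip (A₁ (E.β * dθ w)) (A₁ w)|
      ≤ 13 * E.K ^ 3 * nrm (E.X (A₁ w)) * nrm (A₁ w) := by
  have hK := E.three_le_K
  have hCK := E.C_le_K
  have h0 := nn_Adθ_le hw hN
  set W := A₁ w
  have sW : SF W := A_sf _ hw
  have n0 := E.S.nn_nonneg W
  have h1 := abs_ip_lower_le E.hβ hw.dθ sW h0 E.bβ1 E.bβν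
  have ca1 : ContDiff ℝ (1 : ℕ) E.β := E.hβ.of_nat (by omega)
  have ca0 : ContDiff ℝ (0 : ℕ) E.β := ca1.of_nat zero_le_one
  have tβ : TF 1 (E.β * W) := TF.cmul ca1 (sW 1)
  have cb : ContDiff ℝ (0 : ℕ) (dθ E.β) := contDiff_dθ ca1
  have hbW : Bdry E W := hb.A _
  have h2 := ip_dθ (sW 1) tβ (hbW.mul_left (g := E.β * W))
  have s1 : TF 0 (dθ E.β * W) := TF.cmul cb (sW 0)
  have s2 : TF 0 (E.β * dθ W) := TF.cmul ca0 (sW.dθ 0)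
  rw [dθ_mul (ca1.diff le_rfl) (sf_diff sW), ip_add_right s1 s2 (sW 0),
    ip_comm W (dθ E.β * W), ip_comm W (E.β * dθ W), ← ip_mul_left] at h2
  have b1 : |E.S.ip (dθ E.β * W) W| ≤ E.K * nrm W * nrm W :=
    abs_ip_cmul_le cb.continuous (sW 0) (sW 0) (by linarith) fun q hq => (E.bβθ q hq).trans hCK
  have e1 : A₁ (dθ w) = dθ W := shiftE_dθ_iterate _ _ (hw _).cd
  rw [e1] at h1
  have e : E.K * nrm W * nrm W ≤ E.K ^ 3 * nrm (E.X W) * nrm W := by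
    refine mul_le_mul_of_nonneg_right (mul_le_mul ?_ hN n0 (by positivity)) n0
    nlinarith
  rw [abs_le] at *
  constructor <;> nlinarith

set_option maxHeartbeats 1000000 in
/-- The degenerate second order term.  Its contribution has a sign, up to errors that are small
for small opening angles. -/
lemma energy_Z (hw : SF w) (hb : Bdry E w)
    (hN : nrm (A₁ w) ≤ nrm (E.X (A₁ w))) :
    nrm (E.sk * E.Z (A₁ w)) ^ 2
      - 181 * E.K ^ 4 * (nrm (E.X (A₁ w)) + nrm (E.sk * E.Z (A₁ w)))
        * nrm (A₁ w)
      - 40 * E.K ^ 3 * E.S.δ * nrm (E.X (A₁ w)) ^ 2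
      ≤ -E.S.ip (A₁ (E.Z (E.k * E.Z w))) (A₁ w) := by
  have hK := E.three_le_K
  have hC := E.hC
  have hCK := E.C_le_K
  have hν := E.hν
  have hδ := E.S.hδ
  have hU := nn_AZ_le hw hN
  have hskY := nn_sk_DY_le (E := E) hw
  obtain ⟨ρ, sρ, eU, hρ⟩ := A_Z_eq hw hN
  have hR := nn_R_le le_rfl (hw (E.n + 1 + 1))
  have eV : A₁ (E.Z w) = E.Z (A₁ w) + E.R (E.n + 1) w := A_Z (hw _)
  have eV' : A₁ (E.Z w) = shiftE E.ν (E.A E.n (E.Z w)) := A_succ _ _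
  set W := A₁ w
  set P := nrm (E.X W)
  set G := nrm (E.sk * E.Z W)
  set N := nrm W
  set U := E.A E.n (E.Z w)
  set V := A₁ (E.Z w)
  set Y := E.A E.n w
  have sW : SF W := A_sf _ hw
  have sZw : SF (E.Z w) := Z_sf hw
  have sU : SF U := A_sf _ sZw
  have sV : SF V := A_sf _ sZw
  have sDY : SF (E.D Y) := D_sf (A_sf _ hw)
  have sR : SF (E.R (E.n + 1) w) := fun _ => R_tf (hw _)
  have hP0 : 0 ≤ P := E.S.nn_nonneg _
  have hG0 : 0 ≤ G := E.S.nn_nonneg _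
  have hN0 : 0 ≤ N := E.S.nn_nonneg _
  have hbW : Bdry E W := hb.A _
  have hU0 : 0 ≤ nrm U := E.S.nn_nonneg _
  -- powers of the constant
  have k2 : 3 * E.K ≤ E.K ^ 2 := by nlinarith
  have k3 : 3 * E.K ^ 2 ≤ E.K ^ 3 := by nlinarith [sq_nonneg E.K]
  have k4 : 3 * E.K ^ 3 ≤ E.K ^ 4 := by nlinarith [pow_pos (by linarith : 0 < E.K) 3]
  -- the norm of `√k V`
  have hskV : nrm (E.sk * V) ≤ G + E.K * N := by
    rw [eV, mul_add]
    refine (nn_add_le (sk_tf (Z_sf sW 0)) (sk_tf (sR 0))).trans ?_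
    exact add_le_add le_rfl ((nn_sk_le (sR 0)).trans hR)
  -- the first order term of the commutator
  set F := euler E.k * U with hF
  have tF : TF 1 F := ek_tf (by omega) (sU 1)
  have nF : nrm F ≤ 10 * E.K ^ 2 * P := by
    have := nn_cmul_le (contDiff_euler (n := E.n + 1) E.hk).continuous (sU 0)
      (by linarith : 0 ≤ E.C) E.bk1
    calc nrm F ≤ E.C * nrm U := this
      _ ≤ E.K * (10 * E.K * P) := by gcongr
      _ = _ := by ring
  have nDF : nrm (E.D F) ≤ 20 * E.K ^ 3 * (P + G) := by
    have ck1 : ContDiff ℝ (1 : ℕ) (euler E.k) :=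
      (contDiff_euler (n := E.n + 1) E.hk).of_le (by exact_mod_cast (by omega : 1 ≤ E.n + 1))
    have ck2 : ContDiff ℝ (0 : ℕ) (euler (euler E.k)) := contDiff_euler ck1
    have e1 : E.D F = E.φ * (euler (euler E.k) * U) + (E.φ * (euler E.k * V)
        - E.ν • (E.φ * (euler E.k * U))) := by
      rw [D, hF, euler_mul (ck1.diff le_rfl) (sf_diff sU), eV', shiftE, mul_add,
        mul_add (euler E.k), mul_smul_comm, mul_add E.φ, mul_smul_comm]
      abel
    have t1 : TF 0 (E.φ * (euler (euler E.k) * U)) := TF.cmul (cφ 0) (TF.cmul ck2 (sU 0))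
    have t2 : TF 0 (E.φ * (euler E.k * V)) := TF.cmul (cφ 0) (ek_tf (by omega) (sV 0))
    have t3 : TF 0 (E.φ * (euler E.k * U)) := TF.cmul (cφ 0) (ek_tf (by omega) (sU 0))
    have b1 : nrm (E.φ * (euler (euler E.k) * U)) ≤ 10 * E.K ^ 3 * P := by
      have c1 := nn_φ_le (E := E) (TF.cmul ck2 (sU 0))
      have c2 := nn_cmul_le ck2.continuous (sU 0) (by linarith : 0 ≤ E.C) E.bk2
      calc _ ≤ E.C * (E.C * nrm U) := c1.trans (mul_le_mul_of_nonneg_left c2 (by linarith))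
        _ ≤ E.K * (E.K * (10 * E.K * P)) := by gcongr
        _ = _ := by ring
    have b2 : nrm (E.φ * (euler E.k * V)) ≤ E.K * (G + E.K * N) := by
      refine (nn_φk1_le (sV 0)).trans ?_
      have := E.S.nn_nonneg (E.sk * V)
      gcongr
    have b3 : E.ν * nrm (E.φ * (euler E.k * U)) ≤ E.K * (4 * G + 4 * P + 18 * E.K * N + 8 * E.K * P) := by
      have c1 := nn_φk1_le (E := E) (sU 0)
      have c2 : nrm (E.sk * U) ≤ 2 * nrm (E.sk * E.D Y) + nrm ρ := by
        have d1 : E.sk * U = (E.sk * E.D Y + E.τ * (E.τ * (E.sk * E.D Y))) + E.sk * ρ := by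
          rw [eU]; ring
        have ts : TF 0 (E.sk * E.D Y) := sk_tf (sDY 0)
        rw [d1]
        refine (nn_add_le (ts.add (TF.cmul (cτ 0) (TF.cmul (cτ 0) ts))) (sk_tf (sρ 0))).trans ?_
        exact add_le_add (nn_ττ_le ts) (nn_sk_le (sρ 0))
      have c3 : E.ν * nrm (E.sk * U) ≤ 4 * G + 4 * P + 18 * E.K * N + 8 * E.K * P := by
        have := mul_le_mul_of_nonneg_left c2 (by linarith : 0 ≤ E.ν)
        linarith
      have c4 := E.S.nn_nonneg (E.sk * U)
      calc E.ν * nrm (E.φ * (euler E.k * U)) ≤ E.ν * (E.C * nrm (E.sk * U)) := by gcongr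
        _ = E.C * (E.ν * nrm (E.sk * U)) := by ring
        _ ≤ E.K * (E.ν * nrm (E.sk * U)) := by gcongr
        _ ≤ _ := by gcongr
    have b4 := nn_add_le (S := E.S) t1 (t2.sub (t3.smul E.ν))
    have b5 := nn_sub_le (S := E.S) t2 (t3.smul E.ν)
    rw [nn_smul, abs_of_nonneg (by linarith : 0 ≤ E.ν)] at b5
    rw [← e1] at b4
    have i1 : E.K ^ 2 * N ≤ E.K ^ 2 * P := by gcongr
    have i2 : E.K ^ 2 * P ≤ 1 / 3 * (E.K ^ 3 * P) := by
      have := mul_le_mul_of_nonneg_right k3 hP0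
      linarith
    have i3 : E.K * P ≤ 1 / 9 * (E.K ^ 3 * P) := by
      have := mul_le_mul_of_nonneg_right k2 hP0
      linarith
    have i4 : E.K * G ≤ 1 / 9 * (E.K ^ 3 * G) := by
      have := mul_le_mul_of_nonneg_right k2 hG0
      have := mul_le_mul_of_nonneg_right k3 hG0
      linarith
    have i5 : 0 ≤ E.K ^ 3 * G := by positivity
    linarith
  have jF : ((E.n + 1 : ℕ) : ℝ) * |E.S.ip F (E.Z W)|
      ≤ 60 * E.K ^ 4 * (P + G) * N + 20 * E.K ^ 3 * E.S.δ * P ^ 2 := by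
    have c1 := abs_ip_Z_le (E := E) tF (sW 1)
    have c2 : |E.S.ip F (E.Z W)| ≤ 2 * (20 * E.K ^ 3 * (P + G)) * N
        + 2 * E.K * (10 * E.K ^ 2 * P) * N + 2 * E.S.δ * (10 * E.K ^ 2 * P) * P := by
      refine c1.trans ?_
      gcongr
    calc _ ≤ E.K * (2 * (20 * E.K ^ 3 * (P + G)) * N
        + 2 * E.K * (10 * E.K ^ 2 * P) * N + 2 * E.S.δ * (10 * E.K ^ 2 * P) * P) :=
          mul_le_mul E.m_le_K c2 (abs_nonneg _) (by linarith)
      _ ≤ _ := by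
        have c4 : 0 ≤ E.K ^ 4 * G * N := by positivity
        linarith
  -- the remainder
  set Q := rem E.ν E.n E.k (E.Z w)
  have ck : ContDiff ℝ (E.n + 1 : ℕ) E.k := E.hk.of_le (by exact_mod_cast Nat.le_succ _)
  have tQ : TF 1 Q := TF_rem (E.hk.of_le (by exact_mod_cast (by omega : 1 + E.n + 1 ≤ E.n + 2)))
    (sZw _)
  have h2p := E.two_pow_le_K
  have nQ : nrm Q ≤ 20 * E.K ^ 2 * P := by
    have c1 := nn_rem_le E.hν E.hγ ck (sZw _)
      (fun i h1 h2 => E.bkν i h1 (by omega))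
    calc nrm Q ≤ 2 ^ (E.n + 1) * (2 * nrm U) := c1
      _ ≤ E.K * (2 * (10 * E.K * P)) := by
        refine mul_le_mul ?_ (by linarith) (by linarith) (by linarith)
        linarith [pow_pos (by norm_num : (0 : ℝ) < 2) (E.n + 1)]
      _ = _ := by ring
  have nDQ : nrm (E.D Q) ≤ 20 * E.K ^ 4 * P := by
    have c1 := nn_euler_rem_le E.hν E.hγ (by linarith : 0 ≤ E.C) E.hk (sZw _)
      E.bk2 E.bkν
    have c2 := nn_φ_le (E := E) tQ.euler
    have c3 : nrm (euler Q) ≤ 20 * E.K ^ 3 * P := by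
      calc nrm (euler Q) ≤ 2 ^ (E.n + 1) * ((8 + 3 * E.C) * nrm U) := c1
        _ ≤ (E.K / 3) * ((6 * E.K) * (10 * E.K * P)) := by
          refine mul_le_mul (by linarith) (mul_le_mul (by linarith) hU hU0 (by linarith))
            (mul_nonneg (by linarith) hU0) (by linarith)
        _ = _ := by ring
    have c4 := E.S.nn_nonneg (euler Q)
    calc nrm (E.D Q) ≤ E.C * nrm (euler Q) := c2
      _ ≤ E.K * (20 * E.K ^ 3 * P) := by gcongr
      _ = _ := by ring
  have jQ : |E.S.ip Q (E.Z W)| ≤ 60 * E.K ^ 4 * (P + G) * N + 20 * E.K ^ 3 * E.S.δ * P ^ 2 := by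
    have c1 := abs_ip_Z_le (E := E) tQ (sW 1)
    have c2 : |E.S.ip Q (E.Z W)| ≤ 2 * (20 * E.K ^ 4 * P) * N
        + 2 * E.K * (20 * E.K ^ 2 * P) * N + 2 * E.S.δ * (20 * E.K ^ 2 * P) * P := by
      refine c1.trans ?_
      gcongr
    have c3 : 0 ≤ E.K ^ 4 * G * N := by positivity
    have c4 := mul_le_mul_of_nonneg_right k4 (mul_nonneg hP0 hN0)
    have c5 := mul_le_mul_of_nonneg_right k3 (mul_nonneg hδ.le (mul_nonneg hP0 hP0))
    have c6 : 0 ≤ E.K ^ 4 * P * N := by positivity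
    have c7 : 0 ≤ E.K ^ 3 * E.S.δ * (P * P) := by positivity
    linarith
  -- the commutator as a whole
  set V2 := A₁ (E.k * E.Z w)
  have eV2 : V2 = E.k * V + ((E.n + 1 : ℕ) : ℝ) • F + Q := A_mul _ _
  have tkZ : TF (E.n + 2) (E.k * E.Z w) := k_tf le_rfl (sZw _)
  have tV2 : TF 1 V2 := A_tf (tkZ.of_le (by omega))
  have tkV : TF 0 (E.k * V) := k_tf (by omega) (sV 0)
  have tF0 := tF.of_le zero_le_one
  have tQ0 := tQ.of_le zero_le_one
  have hm0 : (0 : ℝ) ≤ ((E.n + 1 : ℕ) : ℝ) := Nat.cast_nonneg _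
  have nV2 : nrm V2 ≤ 20 * E.K ^ 3 * (P + G) := by
    have c1 := nn_add_le (S := E.S) (tkV.add (tF0.smul ((E.n + 1 : ℕ) : ℝ))) tQ0
    have c2 := nn_add_le (S := E.S) tkV (tF0.smul ((E.n + 1 : ℕ) : ℝ))
    rw [nn_smul, abs_of_nonneg hm0] at c2
    rw [← eV2] at c1
    have c3 := (nn_k_le (E := E) (sV 0)).trans hskV
    have c4 : ((E.n + 1 : ℕ) : ℝ) * nrm F ≤ E.K * (10 * E.K ^ 2 * P) :=
      mul_le_mul E.m_le_K nF (E.S.nn_nonneg _) (by linarith)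
    have i1 : E.K * N ≤ E.K * P := by gcongr
    have i2 := mul_le_mul_of_nonneg_right k3 hP0
    have i3 := mul_le_mul_of_nonneg_right k2 hP0
    have i4 : G ≤ E.K ^ 3 * G := le_mul_of_one_le_left hG0 (by nlinarith)
    linarith
  have e1 : A₁ (E.Z (E.k * E.Z w)) = E.Z V2 + E.R (E.n + 1) (E.k * E.Z w) :=
    A_Z tkZ
  have tR2 : TF 0 (E.R (E.n + 1) (E.k * E.Z w)) := R_tf (tkZ.of_le (by omega))
  have e2 := ip_Z tV2 (sW 1) (hbW.mul_right (g := V2))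
  have tV20 := tV2.of_le zero_le_one
  have j1 : |E.S.ip V2 (E.dv * W)| ≤ E.K * nrm V2 * N := by
    rw [← ip_mul_left]
    exact abs_ip_cmul_le (cdv 0).continuous tV20 (sW 0) (by linarith) bdv
  have j2 : |E.S.ip V2 (E.τ' * W)| ≤ E.K * nrm V2 * N := by
    rw [← ip_mul_left]
    exact abs_ip_cmul_le (cτ' 0).continuous tV20 (sW 0) (by linarith)
      fun q hq => (E.bτ' q hq).trans (by linarith)
  have nR2 : nrm (E.R (E.n + 1) (E.k * E.Z w)) ≤ E.K * nrm V2 :=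
    nn_R_le (E := E) (i := E.n + 1) le_rfl tkZ
  have j3 : |E.S.ip (E.R (E.n + 1) (E.k * E.Z w)) W| ≤ E.K * nrm V2 * N :=
    (abs_ip_le tR2 (sW 0)).trans
      (mul_le_mul_of_nonneg_right nR2 hN0)
  have j4 : G ^ 2 - E.K * N * G ≤ E.S.ip (E.k * V) (E.Z W) := by
    rw [ip_k, eV, mul_add, ip_add_left (sk_tf (Z_sf sW 0)) (sk_tf (sR 0))
      (sk_tf (Z_sf sW 0)), ← nn_sq]
    have c1 := (abs_le.1 (abs_ip_le (S := E.S) (sk_tf (E := E) (sR 0))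
      (sk_tf (E := E) (Z_sf (E := E) sW 0)))).1
    have c2 := mul_le_mul_of_nonneg_right ((nn_sk_le (E := E) (sR 0)).trans hR) hG0
    linarith
  have e3 : E.S.ip V2 (E.Z W) = E.S.ip (E.k * V) (E.Z W)
      + ((E.n + 1 : ℕ) : ℝ) * E.S.ip F (E.Z W) + E.S.ip Q (E.Z W) := by
    have tZ := Z_sf (E := E) sW 0
    rw [eV2, ip_add_left (tkV.add (tF0.smul _)) tQ0 tZ,
      ip_add_left tkV (tF0.smul _) tZ, ip_smul_left]
  rw [e1, ip_add_left (Z_tf tV2) tR2 (sW 0), e2]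
  have jV : E.K * nrm V2 * N ≤ 20 * E.K ^ 4 * (P + G) * N := by
    calc E.K * nrm V2 * N ≤ E.K * (20 * E.K ^ 3 * (P + G)) * N := by gcongr
      _ = _ := by ring
  have jF' : |((E.n + 1 : ℕ) : ℝ) * E.S.ip F (E.Z W)|
      ≤ 60 * E.K ^ 4 * (P + G) * N + 20 * E.K ^ 3 * E.S.δ * P ^ 2 := by
    rwa [abs_mul, abs_of_nonneg hm0]
  have jG : E.K * N * G ≤ E.K ^ 4 * (P + G) * N := by
    have c1 : E.K ≤ E.K ^ 4 := by linarith
    have c2 : 0 ≤ E.K ^ 4 * P * N := by positivity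
    have := mul_le_mul_of_nonneg_right c1 (mul_nonneg hN0 hG0)
    linarith
  have := (abs_le.1 j1).1
  have := (abs_le.1 j2).2
  have := (abs_le.1 j3).2
  have := (abs_le.1 jF').1
  have := (abs_le.1 jQ).1
  linarith

/-- The energy inequality: on functions vanishing for `θ = 0, δ`, the operator `-M`, commuted with
a power of `r ∂_r + ν`, is positive if the opening angle is small. -/
theorem energy (hδ : E.S.δ * E.K ^ 4 ≤ 1 / 4000) (hw : SF w) (hb : Bdry E w) :
    nrm (E.X (A₁ w)) ^ 2 / 2
      ≤ -E.S.ip (A₁ (E.M w)) (A₁ w) ∧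
    nrm (A₁ w) ≤ nrm (E.X (A₁ w)) := by
  have hK := E.three_le_K
  have hδ0 := E.S.hδ
  have k4 : E.K ≤ E.K ^ 4 := le_self_pow₀ (by linarith) (by norm_num)
  have k3 : E.K ^ 3 ≤ E.K ^ 4 := pow_le_pow_right₀ (by linarith) (by norm_num)
  have k2 : E.K ^ 2 ≤ E.K ^ 4 := pow_le_pow_right₀ (by linarith) (by norm_num)
  have hδK : E.S.δ * E.K ≤ 1 / 4000 := (mul_le_mul_of_nonneg_left k4 hδ0.le).trans hδ
  have sW : SF (A₁ w) := A_sf _ hw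
  have hp := poincare (by linarith) (sW 1) (hb.A _)
  set P := nrm (E.X (A₁ w)) with hP
  have hP0 : 0 ≤ P := E.S.nn_nonneg _
  have hN : nrm (A₁ w) ≤ P := by nlinarith
  refine ⟨?_, hN⟩
  have h1 := energy_X hw hb hN
  have h2 := energy_Z hw hb hN
  have h3 := (abs_le.1 (energy_α (E := E) hw)).2
  have h4 := (abs_le.1 (energy_β hw hb hN)).2
  have tk : TF (E.n + 2) (E.k * E.Z w) := k_tf le_rfl (Z_sf hw _)
  have t1 : TF (E.n + 1) (E.X (E.X w)) := X_sf (X_sf hw) _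
  have t2 : TF (E.n + 1) (E.Z (E.k * E.Z w)) := Z_tf tk
  have t3 : TF (E.n + 1) (E.α * E.D w) := TF.cmul E.hα (D_sf hw _)
  have t4 : TF (E.n + 1) (E.β * dθ w) := TF.cmul E.hβ (hw.dθ _)
  have e : A₁ (E.M w) = A₁ (E.X (E.X w))
      + A₁ (E.Z (E.k * E.Z w)) + A₁ (E.α * E.D w)
      + A₁ (E.β * dθ w) := by
    rw [M, A, shiftE_iterate_add _ _ ((t1.add t2).add t3).cd t4.cd,
      shiftE_iterate_add _ _ (t1.add t2).cd t3.cd, shiftE_iterate_add _ _ t1.cd t2.cd]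
    rfl
  have z1 : TF 0 (A₁ (E.X (E.X w))) := A_tf (by simpa using t1)
  have z2 : TF 0 (A₁ (E.Z (E.k * E.Z w))) := A_tf (by simpa using t2)
  have z3 : TF 0 (A₁ (E.α * E.D w)) := A_tf (by simpa using t3)
  have z4 : TF 0 (A₁ (E.β * dθ w)) := A_tf (by simpa using t4)
  rw [e, ip_add_left ((z1.add z2).add z3) z4 (sW 0),
    ip_add_left (z1.add z2) z3 (sW 0), ip_add_left z1 z2 (sW 0)]
  set N := nrm (A₁ w)
  set G := nrm (E.sk * E.Z (A₁ w))
  have hN0 : 0 ≤ N := E.S.nn_nonneg _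
  have hG0 : 0 ≤ G := E.S.nn_nonneg _
  rw [← hP] at h1 h2 h4
  have i1 : E.K ^ 4 * N ≤ P / 1000 := by
    have := mul_le_mul_of_nonneg_left hp (by positivity : 0 ≤ E.K ^ 4)
    have := mul_le_mul_of_nonneg_right hδ hP0
    nlinarith
  have i4 : E.K ^ 3 * E.S.δ * P ^ 2 ≤ P * P / 4000 := by
    have := mul_le_mul_of_nonneg_right ((mul_le_mul_of_nonneg_left k3 hδ0.le).trans hδ)
      (mul_nonneg hP0 hP0)
    nlinarith
  have i5 : E.K ^ 2 * (P * N) ≤ E.K ^ 4 * (P * N) := by gcongr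
  have i6 : E.K ^ 3 * (P * N) ≤ E.K ^ 4 * (P * N) := by gcongr
  nlinarith [sq_nonneg (P - G)]

end DegenerateOperator

/-! ### Families of functions with uniformly bounded directional derivatives -/

/-- Open sets `O i`, on which the functions of a family are to be smooth, subsets `U i`, on which
derivatives are to be bounded uniformly in `i`, and two vector fields, along which the derivatives
are taken. -/
structure Dom (ι E : Type*) [NormedAddCommGroup E] [NormedSpace ℝ E] where
  (e : Fin 2 → E → E) (O U : ι → Set E)
  he : ∀ j (n : ℕ), ContDiff ℝ n (e j)
  hO : ∀ i, IsOpen (O i)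
  hU : ∀ i, U i ⊆ O i

namespace Dom

variable {ι κ E F : Type*} [NormedAddCommGroup E] [NormedSpace ℝ E] [NormedAddCommGroup F]
  [NormedSpace ℝ F] {A : Dom ι E} {M N : ℕ} {f g : ι → E → ℝ}

/-- The derivative along one of the two vector fields. -/
def d (A : Dom ι E) (j : Fin 2) (f : E → ℝ) : E → ℝ := fun x => fderiv ℝ f x (A.e j x)

/-- Uniformly bounded families. -/
def Bdd (A : Dom ι E) (f : ι → E → ℝ) : Prop := ∃ C, ∀ i, ∀ x ∈ A.U i, |f i x| ≤ C

/-- The derivatives of order at most `N` along the two vector fields are uniformly bounded. -/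
def FB (A : Dom ι E) : ℕ → (ι → E → ℝ) → Prop
  | 0, f => A.Bdd f
  | N + 1, f => A.Bdd f ∧ ∀ j, FB A N fun i => A.d j (f i)

/-- Families of `C^M` functions whose derivatives of order at most `N` are uniformly bounded. -/
structure FC (A : Dom ι E) (M N : ℕ) (f : ι → E → ℝ) : Prop where
  le : N ≤ M
  cd : ∀ i, ContDiffOn ℝ M (f i) (A.O i)
  fb : A.FB N f

lemma Bdd.add (hf : A.Bdd f) (hg : A.Bdd g) : A.Bdd fun i x => f i x + g i x := by
  obtain ⟨⟨C, hC⟩, C', hC'⟩ := And.intro hf hg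
  exact ⟨C + C', fun i q hq => (abs_add_le _ _).trans (add_le_add (hC i q hq) (hC' i q hq))⟩

lemma Bdd.mul (hf : A.Bdd f) (hg : A.Bdd g) : A.Bdd fun i x => f i x * g i x := by
  obtain ⟨⟨C, hC⟩, C', hC'⟩ := And.intro hf hg
  refine ⟨C * C', fun i q hq => ?_⟩
  rw [abs_mul]
  exact mul_le_mul (hC i q hq) (hC' i q hq) (abs_nonneg _) ((abs_nonneg _).trans (hC i q hq))

lemma Bdd.congr (h : A.Bdd f) (hfg : ∀ i, EqOn (g i) (f i) (A.O i)) : A.Bdd g :=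
  h.imp fun C hC i x hx => by rw [hfg i (A.hU i hx)]; exact hC i x hx

lemma FB.bdd (h : A.FB N f) : A.Bdd f := by
  cases N with
  | zero => exact h
  | succ N => exact h.1

lemma FB.of_succ (h : A.FB (N + 1) f) : A.FB N f := by
  induction N generalizing f with
  | zero => exact h.1
  | succ N ih => exact ⟨h.1, fun j => ih (h.2 j)⟩

lemma FB.of_le {N' : ℕ} (h : A.FB N f) (hN : N' ≤ N) : A.FB N' f := by
  induction N, hN using Nat.le_induction with
  | base => exact h
  | succ N _ ih => exact ih h.of_succ

lemma d_congr {O : Set E} (hO : IsOpen O) {f g : E → ℝ} (h : EqOn f g O) (j : Fin 2) :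
    EqOn (A.d j f) (A.d j g) O := fun x hx => by
  have : f =ᶠ[𝓝 x] g := by filter_upwards [hO.mem_nhds hx] with y hy using h hy
  simp only [d, this.fderiv_eq]

lemma FB.congr (h : A.FB N f) (hfg : ∀ i, EqOn (g i) (f i) (A.O i)) : A.FB N g := by
  induction N generalizing f g with
  | zero => exact h.congr hfg
  | succ N ih => exact ⟨h.1.congr hfg, fun j => ih (h.2 j) fun i => d_congr (A.hO i) (hfg i) j⟩

namespace FC

lemma congr (h : A.FC M N f) (hfg : ∀ i, EqOn (g i) (f i) (A.O i)) : A.FC M N g :=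
  ⟨h.le, fun i => (h.cd i).congr (hfg i), h.fb.congr hfg⟩

lemma of_le {M' N' : ℕ} (h : A.FC M N f) (hM : M' ≤ M) (hN : N' ≤ N) (hNM : N' ≤ M') :
    A.FC M' N' f :=
  ⟨hNM, fun i => (h.cd i).of_nat hM, h.fb.of_le hN⟩

lemma contDiffOn_d {O : Set E} (hO : IsOpen O) {f : E → ℝ} (hf : ContDiffOn ℝ (M + 1 : ℕ) f O)
    (j : Fin 2) : ContDiffOn ℝ M (A.d j f) O :=
  (hf.fderiv_of_isOpen hO (by norm_cast)).clm_apply (A.he j M).contDiffOn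

lemma d (h : A.FC (M + 1) (N + 1) f) (j : Fin 2) : A.FC M N fun i => A.d j (f i) :=
  ⟨Nat.le_of_succ_le_succ h.le, fun i => contDiffOn_d (A.hO i) (h.cd i) j, h.fb.2 j⟩

/-- A bounded family whose derivatives coincide with given families. -/
lemma of_d (h : A.FC (M + 1) 0 f) {f' : Fin 2 → ι → E → ℝ} (hd : ∀ j, A.FC M N (f' j))
    (he : ∀ j i, EqOn (A.d j (f i)) (f' j i) (A.O i)) : A.FC (M + 1) (N + 1) f :=
  ⟨Nat.succ_le_succ (hd 0).le, h.cd, h.fb.bdd, fun j => (hd j).fb.congr (he j)⟩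

lemma differentiableAt (h : A.FC M N f) (hM : 1 ≤ M) {i : ι} {x : E} (hx : x ∈ A.O i) :
    DifferentiableAt ℝ (f i) x :=
  ((h.cd i).contDiffAt ((A.hO i).mem_nhds hx)).differentiableAt (by exact_mod_cast (by omega : M ≠ 0))

lemma const (hNM : N ≤ M) {c : ι → ℝ} {C : ℝ} (hc : ∀ i, |c i| ≤ C) : A.FC M N fun i _ => c i := by
  refine ⟨hNM, fun i => contDiffOn_const, ?_⟩
  clear hNM
  induction N generalizing c C with
  | zero => exact ⟨C, fun i _ _ => hc i⟩
  | succ N ih =>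
    refine ⟨⟨C, fun i _ _ => hc i⟩, fun j => ?_⟩
    convert ih (c := fun _ => 0) (C := 0) (by simp) using 3
    simp [Dom.d]

lemma add (hf : A.FC M N f) (hg : A.FC M N g) : A.FC M N fun i x => f i x + g i x := by
  induction N generalizing f g M with
  | zero => exact ⟨hf.le, fun i => (hf.cd i).add (hg.cd i), hf.fb.add hg.fb⟩
  | succ N ih =>
    obtain ⟨M, rfl⟩ : ∃ k, M = k + 1 := ⟨M - 1, by have := hf.le; omega⟩
    refine ⟨hf.le, fun i => (hf.cd i).add (hg.cd i), hf.fb.1.add hg.fb.1, fun j => ?_⟩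
    refine (ih (hf.d j) (hg.d j)).fb.congr fun i x hx => ?_
    simp only [Dom.d]
    rw [fderiv_fun_add (hf.differentiableAt (by omega) hx) (hg.differentiableAt (by omega) hx)]
    rfl

lemma mul (hf : A.FC M N f) (hg : A.FC M N g) : A.FC M N fun i x => f i x * g i x := by
  induction N generalizing f g M with
  | zero => exact ⟨hf.le, fun i => (hf.cd i).mul (hg.cd i), hf.fb.mul hg.fb⟩
  | succ N ih =>
    obtain ⟨M, rfl⟩ : ∃ k, M = k + 1 := ⟨M - 1, by have := hf.le; omega⟩
    have hl := Nat.le_of_succ_le_succ hf.le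
    refine ⟨hf.le, fun i => (hf.cd i).mul (hg.cd i), hf.fb.1.mul hg.fb.1, fun j => ?_⟩
    refine ((ih (hf.of_le (Nat.le_succ M) (Nat.le_succ N) hl) (hg.d j)).add
      (ih (hg.of_le (Nat.le_succ M) (Nat.le_succ N) hl) (hf.d j))).fb.congr fun i x hx => ?_
    simp only [Dom.d]
    rw [fderiv_fun_mul (hf.differentiableAt (by omega) hx) (hg.differentiableAt (by omega) hx)]
    simp

lemma smul (hf : A.FC M N f) (c : ℝ) : A.FC M N fun i x => c * f i x :=
  (const (c := fun _ => c) hf.le fun _ => le_rfl).mul hf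

lemma neg (hf : A.FC M N f) : A.FC M N fun i x => -f i x := by
  simpa using hf.smul (-1)

lemma sub (hf : A.FC M N f) (hg : A.FC M N g) : A.FC M N fun i x => f i x - g i x := by
  simpa [sub_eq_add_neg] using hf.add hg.neg

lemma sum {s : Fin 2 → ι → E → ℝ} (h : ∀ k, A.FC M N (s k)) :
    A.FC M N fun i x => ∑ k, s k i x := by
  simpa only [Fin.sum_univ_two] using (h 0).add (h 1)

lemma inv (hf : A.FC M N f) {c : ℝ} (hc : 0 < c) (h0 : ∀ i, ∀ x ∈ A.O i, f i x ≠ 0)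
    (hl : ∀ i, ∀ x ∈ A.U i, c ≤ |f i x|) : A.FC M N fun i x => (f i x)⁻¹ := by
  have key : A.Bdd fun i x => (f i x)⁻¹ := ⟨c⁻¹, fun i x hx => by
    rw [abs_inv]
    exact inv_anti₀ hc (hl i x hx)⟩
  have cd : ∀ i, ContDiffOn ℝ M (fun x => (f i x)⁻¹) (A.O i) := fun i => (hf.cd i).inv (h0 i)
  have hle := hf.le
  suffices H : ∀ n ≤ N, A.FC M n fun i x => (f i x)⁻¹ from H N le_rfl
  intro n
  induction n with
  | zero => exact fun _ => ⟨Nat.zero_le _, cd, key⟩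
  | succ n ih =>
    intro hn
    obtain ⟨M, rfl⟩ : ∃ k, M = k + 1 := ⟨M - 1, by omega⟩
    have h1 := (ih (by omega)).of_le (Nat.le_succ M) le_rfl (by omega)
    refine ⟨by omega, cd, key, fun j => ?_⟩
    refine ((((hf.of_le le_rfl hn (by omega)).d j).mul (h1.mul h1)).neg).fb.congr fun i x hx => ?_
    have := (hasDerivAt_inv (h0 i x hx)).comp_hasFDerivAt x
      (hf.differentiableAt (by omega) hx).hasFDerivAt
    simp only [Dom.d]
    rw [show (fun x => (f i x)⁻¹) = (fun y => y⁻¹) ∘ f i from rfl, this.fderiv]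
    simp [sq]
    ring

lemma reindex (e : κ → ι) (hf : A.FC M N f) :
    FC ⟨A.e, fun k => A.O (e k), fun k => A.U (e k), A.he, fun _ => A.hO _, fun _ => A.hU _⟩ M N
      fun k => f (e k) := by
  refine ⟨hf.le, fun k => hf.cd _, ?_⟩
  have := hf.fb
  clear hf
  induction N generalizing f with
  | zero => exact this.imp fun C hC k => hC (e k)
  | succ N ih => exact ⟨this.1.imp fun C hC k => hC (e k), fun j => ih (this.2 j)⟩

/-- A fixed function on a neighbourhood of a compact set. -/
lemma of_contDiffOn {K V : Set E} (hK : IsCompact K) (hV : IsOpen V) (hKV : K ⊆ V) {a : E → ℝ}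
    (ha : ContDiffOn ℝ M a V) (hNM : N ≤ M) (hO : ∀ i, A.O i ⊆ V) (hU : ∀ i, A.U i ⊆ K) :
    A.FC M N fun _ => a := by
  refine ⟨hNM, fun i => ha.mono (hO i), ?_⟩
  have key : ∀ {a : E → ℝ}, ContinuousOn a V → A.Bdd fun _ => a := fun ha => by
    obtain ⟨C, hC⟩ := hK.exists_bound_of_continuousOn (ha.mono hKV)
    exact ⟨C, fun i q hq => hC q (hU i hq)⟩
  induction N generalizing a M with
  | zero => exact key ha.continuousOn
  | succ N ih =>
    obtain ⟨M, rfl⟩ : ∃ k, M = k + 1 := ⟨M - 1, by omega⟩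
    exact ⟨key ha.continuousOn, fun j => ih (contDiffOn_d hV ha j) (by omega)⟩

/-- The chain rule, for maps `X i` whose derivatives have the components `c`. -/
lemma comp {B : Dom ι F} (hf : A.FC M N f) {X : ι → F → E}
    {c : Fin 2 → Fin 2 → ι → F → ℝ} (hX : ∀ i, ContDiffOn ℝ M (X i) (B.O i))
    (hO : ∀ i, MapsTo (X i) (B.O i) (A.O i)) (hU : ∀ i, MapsTo (X i) (B.U i) (A.U i))
    (hc : ∀ j l, B.FC (M - 1) (N - 1) (c j l))
    (hd : 1 ≤ M → ∀ j i, ∀ x ∈ B.O i, fderiv ℝ (X i) x (B.e j x) =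
      ∑ l, c j l i x • A.e l (X i x)) :
    B.FC M N fun i x => f i (X i x) := by
  have key : ∀ {f : ι → E → ℝ}, A.Bdd f → B.Bdd fun i x => f i (X i x) := fun h =>
    h.imp fun C hC i x hx => hC i _ (hU i hx)
  induction N generalizing f M with
  | zero => exact ⟨hf.le, fun i => (hf.cd i).comp (hX i) (hO i), key hf.fb⟩
  | succ N ih =>
    obtain ⟨M, rfl⟩ : ∃ k, M = k + 1 := ⟨M - 1, by have := hf.le; omega⟩
    have hl := Nat.le_of_succ_le_succ hf.le
    refine ⟨hf.le, fun i => (hf.cd i).comp (hX i) (hO i), key hf.fb.1, fun j => ?_⟩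
    have h1 : ∀ l, B.FC M N fun i x => A.d l (f i) (X i x) := fun l =>
      ih (hf.d l) (fun i => (hX i).of_nat (Nat.le_succ M))
        (fun j l => (hc j l).of_le (Nat.sub_le _ _) (Nat.sub_le _ _) (by omega))
        (fun _ => hd (by omega))
    refine (FC.sum fun l => (hc j l).mul (h1 l)).fb.congr fun i x hx => ?_
    have dX : DifferentiableAt ℝ (X i) x :=
      ((hX i).contDiffAt ((B.hO i).mem_nhds hx)).differentiableAt (by norm_cast)
    have df := hf.differentiableAt (by omega) (hO i hx)
    simp only [Dom.d]
    rw [show (fun x => f i (X i x)) = f i ∘ X i from rfl, fderiv_comp x df dX,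
      ContinuousLinearMap.comp_apply, hd (by omega) j i x hx, map_sum]
    simp

end FC

end Dom

/-- Families of functions on the plane, with derivatives along `r ∂_r` and `∂_θ`. -/
def polarDom {ι : Type*} (U : ι → Set (ℝ × ℝ)) : Dom ι (ℝ × ℝ) :=
  ⟨![fun q => (q.1, 0), fun _ => (0, 1)], fun _ => univ, U, fun j n => by
    fin_cases j
    exacts [contDiff_fst.prodMk contDiff_const, contDiff_const], fun _ => isOpen_univ,
    fun _ => subset_univ _⟩

/-- Families of `C^N` functions whose derivatives of order at most `N` along `r ∂_r` and `∂_θ` are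
bounded on the sets `U i`, uniformly in `i`. -/
abbrev BC {ι : Type*} (U : ι → Set (ℝ × ℝ)) (N : ℕ) (f : ι → ℱ) : Prop := (polarDom U).FC N N f

section

variable {ι : Type*} {U : ι → Set (ℝ × ℝ)} {N : ℕ} {f : ι → ℱ}

lemma euler_eq_d {g : ℱ} (hg : Differentiable ℝ g) : euler g = (polarDom U).d 0 g := by
  funext q
  have e : ((q.1, 0) : ℝ × ℝ) = q.1 • (1, 0) := by simp
  rw [euler, dr_eq_fderiv (hg q)]
  exact (congrArg (fderiv ℝ g q) e).trans (map_smul _ _ _) |>.symm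

lemma dθ_eq_d {g : ℱ} (hg : Differentiable ℝ g) : dθ g = (polarDom U).d 1 g :=
  funext fun q => dθ_eq_fderiv (hg q)

namespace Dom.FC

lemma contDiff (hf : BC U N f) (i : ι) : ContDiff ℝ N (f i) := contDiffOn_univ.1 (hf.cd i)

lemma euler (hf : BC U (N + 1) f) : BC U N fun i => euler (f i) :=
  (hf.d 0).congr fun i _ _ => congrFun
    (euler_eq_d ((hf.contDiff i).differentiable (by norm_cast))) _

lemma dθ (hf : BC U (N + 1) f) : BC U N fun i => dθ (f i) :=
  (hf.d 1).congr fun i _ _ => congrFun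
    (dθ_eq_d ((hf.contDiff i).differentiable (by norm_cast))) _

lemma of_succ (hf : BC U (N + 1) f) : BC U N f := hf.of_le (Nat.le_succ N) (Nat.le_succ N) le_rfl

lemma exists_bound (hf : BC U N f) : ∃ C ≥ 1, ∀ i, ∀ q ∈ U i, |f i q| ≤ C := by
  obtain ⟨C, hC⟩ := hf.fb.bdd
  exact ⟨max C 1, le_max_right _ _, fun i q hq => (hC i q hq).trans (le_max_left _ _)⟩

end Dom.FC

/-- A fixed smooth function has bounded derivatives on subsets of a fixed compact set. -/
lemma BC.of_contDiff {K : Set (ℝ × ℝ)} (hK : IsCompact K) (hU : ∀ i, U i ⊆ K) {a : ℱ}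
    (ha : ContDiff ℝ N a) : BC U N fun _ => a :=
  .of_contDiffOn hK isOpen_univ (subset_univ _) ha.contDiffOn le_rfl (fun _ => subset_univ _) hU

/-- Bounds for the derivatives along `r ∂_r` and `∂_θ`, by induction. -/
lemma BC.of_derivs (hf : ∀ i, ContDiff ℝ (N + 1 : ℕ) (f i)) (h0 : (polarDom U).Bdd f)
    (hr : BC U N fun i => euler (f i)) (hθ : BC U N fun i => dθ (f i)) : BC U (N + 1) f :=
  .of_d ⟨Nat.zero_le _, fun i => (hf i).contDiffOn, h0⟩
    (f' := ![fun i => euler (f i), fun i => dθ (f i)]) (fun j => by fin_cases j <;> assumption)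
    fun j i q _ => by
      have := (hf i).differentiable (by norm_cast)
      fin_cases j
      exacts [(congrFun (euler_eq_d this) q).symm, (congrFun (dθ_eq_d this) q).symm]

end

/-! ### Primitives in the radial variable -/

/-- The primitive in the first variable which vanishes for `r = 0`. -/
def prim (F : ℱ) : ℱ := fun q => ∫ ρ in (0 : ℝ)..q.1, F (ρ, q.2)

lemma continuous_prim (hF : Continuous F) : Continuous (prim F) := by
  have h : Continuous (fun θ ρ : ℝ => F (ρ, θ)).uncurry := hF.comp continuous_swap
  exact (intervalIntegral.continuous_parametric_primitive_of_continuous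
    h).comp continuous_swap

lemma hasDerivAt_prim_r (hF : Continuous F) (q : ℝ × ℝ) :
    HasDerivAt (fun r => prim F (r, q.2)) (F q) q.1 := by
  have h : Continuous fun ρ => F (ρ, q.2) := by fun_prop
  exact intervalIntegral.integral_hasDerivAt_right (h.intervalIntegrable _ _)
    h.aestronglyMeasurable.stronglyMeasurableAtFilter h.continuousAt

lemma hasDerivAt_prim_θ (hF : ContDiff ℝ (1 : ℕ) F) (q : ℝ × ℝ) :
    HasDerivAt (fun θ => prim F (q.1, θ)) (prim (dθ F) q) q.2 := by
  have hd : Continuous (dθ F) := (contDiff_dθ hF).continuous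
  obtain ⟨C, hC⟩ := (isCompact_uIcc).prod
    (isCompact_Icc (a := q.2 - 1) (b := q.2 + 1)) |>.exists_bound_of_continuousOn hd.continuousOn
  refine (intervalIntegral.hasDerivAt_integral_of_dominated_loc_of_deriv_le
    (F := fun θ ρ => F (ρ, θ)) (F' := fun θ ρ => dθ F (ρ, θ)) (bound := fun _ => C)
    (s := Icc (q.2 - 1) (q.2 + 1))
    (Icc_mem_nhds (by linarith) (by linarith)) ?_ ?_ ?_ ?_ ?_ ?_).2
  · exact Eventually.of_forall fun θ => (by fun_prop : Continuous fun ρ => F (ρ, θ)).aestronglyMeasurable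
  · exact (by fun_prop : Continuous fun ρ => F (ρ, q.2)).intervalIntegrable _ _
  · exact (by fun_prop : Continuous fun ρ => dθ F (ρ, q.2)).aestronglyMeasurable
  · exact Eventually.of_forall fun ρ hρ θ hθ => hC (ρ, θ) ⟨uIoc_subset_uIcc hρ, hθ⟩
  · simp
  · exact Eventually.of_forall fun ρ _ θ _ =>
      hasDerivAt_dθ (hF.diff le_rfl (ρ, θ))

lemma hasFDerivAt_prim (hF : ContDiff ℝ (1 : ℕ) F) (q : ℝ × ℝ) :
    HasFDerivAt (prim F) (F q • ContinuousLinearMap.fst ℝ ℝ ℝ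
      + prim (dθ F) q • ContinuousLinearMap.snd ℝ ℝ ℝ) q := by
  have hc := hF.continuous
  have hp := continuous_prim (contDiff_dθ (n := 0) hF).continuous
  have h := hasStrictFDerivAt_uncurry_coprod (𝕜 := ℝ) (u := q)
    (f := fun r θ => prim F (r, θ))
    (f₁ := fun r θ => ContinuousLinearMap.toSpanSingleton ℝ (F (r, θ)))
    (f₂ := fun r θ => ContinuousLinearMap.toSpanSingleton ℝ (prim (dθ F) (r, θ)))
    (Eventually.of_forall fun v => (hasDerivAt_prim_r hc v).hasFDerivAt)
    (Eventually.of_forall fun v => (hasDerivAt_prim_θ hF v).hasFDerivAt)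
    ?_ ?_
  · refine h.hasFDerivAt.congr_fderiv ?_
    ext <;> simp [Function.HasUncurry.uncurry]
  · exact ((ContinuousLinearMap.toSpanSingletonCLE (𝕜 := ℝ) (E := ℝ)).continuous.comp hc).continuousAt
  · exact ((ContinuousLinearMap.toSpanSingletonCLE (𝕜 := ℝ) (E := ℝ)).continuous.comp hp).continuousAt

lemma contDiff_prim {N : ℕ} (hF : ContDiff ℝ N F) : ContDiff ℝ N (prim F) := by
  induction N generalizing F with
  | zero =>
    have := continuous_prim hF.continuous
    exact_mod_cast contDiff_zero.2 this
  | succ N ih =>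
    have h1 : ContDiff ℝ (1 : ℕ) F := hF.of_nat (Nat.le_add_left 1 N)
    have h2 : ContDiff ℝ N F := hF.of_nat (Nat.le_succ N)
    have := (contDiff_succ_iff_hasFDerivAt (f := prim F)).2
      ⟨fun q => F q • ContinuousLinearMap.fst ℝ ℝ ℝ
        + prim (dθ F) q • ContinuousLinearMap.snd ℝ ℝ ℝ,
        (h2.smul contDiff_const).add ((ih (contDiff_dθ hF)).smul contDiff_const),
        fun q => hasFDerivAt_prim h1 q⟩
    exact_mod_cast this

lemma SF_prim (hF : SF F) : SF (prim F) := fun N => by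
  obtain ⟨r₀, h0, h⟩ := (hF N).zero
  refine ⟨contDiff_prim (hF N).cd, r₀, h0, fun q hq => ?_⟩
  refine (intervalIntegral.integral_congr (g := fun _ => 0) fun ρ hρ => ?_).trans (by simp)
  refine h _ (lt_of_le_of_lt hρ.2 (max_lt h0 hq))

lemma SF_rpow_mul (s : ℝ) (hF : SF F) : SF ((fun q => q.1 ^ s) * F) :=
  fun N => (hF N).rpow_mul s

lemma SF.smul (c : ℝ) (hF : SF F) : SF (c • F) := fun N => (hF N).smul c

lemma SF.zero_fun : SF (0 : ℱ) := fun _ => TF.zero_fun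

/-- Solution of `(r ∂_r + ν) w = G` vanishing near `r = 0`. -/
def fwd (ν : ℝ) (G : ℱ) : ℱ :=
  (fun q => q.1 ^ (-ν)) * prim ((fun q => q.1 ^ (ν - 1)) * G)

lemma SF_fwd (ν : ℝ) (hG : SF G) : SF (fwd ν G) :=
  SF_rpow_mul _ (SF_prim (SF_rpow_mul _ hG))

lemma euler_rpow_mul {q : ℝ × ℝ} (s : ℝ) (hq : 0 < q.1)
    (hf : DifferentiableAt ℝ f q) :
    euler ((fun q => q.1 ^ s) * f) q = s * (q.1 ^ s * f q) + q.1 ^ s * euler f q := by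
  have h1 : HasDerivAt (fun r : ℝ => r ^ s) (s * q.1 ^ (s - 1)) q.1 :=
    hasDerivAt_rpow_const (Or.inl hq.ne')
  have h2 := (h1.mul (hasDerivAt_dr hf)).deriv
  have h3 : dr ((fun q => q.1 ^ s) * f) q
      = s * q.1 ^ (s - 1) * f (q.1, q.2) + q.1 ^ s * dr f q := h2
  rw [euler, h3, euler, rpow_sub_one hq.ne']
  field_simp

lemma dr_prim (hF : Continuous F) (q : ℝ × ℝ) : dr (prim F) q = F q :=
  (hasDerivAt_prim_r hF q).deriv

lemma shiftE_fwd (ν : ℝ) (hG : SF G) : shiftE ν (fwd ν G) = G := by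
  funext q
  obtain ⟨r₀, h0, h⟩ := (hG 0).zero
  rcases lt_or_ge 0 q.1 with hq | hq
  · have h1 := SF_prim (SF_rpow_mul (ν - 1) hG)
    have h2 := euler_rpow_mul (-ν) hq (sf_diff h1 q)
    simp only [shiftE, Pi.add_apply, Pi.smul_apply, smul_eq_mul]
    rw [fwd, h2, euler, dr_prim (SF_rpow_mul (ν - 1) hG 0).cont]
    simp only [Pi.mul_apply]
    rw [rpow_sub_one hq.ne', rpow_neg hq.le]
    have := (rpow_pos_of_pos hq ν).ne'
    field_simp
    ring
  · obtain ⟨r₁, h1, h'⟩ := (TF.shiftE ν (SF_fwd ν hG 1)).zero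
    rw [h' q (hq.trans_lt h1), h q (hq.trans_lt h0)]

lemma fwd_eq_zero (ν : ℝ) {r θ : ℝ} (hr : 0 < r)
    (h : ∀ ρ ∈ Ioc 0 r, G (ρ, θ) = 0) : fwd ν G (r, θ) = 0 := by
  have : prim ((fun q => q.1 ^ (ν - 1)) * G) (r, θ) = 0 := by
    rw [prim, intervalIntegral.integral_of_le hr.le]
    refine (setIntegral_congr_fun measurableSet_Ioc (g := fun _ => 0) fun ρ hρ => ?_).trans (by simp)
    simp [h ρ hρ]
  rw [fwd, Pi.mul_apply, this, mul_zero]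

/-- The operator `p - r ∂_r`, for a suitable exponent `p` the adjoint of `r ∂_r + ν`. -/
def adjE (p : ℝ) (f : ℱ) : ℱ := p • f - euler f

lemma SF.adjE (p : ℝ) (hf : SF f) : SF (adjE p f) := (hf.smul p).sub hf.euler

lemma adjE_add (p : ℝ) (hf : SF f) (hg : SF g) :
    adjE p (f + g) = adjE p f + adjE p g := by
  rw [adjE, adjE, adjE, euler_add (sf_diff hf) (sf_diff hg), smul_add]
  abel

lemma adjE_smul (p c : ℝ) (f : ℱ) : adjE p (c • f) = c • adjE p f := by
  rw [adjE, adjE, euler_smul, smul_sub, smul_comm]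

/-- The factor `∫_r^σ ρ^(-p-1) G dρ` of the solution of `(p - r ∂_r) g = G` that vanishes for
`r = σ`. -/
def bwd (σ p : ℝ) (G : ℱ) : ℱ :=
  fun q => prim ((fun q => q.1 ^ (-p - 1)) * G) (σ, q.2) - prim ((fun q => q.1 ^ (-p - 1)) * G) q

lemma contDiff_bwd (σ p : ℝ) (hG : SF G) (N : ℕ) : ContDiff ℝ N (bwd σ p G) := by
  have h := (SF_prim (SF_rpow_mul (-p - 1) hG) N).cd
  exact (h.comp (contDiff_const.prodMk contDiff_snd)).sub h

lemma bwd_σ (σ p θ : ℝ) : bwd σ p G (σ, θ) = 0 := sub_self _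

/-- Near `r = 0` the function `bwd` does not depend on `r`. -/
lemma bwd_eq (σ p : ℝ) (hG : SF G) :
    ∃ r₀ > 0, ∀ q : ℝ × ℝ, q.1 < r₀ → bwd σ p G q = bwd σ p G (0, q.2) := by
  obtain ⟨r₀, h0, h⟩ := (SF_prim (SF_rpow_mul (-p - 1) hG) 0).zero
  refine ⟨r₀, h0, fun q hq => ?_⟩
  simp only [bwd]
  rw [h q hq, h (0, q.2) h0]

lemma dr_bwd (σ p : ℝ) (hG : SF G) (q : ℝ × ℝ) :
    dr (bwd σ p G) q = -(q.1 ^ (-p - 1) * G q) := by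
  have h := hasDerivAt_prim_r (SF_rpow_mul (-p - 1) hG 0).cont q
  exact (h.const_sub (prim ((fun q => q.1 ^ (-p - 1)) * G) (σ, q.2))).deriv

lemma bwd_eq_zero {σ p r θ : ℝ} (hr : r ∈ Ioo 0 σ)
    (h : ∀ ρ ∈ Ioo 0 σ, G (ρ, θ) = 0) : bwd σ p G (r, θ) = 0 := by
  have key : ∀ s, 0 ≤ s → s ≤ σ → prim ((fun q => q.1 ^ (-p - 1)) * G) (s, θ) = 0 := by
    intro s h0 hs
    rw [prim, intervalIntegral.integral_of_le h0, integral_Ioc_eq_integral_Ioo]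
    refine (setIntegral_congr_fun measurableSet_Ioo (g := fun _ => 0) fun ρ hρ => ?_).trans (by simp)
    simp [h ρ ⟨hρ.1, hρ.2.trans_le hs⟩]
  have hσ := hr.1.trans hr.2
  simp [bwd, key σ hσ.le le_rfl, key r hr.1.le hr.2.le]

namespace DegenerateOperator

/-! ### The formal adjoint -/

/-- The formal adjoint of `X`. -/
def Xt (E : DegenerateOperator) (f : ℱ) : ℱ := -E.X f - E.τ * (E.dv * f)

/-- The formal adjoint of `Z`. -/
def Zt (E : DegenerateOperator) (f : ℱ) : ℱ := -E.Z f - E.dv * f + E.τ' * f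

/-- The formal adjoint of `D`. -/
def Dt (E : DegenerateOperator) (f : ℱ) : ℱ := -E.D f - E.dv * f

/-- The formal adjoint of `M`, with respect to the weighted inner product. -/
def Mt (E : DegenerateOperator) (f : ℱ) : ℱ :=
  E.Xt (E.Xt f) + E.Zt (E.k * E.Zt f) + E.Dt (E.α * f) - dθ (E.β * f)

variable {E : DegenerateOperator} {f g h w G : ℱ}

local notation "nrm" => E.S.nn

lemma dv_tf {N : ℕ} (hf : TF N f) : TF N (E.dv * f) := TF.cmul (cdv N) hf

lemma Xt_tf {N : ℕ} (hf : TF (N + 1) f) : TF N (E.Xt f) :=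
  (X_tf hf).neg.sub (TF.cmul (cτ N) (dv_tf (hf.of_le (by omega))))

lemma Zt_tf {N : ℕ} (hf : TF (N + 1) f) : TF N (E.Zt f) :=
  ((Z_tf hf).neg.sub (dv_tf (hf.of_le (by omega)))).add
    (TF.cmul (cτ' N) (hf.of_le (by omega)))

lemma Dt_tf {N : ℕ} (hf : TF (N + 1) f) : TF N (E.Dt f) :=
  (D_tf hf).neg.sub (dv_tf (hf.of_le (by omega)))

lemma SF.Xt (hf : SF f) : SF (E.Xt f) := fun N => Xt_tf (hf (N + 1))

lemma α_tf {N : ℕ} (hN : N ≤ E.n + 1) (hf : TF N f) : TF N (E.α * f) :=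
  TF.cmul (E.hα.of_nat hN) hf

lemma β_tf {N : ℕ} (hN : N ≤ E.n + 1) (hf : TF N f) : TF N (E.β * f) :=
  TF.cmul (E.hβ.of_nat hN) hf

lemma Mt_tf (hf : SF f) : TF 0 (E.Mt f) :=
  (((Xt_tf (Xt_tf (hf 2))).add (Zt_tf (k_tf (by omega) (Zt_tf (hf 2))))).add
    (Dt_tf (α_tf (by omega) (hf 1)))).sub (β_tf (by omega) (hf 1)).dθ

lemma ip_Xt (hf : TF 1 f) (hg : TF 1 g) (hb : Bdry E (f * g)) :
    E.S.ip (E.X f) g = E.S.ip f (E.Xt g) := by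
  have hf0 := hf.of_le zero_le_one
  have hg0 := hg.of_le zero_le_one
  rw [ip_X hf hg hb, Xt, ip_sub_right (X_tf hg).neg (TF.cmul (cτ 0) (dv_tf hg0)) hf0,
    ip_neg_right]

lemma ip_Zt (hf : TF 1 f) (hg : TF 1 g) (hb : Bdry E (f * g)) :
    E.S.ip (E.Z f) g = E.S.ip f (E.Zt g) := by
  have hf0 := hf.of_le zero_le_one
  have hg0 := hg.of_le zero_le_one
  rw [ip_Z hf hg hb, Zt, ip_add_right ((Z_tf hg).neg.sub (dv_tf hg0))
    (TF.cmul (cτ' 0) hg0) hf0, ip_sub_right (Z_tf hg).neg (dv_tf hg0) hf0,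
    ip_neg_right]

lemma ip_Dt (hf : TF 1 f) (hg : TF 1 g) : E.S.ip (E.D f) g = E.S.ip f (E.Dt g) := by
  have hf0 := hf.of_le zero_le_one
  have hg0 := hg.of_le zero_le_one
  rw [ip_D hf hg, Dt, ip_sub_right (D_tf hg).neg (dv_tf hg0) hf0, ip_neg_right]

lemma ip_M (hw : SF w) (hh : SF h) (bw : Bdry E w) (bh : Bdry E h) :
    E.S.ip (E.M w) h = E.S.ip w (E.Mt h) := by
  have t1 : TF 0 (E.X (E.X w)) := X_sf (X_sf hw) 0
  have tZ : TF 1 (E.k * E.Z w) := k_tf (by omega) (Z_sf hw 1)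
  have t2 : TF 0 (E.Z (E.k * E.Z w)) := Z_tf tZ
  have t3 : TF 0 (E.α * E.D w) := α_tf (by omega) (D_sf hw 0)
  have t4 : TF 0 (E.β * dθ w) := β_tf (by omega) (hw.dθ 0)
  have s1 : TF 0 (E.Xt (E.Xt h)) := Xt_tf (Xt_tf (hh 2))
  have sZ : TF 1 (E.k * E.Zt h) := k_tf (by omega) (Zt_tf (hh 2))
  have s2 : TF 0 (E.Zt (E.k * E.Zt h)) := Zt_tf sZ
  have sα : TF 1 (E.α * h) := α_tf (by omega) (hh 1)
  have s3 : TF 0 (E.Dt (E.α * h)) := Dt_tf sα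
  have sβ : TF 1 (E.β * h) := β_tf (by omega) (hh 1)
  have s4 : TF 0 (dθ (E.β * h)) := sβ.dθ
  rw [M, ip_add_left ((t1.add t2).add t3) t4 (hh 0), ip_add_left (t1.add t2) t3 (hh 0),
    ip_add_left t1 t2 (hh 0), Mt, ip_sub_right ((s1.add s2).add s3) s4 (hw 0),
    ip_add_right (s1.add s2) s3 (hw 0), ip_add_right s1 s2 (hw 0),
    ip_Xt (X_sf hw 1) (hh 1) bh.mul_right, ip_Xt (hw 1) (Xt_tf (hh 2)) bw.mul_left,
    ip_Zt tZ (hh 1) bh.mul_right, ip_mul_left, ip_Zt (hw 1) sZ bw.mul_left,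
    ip_mul_left, ip_Dt (hw 1) sα, ip_mul_left,
    ip_dθ (hw 1) sβ (bw.mul_left (g := E.β * h))]
  ring

/-- The exponent for which `p - r ∂_r` is the adjoint of `r ∂_r + ν`. -/
def p (E : DegenerateOperator) : ℝ := E.ν - (1 - E.S.γ)

/-- The powers of the adjoint of `r ∂_r + ν`. -/
def At (E : DegenerateOperator) (j : ℕ) (f : ℱ) : ℱ := (adjE E.p)^[j] f

/-- Functions for which no boundary terms occur at `r = σ` when `j` factors `r ∂_r + ν` are
integrated by parts. -/
def Cls (E : DegenerateOperator) : ℕ → (ℱ) → Prop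
  | 0, g => SF g ∧ Bdry E g
  | j + 1, g => SF g ∧ Bdry E g ∧ (∀ t, g (E.S.σ, t) = 0) ∧ Cls E j (adjE E.p g)

lemma Cls.sf {j : ℕ} (hg : Cls E j g) : SF g := by cases j <;> exact hg.1

lemma Cls.bdry {j : ℕ} (hg : Cls E j g) : Bdry E g := by
  cases j
  · exact hg.2
  · exact hg.2.1

lemma Bdry.add (hf : Bdry E f) (hg : Bdry E g) : Bdry E (f + g) := fun r hr => by
  simp [(hf r hr).1, (hf r hr).2, (hg r hr).1, (hg r hr).2]

lemma Bdry.smul (c : ℝ) (hf : Bdry E f) : Bdry E (c • f) := fun r hr => by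
  simp [(hf r hr).1, (hf r hr).2]

lemma Cls.add {j : ℕ} (hf : Cls E j f) (hg : Cls E j g) : Cls E j (f + g) := by
  induction j generalizing f g with
  | zero => exact ⟨hf.1.add hg.1, hf.2.add hg.2⟩
  | succ j ih =>
    refine ⟨hf.1.add hg.1, hf.2.1.add hg.2.1, fun t => ?_, ?_⟩
    · rw [Pi.add_apply, hf.2.2.1, hg.2.2.1, add_zero]
    · rw [adjE_add _ hf.1 hg.1]
      exact ih hf.2.2.2 hg.2.2.2

lemma Cls.smul {j : ℕ} (c : ℝ) (hf : Cls E j f) : Cls E j (c • f) := by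
  induction j generalizing f with
  | zero => exact ⟨hf.1.smul c, hf.2.smul c⟩
  | succ j ih =>
    refine ⟨hf.1.smul c, hf.2.1.smul c, fun t => ?_, ?_⟩
    · rw [Pi.smul_apply, hf.2.2.1, smul_zero]
    · rw [adjE_smul]
      exact ih hf.2.2.2

lemma At_sf (j : ℕ) (hf : SF f) : SF (E.At j f) := by
  induction j generalizing f with
  | zero => exact hf
  | succ j ih => exact ih (hf.adjE E.p)

lemma At_add (j : ℕ) (hf : SF f) (hg : SF g) : E.At j (f + g) = E.At j f + E.At j g := by
  induction j generalizing f g with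
  | zero => rfl
  | succ j ih =>
    have := ih (hf.adjE E.p) (hg.adjE E.p)
    rw [← adjE_add _ hf hg] at this
    exact this

lemma At_smul (j : ℕ) (c : ℝ) : E.At j (c • f) = c • E.At j f := by
  induction j generalizing f with
  | zero => rfl
  | succ j ih =>
    have := ih (f := adjE E.p f)
    rw [← adjE_smul] at this
    exact this

lemma Cls.At_bdry {j : ℕ} (hf : Cls E j f) : Bdry E (E.At j f) := by
  induction j generalizing f with
  | zero => exact hf.2
  | succ j ih => exact ih hf.2.2.2

/-- `f` vanishes on an open set. -/
lemma euler_eq_zero_of_isOpen {V : Set (ℝ × ℝ)} (hV : IsOpen V) (hf : ∀ q ∈ V, f q = 0) :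
    ∀ q ∈ V, euler f q = 0 := fun q hq => by
  have h1 : ∀ᶠ r in 𝓝 q.1, f (r, q.2) = 0 := by
    have : Tendsto (fun r : ℝ => (r, q.2)) (𝓝 q.1) (𝓝 q) :=
      (by fun_prop : Continuous fun r : ℝ => (r, q.2)).tendsto _
    exact (this.eventually (hV.mem_nhds hq)).mono fun r hr => hf _ hr
  have h2 : (fun r => f (r, q.2)) =ᶠ[𝓝 q.1] fun _ => 0 := h1
  rw [euler, dr, h2.deriv_eq]
  simp

lemma dθ_eq_zero_of_isOpen {V : Set (ℝ × ℝ)} (hV : IsOpen V) (hf : ∀ q ∈ V, f q = 0) :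
    ∀ q ∈ V, dθ f q = 0 := fun q hq => by
  have h1 : ∀ᶠ r in 𝓝 q.2, f (q.1, r) = 0 := by
    have : Tendsto (fun r : ℝ => (q.1, r)) (𝓝 q.2) (𝓝 q) :=
      (by fun_prop : Continuous fun r : ℝ => (q.1, r)).tendsto _
    exact (this.eventually (hV.mem_nhds hq)).mono fun r hr => hf _ hr
  have h2 : (fun r => f (q.1, r)) =ᶠ[𝓝 q.2] fun _ => 0 := h1
  rw [dθ, h2.deriv_eq]
  simp

lemma Bdry.adjE (hf : Bdry E f) (c : ℝ) : Bdry E (adjE c f) := by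
  have h := (hf.A 1).add (hf.smul (-E.ν))
  have h2 : E.A 1 f + (-E.ν) • f = euler f := by
    rw [DegenerateOperator.A, Function.iterate_one, shiftE, neg_smul]
    abel
  rw [h2] at h
  have := (hf.smul c).add (h.smul (-1))
  rwa [neg_one_smul, ← sub_eq_add_neg] at this

lemma Cls.of_vanish {j : ℕ} (sg : SF g) (bg : Bdry E g) (hg : ∀ q : ℝ × ℝ, E.S.σ / 2 < q.1 → g q = 0) :
    Cls E j g := by
  have hσ := E.S.hσ
  induction j generalizing g with
  | zero => exact ⟨sg, bg⟩
  | succ j ih =>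
    refine ⟨sg, bg, fun t => hg _ (by simpa using by linarith), ih (sg.adjE _) (bg.adjE _) ?_⟩
    intro q hq
    have h1 := euler_eq_zero_of_isOpen (V := {q : ℝ × ℝ | E.S.σ / 2 < q.1})
      (isOpen_lt continuous_const continuous_fst) hg q hq
    simp [adjE, h1, hg q hq]

lemma ip_A {j : ℕ} (hf : TF j f) (hg : Cls E j g) :
    E.S.ip (E.A j f) g = E.S.ip f (E.At j g) := by
  induction j generalizing g with
  | zero => rfl
  | succ j ih =>
    have hA : TF 1 (E.A j f) := A_tf (hf.of_le (by omega))
    have hA0 := hA.of_le zero_le_one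
    have sg := hg.sf
    have h1 := E.S.ip_euler hA (sg 1)
    simp only [hg.2.2.1, mul_zero, integral_zero, add_zero] at h1
    have h2 : E.S.ip (shiftE E.ν (E.A j f)) g = E.S.ip (E.A j f) (adjE E.p g) := by
      rw [shiftE, ip_add_left hA.euler (hA0.smul _) (sg 0), h1, ip_smul_left, adjE,
        ip_sub_right ((sg 0).smul _) (sg.euler 0) hA0, ip_smul_right, p]
      ring
    rw [A_succ, h2, ih (hf.of_le (by omega)) hg.2.2.2]
    rfl

/-- The operator `(r ∂_r + ν)^j` is invertible on functions vanishing near `r = 0`. -/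
lemma exists_A_eq (j : ℕ) (hG : SF G) (bG : Bdry E G) : ∃ w, SF w ∧ Bdry E w ∧ E.A j w = G := by
  induction j generalizing G with
  | zero => exact ⟨G, hG, bG, rfl⟩
  | succ j ih =>
    obtain ⟨w, h1, h2, h3⟩ := ih (SF_fwd E.ν hG) (fun r hr =>
      ⟨fwd_eq_zero _ hr.1 fun ρ hρ => (bG ρ ⟨hρ.1, hρ.2.trans_lt hr.2⟩).1,
        fwd_eq_zero _ hr.1 fun ρ hρ => (bG ρ ⟨hρ.1, hρ.2.trans_lt hr.2⟩).2⟩)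
    refine ⟨w, h1, h2, ?_⟩
    rw [A_succ, h3, shiftE_fwd _ hG]

/-! ### Bounds for families of test functions -/

section
variable {ι : Type*} {N : ℕ} {F : ι → ℱ}

/-- Families with bounded derivatives on the rectangle. -/
abbrev BF (E : DegenerateOperator) {ι : Type*} (N : ℕ) (F : ι → ℱ) : Prop :=
  BC (fun _ : ι => Ω(E.S)) N F

namespace BF

lemma cmul (ha : ContDiff ℝ N a) (hF : BF E N F) : BF E N fun i => a * F i :=
  Dom.FC.mul (BC.of_contDiff (isCompact_Icc.prod isCompact_Icc) (fun _ => rect_subset _ _) ha) hF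

lemma D (hF : BF E (N + 1) F) : BF E N fun i => E.D (F i) := cmul (cφ N) hF.euler

lemma X (hF : BF E (N + 1) F) : BF E N fun i => E.X (F i) := (cmul (cτ N) (D hF)).add hF.dθ

lemma dv (hF : BF E (N + 1) F) : BF E N fun i => E.dv * F i := cmul (cdv N) hF.of_succ

lemma Xt (hF : BF E (N + 1) F) : BF E N fun i => E.Xt (F i) :=
  (X hF).neg.sub (cmul (cτ N) (dv hF))

lemma Zt (hF : BF E (N + 1) F) : BF E N fun i => E.Zt (F i) :=
  (((cmul (cφ N) hF.euler).sub (cmul (cτ N) hF.dθ)).neg.sub (dv hF)).add (cmul (cτ' N) hF.of_succ)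

lemma Mt (hF : BF E 2 F) : BF E 0 fun i => E.Mt (F i) := by
  have ck : ContDiff ℝ (1 : ℕ) E.k := E.hk.of_nat (by omega)
  have cα : ContDiff ℝ (1 : ℕ) E.α := E.hα.of_nat (by omega)
  have cβ : ContDiff ℝ (1 : ℕ) E.β := E.hβ.of_nat (by omega)
  have b3 := cmul cα hF.of_succ
  exact ((Dom.FC.add (Xt (Xt hF)) (Zt (cmul ck (Zt hF)))).add
    ((D b3).neg.sub (dv b3))).sub (cmul cβ hF.of_succ).dθ

lemma At {j : ℕ} (hF : BF E (N + j) F) : BF E N fun i => E.At j (F i) := by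
  induction j generalizing F with
  | zero => exact hF
  | succ j ih => exact ih (F := fun i => adjE E.p (F i)) ((hF.of_succ.smul E.p).sub hF.euler)

end BF

end

/-- Functions vanishing for `r < ρ`. -/
def Van (ρ : ℝ) (f : ℱ) : Prop := ∀ q ∈ {q : ℝ × ℝ | q.1 < ρ}, f q = 0

lemma isOpen_van (ρ : ℝ) : IsOpen {q : ℝ × ℝ | q.1 < ρ} := isOpen_lt continuous_fst continuous_const

namespace Van
variable {ρ : ℝ}
lemma euler (hf : Van ρ f) : Van ρ (euler f) := euler_eq_zero_of_isOpen (isOpen_van ρ) hf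
lemma dθ (hf : Van ρ f) : Van ρ (dθ f) := dθ_eq_zero_of_isOpen (isOpen_van ρ) hf
lemma add (hf : Van ρ f) (hg : Van ρ g) : Van ρ (f + g) := fun q hq => by simp [hf q hq, hg q hq]
lemma neg (hf : Van ρ f) : Van ρ (-f) := fun q hq => by simp [hf q hq]
lemma sub (hf : Van ρ f) (hg : Van ρ g) : Van ρ (f - g) := fun q hq => by simp [hf q hq, hg q hq]
lemma cmul (a : ℱ) (hf : Van ρ f) : Van ρ (a * f) := fun q hq => by simp [hf q hq]
lemma smul (c : ℝ) (hf : Van ρ f) : Van ρ (c • f) := fun q hq => by simp [hf q hq]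

lemma Xt (hf : Van ρ f) : Van ρ (E.Xt f) :=
  ((((hf.euler.cmul _).cmul _).add hf.dθ).neg).sub ((hf.cmul _).cmul _)

lemma Zt (hf : Van ρ f) : Van ρ (E.Zt f) :=
  ((((hf.euler.cmul _).sub (hf.dθ.cmul _)).neg).sub (hf.cmul _)).add (hf.cmul _)

lemma Mt (hf : Van ρ f) : Van ρ (E.Mt f) :=
  (((hf.Xt.Xt).add (hf.Zt.cmul _).Zt).add (((hf.cmul _).euler.cmul _).neg.sub
    ((hf.cmul _).cmul _))).sub (hf.cmul _).dθ

lemma At (j : ℕ) (hf : Van ρ f) : Van ρ (E.At j f) := by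
  induction j generalizing f with
  | zero => exact hf
  | succ j ih => exact ih (f := adjE E.p f) ((hf.smul _).sub hf.euler)
end Van

lemma nn_le_of_van {ρ C : ℝ} (hρ : 0 < ρ) (hγ : 0 ≤ E.S.γ) (hf : TF 0 f) (hv : Van ρ f)
    (hC : ∀ q ∈ Ω(E.S), |f q| ≤ C) :
    nrm f ≤ ρ ^ (-(E.S.γ / 2)) * (C * √(E.S.σ * E.S.δ)) := by
  have hσ := E.S.hσ
  have hδ := E.S.hδ
  have hC0 : 0 ≤ C := by
    have : (E.S.σ / 2, E.S.δ / 2) ∈ Ω(E.S) :=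
      ⟨⟨by simpa using by linarith, by simpa using by linarith⟩,
        ⟨by simpa using by linarith, by simpa using by linarith⟩⟩
    exact (abs_nonneg _).trans (hC _ this)
  apply le_of_sq_le_sq _ (by positivity)
  have hvol : volume.real Ω(E.S) = E.S.σ * E.S.δ := by
    rw [rect, Measure.real, Measure.volume_eq_prod, Measure.prod_prod, volume_Ioo,
      volume_Ioo, ENNReal.toReal_mul]
    simp [hσ.le, hδ.le]
  have hfin : volume Ω(E.S) ≠ ⊤ := by
    rw [rect, Measure.volume_eq_prod, Measure.prod_prod, volume_Ioo, volume_Ioo]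
    exact ENNReal.mul_ne_top ENNReal.ofReal_ne_top ENNReal.ofReal_ne_top
  rw [nn_sq, mul_pow, mul_pow, sq_sqrt (by positivity), ← rpow_natCast,
    ← rpow_mul hρ.le]
  have h1 : E.S.ip f f ≤ ∫ q in Ω(E.S), ρ ^ (-E.S.γ) * C ^ 2 := by
    refine setIntegral_mono_on (integrable hf hf.cont) (integrableOn_const hfin)
      (measurableSet_rect _ _) fun q hq => ?_
    rcases lt_or_ge q.1 ρ with h | h
    · rw [hv q h]
      simp only [mul_zero]
      positivity
    · refine mul_le_mul ?_ ?_ (mul_self_nonneg _) (by positivity)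
      · exact rpow_le_rpow_of_nonpos hρ h (by linarith)
      · rw [← sq, ← sq_abs]
        exact pow_le_pow_left₀ (abs_nonneg _) (hC q hq) 2
  refine h1.trans_eq ?_
  rw [setIntegral_const, hvol, smul_eq_mul]
  norm_num
  ring_nf

end DegenerateOperator

/-! ### Test functions concentrated near the vertex -/

/-- A smooth function of `r` which vanishes for `r < 1 / 2` and equals `1` for `r > 1`. -/
def step (s : ℝ) : ℝ := smoothTransition (2 * s - 1)

lemma contDiff_step (N : ℕ) : ContDiff ℝ N step :=
  smoothTransition.contDiff.comp (by fun_prop)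

lemma step_zero {s : ℝ} (hs : s ≤ 1 / 2) : step s = 0 :=
  smoothTransition.zero_of_nonpos (by linarith)

lemma step_one {s : ℝ} (hs : 1 ≤ s) : step s = 1 :=
  smoothTransition.one_of_one_le (by linarith)

lemma step_mem (s : ℝ) : 0 ≤ step s ∧ step s ≤ 1 :=
  ⟨smoothTransition.nonneg _, smoothTransition.le_one _⟩

/-- The function `(r, θ) ↦ Ψ (t r)`. -/
def scale (Ψ : ℝ → ℝ) (t : ℝ) : ℱ := fun q => Ψ (t * q.1)

lemma euler_scale {Ψ : ℝ → ℝ} (hΨ : Differentiable ℝ Ψ) (t : ℝ) :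
    euler (scale Ψ t) = scale (fun s => s * deriv Ψ s) t := by
  funext q
  have h : HasDerivAt (fun r => Ψ (t * r)) (deriv Ψ (t * q.1) * t) q.1 := by
    have h1 : HasDerivAt (fun r => t * r) t q.1 := by simpa using (hasDerivAt_id q.1).const_mul t
    exact (hΨ (t * q.1)).hasDerivAt.comp q.1 h1
  have h2 : dr (scale Ψ t) q = deriv Ψ (t * q.1) * t := h.deriv
  rw [euler, h2, scale]
  ring

lemma contDiff_scale {Ψ : ℝ → ℝ} {N : ℕ} (hΨ : ContDiff ℝ N Ψ) (t : ℝ) :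
    ContDiff ℝ N (scale Ψ t) := hΨ.comp (by fun_prop)

/-- A smooth function of one variable whose derivative lives in `[1/2, 1]` and which is constant
outside of this interval. -/
structure Shell (Ψ : ℝ → ℝ) : Prop where
  cd : ∀ N : ℕ, ContDiff ℝ N Ψ
  left : ∀ s < 1 / 2, Ψ s = 0
  right : ∀ s > 1, Ψ s = 0

lemma Shell.deriv {Ψ : ℝ → ℝ} (h : Shell Ψ) : Shell fun s => s * deriv Ψ s := by
  refine ⟨fun N => contDiff_id.mul ((h.cd (N + 1)).iterate_deriv' N 1), fun s hs => ?_, fun s hs => ?_⟩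
  · have : Ψ =ᶠ[𝓝 s] fun _ => 0 := (eventually_lt_nhds hs).mono h.left
    simp [this.deriv_eq]
  · have : Ψ =ᶠ[𝓝 s] fun _ => 0 := (eventually_gt_nhds hs).mono h.right
    simp [this.deriv_eq]

lemma Shell.bdd {Ψ : ℝ → ℝ} (h : Shell Ψ) : ∃ C, ∀ s, |Ψ s| ≤ C := by
  obtain ⟨C, hC⟩ := (isCompact_Icc (a := (1 / 2 : ℝ))).exists_bound_of_continuousOn
    (h.cd 0).continuous.continuousOn
  refine ⟨max C 0, fun s => ?_⟩
  by_cases hs : s ∈ Icc (1 / 2 : ℝ) 1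
  · exact (hC s hs).trans (le_max_left _ _)
  · have : Ψ s = 0 := by
      rcases lt_or_ge s (1 / 2) with h1 | h1
      · exact h.left s h1
      · exact h.right s (not_le.1 fun h2 => hs ⟨h1, h2⟩)
    rw [this, abs_zero]
    exact le_max_right _ _

lemma BC.scale {ι : Type*} {U : ι → Set (ℝ × ℝ)} {N : ℕ} {Ψ : ℝ → ℝ} (h : Shell Ψ) (t : ι → ℝ) :
    BC U N fun i => scale Ψ (t i) := by
  have key : (polarDom U).Bdd fun i => EllipticSector.scale Ψ (t i) :=
    h.bdd.imp fun C hC i q _ => hC _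
  induction N generalizing Ψ with
  | zero => exact ⟨le_rfl, fun i => (contDiff_scale (h.cd _) _).contDiffOn, key⟩
  | succ N ih =>
    refine .of_derivs (fun i => contDiff_scale (h.cd _) _) key ?_ ?_
    · simp only [fun i => euler_scale ((h.cd 1).differentiable (by norm_num)) (t i)]
      exact ih h.deriv (h.deriv.bdd.imp fun C hC i q _ => hC _)
    · refine (Dom.FC.const (c := fun _ => 0) (C := 0) le_rfl (by simp)).congr fun i q _ => ?_
      simp [dθ, EllipticSector.scale]

lemma shell_step : Shell fun s => s * deriv step s := by
  refine ⟨fun N => contDiff_id.mul ((contDiff_step (N + 1)).iterate_deriv' N 1), fun s hs => ?_, fun s hs => ?_⟩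
  · have : step =ᶠ[𝓝 s] fun _ => 0 := (eventually_lt_nhds hs).mono fun s hs => step_zero hs.le
    simp [this.deriv_eq]
  · have : step =ᶠ[𝓝 s] fun _ => 1 := (eventually_gt_nhds hs).mono fun s hs => step_one hs.le
    simp [this.deriv_eq]

lemma Shell.rpow_mul {Ψ : ℝ → ℝ} (h : Shell Ψ) (p : ℝ) : Shell fun s => s ^ p * Ψ s := by
  refine ⟨fun N => contDiff_iff_contDiffAt.2 fun s => ?_, fun s hs => by simp [h.left s hs],
    fun s hs => by simp [h.right s hs]⟩
  rcases lt_or_ge s (1 / 2) with h1 | h1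
  · have : (fun s => s ^ p * Ψ s) =ᶠ[𝓝 s] fun _ => 0 :=
      (eventually_lt_nhds h1).mono fun s hs => by simp [h.left s hs]
    exact contDiffAt_const.congr_of_eventuallyEq this
  · exact (contDiffAt_rpow_const_of_ne (by linarith)).mul (h.cd N).contDiffAt

lemma SF_scale {Ψ : ℝ → ℝ} (hΨ : ∀ N : ℕ, ContDiff ℝ N Ψ) (h0 : ∀ s < 1 / 2, Ψ s = 0) {t : ℝ}
    (ht : 0 < t) : SF (scale Ψ t) := fun N =>
  ⟨contDiff_scale (hΨ N) t, 1 / (2 * t), by positivity, fun q hq => h0 _ (by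
    rw [lt_div_iff₀ (by positivity)] at hq
    linarith)⟩

namespace DegenerateOperator

variable {E : DegenerateOperator} {G : ℱ}

local notation "nrm" => E.S.nn

/-- The cut-off of the solution `g` of `(p - r ∂_r) g = G` with `g = 0` for `r = σ`. -/
def cutSol (E : DegenerateOperator) (G : ℱ) (t : ℝ) : ℱ :=
  (fun q => q.1 ^ E.p) * (bwd E.S.σ E.p G * scale step t)

/-- The error caused by the cut-off. -/
def cutErr (E : DegenerateOperator) (G : ℱ) (t : ℝ) : ℱ :=
  (fun q => q.1 ^ E.p) * (bwd E.S.σ E.p G * scale (fun s => s * deriv step s) t)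

lemma SF_cutSol (hG : SF G) {t : ℝ} (ht : 0 < t) : SF (E.cutSol G t) :=
  SF_rpow_mul _ (SF.cmul (contDiff_bwd _ _ hG) (SF_scale contDiff_step (fun _ h => step_zero h.le) ht))

lemma SF_cutErr (hG : SF G) {t : ℝ} (ht : 0 < t) : SF (E.cutErr G t) :=
  SF_rpow_mul _ (SF.cmul (contDiff_bwd _ _ hG) (SF_scale shell_step.cd shell_step.left ht))

lemma bdry_bwd (bG : Bdry E G) : Bdry E (bwd E.S.σ E.p G) := fun _ hr =>
  ⟨bwd_eq_zero hr fun ρ hρ => (bG ρ hρ).1, bwd_eq_zero hr fun ρ hρ => (bG ρ hρ).2⟩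

lemma adjE_cutSol (hG : SF G) {t : ℝ} (ht : 0 < t) {r₀ : ℝ} (hr : 1 ≤ t * r₀)
    (h : ∀ q : ℝ × ℝ, q.1 < r₀ → G q = 0) :
    adjE E.p (E.cutSol G t) = G + (-1 : ℝ) • E.cutErr G t := by
  have hr0 : 0 < r₀ := by
    by_contra h'
    nlinarith [not_lt.1 h']
  funext q
  rcases lt_or_ge 0 q.1 with hq | hq
  · have d1 : Differentiable ℝ (bwd E.S.σ E.p G) := (contDiff_bwd _ _ hG 1).diff le_rfl
    have d2 : Differentiable ℝ (scale step t) :=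
      (contDiff_scale (contDiff_step 1) t).diff le_rfl
    have e1 := euler_rpow_mul (f := bwd E.S.σ E.p G * scale step t) E.p hq ((d1 q).mul (d2 q))
    have e2 : G q * scale step t q = G q := by
      rcases lt_or_ge q.1 r₀ with h1 | h1
      · rw [h q h1, zero_mul]
      · rw [scale, step_one (hr.trans (by gcongr)), mul_one]
    rw [euler_mul d1 d2, euler_scale ((contDiff_step 1).differentiable (by norm_num))] at e1
    simp only [adjE, Pi.sub_apply, Pi.add_apply, Pi.smul_apply, smul_eq_mul, cutSol, cutErr]
    rw [e1]
    simp only [Pi.mul_apply, Pi.add_apply]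
    rw [euler, dr_bwd _ _ hG]
    have e3 : q.1 ^ E.p * (q.1 * -(q.1 ^ (-E.p - 1) * G q)) = -G q := by
      rw [rpow_sub_one hq.ne', rpow_neg hq.le]
      have := (rpow_pos_of_pos hq E.p).ne'
      field_simp
    linear_combination (-scale step t q) * e3 + e2
  · obtain ⟨r₁, h1, h1'⟩ := ((SF_cutSol (E := E) hG ht).adjE E.p 0).zero
    obtain ⟨r₂, h2, h2'⟩ := (SF_cutErr (E := E) hG ht 0).zero
    simp [h1' q (hq.trans_lt h1), h2' q (hq.trans_lt h2), h q (hq.trans_lt hr0)]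

/-- Near the vertex the error is a multiple of a rescaled function. -/
lemma cutErr_eq {t r₀ : ℝ} (ht : 0 < t) (hr : 1 ≤ t * r₀)
    (h : ∀ q : ℝ × ℝ, q.1 < r₀ → bwd E.S.σ E.p G q = bwd E.S.σ E.p G (0, q.2)) :
    E.cutErr G t = t ^ (-E.p) • ((fun q : ℝ × ℝ => bwd E.S.σ E.p G (0, q.2)) *
      scale (fun s => s ^ E.p * (s * deriv step s)) t) := by
  funext q
  simp only [cutErr, Pi.mul_apply, Pi.smul_apply, smul_eq_mul]
  rcases lt_or_ge (t * q.1) (1 / 2) with h1 | h1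
  · have := shell_step.left _ h1
    simp only [scale, this, mul_zero]
  rcases lt_or_ge 1 (t * q.1) with h2 | h2
  · have := shell_step.right _ h2
    simp only [scale, this, mul_zero]
  have hq : 0 < q.1 := by
    by_contra h'
    nlinarith [not_lt.1 h']
  rcases lt_or_ge q.1 r₀ with h3 | h3
  · rw [h q h3]
    simp only [scale]
    rw [mul_rpow ht.le hq.le, rpow_neg ht.le]
    have := (rpow_pos_of_pos ht E.p).ne'
    field_simp
  · have h4 : t * q.1 = 1 := le_antisymm h2 (hr.trans (by gcongr))
    have h5 : deriv step 1 = 0 := by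
      have h6 : IsLocalMax step 1 := Eventually.of_forall fun s => by
        rw [step_one le_rfl]
        exact (step_mem s).2
      exact h6.deriv_eq_zero
    simp [scale, h4, h5]

/-- A functional with the bound `|ℓ h| ≤ C (‖Mᵗ h‖ + ‖h‖)` vanishes, if it vanishes on the functions
`(p - r ∂_r)^m G`, where `G` vanishes to order `m` for `r = σ`. -/
theorem eq_zero_of_cls (hγ : 0 < E.S.γ) {ℓ : (ℱ) → ℝ} {C : ℝ}
    (hadd : ∀ f g, SF f → SF g → ℓ (f + g) = ℓ f + ℓ g) (hsmul : ∀ (c : ℝ) f, SF f → ℓ (c • f) = c * ℓ f)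
    (hC : 0 ≤ C) (hb : ∀ h, SF h → Bdry E h → |ℓ h| ≤ C * (nrm (E.Mt h) + nrm h)) (m : ℕ)
    (hm : ∀ G, Cls E m G → ℓ (E.At m G) = 0) {h : ℱ} (sh : SF h) (bh : Bdry E h) :
    ℓ h = 0 := by
  have hσ := E.S.hσ
  suffices H : ∀ j, (∀ G, Cls E (j + 1) G → ℓ (E.At (j + 1) G) = 0) →
      ∀ G, Cls E j G → ℓ (E.At j G) = 0 by
    have H' : ∀ j, (∀ G, Cls E j G → ℓ (E.At j G) = 0) → ∀ G, Cls E 0 G → ℓ (E.At 0 G) = 0 := by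
      intro j
      induction j with
      | zero => exact id
      | succ j ih => exact fun hj => ih (H j hj)
    exact H' m hm h ⟨sh, bh⟩
  intro j hj G hG
  have sG := hG.sf
  obtain ⟨r₁, h1, hG1⟩ := (sG 0).zero
  obtain ⟨r₂, h2, hG2⟩ := bwd_eq E.S.σ E.p sG
  set c : ℱ := fun q => bwd E.S.σ E.p G (0, q.2) with hc
  set Ψ : ℝ → ℝ := fun s => s ^ E.p * (s * deriv step s)
  have sΨ : Shell Ψ := shell_step.rpow_mul E.p
  have cc : ∀ N : ℕ, ContDiff ℝ N c := fun N =>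
    (contDiff_bwd E.S.σ E.p sG N).comp (contDiff_const.prodMk contDiff_snd)
  have bc : ∀ f, Bdry E (c * f) := fun f r hr => by
    set ρ := min (r₂ / 2) (E.S.σ / 2)
    have hρ0 : 0 < ρ := lt_min (by linarith) (by linarith)
    have hρ1 : ρ < r₂ := (min_le_left _ _).trans_lt (by linarith)
    have hρ2 : ρ < E.S.σ := (min_le_right _ _).trans_lt (by linarith)
    have := bdry_bwd hG.bdry ρ ⟨hρ0, hρ2⟩
    rw [hG2 (ρ, _) hρ1, hG2 (ρ, _) hρ1] at this
    simp [hc, this.1, this.2]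
  let ι := {t : ℝ // 0 < t}
  let F : ι → ℱ := fun t => c * scale Ψ t.1
  have sF : ∀ t : ι, SF (F t) := fun t => SF.cmul cc (SF_scale sΨ.cd sΨ.left t.2)
  have bF : BF E (2 + j) F := BF.cmul (cc _) (BC.scale sΨ fun t : ι => t.1)
  have vF : ∀ t : ι, Van (1 / (2 * t.1)) (F t) := fun t q hq => by
    have hq' : q.1 < 1 / (2 * t.1) := hq
    have ht := t.2
    rw [lt_div_iff₀ (by positivity)] at hq'
    simp only [F, Pi.mul_apply, scale]
    rw [sΨ.left _ (by linarith), mul_zero]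
  have clsF : ∀ t : ι, 2 / E.S.σ ≤ t.1 → Cls E j (F t) := fun t ht => by
    refine Cls.of_vanish (sF t) (bc _) fun q hq => ?_
    simp only [F, Pi.mul_apply, scale]
    rw [sΨ.right _ ?_, mul_zero]
    rw [div_le_iff₀ hσ] at ht
    have := mul_lt_mul_of_pos_left hq t.2
    linarith
  have bA : BF E 2 fun t => E.At j (F t) := BF.At bF
  obtain ⟨C1, hC1⟩ := (BF.Mt bA).fb.bdd
  obtain ⟨C2, hC2⟩ := bA.fb.bdd
  -- the bound for the error
  set B := C * ((C1 + C2) * √(E.S.σ * E.S.δ)) with hB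
  have key : ∀ t : ℝ, max (max 1 (2 / E.S.σ)) (max (1 / r₁) (1 / r₂)) ≤ t →
      |ℓ (E.At j G)| ≤ t ^ (-E.p) * ((1 / (2 * t)) ^ (-(E.S.γ / 2)) * B) := by
    intro t ht
    simp only [max_le_iff] at ht
    obtain ⟨⟨ht1, ht2⟩, ht3, ht4⟩ := ht
    have ht0 : 0 < t := by linarith
    rw [div_le_iff₀ h1] at ht3
    rw [div_le_iff₀ h2] at ht4
    have e1 := adjE_cutSol (E := E) sG ht0 ht3 hG1
    have e2 := cutErr_eq ht0 ht4 hG2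
    have cE : Cls E j (E.cutErr G t) := by
      rw [e2]
      exact (clsF ⟨t, ht0⟩ ht2).smul _
    have cS : Cls E (j + 1) (E.cutSol G t) := by
      refine ⟨SF_cutSol sG ht0, ?_, fun θ => ?_, ?_⟩
      · exact Bdry.mul_right ((bdry_bwd hG.bdry).mul_left)
      · simp [cutSol, bwd_σ]
      · rw [e1]
        exact hG.add (cE.smul _)
    have e3 := hj _ cS
    have e4 : E.At (j + 1) (E.cutSol G t) = E.At j (adjE E.p (E.cutSol G t)) := rfl
    rw [e4, e1, At_add j sG (cE.sf.smul _), hadd _ _ (At_sf j sG) (At_sf j (cE.sf.smul _)),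
      At_smul, hsmul _ _ (At_sf j cE.sf), e2, At_smul, hsmul _ _ (At_sf j (sF ⟨t, ht0⟩))] at e3
    have e5 : ℓ (E.At j G) = t ^ (-E.p) * ℓ (E.At j (F ⟨t, ht0⟩)) := by linarith
    rw [e5, abs_mul, abs_of_nonneg (by positivity)]
    refine mul_le_mul_of_nonneg_left ?_ (by positivity)
    have v1 := (vF ⟨t, ht0⟩).At (E := E) j
    have sA := At_sf (E := E) j (sF ⟨t, ht0⟩)
    have n1 := nn_le_of_van (by positivity) hγ.le (Mt_tf sA) v1.Mt (hC1 ⟨t, ht0⟩)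
    have n2 := nn_le_of_van (by positivity) hγ.le (sA 0) v1 (hC2 ⟨t, ht0⟩)
    refine (hb _ sA (clsF ⟨t, ht0⟩ ht2).At_bdry).trans ?_
    calc _ ≤ C * ((1 / (2 * t)) ^ (-(E.S.γ / 2)) * (C1 * √(E.S.σ * E.S.δ))
          + (1 / (2 * t)) ^ (-(E.S.γ / 2)) * (C2 * √(E.S.σ * E.S.δ))) :=
          mul_le_mul_of_nonneg_left (add_le_add n1 n2) hC
      _ = _ := by rw [hB]; ring
  have hlim : Tendsto (fun t : ℝ => 2 ^ (E.S.γ / 2) * B * t ^ (-(E.p - E.S.γ / 2))) atTop (𝓝 0) := by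
    have hp : 0 < E.p - E.S.γ / 2 := by
      rw [p]
      linarith [E.hν]
    simpa using (tendsto_rpow_neg_atTop hp).const_mul (2 ^ (E.S.γ / 2) * B)
  have hle : |ℓ (E.At j G)| ≤ 0 := by
    refine ge_of_tendsto hlim ?_
    filter_upwards [eventually_ge_atTop (max (max 1 (2 / E.S.σ)) (max (1 / r₁) (1 / r₂)))] with t ht
    refine (key t ht).trans_eq ?_
    have ht0 : 0 < t := by
      have := (le_max_left _ _).trans ((le_max_left _ _).trans ht)
      linarith
    rw [one_div, inv_rpow (by positivity), ← rpow_neg (by positivity), neg_neg,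
      mul_rpow (by norm_num) ht0.le, show -(E.p - E.S.γ / 2) = -E.p + E.S.γ / 2 by ring,
      rpow_add ht0]
    ring
  exact abs_nonpos_iff.1 hle

end DegenerateOperator

/-! ### A representation theorem of Lions–Lax–Milgram type -/

/-- If `w ↦ ⟪s w, J w⟫` is coercive on the test space, every functional bounded by `‖J w‖` is of the
form `w ↦ ⟪U, s w⟫` with `U` in a closed subspace containing the range of `J`. -/
theorem exists_inner_eq {W H : Type*} [AddCommGroup W] [Module ℝ W] [NormedAddCommGroup H]
    [InnerProductSpace ℝ H] [CompleteSpace H] (K : Submodule ℝ H) [CompleteSpace K]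
    (J s : W →ₗ[ℝ] H) (F : W →ₗ[ℝ] ℝ) {c C : ℝ} (hJ : ∀ w, J w ∈ K) (hc : 0 < c) (hC : 0 ≤ C)
    (hcoer : ∀ w, c * ‖J w‖ ^ 2 ≤ inner ℝ (s w) (J w)) (hF : ∀ w, |F w| ≤ C * ‖J w‖) :
    ∃ U ∈ K, ∀ w, inner ℝ U (s w) = F w := by
  let T : W →ₗ[ℝ] K := (K.orthogonalProjectionOnto : H →ₗ[ℝ] K) ∘ₗ s
  have hT : ∀ w (x : K), inner ℝ (T w : H) (x : H) = inner ℝ (s w) (x : H) := fun w x =>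
    Submodule.inner_orthogonalProjectionOnto_eq_of_mem_right x (s w)
  have h1 : ∀ w, c * ‖J w‖ ≤ ‖T w‖ := fun w => by
    have h2 : c * ‖J w‖ ^ 2 ≤ ‖T w‖ * ‖J w‖ := by
      have h3 := hT w ⟨J w, hJ w⟩
      have h4 := real_inner_le_norm (T w : H) (J w)
      rw [h3] at h4
      exact (hcoer w).trans h4
    rcases eq_or_lt_of_le (norm_nonneg (J w)) with h0 | h0
    · rw [← h0, mul_zero]
      exact norm_nonneg _
    · have : (c * ‖J w‖) * ‖J w‖ ≤ ‖T w‖ * ‖J w‖ := by linarith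
      exact le_of_mul_le_mul_right this h0
  have h2 : ∀ w, |F w| ≤ C / c * ‖T w‖ := fun w => by
    refine (hF w).trans ?_
    have := mul_le_mul_of_nonneg_left (h1 w) (div_nonneg hC hc.le)
    calc C * ‖J w‖ = C / c * (c * ‖J w‖) := by field_simp
      _ ≤ _ := this
  have hker : T.ker ≤ F.ker := fun w hw => by
    rw [LinearMap.mem_ker] at hw ⊢
    have := h2 w
    rw [hw, norm_zero, mul_zero] at this
    exact abs_nonpos_iff.1 this
  let f : T.range →ₗ[ℝ] ℝ := (T.ker.liftQ F hker) ∘ₗ T.quotKerEquivRange.symm.toLinearMap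
  have hf : ∀ w, f ⟨T w, LinearMap.mem_range_self T w⟩ = F w := fun w => by
    have : T.quotKerEquivRange.symm ⟨T w, LinearMap.mem_range_self T w⟩ = T.ker.mkQ w :=
      T.quotKerEquivRange_symm_apply_image w (LinearMap.mem_range_self T w)
    simp only [f, LinearMap.comp_apply, LinearEquiv.coe_coe, this]
    simp
  have hfb : ∀ x, ‖f x‖ ≤ C / c * ‖x‖ := by
    rintro ⟨_, w, rfl⟩
    rw [hf w]
    exact h2 w
  obtain ⟨g, hg, -⟩ := exists_extension_norm_eq T.range (f.mkContinuous (C / c) hfb)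
  refine ⟨((InnerProductSpace.toDual ℝ K).symm g : K), Subtype.mem _, fun w => ?_⟩
  have h3 := hg ⟨T w, LinearMap.mem_range_self T w⟩
  rw [LinearMap.mkContinuous_apply, hf] at h3
  rw [← h3, ← InnerProductSpace.toDual_symm_apply (x := T w),
    real_inner_comm, ← hT w, real_inner_comm]
  rfl

/-! ### The weighted space as a space of square integrable functions -/

namespace Strip
variable {S : Strip}

/-- The measure `dr dθ` on the rectangle. -/
abbrev μ (S : Strip) : Measure (ℝ × ℝ) := volume.restrict Ω(S)

/-- The function `r ^ (-γ/2) f`. -/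
def wt (S : Strip) (f : ℱ) : ℱ := fun q => q.1 ^ (-(S.γ / 2)) * f q

open Classical in
/-- The isometric embedding `f ↦ r ^ (-γ/2) f` of the weighted space into `L²`. -/
def emb (S : Strip) (f : ℱ) : Lp ℝ 2 S.μ :=
  if h : MemLp (S.wt f) 2 S.μ then h.toLp _ else 0

lemma emb_eq (h : MemLp (S.wt f) 2 S.μ) : S.emb f = h.toLp _ := dif_pos h

lemma coe_emb (h : MemLp (S.wt f) 2 S.μ) : S.emb f =ᵐ[S.μ] S.wt f := by
  rw [emb_eq h]
  exact h.coeFn_toLp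

lemma memLp_wt (hf : TF 0 f) : MemLp (S.wt f) 2 S.μ := by
  have h1 : Continuous (S.wt f) := (hf.rpow_mul (-(S.γ / 2))).cont
  rw [memLp_two_iff_integrable_sq h1.aestronglyMeasurable]
  exact integrableOn_rect (h1.pow 2) _ _

lemma wt_mul_wt {q : ℝ × ℝ} (hq : q ∈ Ω(S)) :
    S.wt f q * S.wt g q = q.1 ^ (-S.γ) * (f q * g q) := by
  have : q.1 ^ (-S.γ) = q.1 ^ (-(S.γ / 2)) * q.1 ^ (-(S.γ / 2)) := by
    rw [← rpow_add hq.1.1]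
    ring_nf
  rw [wt, wt, this]
  ring

lemma inner_emb_eq (hf : MemLp (S.wt f) 2 S.μ) (hg : MemLp (S.wt g) 2 S.μ) :
    inner ℝ (S.emb f) (S.emb g) = S.ip f g := by
  rw [L2.inner_def, ip]
  refine integral_congr_ae ?_
  filter_upwards [coe_emb hf, coe_emb hg, ae_restrict_mem (measurableSet_rect _ _)] with q h1 h2 hq
  rw [h1, h2, ← wt_mul_wt hq]
  simp [mul_comm]

lemma inner_emb (hf : TF 0 f) (hg : TF 0 g) : inner ℝ (S.emb f) (S.emb g) = S.ip f g :=
  inner_emb_eq (memLp_wt hf) (memLp_wt hg)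

lemma norm_emb (hf : TF 0 f) : ‖S.emb f‖ = S.nn f := by
  rw [nn, ← inner_emb hf hf, real_inner_self_eq_norm_sq, sqrt_sq (norm_nonneg _)]

lemma wt_add : S.wt (f + g) = S.wt f + S.wt g := by
  funext q
  simp only [wt, Pi.add_apply]
  ring

lemma wt_smul (c : ℝ) : S.wt (c • f) = c • S.wt f := by
  funext q
  simp only [wt, Pi.smul_apply, smul_eq_mul]
  ring

lemma emb_add (hf : MemLp (S.wt f) 2 S.μ) (hg : MemLp (S.wt g) 2 S.μ) :
    S.emb (f + g) = S.emb f + S.emb g := by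
  have h : MemLp (S.wt (f + g)) 2 S.μ := by
    rw [wt_add]
    exact hf.add hg
  rw [emb_eq hf, emb_eq hg, emb_eq h, ← MemLp.toLp_add hf hg]
  congr 1
  exact wt_add

lemma emb_smul (c : ℝ) (hf : MemLp (S.wt f) 2 S.μ) : S.emb (c • f) = c • S.emb f := by
  have h : MemLp (S.wt (c • f)) 2 S.μ := by
    rw [wt_smul]
    exact hf.const_smul c
  rw [emb_eq hf, emb_eq h, ← MemLp.toLp_const_smul c hf]
  congr 1
  exact wt_smul c

lemma emb_sub (hf : MemLp (S.wt f) 2 S.μ) (hg : MemLp (S.wt g) 2 S.μ) :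
    S.emb (f - g) = S.emb f - S.emb g := by
  have hg' : MemLp (S.wt ((-1 : ℝ) • g)) 2 S.μ := by
    rw [wt_smul]
    exact hg.const_smul _
  rw [sub_eq_add_neg, ← neg_one_smul ℝ g, emb_add hf hg', emb_smul _ hg, neg_one_smul,
    ← sub_eq_add_neg]

lemma lintegral_sq (X : Lp ℝ 2 S.μ) :
    ∫⁻ q in Ω(S), ENNReal.ofReal (X q ^ 2) = ENNReal.ofReal (‖X‖ ^ 2) := by
  have h1 : Integrable (fun q => X q ^ 2) S.μ :=
    (memLp_two_iff_integrable_sq (Lp.aestronglyMeasurable X)).1 (Lp.memLp X)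
  rw [← ofReal_integral_eq_lintegral_ofReal h1 (Eventually.of_forall fun q => sq_nonneg _),
    ← real_inner_self_eq_norm_sq, L2.inner_def]
  congr 2
  funext q
  simp [sq]

end Strip

/-! ### Radial derivatives -/

/-- The function `r^s ∂_r^s f`. -/
def rdr (s : ℕ) (f : ℱ) : ℱ := fun q => q.1 ^ s * dr^[s] f q

lemma SF.dr (hf : SF f) : SF (dr f) := fun N => (hf (N + 1)).dr

lemma SF.dr_iterate (s : ℕ) (hf : SF f) : SF (EllipticSector.dr^[s] f) := by
  induction s generalizing f with
  | zero => exact hf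
  | succ s ih => exact ih hf.dr

lemma SF.dθ_iterate (s : ℕ) (hf : SF f) : SF (EllipticSector.dθ^[s] f) := by
  induction s generalizing f with
  | zero => exact hf
  | succ s ih => exact ih hf.dθ

lemma SF_rdr (s : ℕ) (hf : SF f) : SF (rdr s f) :=
  SF.cmul (a := fun q => q.1 ^ s) (fun _ => contDiff_fst.pow s) (hf.dr_iterate s)

lemma rdr_succ (ν : ℝ) (s : ℕ) (hf : SF f) :
    rdr (s + 1) f = shiftE ν (rdr s f) + (-(ν + s)) • rdr s f := by
  funext q
  have hd := sf_diff (hf.dr_iterate s) q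
  have h1 := (((hasDerivAt_id q.1).pow s).mul (hasDerivAt_dr hd)).deriv
  have h2 : dr (rdr s f) q = (s : ℝ) * q.1 ^ (s - 1) * dr^[s] f q + q.1 ^ s * dr (dr^[s] f) q := by
    simp only [id, mul_one] at h1
    exact h1
  simp only [shiftE, Pi.add_apply, Pi.smul_apply, smul_eq_mul, euler, h2]
  rw [rdr, rdr, Function.iterate_succ_apply', pow_succ]
  cases s with
  | zero => simp
  | succ s =>
    rw [Nat.add_sub_cancel, pow_succ]
    push_cast
    ring

namespace DegenerateOperator
variable {E : DegenerateOperator}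

local notation "nrm" => E.S.nn

lemma A_add (j : ℕ) (hf : SF f) (hg : SF g) : E.A j (f + g) = E.A j f + E.A j g :=
  shiftE_iterate_add _ _ (hf _).cd (hg _).cd

lemma A_smul (j : ℕ) (c : ℝ) (f : ℱ) : E.A j (c • f) = c • E.A j f :=
  shiftE_iterate_smul _ _ _ _

lemma nn_A_mono {i j : ℕ} (h : i ≤ j) (hf : SF f) : nrm (E.A i f) ≤ nrm (E.A j f) :=
  nn_iterate_le E.hν E.hγ h (hf _)

variable (E) in
lemma exists_nn_A_rdr_le (s : ℕ) : ∀ j, ∃ C ≥ 0, ∀ f, SF f →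
    nrm (E.A j (rdr s f)) ≤ C * nrm (E.A (j + s) f) := by
  induction s with
  | zero =>
    refine fun j => ⟨1, zero_le_one, fun f hf => le_of_eq ?_⟩
    have : rdr 0 f = f := by
      funext q
      simp [rdr]
    rw [this, one_mul, add_zero]
  | succ s ih =>
    intro j
    obtain ⟨C, hC0, hC⟩ := ih j
    obtain ⟨C', hC0', hC'⟩ := ih (j + 1)
    have hν := E.hν
    refine ⟨C' + (E.ν + s) * C, by positivity, fun f hf => ?_⟩
    have sr := SF_rdr s hf
    have e : E.A j (rdr (s + 1) f) = E.A (j + 1) (rdr s f) + (-(E.ν + s)) • E.A j (rdr s f) := by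
      rw [rdr_succ E.ν s hf, A_add j (fun N => (sr (N + 1)).shiftE _) (sr.smul _), A_smul]
      rfl
    rw [e]
    refine (nn_add_le (A_sf _ sr 0) ((A_sf _ sr 0).smul _)).trans ?_
    rw [nn_smul, abs_neg, abs_of_nonneg (by positivity)]
    have h1 := hC' f hf
    have h2 := (hC f hf).trans (mul_le_mul_of_nonneg_left
      (nn_A_mono (Nat.le_succ (j + s)) hf) hC0)
    have e2 : j + 1 + s = j + (s + 1) := by omega
    rw [e2] at h1
    have h3 := mul_le_mul_of_nonneg_left h2 (by positivity : 0 ≤ E.ν + s)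
    calc _ ≤ C' * nrm (E.A (j + (s + 1)) f) + (E.ν + s) * (C * nrm (E.A (j + (s + 1)) f)) :=
          add_le_add h1 h3
      _ = _ := by ring

variable (E) in
lemma exists_nn_A_le (j : ℕ) : ∀ s, ∃ C ≥ 0, ∀ f, SF f →
    nrm (E.A j (rdr s f)) ≤ C * ∑ t ∈ Finset.range (s + j + 1), nrm (rdr t f) := by
  induction j with
  | zero =>
    refine fun s => ⟨1, zero_le_one, fun f _ => ?_⟩
    rw [one_mul, add_zero]
    exact Finset.single_le_sum (f := fun t => nrm (rdr t f)) (fun t _ => E.S.nn_nonneg _)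
      (Finset.self_mem_range_succ s)
  | succ j ih =>
    intro s
    obtain ⟨C, hC0, hC⟩ := ih s
    obtain ⟨C', hC0', hC'⟩ := ih (s + 1)
    have hν := E.hν
    refine ⟨C' + (E.ν + s) * C, by positivity, fun f hf => ?_⟩
    have sr := SF_rdr s hf
    have sr' := SF_rdr (s + 1) hf
    have e : E.A (j + 1) (rdr s f) = E.A j (rdr (s + 1) f) + (E.ν + s) • E.A j (rdr s f) := by
      have h : shiftE E.ν (rdr s f) = rdr (s + 1) f + (E.ν + s) • rdr s f := by
        rw [rdr_succ E.ν s hf, neg_smul]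
        abel
      rw [← A_smul, ← A_add j sr' (sr.smul _), ← h]
      rfl
    rw [e]
    refine (nn_add_le (A_sf _ sr' 0) ((A_sf _ sr 0).smul _)).trans ?_
    rw [nn_smul, abs_of_nonneg (by positivity)]
    have h1 := hC' f hf
    have e2 : s + 1 + j + 1 = s + (j + 1) + 1 := by omega
    rw [e2] at h1
    have h4 : ∑ t ∈ Finset.range (s + j + 1), nrm (rdr t f)
        ≤ ∑ t ∈ Finset.range (s + (j + 1) + 1), nrm (rdr t f) :=
      Finset.sum_le_sum_of_subset_of_nonneg (Finset.range_mono (by omega))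
        fun t _ _ => E.S.nn_nonneg _
    have h2 := (hC f hf).trans (mul_le_mul_of_nonneg_left h4 hC0)
    have h3 := mul_le_mul_of_nonneg_left h2 (by positivity : 0 ≤ E.ν + s)
    calc _ ≤ _ := add_le_add h1 h3
      _ = _ := by ring

variable (E) in
lemma exists_nn_A_cmul_le (j : ℕ) (ha : ContDiff ℝ j a) : ∃ C ≥ 0, ∀ f, SF f →
    nrm (E.A j (a * f)) ≤ C * nrm (E.A j f) := by
  have key : ∀ i, i ≤ j → ∃ C ≥ 0, ∀ q ∈ Ω(E.S), |euler^[i] a q| ≤ C := fun i hi => by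
    have hc : Continuous (euler^[i] a) := (contDiff_euler_iterate (n := 0) i
      (ha.of_le (by exact_mod_cast (by omega : 0 + i ≤ j)))).continuous
    obtain ⟨C, hC⟩ := (isCompact_Icc.prod isCompact_Icc).exists_bound_of_continuousOn
      (s := Icc 0 E.S.σ ×ˢ Icc 0 E.S.δ) hc.continuousOn
    exact ⟨max C 0, le_max_right _ _, fun q hq =>
      (hC q (rect_subset _ _ hq)).trans (le_max_left _ _)⟩
  choose! C hC0 hC using key
  refine ⟨∑ p ∈ antidiagonal j, (j.choose p.1 : ℝ) * C p.1, ?_, fun f hf => ?_⟩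
  · refine Finset.sum_nonneg fun p hp => mul_nonneg (Nat.cast_nonneg _) (hC0 _ ?_)
    have := mem_antidiagonal.1 hp
    omega
  rw [A, shiftE_iterate_mul _ _ ha (hf _).cd, Finset.sum_mul]
  have ht : ∀ p ∈ antidiagonal j,
      TF 0 (euler^[p.1] a * (shiftE E.ν)^[p.2] f) := fun p hp => by
    have := mem_antidiagonal.1 hp
    exact TF.cmul (contDiff_euler_iterate (n := 0) _
      (ha.of_le (by exact_mod_cast (by omega : 0 + p.1 ≤ j)))) (A_sf (E := E) p.2 hf 0)
  refine (nn_sum_le _ fun p hp => (ht p hp).smul _).trans (Finset.sum_le_sum fun p hp => ?_)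
  have hp' := mem_antidiagonal.1 hp
  rw [nn_smul, abs_of_nonneg (Nat.cast_nonneg _), mul_assoc]
  refine mul_le_mul_of_nonneg_left ?_ (Nat.cast_nonneg _)
  have h1 := nn_cmul_le (S := E.S) (contDiff_euler_iterate (n := 0) p.1
      (ha.of_le (by exact_mod_cast (by omega : 0 + p.1 ≤ j)))).continuous (A_sf (E := E) p.2 hf 0)
      (hC0 p.1 (by omega)) (hC p.1 (by omega))
  exact h1.trans (mul_le_mul_of_nonneg_left (nn_A_mono (by omega) hf) (hC0 p.1 (by omega)))

end DegenerateOperator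

/-! ### The spaces `H^{(m,1,γ)}` -/

lemma dr_congr_on {V : Set (ℝ × ℝ)} (hV : IsOpen V) (h : ∀ q ∈ V, f q = g q) :
    ∀ q ∈ V, dr f q = dr g q := fun q hq => by
  have h1 : ∀ᶠ r in 𝓝 q.1, f (r, q.2) = g (r, q.2) := by
    have : Tendsto (fun r : ℝ => (r, q.2)) (𝓝 q.1) (𝓝 q) :=
      (by fun_prop : Continuous fun r : ℝ => (r, q.2)).tendsto _
    exact (this.eventually (hV.mem_nhds hq)).mono fun r hr => h _ hr
  exact Filter.EventuallyEq.deriv_eq h1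

lemma dθ_congr_on {V : Set (ℝ × ℝ)} (hV : IsOpen V) (h : ∀ q ∈ V, f q = g q) :
    ∀ q ∈ V, dθ f q = dθ g q := fun q hq => by
  have h1 : ∀ᶠ r in 𝓝 q.2, f (q.1, r) = g (q.1, r) := by
    have : Tendsto (fun r : ℝ => (q.1, r)) (𝓝 q.2) (𝓝 q) :=
      (by fun_prop : Continuous fun r : ℝ => (q.1, r)).tendsto _
    exact (this.eventually (hV.mem_nhds hq)).mono fun r hr => h _ hr
  exact Filter.EventuallyEq.deriv_eq h1

lemma dr_iterate_congr_on {V : Set (ℝ × ℝ)} (hV : IsOpen V) (s : ℕ)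
    (h : ∀ q ∈ V, f q = g q) : ∀ q ∈ V, dr^[s] f q = dr^[s] g q := by
  induction s generalizing f g with
  | zero => exact h
  | succ s ih => exact ih (dr_congr_on hV h)

lemma dθ_iterate_congr_on {V : Set (ℝ × ℝ)} (hV : IsOpen V) (s : ℕ)
    (h : ∀ q ∈ V, f q = g q) : ∀ q ∈ V, dθ^[s] f q = dθ^[s] g q := by
  induction s generalizing f g with
  | zero => exact h
  | succ s ih => exact ih (dθ_congr_on hV h)

lemma normSq_congr {σ δ lam γ : ℝ} {m l : ℕ} (h : ∀ q ∈ rect σ δ, f q = g q) :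
    normSq σ δ lam γ m l f = normSq σ δ lam γ m l g := by
  refine setLIntegral_congr_fun (measurableSet_rect _ _) fun q hq => ?_
  congr 1
  refine Finset.sum_congr rfl fun s _ => Finset.sum_congr rfl fun t _ => ?_
  rw [dr_iterate_congr_on (isOpen_rect σ δ) s (dθ_iterate_congr_on (isOpen_rect σ δ) t h) q hq]

/-- On the rectangle, the elements of `CBar` agree with smooth functions vanishing near `r ≤ 0`. -/
lemma exists_SF_of_mem_CBar {σ δ : ℝ} {v : ℱ} (hv : v ∈ CBar σ δ) :
    ∃ v', SF v' ∧ (∀ q ∈ rect σ δ, v q = v' q) ∧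
      ∀ r θ, v (r, θ) = 0 → v' (r, θ) = 0 := by
  obtain ⟨h1, r₀, h0, h2⟩ := hv
  refine ⟨v * scale step (1 / r₀), SF.cmul (fun N => h1.of_le (by exact_mod_cast le_top))
    (SF_scale contDiff_step (fun _ h => step_zero h.le) (by positivity)), fun q hq => ?_,
    fun r θ h => by simp [h]⟩
  rcases lt_or_ge q.1 r₀ with h | h
  · simp [h2 q hq h]
  · rw [Pi.mul_apply, scale, step_one, mul_one]
    rw [one_div, inv_mul_eq_div, le_div_iff₀ h0]
    linarith

lemma SF.mem_CBar (hf : SF f) (σ δ : ℝ) : f ∈ CBar σ δ := by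
  obtain ⟨r₀, h0, h⟩ := (hf 0).zero
  exact ⟨contDiff_infty.2 fun N => (hf N).cd, r₀, h0, fun q _ hq => h q hq⟩

lemma dr_iterate_add (s : ℕ) (hf : SF f) (hg : SF g) :
    dr^[s] (f + g) = dr^[s] f + dr^[s] g := by
  induction s generalizing f g with
  | zero => rfl
  | succ s ih => rw [iterate_succ_apply, dr_add (sf_diff hf) (sf_diff hg), ih hf.dr hg.dr]; rfl

lemma dθ_iterate_add (s : ℕ) (hf : SF f) (hg : SF g) :
    dθ^[s] (f + g) = dθ^[s] f + dθ^[s] g := by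
  induction s generalizing f g with
  | zero => rfl
  | succ s ih => rw [iterate_succ_apply, dθ_add (sf_diff hf) (sf_diff hg), ih hf.dθ hg.dθ]; rfl

lemma dr_iterate_smul (s : ℕ) (c : ℝ) : dr^[s] (c • f) = c • dr^[s] f := by
  induction s generalizing f with
  | zero => rfl
  | succ s ih => rw [iterate_succ_apply, dr_smul, ih]; rfl

lemma dθ_iterate_smul (s : ℕ) (c : ℝ) : dθ^[s] (c • f) = c • dθ^[s] f := by
  induction s generalizing f with
  | zero => rfl
  | succ s ih => rw [iterate_succ_apply, dθ_smul, ih]; rfl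

/-- The weighted derivatives entering the norm `‖·‖_{(m,1,γ)}`. -/
def cmp (m : ℕ) (lam : ℝ) (i : Fin (m + 1) × Fin 2) (f : ℱ) : ℱ :=
  if (i.1 : ℕ) + i.2 ≤ m then √(lam⁻¹) ^ (i.1 : ℕ) • rdr i.1 (dθ^[i.2] f) else 0

lemma SF_cmp {m : ℕ} {lam : ℝ} (i : Fin (m + 1) × Fin 2) (hf : SF f) :
    SF (cmp m lam i f) := by
  rw [cmp]
  split_ifs
  · exact (SF_rdr _ (hf.dθ_iterate _)).smul _
  · exact SF.zero_fun

lemma cmp_add {m : ℕ} {lam : ℝ} (i : Fin (m + 1) × Fin 2) (hf : SF f) (hg : SF g) :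
    cmp m lam i (f + g) = cmp m lam i f + cmp m lam i g := by
  rw [cmp, cmp, cmp]
  split_ifs
  · funext q
    rw [dθ_iterate_add _ hf hg]
    simp only [rdr, Pi.smul_apply, Pi.add_apply, smul_eq_mul,
      dr_iterate_add i.1 (hf.dθ_iterate i.2) (hg.dθ_iterate i.2)]
    ring
  · simp

lemma cmp_smul {m : ℕ} {lam : ℝ} (i : Fin (m + 1) × Fin 2) (c : ℝ) :
    cmp m lam i (c • f) = c • cmp m lam i f := by
  rw [cmp, cmp]
  split_ifs
  · funext q
    rw [dθ_iterate_smul]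
    simp only [rdr, Pi.smul_apply, smul_eq_mul, dr_iterate_smul]
    ring
  · simp

lemma cmp_zero {m : ℕ} {lam : ℝ} (f : ℱ) : cmp m lam (0, 0) f = f := by
  funext q
  simp [cmp, rdr]

namespace Strip
variable {S : Strip} {m : ℕ} {lam : ℝ}

lemma normSq_eq (hlam : 0 < lam) (hm : 1 ≤ m) (hf : SF f) :
    normSq S.σ S.δ lam S.γ m 1 f = ENNReal.ofReal (∑ i, S.nn (cmp m lam i f) ^ 2) := by
  have hi : ∀ i, Integrable (fun q : ℝ × ℝ => q.1 ^ (-S.γ) * (cmp m lam i f q * cmp m lam i f q)) S.μ :=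
    fun i => integrable (SF_cmp i hf 0) (SF_cmp i hf 0).cont
  have e1 : ∑ i, S.nn (cmp m lam i f) ^ 2
      = ∫ q in Ω(S), ∑ i, q.1 ^ (-S.γ) * (cmp m lam i f q * cmp m lam i f q) := by
    rw [integral_finsetSum _ fun i _ => hi i]
    exact Finset.sum_congr rfl fun i _ => S.nn_sq _
  rw [e1, ofReal_integral_eq_lintegral_ofReal (integrable_finsetSum _ fun i _ => hi i)]
  · refine setLIntegral_congr_fun (measurableSet_rect _ _) fun q hq => ?_
    congr 1
    rw [Fintype.sum_prod_type, Finset.sum_range]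
    refine Finset.sum_congr rfl fun s _ => ?_
    rw [Finset.sum_range]
    refine Finset.sum_congr rfl fun t _ => ?_
    rw [max_eq_left hm, cmp]
    split_ifs with h
    · have h1 : q.1 ^ (-S.γ + 2 * ((s : ℕ) : ℝ)) = q.1 ^ (-S.γ) * (q.1 ^ (s : ℕ)) ^ 2 := by
        rw [rpow_add hq.1.1, ← pow_mul, ← rpow_natCast]
        push_cast
        ring_nf
      have h2 : (lam⁻¹) ^ (s : ℕ) = (√(lam⁻¹) ^ (s : ℕ)) ^ 2 := by
        rw [← pow_mul, mul_comm, pow_mul, sq_sqrt (by positivity)]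
      simp only [rdr, Pi.smul_apply, smul_eq_mul]
      rw [h1, h2]
      ring
    · simp
  · filter_upwards [ae_restrict_mem (measurableSet_rect _ _)] with q hq
    exact Finset.sum_nonneg fun i _ => mul_nonneg (rpow_nonneg hq.1.1.le _) (mul_self_nonneg _)

lemma nn_cmp_le (hlam : 0 < lam) (hm : 1 ≤ m) (hf : SF f) {B : ℝ} (hB : 0 ≤ B)
    (h : normSq S.σ S.δ lam S.γ m 1 f ≤ ENNReal.ofReal (B ^ 2)) (i : Fin (m + 1) × Fin 2) :
    S.nn (cmp m lam i f) ≤ B := by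
  rw [normSq_eq hlam hm hf, ENNReal.ofReal_le_ofReal_iff (by positivity)] at h
  refine le_of_sq_le_sq (le_trans ?_ h) hB
  exact Finset.single_le_sum (f := fun i => S.nn (cmp m lam i f) ^ 2) (fun _ _ => sq_nonneg _)
    (Finset.mem_univ i)

lemma normSq_zero_eq (f : ℱ) :
    normSq S.σ S.δ lam S.γ 0 0 f = ∫⁻ q in Ω(S), ENNReal.ofReal (S.wt f q ^ 2) := by
  refine setLIntegral_congr_fun (measurableSet_rect _ _) fun q hq => ?_
  simp only [Finset.range_one, Finset.sum_singleton, zero_add]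
  rw [show S.wt f q ^ 2 = q.1 ^ (-S.γ) * (f q * f q) from by rw [sq, wt_mul_wt hq]]
  simp [sq]

lemma aesm_wt (hf : AEStronglyMeasurable f S.μ) : AEStronglyMeasurable (S.wt f) S.μ := by
  have : Measurable fun q : ℝ × ℝ => q.1 ^ (-(S.γ / 2)) := measurable_fst.pow_const _
  exact this.aestronglyMeasurable.mul hf

lemma memLp_of_normSq (hf : AEStronglyMeasurable f S.μ)
    (h : normSq S.σ S.δ lam S.γ 0 0 f ≠ ⊤) : MemLp (S.wt f) 2 S.μ := by
  rw [normSq_zero_eq] at h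
  rw [memLp_two_iff_integrable_sq (aesm_wt hf)]
  exact (lintegral_ofReal_ne_top_iff_integrable ((aesm_wt hf).pow 2)
    (Eventually.of_forall fun q => sq_nonneg _)).1 h

lemma normSq_zero_eq' (h : MemLp (S.wt f) 2 S.μ) :
    normSq S.σ S.δ lam S.γ 0 0 f = ENNReal.ofReal (‖S.emb f‖ ^ 2) := by
  rw [normSq_zero_eq, ← lintegral_sq]
  refine lintegral_congr_ae ?_
  filter_upwards [coe_emb h] with q hq
  rw [hq]

/-- An element of `H^{(m,1,γ)}` is a limit of smooth functions which are bounded in the norm of the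
space. -/
lemma exists_seq_of_memH (hlam : 0 < lam) (hm : 1 ≤ m) (hf : MemH S.σ S.δ lam S.γ m 1 f) :
    MemLp (S.wt f) 2 S.μ ∧ ∃ v : ℕ → ℱ, (∀ n, SF (v n)) ∧
      Tendsto (fun n => S.emb (v n)) atTop (𝓝 (S.emb f)) ∧
      ∃ B ≥ 0, ∀ n i, S.nn (cmp m lam i (v n)) ≤ B := by
  obtain ⟨hmeas, v, hv, hc, hl⟩ := hf
  choose v' sv' ev' _ using fun n => exists_SF_of_mem_CBar (hv n)
  have hl' : Tendsto (fun n => normSq S.σ S.δ lam S.γ 0 0 (v' n - f)) atTop (𝓝 0) := by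
    refine hl.congr fun n => normSq_congr fun q hq => ?_
    simp [ev' n q hq]
  have hc' : Tendsto (fun n : ℕ × ℕ => normSq S.σ S.δ lam S.γ m 1 (v' n.1 - v' n.2)) atTop (𝓝 0) := by
    refine hc.congr fun n => normSq_congr fun q hq => ?_
    simp [ev' _ q hq]
  have meas : ∀ n, AEStronglyMeasurable (v' n - f) S.μ := fun n =>
    ((sv' n 0).cont.aestronglyMeasurable).sub hmeas
  have hfin : ∀ᶠ n in atTop, MemLp (S.wt (v' n - f)) 2 S.μ :=
    (hl'.eventually (gt_mem_nhds (by norm_num : (0 : ENNReal) < 1))).mono fun n hn =>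
      memLp_of_normSq (meas n) (hn.trans ENNReal.one_lt_top).ne
  have hfL : MemLp (S.wt f) 2 S.μ := by
    obtain ⟨n, hn⟩ := hfin.exists
    have h1 := (memLp_wt (sv' n 0)).sub hn
    refine h1.ae_eq (Eventually.of_forall fun q => ?_)
    simp only [wt, Pi.sub_apply]
    ring
  have h1 := hc'.eventually (gt_mem_nhds (by norm_num : (0 : ENNReal) < 1))
  rw [eventually_atTop_prod_self'] at h1
  obtain ⟨N, hN⟩ := h1
  refine ⟨hfL, fun n => v' (n + N), fun n => sv' _, ?_, ?_⟩
  · rw [tendsto_iff_norm_sub_tendsto_zero]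
    have h2 : Tendsto (fun n => ‖S.emb (v' n) - S.emb f‖ ^ 2) atTop (𝓝 0) := by
      have h3 : Tendsto (fun n => (normSq S.σ S.δ lam S.γ 0 0 (v' n - f)).toReal) atTop (𝓝 0) := by
        have := (ENNReal.tendsto_toReal ENNReal.zero_ne_top).comp hl'
        simpa [comp_def] using this
      refine h3.congr' (hfin.mono fun n hn => ?_)
      rw [normSq_zero_eq' hn, ENNReal.toReal_ofReal (by positivity),
        emb_sub (memLp_wt (sv' n 0)) hfL]
    have h3 := (h2.sqrt).comp (tendsto_add_atTop_nat N)
    simpa [comp_def, sqrt_sq] using h3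
  · refine ⟨∑ i, S.nn (cmp m lam i (v' N)) + 1, ?_, fun n i => ?_⟩
    · have : 0 ≤ ∑ i, S.nn (cmp m lam i (v' N)) := Finset.sum_nonneg fun i _ => nn_nonneg _
      linarith
    · have s1 := (sv' (n + N)).sub (sv' N)
      have h2 : S.nn (cmp m lam i (v' (n + N) - v' N)) ≤ 1 :=
        nn_cmp_le hlam hm s1 zero_le_one (by
          simpa using (hN (n + N) (by simp) N le_rfl).le) i
      have e : v' (n + N) = (v' (n + N) - v' N) + v' N := by abel
      change S.nn (cmp m lam i (v' (n + N))) ≤ _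
      rw [e, cmp_add i s1 (sv' N)]
      have h3 := Finset.single_le_sum (f := fun i => S.nn (cmp m lam i (v' N)))
        (fun _ _ => nn_nonneg _) (Finset.mem_univ i)
      have h4 := nn_add_le (S := S) (SF_cmp (lam := lam) i s1 0) (SF_cmp (lam := lam) i (sv' N) 0)
      exact h4.trans (by linarith)

/-- The Hilbert space in which `H^{(m,1,γ)}` is embedded. -/
abbrev Amb (S : Strip) (m : ℕ) : Type := PiLp 2 fun _ : Fin (m + 1) × Fin 2 => Lp ℝ 2 S.μ

/-- Limits of smooth functions in the norm of `H^{(m,1,γ)}` belong to this space. -/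
lemma memH_of_tendsto (hlam : 0 < lam) (hm : 1 ≤ m) {w : ℕ → ℱ} (hw : ∀ n, SF (w n))
    {U : S.Amb m} (hU : Tendsto (fun n => (WithLp.toLp 2 fun i => S.emb (cmp m lam i (w n)) : S.Amb m))
      atTop (𝓝 U)) :
    MemH S.σ S.δ lam S.γ m 1 (fun q => q.1 ^ (S.γ / 2) * U (0, 0) q) ∧
      MemLp (S.wt fun q => q.1 ^ (S.γ / 2) * U (0, 0) q) 2 S.μ ∧
      S.emb (fun q => q.1 ^ (S.γ / 2) * U (0, 0) q) = U (0, 0) := by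
  set u : ℱ := fun q => q.1 ^ (S.γ / 2) * U (0, 0) q with hu
  have hmeas : AEStronglyMeasurable u S.μ := by
    have : Measurable fun q : ℝ × ℝ => q.1 ^ (S.γ / 2) := measurable_fst.pow_const _
    exact this.aestronglyMeasurable.mul (Lp.aestronglyMeasurable _)
  have hwt : S.wt u =ᵐ[S.μ] U (0, 0) := by
    filter_upwards [ae_restrict_mem (measurableSet_rect _ _)] with q hq
    rw [wt, hu, ← mul_assoc, ← rpow_add hq.1.1]
    simp
  have hLp : MemLp (S.wt u) 2 S.μ := (memLp_congr_ae hwt).2 (Lp.memLp _)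
  have hemb : S.emb u = U (0, 0) := by
    rw [emb_eq hLp]
    exact (MemLp.toLp_congr hLp (Lp.memLp _) hwt).trans (Lp.toLp_coeFn _ _)
  refine ⟨⟨hmeas, w, fun n => (hw n).mem_CBar _ _, ?_, ?_⟩, hLp, hemb⟩
  · have h1 : Tendsto (fun n : ℕ × ℕ => ENNReal.ofReal
        (‖(WithLp.toLp 2 fun i => S.emb (cmp m lam i (w n.1)) : S.Amb m)
          - WithLp.toLp 2 fun i => S.emb (cmp m lam i (w n.2))‖ ^ 2)) atTop (𝓝 0) := by
      have h2 := ((hU.comp tendsto_fst).sub (hU.comp tendsto_snd) : Tendsto _ (atTop ×ˢ atTop) _)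
      rw [prod_atTop_atTop_eq] at h2
      have h3 := ENNReal.tendsto_ofReal ((h2.norm).pow 2)
      simpa using h3
    refine h1.congr fun n => ?_
    have s1 := (hw n.1).sub (hw n.2)
    rw [normSq_eq hlam hm s1, PiLp.norm_sq_eq_of_L2]
    congr 1
    refine Finset.sum_congr rfl fun i _ => ?_
    rw [← norm_emb (SF_cmp i s1 0)]
    congr 2
    have e : cmp m lam i (w n.1 - w n.2) = cmp m lam i (w n.1) - cmp m lam i (w n.2) := by
      rw [sub_eq_add_neg, ← neg_one_smul ℝ (w n.2), cmp_add i (hw _) ((hw _).smul _), cmp_smul,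
        neg_one_smul, ← sub_eq_add_neg]
    rw [e, emb_sub (memLp_wt (SF_cmp i (hw _) 0)) (memLp_wt (SF_cmp i (hw _) 0))]
    rfl
  · have h1 : Tendsto (fun n => S.emb (w n)) atTop (𝓝 (U (0, 0))) := by
      have h2 := ((PiLp.continuous_apply 2 (fun _ : Fin (m + 1) × Fin 2 => Lp ℝ 2 S.μ) (0, 0)).tendsto U).comp hU
      refine h2.congr fun n => ?_
      simp [cmp_zero]
    have h2 : Tendsto (fun n => ENNReal.ofReal (‖S.emb (w n) - U (0, 0)‖ ^ 2)) atTop (𝓝 0) := by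
      have := ENNReal.tendsto_ofReal (((h1.sub_const (U (0, 0))).norm).pow 2)
      simpa using this
    refine h2.congr fun n => ?_
    have h3 : MemLp (S.wt (w n - u)) 2 S.μ := by
      refine ((memLp_wt (hw n 0)).sub hLp).ae_eq (Eventually.of_forall fun q => ?_)
      simp only [wt, Pi.sub_apply]
      ring
    rw [normSq_zero_eq' h3,
      emb_sub (memLp_wt (hw n 0)) hLp, hemb]

end Strip

/-! ### Existence of weak solutions for the degenerate operator -/

namespace DegenerateOperator

variable {E : DegenerateOperator} {w : ℱ} {lam : ℝ}

local notation "nrm" => E.S.nn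
local notation "A₁" => E.A (E.n + 1)
local notation "At₁" => E.At (E.n + 1)

lemma M_tf_succ (hw : SF w) : TF (E.n + 1) (E.M w) := by
  have h1 := X_sf (E := E) hw
  have h2 := Z_sf (E := E) hw
  exact (((X_sf (E := E) h1 _).add (Z_tf (k_tf le_rfl (h2 (E.n + 2))))).add
    (α_tf le_rfl (D_sf (E := E) hw _))).add (β_tf le_rfl (hw.dθ _))

lemma D_add (hf : Differentiable ℝ f) (hg : Differentiable ℝ g) : E.D (f + g) = E.D f + E.D g := by
  rw [D, D, D, euler_add hf hg, mul_add]

lemma D_smul (c : ℝ) : E.D (c • f) = c • E.D f := by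
  rw [D, D, euler_smul, mul_smul_comm]

lemma Xt_add (hf : Differentiable ℝ f) (hg : Differentiable ℝ g) : E.Xt (f + g) = E.Xt f + E.Xt g := by
  simp only [Xt, X, D_add hf hg, dθ_add hf hg]
  ring

lemma Zt_add (hf : Differentiable ℝ f) (hg : Differentiable ℝ g) : E.Zt (f + g) = E.Zt f + E.Zt g := by
  simp only [Zt, Z, D_add hf hg, dθ_add hf hg]
  ring

lemma Dt_add (hf : Differentiable ℝ f) (hg : Differentiable ℝ g) : E.Dt (f + g) = E.Dt f + E.Dt g := by
  simp only [Dt, D_add hf hg]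
  ring

lemma Xt_smul (c : ℝ) : E.Xt (c • f) = c • E.Xt f := by
  simp only [Xt, X, D_smul, dθ_smul, mul_smul_comm, smul_sub, smul_neg, smul_add]

lemma Zt_smul (c : ℝ) : E.Zt (c • f) = c • E.Zt f := by
  simp only [Zt, Z, D_smul, dθ_smul, mul_smul_comm, smul_sub, smul_neg, smul_add]

lemma Dt_smul (c : ℝ) : E.Dt (c • f) = c • E.Dt f := by
  simp only [Dt, D_smul, mul_smul_comm, smul_sub, smul_neg]

lemma Mt_add (hf : SF f) (hg : SF g) : E.Mt (f + g) = E.Mt f + E.Mt g := by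
  have df := sf_diff hf
  have dg := sf_diff hg
  have kZ : ∀ {f}, SF f → Differentiable ℝ (E.k * E.Zt f) := fun hf =>
    (k_tf (Nat.le_add_left 1 _) (Zt_tf (hf 2))).diff le_rfl
  have aD : ∀ {f}, SF f → Differentiable ℝ (E.α * f) := fun hf =>
    (α_tf (Nat.le_add_left 1 _) (hf 1)).diff le_rfl
  have bD : ∀ {f}, SF f → Differentiable ℝ (E.β * f) := fun hf =>
    (β_tf (Nat.le_add_left 1 _) (hf 1)).diff le_rfl
  simp only [Mt]
  rw [Xt_add df dg, Xt_add (sf_diff (SF.Xt hf)) (sf_diff (SF.Xt hg)), Zt_add df dg,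
    mul_add E.k, mul_add E.α, mul_add E.β, Zt_add (kZ hf) (kZ hg), Dt_add (aD hf) (aD hg),
    dθ_add (bD hf) (bD hg)]
  ring

lemma Mt_smul (c : ℝ) : E.Mt (c • f) = c • E.Mt f := by
  simp only [Mt, Xt_smul, Zt_smul, Dt_smul, dθ_smul, mul_smul_comm, smul_sub, smul_add]

/-- Integration by parts of the full operator `A^m` and `M`. -/
lemma ip_A_M (hw : SF w) (bw : Bdry E w) (hc : Cls E (E.n + 1) (A₁ w)) :
    E.S.ip (A₁ (E.M w)) (A₁ w)
      = E.S.ip w (E.Mt (At₁ (A₁ w))) := by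
  rw [ip_A (M_tf_succ hw) hc, ip_M hw (At_sf _ hc.sf) bw hc.At_bdry]

variable (E lam) in
lemma exists_nn_cmp_le : ∃ C ≥ 0, ∀ w, SF w → nrm (A₁ w) ≤ nrm (E.X (A₁ w)) →
    ∀ i, nrm (cmp (E.n + 1) lam i w) ≤ C * nrm (E.X (A₁ w)) := by
  have hK := E.three_le_K
  suffices H : ∀ i, ∃ C ≥ 0, ∀ w, SF w →
      nrm (A₁ w) ≤ nrm (E.X (A₁ w)) →
      nrm (cmp (E.n + 1) lam i w) ≤ C * nrm (E.X (A₁ w)) by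
    choose C hC0 hC using H
    refine ⟨∑ i, C i, Finset.sum_nonneg fun i _ => hC0 i, fun w hw hN i => (hC i w hw hN).trans ?_⟩
    exact mul_le_mul_of_nonneg_right (Finset.single_le_sum (fun j _ => hC0 j) (Finset.mem_univ i))
      (nn_nonneg _)
  rintro ⟨s, t⟩
  by_cases h : (s : ℕ) + t ≤ E.n + 1
  swap
  · refine ⟨0, le_rfl, fun w _ _ => ?_⟩
    rw [cmp, if_neg h, nn_zero, zero_mul]
  obtain ⟨C, hC0, hC⟩ := exists_nn_A_rdr_le E s 0
  refine ⟨√(lam⁻¹) ^ (s : ℕ) * (C * (6 * E.K)), by positivity, fun w hw hN => ?_⟩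
  rw [cmp, if_pos h, nn_smul, abs_of_nonneg (by positivity), mul_assoc]
  refine mul_le_mul_of_nonneg_left ?_ (by positivity)
  refine (hC _ (hw.dθ_iterate t)).trans ?_
  rw [mul_assoc, zero_add]
  refine mul_le_mul_of_nonneg_left ?_ hC0
  have hX := E.S.nn_nonneg (E.X (A₁ w))
  rcases Nat.lt_or_ge 0 (t : ℕ) with h0 | h0
  · have ht : (t : ℕ) = 1 := by omega
    rw [ht] at h ⊢
    exact (nn_A_mono (by omega) hw.dθ).trans (nn_Adθ_le hw hN)
  · have ht : (t : ℕ) = 0 := by omega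
    rw [ht] at h ⊢
    refine ((nn_A_mono (by omega) hw).trans hN).trans ?_
    nlinarith

variable (E) in
/-- The norm of `A^m w` is controlled by the components of the norm of `H^{(m,1,γ)}`. -/
lemma exists_nn_A_le_of_cmp (hlam : 0 < lam) : ∃ C ≥ 0, ∀ w, SF w → ∀ B,
    (∀ i, nrm (cmp (E.n + 1) lam i w) ≤ B) → nrm (A₁ w) ≤ C * B := by
  obtain ⟨C, hC, H⟩ := exists_nn_A_le E (E.n + 1) 0
  refine ⟨C * ∑ t ∈ Finset.range (0 + (E.n + 1) + 1), (√(lam⁻¹) ^ t)⁻¹, by positivity,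
    fun w sw B hB => ?_⟩
  have h2 := H _ sw
  have e : rdr 0 w = w := by funext q; simp [rdr]
  rw [e] at h2
  rw [mul_assoc, Finset.sum_mul]
  refine h2.trans (mul_le_mul_of_nonneg_left (Finset.sum_le_sum fun t ht => ?_) hC)
  have hp : 0 < √(lam⁻¹) ^ t := by positivity
  have h1 := hB (⟨t, by simpa using ht⟩, 0)
  rw [cmp, if_pos (by simp at ht ⊢; omega), nn_smul, abs_of_pos (by positivity)] at h1
  rw [inv_mul_eq_div, le_div_iff₀ hp, mul_comm]
  exact h1

lemma exists_inner_emb_le (hlam : 0 < lam) (ha : ∀ N : ℕ, ContDiff ℝ N a)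
    (hf : MemH E.S.σ E.S.δ lam E.S.γ (E.n + 1) 1 f) :
    ∃ C ≥ 0, ∀ G, Cls E (E.n + 1) G →
      |inner ℝ (E.S.emb f) (E.S.emb (a * At₁ G))| ≤ C * nrm G := by
  obtain ⟨-, v, sv, hv, B, hB, hvB⟩ := exists_seq_of_memH hlam (by omega) hf
  obtain ⟨C₁, hC₁, H₁⟩ := exists_nn_A_cmul_le E (E.n + 1) (ha _)
  obtain ⟨C₂, hC₂, H₂⟩ := exists_nn_A_le_of_cmp E hlam
  refine ⟨C₁ * (C₂ * B), by positivity, fun G hG => ?_⟩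
  have sG := At_sf (E := E) (E.n + 1) hG.sf
  have h1 := ((hv.inner (tendsto_const_nhds (x := E.S.emb (a * At₁ G)))).abs :
    Tendsto (fun l => |inner ℝ (E.S.emb (v l)) (E.S.emb (a * At₁ G))|) _ _)
  refine le_of_tendsto h1 (Eventually.of_forall fun l => ?_)
  have sa : SF (a * v l) := (sv l).cmul ha
  rw [inner_emb (sv l 0) (sG.cmul ha 0), ← ip_mul_left, ← ip_A (sa _) hG]
  refine (abs_ip_le (A_sf _ sa 0) (hG.sf 0)).trans
    (mul_le_mul_of_nonneg_right ?_ (nn_nonneg _))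
  exact (H₁ _ (sv l)).trans (mul_le_mul_of_nonneg_left (H₂ _ (sv l) B (hvB l)) hC₁)

variable (E) in
/-- Smooth functions vanishing for `θ = 0, δ`. -/
def bdrySubmodule : Submodule ℝ (ℱ) where
  carrier := {w | SF w ∧ Bdry E w}
  add_mem' := fun h h' => ⟨h.1.add h'.1, h.2.add h'.2⟩
  zero_mem' := ⟨SF.zero_fun, fun _ _ => ⟨rfl, rfl⟩⟩
  smul_mem' := fun c _ h => ⟨h.1.smul c, h.2.smul c⟩

variable (E) in
/-- The test functions `w` for which `A^m w` vanishes to order `m` for `r = σ`. -/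
def testSubmodule : Submodule ℝ (ℱ) where
  carrier := {w | (SF w ∧ Bdry E w) ∧ Cls E (E.n + 1) (A₁ w)}
  add_mem' := fun h h' => ⟨(bdrySubmodule E).add_mem h.1 h'.1, by
    rw [A_add _ h.1.1 h'.1.1]
    exact h.2.add h'.2⟩
  zero_mem' := ⟨(bdrySubmodule E).zero_mem, by
    have h0 : A₁ 0 = 0 := by
      have := A_smul (E := E) (E.n + 1) 0 0
      simpa using this
    rw [h0]
    exact Cls.of_vanish SF.zero_fun (fun _ _ => ⟨rfl, rfl⟩) fun _ _ => rfl⟩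
  smul_mem' := fun c w h => ⟨(bdrySubmodule E).smul_mem c h.1, by
    rw [A_smul]
    exact h.2.smul c⟩

variable (E lam) in
/-- The embedding of smooth functions by their weighted derivatives. -/
def embDeriv : bdrySubmodule E →ₗ[ℝ] E.S.Amb (E.n + 1) where
  toFun w := WithLp.toLp 2 fun i => E.S.emb (cmp (E.n + 1) lam i w)
  map_add' w w' := by
    ext1 i
    have h1 := w.2.1
    have h2 := w'.2.1
    simp only [Submodule.coe_add, PiLp.add_apply]
    rw [cmp_add i h1 h2, emb_add (memLp_wt (SF_cmp i h1 0)) (memLp_wt (SF_cmp i h2 0))]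
  map_smul' c w := by
    ext1 i
    have h1 := w.2.1
    simp only [Submodule.coe_smul, PiLp.smul_apply, RingHom.id_apply]
    rw [cmp_smul, emb_smul c (memLp_wt (SF_cmp i h1 0))]

variable (E) in
/-- The operator `w ↦ Mᵗ (A^m)ᵗ A^m w`. -/
def normalOp (w : ℱ) : ℱ := E.Mt (At₁ (A₁ w))

/-- Solvability of the degenerate equation: there is a weak solution of `M u = a f` in
`H^{(m,1,γ)}`. -/
theorem exists_weak (hδ : E.S.δ * E.K ^ 4 ≤ 1 / 4000) (hγ : 0 < E.S.γ) (hlam : 0 < lam)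
    (ha : ∀ N : ℕ, ContDiff ℝ N a)
    (hf : MemH E.S.σ E.S.δ lam E.S.γ (E.n + 1) 1 f) :
    ∃ u, MemH E.S.σ E.S.δ lam E.S.γ (E.n + 1) 1 u ∧ ∀ h, SF h → Bdry E h →
      ∫ q in Ω(E.S), q.1 ^ (-E.S.γ) * (u q * E.Mt h q)
        = ∫ q in Ω(E.S), q.1 ^ (-E.S.γ) * (f q * (a q * h q)) := by
  obtain ⟨hfL, -⟩ := exists_seq_of_memH hlam (by omega) hf
  obtain ⟨C₁, hC₁, H₁⟩ := exists_nn_cmp_le E lam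
  obtain ⟨C₂, hC₂, H₂⟩ := exists_inner_emb_le hlam ha hf
  let T := testSubmodule E
  let ι : T →ₗ[ℝ] bdrySubmodule E := Submodule.inclusion fun w h => h.1
  let J : T →ₗ[ℝ] E.S.Amb (E.n + 1) := embDeriv E lam ∘ₗ ι
  let Kc : Submodule ℝ (E.S.Amb (E.n + 1)) := (LinearMap.range (embDeriv E lam)).topologicalClosure
  have hKc : IsClosed (Kc : Set (E.S.Amb (E.n + 1))) := Submodule.isClosed_topologicalClosure _
  have : CompleteSpace Kc := hKc.completeSpace_coe
  have sA : ∀ w : T, SF (At₁ (A₁ w)) := fun w => At_sf _ w.2.2.sf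
  have mM : ∀ w : T, MemLp (E.S.wt (E.normalOp w)) 2 E.S.μ := fun w => memLp_wt (Mt_tf (sA w))
  have sa : ∀ w : T, SF (a * At₁ (A₁ w)) := fun w => (sA w).cmul ha
  have Aadd : ∀ w w' : T, At₁ (A₁ (w + w' : T))
      = At₁ (A₁ w) + At₁ (A₁ w') := fun w w' => by
    rw [Submodule.coe_add, A_add _ w.2.1.1 w'.2.1.1, At_add _ w.2.2.sf w'.2.2.sf]
  have Asmul : ∀ (c : ℝ) (w : T), At₁ (A₁ (c • w : T))
      = c • At₁ (A₁ w) := fun c w => by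
    rw [Submodule.coe_smul, A_smul, At_smul]
  let s₀ : T →ₗ[ℝ] Lp ℝ 2 E.S.μ :=
    { toFun := fun w => E.S.emb (E.normalOp w)
      map_add' := fun w w' => by
        rw [← emb_add (mM w) (mM w')]
        simp only [normalOp]
        rw [Aadd, Mt_add (sA w) (sA w')]
      map_smul' := fun c w => by
        rw [RingHom.id_apply, ← emb_smul c (mM w)]
        simp only [normalOp]
        rw [Asmul, Mt_smul] }
  let F₀ : T →ₗ[ℝ] ℝ :=
    { toFun := fun w => inner ℝ (E.S.emb f) (E.S.emb (a * At₁ (A₁ w)))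
      map_add' := fun w w' => by
        rw [Aadd, mul_add, emb_add (memLp_wt (sa w 0)) (memLp_wt (sa w' 0)), inner_add_right]
      map_smul' := fun c w => by
        rw [Asmul, mul_smul_comm, emb_smul c (memLp_wt (sa w 0)), inner_smul_right]
        rfl }
  let s : T →ₗ[ℝ] E.S.Amb (E.n + 1) :=
    { toFun := fun w => WithLp.toLp 2 (Pi.single (0, 0) (-s₀ w))
      map_add' := fun w w' => by rw [map_add, neg_add, Pi.single_add, WithLp.toLp_add]
      map_smul' := fun c w => by rw [map_smul, ← smul_neg, Pi.single_smul, WithLp.toLp_smul]; rfl }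
  have inn : ∀ (U : E.S.Amb (E.n + 1)) w, inner ℝ U (s w) = -inner ℝ (U (0, 0)) (s₀ w) := fun U w => by
    rw [PiLp.inner_apply, Finset.sum_eq_single (0, 0)]
    · change inner ℝ (U (0, 0)) ((Pi.single (0, 0) (-s₀ w) : Fin (E.n + 1 + 1) × Fin 2 → Lp ℝ 2 E.S.μ) (0, 0)) = _
      rw [Pi.single_eq_same, inner_neg_right]
    · intro i _ hi
      change inner ℝ (U i) ((Pi.single (0, 0) (-s₀ w) : Fin (E.n + 1 + 1) × Fin 2 → Lp ℝ 2 E.S.μ) i) = _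
      rw [Pi.single_eq_of_ne hi, inner_zero_right]
    · simp
  have J0 : ∀ w : T, J w (0, 0) = E.S.emb w := fun w => by
    change E.S.emb (cmp (E.n + 1) lam (0, 0) w) = _
    rw [cmp_zero]
  have Jle : ∀ w : T, ‖J w‖ ^ 2 ≤ (2 * (E.n + 1 + 1)) * C₁ ^ 2 * nrm (E.X (A₁ w)) ^ 2 := fun w => by
    have h2 := (energy hδ w.2.1.1 w.2.1.2).2
    rw [PiLp.norm_sq_eq_of_L2]
    have h3 : ∀ i, ‖J w i‖ ^ 2 ≤ C₁ ^ 2 * nrm (E.X (A₁ w)) ^ 2 := fun i => by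
      change ‖E.S.emb (cmp (E.n + 1) lam i w)‖ ^ 2 ≤ _
      rw [norm_emb (SF_cmp i w.2.1.1 0), ← mul_pow]
      exact pow_le_pow_left₀ (nn_nonneg _) (H₁ w w.2.1.1 h2 i) 2
    refine (Finset.sum_le_sum fun i _ => h3 i).trans (le_of_eq ?_)
    simp
    ring
  have coer : ∀ w : T, (4 * (E.n + 1 + 1) * (C₁ ^ 2 + 1))⁻¹ * ‖J w‖ ^ 2 ≤ inner ℝ (s w) (J w) := fun w => by
    rw [real_inner_comm, inn, J0]
    change _ ≤ -inner ℝ (E.S.emb w) (E.S.emb (E.normalOp w))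
    rw [normalOp, inner_emb (w.2.1.1 0) (Mt_tf (sA w)), ← ip_A_M w.2.1.1 w.2.1.2 w.2.2]
    refine le_trans ?_ (energy hδ w.2.1.1 w.2.1.2).1
    rw [inv_mul_le_iff₀ (by positivity)]
    refine (Jle w).trans ?_
    have : 0 ≤ nrm (E.X (A₁ w)) ^ 2 := sq_nonneg _
    have h5 : (0 : ℝ) ≤ (E.n + 1 + 1) * nrm (E.X (A₁ w)) ^ 2 := by positivity
    nlinarith
  obtain ⟨C₃, hC₃, H₃⟩ := exists_nn_A_le_of_cmp E hlam
  have hlow : ∀ w : T, nrm (A₁ w) ≤ C₃ * ‖J w‖ := fun w => H₃ _ w.2.1.1 _ fun i => by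
    rw [← norm_emb (SF_cmp i w.2.1.1 0)]
    exact PiLp.norm_apply_le (J w) i
  obtain ⟨U, hU, HU⟩ := exists_inner_eq Kc J s (-F₀)
    (C := C₂ * C₃)
    (fun w => Submodule.le_topologicalClosure _ (LinearMap.mem_range_self _ _))
    (by positivity) (by positivity) coer fun w => by
      rw [LinearMap.neg_apply, abs_neg]
      rw [mul_assoc]
      exact (H₂ _ w.2.2).trans (mul_le_mul_of_nonneg_left (hlow w) hC₂)
  obtain ⟨x, hx, hxU⟩ := mem_closure_iff_seq_limit.1
    (show U ∈ closure (LinearMap.range (embDeriv E lam) : Set (E.S.Amb (E.n + 1))) from hU)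
  choose w hw using hx
  obtain ⟨hm, uL, hu⟩ := memH_of_tendsto (w := fun n => (w n : ℱ)) hlam (by omega)
    (fun n => (w n).2.1) (hxU.congr fun n => (hw n).symm)
  refine ⟨_, hm, fun h sh bh => ?_⟩
  set u : ℱ := fun q => q.1 ^ (E.S.γ / 2) * U (0, 0) q
  let ℓ : (ℱ) → ℝ := fun h =>
    inner ℝ (E.S.emb u) (E.S.emb (E.Mt h)) - inner ℝ (E.S.emb f) (E.S.emb (a * h))
  have hℓ : ℓ h = 0 := by
    obtain ⟨C₄, hC₄⟩ := (isCompact_Icc.prod isCompact_Icc).exists_bound_of_continuousOn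
      (s := Icc 0 E.S.σ ×ˢ Icc 0 E.S.δ) (ha 0).continuous.continuousOn
    have eM : ∀ {h}, SF h → MemLp (E.S.wt (E.Mt h)) 2 E.S.μ := fun sh => memLp_wt (Mt_tf sh)
    have ea : ∀ {h}, SF h → MemLp (E.S.wt (a * h)) 2 E.S.μ := fun sh =>
      memLp_wt (sh.cmul ha 0)
    refine eq_zero_of_cls (C := ‖E.S.emb u‖ + ‖E.S.emb f‖ * max C₄ 0) hγ (fun h g sh sg => ?_)
      (fun c h sh => ?_) (by positivity) (fun h sh bh => ?_) (E.n + 1) (fun G hG => ?_) sh bh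
    · simp only [ℓ]
      rw [Mt_add sh sg, emb_add (eM sh) (eM sg), mul_add, emb_add (ea sh) (ea sg),
        inner_add_right, inner_add_right]
      ring
    · simp only [ℓ]
      rw [Mt_smul, emb_smul c (eM sh), mul_smul_comm, emb_smul c (ea sh),
        inner_smul_right, inner_smul_right]
      ring
    · have h1 := abs_real_inner_le_norm (E.S.emb u) (E.S.emb (E.Mt h))
      have h2 := abs_real_inner_le_norm (E.S.emb f) (E.S.emb (a * h))
      rw [norm_emb (Mt_tf sh)] at h1
      rw [norm_emb (sh.cmul ha 0)] at h2
      have h3 : nrm (a * h) ≤ max C₄ 0 * nrm h :=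
        nn_cmul_le (ha 0).continuous (sh 0) (le_max_right _ _) fun q hq =>
          (hC₄ q (rect_subset _ _ hq)).trans (le_max_left _ _)
      have h4 := mul_le_mul_of_nonneg_left h3 (norm_nonneg (E.S.emb f))
      have n1 := E.S.nn_nonneg h
      have n2 := E.S.nn_nonneg (E.Mt h)
      have n3 : 0 ≤ ‖E.S.emb f‖ * max C₄ 0 := by positivity
      have n4 := norm_nonneg (E.S.emb u)
      refine (abs_sub _ _).trans ?_
      nlinarith
    · obtain ⟨w, sw, bw, ew⟩ := exists_A_eq (E.n + 1) hG.sf hG.bdry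
      have h1 := HU ⟨w, ⟨sw, bw⟩, by rw [ew]; exact hG⟩
      rw [inn, ← hu] at h1
      have h2 : inner ℝ (E.S.emb u) (E.S.emb (E.Mt (At₁ (A₁ w))))
          = inner ℝ (E.S.emb f) (E.S.emb (a * At₁ (A₁ w))) := neg_injective h1
      rw [ew] at h2
      exact sub_eq_zero.2 h2
  have h1 := sub_eq_zero.1 hℓ
  rw [inner_emb_eq uL (memLp_wt (Mt_tf sh)),
    inner_emb_eq hfL (memLp_wt (sh.cmul ha 0))] at h1
  exact h1

end DegenerateOperator

/-! ### The adjoint of the cut-off operator in polar coordinates -/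

section Unweighted

variable {ρ τ k V α β : ℱ}

lemma mul_dr_eq (ha : Differentiable ℝ a) (hG : Differentiable ℝ G) :
    a * dr G = dr (a * G) - dr a * G := by
  rw [dr_mul ha hG]
  ring

lemma mul_dθ_eq (ha : Differentiable ℝ a) (hG : Differentiable ℝ G) :
    a * dθ G = dθ (a * G) - dθ a * G := by
  rw [dθ_mul ha hG]
  ring

lemma dθ_neg (f : ℱ) : dθ (-f) = -dθ f := by
  rw [← neg_one_smul ℝ f, dθ_smul, neg_one_smul]

lemma differentiable_add (hf : Differentiable ℝ f) (hg : Differentiable ℝ g) :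
    Differentiable ℝ (f + g) := hf.add hg

lemma differentiable_sub (hf : Differentiable ℝ f) (hg : Differentiable ℝ g) :
    Differentiable ℝ (f - g) := hf.sub hg

lemma contDiff_mul {n : ℕ} (hf : ContDiff ℝ n f) (hg : ContDiff ℝ n g) :
    ContDiff ℝ n (f * g) := hf.mul hg

/-- The formal adjoint of `(ρ ∂_r τ + ∂_θ)² + (ρ ∂_r - τ ∂_θ) k (ρ ∂_r - τ ∂_θ) + α ρ ∂_r + β ∂_θ` in
non-divergence form. -/
lemma adjoint_expand (hρ : ContDiff ℝ (2 : ℕ) ρ) (hτ : ContDiff ℝ (2 : ℕ) τ)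
    (hk : ContDiff ℝ (2 : ℕ) k) (hV : ContDiff ℝ (2 : ℕ) V) (hα : ContDiff ℝ (1 : ℕ) α)
    (hβ : ContDiff ℝ (1 : ℕ) β) {Xs Zs : (ℱ) → ℱ}
    (hX : ∀ F, Xs F = -dr (ρ * τ * F) - dθ F) (hZ : ∀ F, Zs F = -dr (ρ * F) + dθ (τ * F)) :
    Xs (Xs V) + Zs (k * Zs V) - dr (ρ * (α * V)) - dθ (β * V)
      = dr (dr (ρ * ρ * (k + τ * τ) * V)) + dr (dθ ((2 : ℝ) • (ρ * τ * (1 - k) * V)))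
        + dθ (dθ ((1 + k * (τ * τ)) * V))
        - dr ((ρ * τ * dr (ρ * τ) + dθ (ρ * τ) + ρ * dr (ρ * k) - τ * dθ (ρ * k) + ρ * α) * V)
        - dθ ((τ * dθ (τ * k) - ρ * dr (τ * k) + β) * V) := by
  have d2 : ∀ {F : ℱ}, ContDiff ℝ (2 : ℕ) F → Differentiable ℝ F := fun h =>
    h.diff (by norm_num)
  have dd : ∀ {F : ℱ}, ContDiff ℝ (1 : ℕ) F → Differentiable ℝ F := fun h =>
    h.diff le_rfl
  have lo : ∀ {F : ℱ}, ContDiff ℝ (2 : ℕ) F → ContDiff ℝ (1 : ℕ) F := fun h =>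
    h.of_le (by norm_num)
  have r1 : ∀ {F : ℱ}, ContDiff ℝ (2 : ℕ) F → ContDiff ℝ (1 : ℕ) (dr F) := fun h => contDiff_dr h
  have t1 : ∀ {F : ℱ}, ContDiff ℝ (2 : ℕ) F → ContDiff ℝ (1 : ℕ) (dθ F) := fun h => contDiff_dθ h
  set p := ρ * τ with hp
  have cp : ContDiff ℝ (2 : ℕ) p := hρ.mul hτ
  have a1 : ContDiff ℝ (2 : ℕ) (p * V) := cp.mul hV
  have a2 : ContDiff ℝ (2 : ℕ) (ρ * V) := hρ.mul hV
  have a3 : ContDiff ℝ (2 : ℕ) (τ * V) := hτ.mul hV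
  have b1 : ContDiff ℝ (2 : ℕ) (ρ * k) := hρ.mul hk
  have b2 : ContDiff ℝ (2 : ℕ) (τ * k) := hτ.mul hk
  have eX : Xs (Xs V) = dr (dr (p * (p * V))) + (2 : ℝ) • dr (dθ (p * V)) + dθ (dθ V)
      - dr (dr p * (p * V)) - dr (dθ p * V) := by
    rw [hX, hX]
    have e1 : p * (-dr (p * V) - dθ V)
        = (dr p * (p * V) - dr (p * (p * V))) + (dθ p * V - dθ (p * V)) := by
      rw [mul_sub, mul_neg, mul_dr_eq (d2 cp) (d2 a1), mul_dθ_eq (d2 cp) (d2 hV)]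
      ring
    have c1 := contDiff_mul (r1 cp) (lo a1)
    have c2 := r1 (contDiff_mul cp a1)
    have c3 := contDiff_mul (t1 cp) (lo hV)
    have c4 := t1 a1
    rw [e1, dr_add (differentiable_sub (dd c1) (dd c2)) (differentiable_sub (dd c3) (dd c4)), dr_sub (dd c1) (dd c2), dr_sub (dd c3) (dd c4),
      dθ_sub (show Differentiable ℝ (-dr (p * V)) from (dd (r1 a1)).neg) (dd (t1 hV)), dθ_neg, ← dr_dθ_comm a1, two_smul]
    ring
  have eZ : Zs (k * Zs V) = dr (dr (ρ * k * (ρ * V))) - (2 : ℝ) • dr (dθ (ρ * k * (τ * V)))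
      + dθ (dθ (τ * k * (τ * V))) - dr (dr (ρ * k) * (ρ * V)) + dr (dθ (ρ * k) * (τ * V))
      + dθ (dr (τ * k) * (ρ * V)) - dθ (dθ (τ * k) * (τ * V)) := by
    rw [hZ, hZ]
    have e1 : ρ * (k * (-dr (ρ * V) + dθ (τ * V))) = (dr (ρ * k) * (ρ * V) - dr (ρ * k * (ρ * V)))
        + (dθ (ρ * k * (τ * V)) - dθ (ρ * k) * (τ * V)) := by
      rw [← mul_assoc, mul_add, mul_neg, mul_dr_eq (d2 b1) (d2 a2), mul_dθ_eq (d2 b1) (d2 a3)]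
      ring
    have e2 : τ * (k * (-dr (ρ * V) + dθ (τ * V))) = (dr (τ * k) * (ρ * V) - dr (τ * k * (ρ * V)))
        + (dθ (τ * k * (τ * V)) - dθ (τ * k) * (τ * V)) := by
      rw [← mul_assoc, mul_add, mul_neg, mul_dr_eq (d2 b2) (d2 a2), mul_dθ_eq (d2 b2) (d2 a3)]
      ring
    have c1 := contDiff_mul (r1 b1) (lo a2)
    have c2 := r1 (contDiff_mul b1 a2)
    have c3 := t1 (contDiff_mul b1 a3)
    have c4 := contDiff_mul (t1 b1) (lo a3)
    have f1 := contDiff_mul (r1 b2) (lo a2)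
    have f2 := r1 (contDiff_mul b2 a2)
    have f3 := t1 (contDiff_mul b2 a3)
    have f4 := contDiff_mul (t1 b2) (lo a3)
    have e3 : τ * k * (ρ * V) = ρ * k * (τ * V) := by ring
    rw [e1, e2, dr_add (differentiable_sub (dd c1) (dd c2)) (differentiable_sub (dd c3) (dd c4)), dr_sub (dd c1) (dd c2),
      dr_sub (dd c3) (dd c4), dθ_add (differentiable_sub (dd f1) (dd f2)) (differentiable_sub (dd f3) (dd f4)), dθ_sub (dd f1) (dd f2),
      dθ_sub (dd f3) (dd f4), e3, ← dr_dθ_comm (contDiff_mul b1 a3), two_smul]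
    ring
  have g1 : dr (dr (ρ * ρ * (k + τ * τ) * V)) = dr (dr (p * (p * V))) + dr (dr (ρ * k * (ρ * V))) := by
    rw [← dr_add (dd (r1 (contDiff_mul cp a1))) (dd (r1 (contDiff_mul b1 a2))), ← dr_add (d2 (contDiff_mul cp a1)) (d2 (contDiff_mul b1 a2))]
    congr 2
    rw [hp]
    ring
  have g2 : dr (dθ ((2 : ℝ) • (p * (1 - k) * V)))
      = (2 : ℝ) • dr (dθ (p * V)) - (2 : ℝ) • dr (dθ (ρ * k * (τ * V))) := by
    rw [dθ_smul, dr_smul, ← smul_sub, ← dr_sub (dd (t1 a1)) (dd (t1 (contDiff_mul b1 a3))),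
      ← dθ_sub (d2 a1) (d2 (contDiff_mul b1 a3))]
    congr 3
    rw [hp]
    ring
  have g3 : dθ (dθ ((1 + k * (τ * τ)) * V)) = dθ (dθ V) + dθ (dθ (τ * k * (τ * V))) := by
    rw [← dθ_add (dd (t1 hV)) (dd (t1 (contDiff_mul b2 a3))), ← dθ_add (d2 hV) (d2 (contDiff_mul b2 a3))]
    congr 2
    ring
  have g4 : dr ((p * dr p + dθ p + ρ * dr (ρ * k) - τ * dθ (ρ * k) + ρ * α) * V)
      = dr (dr p * (p * V)) + dr (dθ p * V) + dr (dr (ρ * k) * (ρ * V)) - dr (dθ (ρ * k) * (τ * V))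
        + dr (ρ * (α * V)) := by
    have c1 := contDiff_mul (r1 cp) (lo a1)
    have c2 := contDiff_mul (t1 cp) (lo hV)
    have c3 := contDiff_mul (r1 b1) (lo a2)
    have c4 := contDiff_mul (t1 b1) (lo a3)
    have c5 := contDiff_mul (lo hρ) (contDiff_mul hα (lo hV))
    rw [← dr_add (dd c1) (dd c2), ← dr_add (differentiable_add (dd c1) (dd c2)) (dd c3),
      ← dr_sub (differentiable_add (differentiable_add (dd c1) (dd c2)) (dd c3)) (dd c4), ← dr_add (differentiable_sub (differentiable_add (differentiable_add (dd c1) (dd c2)) (dd c3)) (dd c4)) (dd c5)]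
    congr 1
    ring
  have g5 : dθ ((τ * dθ (τ * k) - ρ * dr (τ * k) + β) * V)
      = dθ (dθ (τ * k) * (τ * V)) - dθ (dr (τ * k) * (ρ * V)) + dθ (β * V) := by
    have c1 := contDiff_mul (t1 b2) (lo a3)
    have c2 := contDiff_mul (r1 b2) (lo a2)
    have c3 := contDiff_mul hβ (lo hV)
    rw [← dθ_sub (dd c1) (dd c2), ← dθ_add (differentiable_sub (dd c1) (dd c2)) (dd c3)]
    congr 1
    ring
  rw [eX, eZ, g1, g2, g3, g4, g5]
  ring

end Unweighted

namespace DegenerateOperator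

variable {E : DegenerateOperator} {f g V : ℱ}

variable (E) in
/-- The weight `r ^ γ`. -/
def rγ : ℱ := fun q => q.1 ^ E.S.γ

variable (E) in
/-- The coefficient `r φ` of `∂_r` in `D`. -/
def ρ : ℱ := Prod.fst * E.φ

lemma cρ (N : ℕ) : ContDiff ℝ N E.ρ := contDiff_fst.mul (cφ N)

lemma dθ_rγ_mul (f : ℱ) : dθ (E.rγ * f) = E.rγ * dθ f := by
  funext q
  simp only [dθ, rγ, Pi.mul_apply]
  exact deriv_const_mul_field _

lemma euler_rγ_mul (hf : TF 1 f) : euler (E.rγ * f) = E.rγ * (E.S.γ • f + euler f) := by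
  funext q
  rcases lt_or_ge 0 q.1 with hq | hq
  · rw [show E.rγ = fun q => q.1 ^ E.S.γ from rfl, euler_rpow_mul _ hq (hf.diff le_rfl q)]
    simp only [Pi.mul_apply, Pi.add_apply, Pi.smul_apply, smul_eq_mul]
    ring
  · obtain ⟨r₀, h0, h⟩ := (hf.rpow_mul E.S.γ).euler.zero
    obtain ⟨r₁, h1, h'⟩ := hf.euler.zero
    obtain ⟨r₂, h2, h''⟩ := hf.zero
    rw [show E.rγ = fun q => q.1 ^ E.S.γ from rfl, h q (hq.trans_lt h0)]
    simp [h' q (hq.trans_lt h1), h'' q (hq.trans_lt h2)]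

lemma dr_ρ_mul (hf : TF 1 f) : dr (E.ρ * f) = E.φ * f + euler E.φ * f + E.φ * euler f := by
  have h1 : Differentiable ℝ E.φ := (cφ 1).diff le_rfl
  have h3 : dr (Prod.fst : ℱ) = 1 := by
    funext q
    simp [dr]
  rw [ρ, dr_mul (differentiable_fst.mul h1) (hf.diff le_rfl), dr_mul differentiable_fst h1, h3]
  funext q
  simp only [euler, Pi.mul_apply, Pi.add_apply, Pi.one_apply]
  ring

lemma dr_ρτ_mul (hf : TF 1 f) : dr (E.ρ * E.τ * f) = E.τ * dr (E.ρ * f) := by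
  rw [mul_assoc, dr_ρ_mul (TF.cmul (cτ 1) hf), dr_ρ_mul hf, show E.τ = fun q => E.τ₀ q.2 from rfl, euler_mul_angle]
  ring

lemma Xt_rγ (hf : TF 1 f) : E.Xt (E.rγ * f) = E.rγ * (-dr (E.ρ * E.τ * f) - dθ f) := by
  rw [Xt, X, D, euler_rγ_mul hf, dθ_rγ_mul, dr_ρτ_mul hf, dr_ρ_mul hf, dv]
  funext q
  simp only [Pi.mul_apply, Pi.add_apply, Pi.sub_apply, Pi.neg_apply, Pi.smul_apply, smul_eq_mul]
  ring

lemma Zt_rγ (hf : TF 1 f) : E.Zt (E.rγ * f) = E.rγ * (-dr (E.ρ * f) + dθ (E.τ * f)) := by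
  rw [Zt, Z, D, euler_rγ_mul hf, dθ_rγ_mul, dr_ρ_mul hf, dv,
    dθ_mul ((cτ 1).diff le_rfl) (hf.diff le_rfl), dθ_τ]
  funext q
  simp only [Pi.mul_apply, Pi.add_apply, Pi.sub_apply, Pi.neg_apply, Pi.smul_apply, smul_eq_mul]
  ring

lemma Dt_rγ (hf : TF 1 f) : E.Dt (E.rγ * f) = E.rγ * -dr (E.ρ * f) := by
  rw [Dt, D, euler_rγ_mul hf, dr_ρ_mul hf, dv]
  funext q
  simp only [Pi.mul_apply, Pi.add_apply, Pi.sub_apply, Pi.neg_apply, Pi.smul_apply, smul_eq_mul]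
  ring

lemma Mt_rγ (hV : SF V) :
    E.Mt (E.rγ * V) = E.rγ *
      (dr (dr (E.ρ * E.ρ * (E.k + E.τ * E.τ) * V)) + dr (dθ ((2 : ℝ) • (E.ρ * E.τ * (1 - E.k) * V)))
        + dθ (dθ ((1 + E.k * (E.τ * E.τ)) * V))
        - dr ((E.ρ * E.τ * dr (E.ρ * E.τ) + dθ (E.ρ * E.τ) + E.ρ * dr (E.ρ * E.k)
            - E.τ * dθ (E.ρ * E.k) + E.ρ * E.α) * V)
        - dθ ((E.τ * dθ (E.τ * E.k) - E.ρ * dr (E.τ * E.k) + E.β) * V)) := by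
  have tX : ∀ {N f}, TF (N + 1) f → TF N (-dr (E.ρ * E.τ * f) - dθ f) := fun hf =>
    (TF.cmul ((cρ _).mul (cτ _)) hf).dr.neg.sub hf.dθ
  have tZ : ∀ {N f}, TF (N + 1) f → TF N (-dr (E.ρ * f) + dθ (E.τ * f)) := fun hf =>
    (TF.cmul (cρ _) hf).dr.neg.add (TF.cmul (cτ _) hf).dθ
  rw [← adjoint_expand (Xs := fun F => -dr (E.ρ * E.τ * F) - dθ F)
    (Zs := fun F => -dr (E.ρ * F) + dθ (E.τ * F)) (cρ 2) (cτ 2)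
    (E.hk.of_nat (Nat.le_add_left 2 _)) (hV 2).cd
    (E.hα.of_nat (Nat.le_add_left 1 _))
    (E.hβ.of_nat (Nat.le_add_left 1 _)) (fun _ => rfl) (fun _ => rfl)]
  have e : ∀ a b c : ℱ, a * (b * c) = b * (a * c) := fun a b c => by ring
  rw [Mt, Xt_rγ (hV 1), Xt_rγ (tX (hV 2)), Zt_rγ (hV 1), e E.k, Zt_rγ (k_tf (Nat.le_add_left 1 _) (tZ (hV 2))),
    e E.α, Dt_rγ (α_tf (Nat.le_add_left 1 _) (hV 1)), e E.β, dθ_rγ_mul]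
  ring

/-- On the rectangle, the adjoint of the cut-off operator is the adjoint of `M`, up to the weights. -/
theorem adjoint_eq {φ : ℝ → ℝ} {k b d sc v : ℱ} (hV : SF V)
    (hφ : ∀ q ∈ Ω(E.S), φ q.1 = E.φ₀ q.1)
    (hk : ∀ q ∈ Ω(E.S), k q = E.k q)
    (hτ : ∀ q ∈ Ω(E.S), E.τ₀ q.2 = tan q.2)
    (hsc : ∀ q ∈ Ω(E.S), sc q = (cos q.2)⁻¹)
    (hcos : ∀ q ∈ Ω(E.S), cos q.2 ≠ 0)
    (hα : ∀ q ∈ Ω(E.S), E.α q = E.k q * (E.τ q * E.τ q) + 1 - dθ E.τ q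
      + q.1 * sc q * (b q + d q * E.τ q) - E.Z E.k q - (E.k q + E.τ q * E.τ q) * (E.φ q + euler E.φ q))
    (hβ : ∀ q ∈ Ω(E.S), E.β q = E.φ q * (2 * (E.k q - 1) * E.τ q
      + q.1 * sc q * (d q - b q * E.τ q)) - E.k q * E.τ q * dθ E.τ q + E.τ q * E.Z E.k q)
    (hv : ∀ q ∈ Ω(E.S), v q = q.1 ^ 2 * sc q ^ 2 * V q) :
    ∀ q ∈ Ω(E.S), (polarOperator φ k b d).adjoint v q
      = q.1 ^ (-E.S.γ) * E.Mt (E.rγ * V) q := by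
  have ho := isOpen_rect E.S.σ E.S.δ
  have hs : ∀ q ∈ Ω(E.S), sin q.2 = E.τ q * cos q.2 := fun q hq => by
    rw [τ, hτ q hq, tan_mul_cos (hcos q hq)]
  have dk : Differentiable ℝ E.k := E.hk.diff (by omega)
  have dφ : Differentiable ℝ E.φ := (cφ 1).diff le_rfl
  have dτ : Differentiable ℝ E.τ := (cτ 1).diff le_rfl
  have dρ : Differentiable ℝ E.ρ := (cρ 1).diff le_rfl
  have h3 : dr (Prod.fst : ℱ) = 1 := by
    funext q
    simp [dr]
  have h4 : dθ (Prod.fst : ℱ) = 0 := by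
    funext q
    simp [dθ]
  have h5 : dr E.τ = 0 := by
    funext q
    simp [dr, τ]
  have h6 : dθ E.φ = 0 := by
    funext q
    simp [dθ, DegenerateOperator.φ]
  have eρ : dr E.ρ = E.φ + Prod.fst * dr E.φ := by rw [ρ, dr_mul differentiable_fst dφ, h3, one_mul]
  have eρ' : dθ E.ρ = 0 := by rw [ρ, dθ_mul differentiable_fst dφ, h4, h6, mul_zero, zero_mul, add_zero]
  have F1 : ∀ q ∈ Ω(E.S), ((polarOperator φ k b d).K * v) q
      = (E.ρ * E.ρ * (E.k + E.τ * E.τ) * V) q := fun q hq => by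
    have hc := hcos q hq
    simp only [polarOperator, Pi.mul_apply, Pi.add_apply, hv q hq, hsc q hq, hs q hq, hφ q hq, hk q hq, ρ, DegenerateOperator.φ]
    field_simp
  have F2 : ∀ q ∈ Ω(E.S), ((polarOperator φ k b d).A * v) q
      = ((2 : ℝ) • (E.ρ * E.τ * (1 - E.k) * V)) q := fun q hq => by
    have hc := hcos q hq
    have hr : q.1 ≠ 0 := hq.1.1.ne'
    simp only [polarOperator, Pi.mul_apply, Pi.sub_apply, Pi.one_apply, Pi.smul_apply, smul_eq_mul,
      hv q hq, hsc q hq, hs q hq, hφ q hq, hk q hq, ρ, DegenerateOperator.φ]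
    field_simp
  have F3 : ∀ q ∈ Ω(E.S), ((polarOperator φ k b d).B * v) q
      = ((1 + E.k * (E.τ * E.τ)) * V) q := fun q hq => by
    have hc := hcos q hq
    have hr : q.1 ≠ 0 := hq.1.1.ne'
    simp only [polarOperator, Pi.mul_apply, Pi.add_apply, Pi.one_apply,
      hv q hq, hsc q hq, hs q hq, hk q hq]
    field_simp
    ring
  have F4 : ∀ q ∈ Ω(E.S), ((polarOperator φ k b d).C * v) q
      = ((E.ρ * E.τ * dr (E.ρ * E.τ) + dθ (E.ρ * E.τ) + E.ρ * dr (E.ρ * E.k)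
            - E.τ * dθ (E.ρ * E.k) + E.ρ * E.α) * V) q := fun q hq => by
    have hc := hcos q hq
    have hr : q.1 ≠ 0 := hq.1.1.ne'
    rw [dr_mul dρ dτ, dθ_mul dρ dτ, dr_mul dρ dk, dθ_mul dρ dk, h5, eρ, eρ']
    simp only [polarOperator, Pi.mul_apply, Pi.add_apply, Pi.sub_apply, Pi.zero_apply, hα q hq, Z, D, euler,
      hv q hq, hsc q hq, hs q hq, hφ q hq, hk q hq, ρ, DegenerateOperator.φ]
    field_simp
    ring
  have F5 : ∀ q ∈ Ω(E.S), ((polarOperator φ k b d).D * v) q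
      = ((E.τ * dθ (E.τ * E.k) - E.ρ * dr (E.τ * E.k) + E.β) * V) q := fun q hq => by
    have hc := hcos q hq
    have hr : q.1 ≠ 0 := hq.1.1.ne'
    rw [dθ_mul dτ dk, dr_mul dτ dk, h5]
    simp only [polarOperator, Pi.mul_apply, Pi.add_apply, Pi.sub_apply, Pi.zero_apply, hβ q hq, Z, D, euler,
      hv q hq, hsc q hq, hs q hq, hφ q hq, hk q hq, ρ, DegenerateOperator.φ]
    field_simp
    ring
  intro q hq
  rw [Mt_rγ hV, PolarOperator.adjoint, dr_congr_on ho (dr_congr_on ho F1) q hq,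
    dr_congr_on ho (dθ_congr_on ho F2) q hq, dθ_congr_on ho (dθ_congr_on ho F3) q hq,
    dr_congr_on ho F4 q hq, dθ_congr_on ho F5 q hq, Pi.mul_apply, show E.rγ q = q.1 ^ E.S.γ from rfl,
    ← mul_assoc (q.1 ^ _), ← rpow_add hq.1.1, neg_add_cancel, rpow_zero, one_mul]
  rfl

end DegenerateOperator

/-! ### Solvability in polar coordinates -/

lemma exists_cutoff {F : Type*} [NormedAddCommGroup F] [NormedSpace ℝ F] [FiniteDimensional ℝ F]
    {K V : Set F} (hK : IsCompact K) (hV : IsOpen V) (h : K ⊆ V) :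
    ∃ χ : F → ℝ, ContDiff ℝ ∞ χ ∧ (∀ᶠ x in 𝓝ˢ K, χ x = 1) ∧
      (∀ x, χ x ∈ Icc (0 : ℝ) 1) ∧ ∃ L, IsCompact L ∧ L ⊆ V ∧ ∀ x ∉ L, χ x = 0 := by
  obtain ⟨L, hL, h1, h2⟩ := exists_compact_between hK hV h
  obtain ⟨χ, hχ1, hχ0, hχ⟩ :=
    exists_contMDiffMap_one_nhds_of_subset_interior (n := (⊤ : ℕ∞)) (modelWithCornersSelf ℝ F) hK.isClosed h1
  exact ⟨χ, χ.contMDiff.contDiff, hχ1, hχ, L, hL, h2, hχ0⟩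

lemma contDiff_cutoff_mul {F : Type*} [NormedAddCommGroup F] [NormedSpace ℝ F] {V L : Set F}
    {n : WithTop ℕ∞} {χ f : F → ℝ} (hχ : ContDiff ℝ n χ) (hV : IsOpen V) (hL : IsCompact L)
    (hLV : L ⊆ V) (h0 : ∀ x ∉ L, χ x = 0) (hf : ContDiffOn ℝ n f V) : ContDiff ℝ n (χ * f) := by
  refine contDiff_iff_contDiffAt.2 fun x => ?_
  by_cases hx : x ∈ L
  · exact hχ.contDiffAt.mul (hf.contDiffAt (hV.mem_nhds (hLV hx)))
  · refine (contDiffAt_const (c := (0 : ℝ))).congr_of_eventuallyEq ?_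
    filter_upwards [hL.isClosed.isOpen_compl.mem_nhds hx] with y hy
    simp [h0 y hy]

lemma exists_smooth_tan : ∃ τ₀ s₀ : ℝ → ℝ, ContDiff ℝ ∞ τ₀ ∧ ContDiff ℝ ∞ s₀ ∧
    ∀ θ ∈ Ioo (0 : ℝ) (1 / 2), τ₀ θ = tan θ ∧ s₀ θ = (cos θ)⁻¹ := by
  have hV : IsOpen {θ : ℝ | cos θ ≠ 0} := isOpen_ne_fun continuous_cos continuous_const
  obtain ⟨χ, cχ, h1, -, L, hL, hLV, h0⟩ := exists_cutoff (K := Icc (0 : ℝ) (1 / 2)) isCompact_Icc hV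
    fun θ hθ => (cos_pos_of_le_one (by rw [abs_of_nonneg hθ.1]; linarith [hθ.2])).ne'
  have c1 : ContDiffOn ℝ ∞ tan {θ : ℝ | cos θ ≠ 0} := fun θ hθ =>
    (contDiffAt_tan.2 hθ).contDiffWithinAt
  have c2 : ContDiffOn ℝ ∞ (fun θ => (cos θ)⁻¹) {θ : ℝ | cos θ ≠ 0} :=
    contDiff_cos.contDiffOn.inv fun θ hθ => hθ
  refine ⟨_, _, contDiff_cutoff_mul cχ hV hL hLV h0 c1, contDiff_cutoff_mul cχ hV hL hLV h0 c2,
    fun θ hθ => ?_⟩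
  have := h1.self_of_nhdsSet θ (Ioo_subset_Icc_self hθ)
  simp [this]

lemma seven_eighths_le_cos {θ : ℝ} (hθ : θ ∈ Ioo (0 : ℝ) (1 / 2)) : 7 / 8 ≤ cos θ := by
  have := one_sub_sq_div_two_le_cos (x := θ)
  nlinarith [hθ.1, hθ.2]

lemma exists_smooth_cutoff {σ : ℝ} (hσ : 0 < σ) {φ : ℝ → ℝ} (hφ : IsCutoff σ φ) :
    ∃ φ₀ : ℝ → ℝ, ContDiff ℝ ∞ φ₀ ∧ φ₀ σ = 0 ∧ (∀ r ∈ Ioo 0 σ, φ r = φ₀ r) ∧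
      ∃ C ≥ 0, ∀ r ∈ Ioo 0 σ, |φ₀ r| ≤ C * (σ - r) := by
  obtain ⟨h1, -, h3, h4⟩ := hφ
  let φ₀ : ℝ → ℝ := fun r => if r ≤ σ / 4 then 1 else φ r
  have e : ∀ r, 0 < r → φ₀ r = φ r := fun r hr => by
    simp only [φ₀]
    split_ifs with h
    · rw [h3 r hr (by linarith)]
    · rfl
  have e1 : ∀ r, r < σ / 2 → φ₀ r = 1 := fun r hr => by
    simp only [φ₀]
    split_ifs with h
    · rfl
    · exact h3 r (by linarith) hr
  have c : ContDiff ℝ ∞ φ₀ := by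
    refine contDiff_iff_contDiffAt.2 fun r => ?_
    rcases lt_or_ge r (σ / 2) with hr | hr
    · refine (contDiffAt_const (c := (1 : ℝ))).congr_of_eventuallyEq ?_
      filter_upwards [Iio_mem_nhds hr] with s hs using e1 s hs
    · have hr0 : 0 < r := by linarith
      refine (h1.contDiffAt (Ici_mem_nhds hr0)).congr_of_eventuallyEq ?_
      filter_upwards [Ioi_mem_nhds hr0] with s hs using e s hs
  have z : φ₀ σ = 0 := by
    have t1 : Tendsto φ₀ (𝓝[>] σ) (𝓝 (φ₀ σ)) := c.continuous.continuousAt.continuousWithinAt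
    refine tendsto_nhds_unique t1 (tendsto_const_nhds.congr' ?_)
    filter_upwards [self_mem_nhdsWithin] with s hs
    rw [e s (hσ.trans hs), h4 s hs]
  refine ⟨φ₀, c, z, fun r hr => (e r hr.1).symm, ?_⟩
  have cd := c.continuous_deriv (by simp)
  obtain ⟨C, hC⟩ := (isCompact_Icc (a := 0) (b := σ)).exists_bound_of_continuousOn cd.continuousOn
  refine ⟨max C 0, le_max_right _ _, fun r hr => ?_⟩
  have := (convex_Icc 0 σ).norm_image_sub_le_of_norm_deriv_le (f := φ₀) (C := max C 0)
    (fun x _ => (c.differentiable (by simp)) x) (fun x hx => (hC x hx).trans (le_max_left _ _))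
    (right_mem_Icc.2 hσ.le) (Ioo_subset_Icc_self hr)
  rw [z, sub_zero, norm_eq_abs, norm_eq_abs, abs_sub_comm r σ,
    abs_of_pos (show 0 < σ - r by linarith [hr.2])] at this
  exact this

/-- The first derivative of a nonnegative function is controlled by its square root. -/
lemma dist_mul_abs_deriv_le {σ : ℝ} {g : ℝ → ℝ} (hg : ContDiff ℝ (2 : ℕ) g)
    (h0 : ∀ x ∈ Ioo 0 σ, 0 ≤ g x) (h1 : ∀ x ∈ Ioo 0 σ, g x ≤ 1)
    (h2 : ∀ x ∈ Ioo 0 σ, |deriv (deriv g) x| ≤ 1) {x : ℝ} (hx : x ∈ Ioo 0 σ) :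
    min x (σ - x) * |deriv g x| ≤ (2 + 2 * σ) * √(g x) := by
  have d1 : Differentiable ℝ g := hg.differentiable (by norm_num)
  have d2 : Differentiable ℝ (deriv g) :=
    ((contDiff_succ_iff_deriv (n := 1)).1 (by exact_mod_cast hg)).2.2.differentiable (by norm_num)
  set d := min x (σ - x) with hd
  have hd0 : 0 < d := lt_min hx.1 (by linarith [hx.2])
  have hdx : d ≤ x := min_le_left _ _
  have hdx' : d ≤ σ - x := min_le_right _ _
  have key : ∀ t, 0 < t → t < d → t * |deriv g x| ≤ g x + t ^ 2 := by
    intro t ht htd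
    have hsub : Icc (x - t) (x + t) ⊆ Ioo 0 σ := fun y hy => ⟨by linarith [hy.1], by linarith [hy.2]⟩
    have hxm : x ∈ Icc (x - t) (x + t) := ⟨by linarith, by linarith⟩
    have b1 : ∀ y ∈ Icc (x - t) (x + t), |deriv g y - deriv g x| ≤ t := fun y hy => by
      have := (convex_Icc (x - t) (x + t)).norm_image_sub_le_of_norm_deriv_le (f := deriv g) (C := 1)
        (fun z _ => d2 z) (fun z hz => h2 z (hsub hz)) hxm hy
      rw [one_mul, norm_eq_abs, norm_eq_abs] at this
      exact this.trans (abs_le.2 ⟨by linarith [hy.1], by linarith [hy.2]⟩)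
    have b2 : ∀ y ∈ Icc (x - t) (x + t), |g y - g x - deriv g x * (y - x)| ≤ t * t := fun y hy => by
      have hder : ∀ z, deriv (fun y => g y - deriv g x * y) z = deriv g z - deriv g x := fun z =>
        (((d1 z).hasDerivAt).sub (((hasDerivAt_id z).const_mul (deriv g x)))).deriv.trans (by ring)
      have := (convex_Icc (x - t) (x + t)).norm_image_sub_le_of_norm_deriv_le
        (f := fun y => g y - deriv g x * y) (C := t)
        (fun z _ => (d1 z).sub ((differentiableAt_id).const_mul _)) (fun z hz => by
          rw [hder]
          exact b1 z hz) hxm hy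
      rw [norm_eq_abs, norm_eq_abs] at this
      have h3 : |y - x| ≤ t := abs_le.2 ⟨by linarith [hy.1], by linarith [hy.2]⟩
      have h4 := this.trans (mul_le_mul_of_nonneg_left h3 ht.le)
      rwa [show g y - deriv g x * y - (g x - deriv g x * x) = g y - g x - deriv g x * (y - x) by ring] at h4
    have m1 : x - t ∈ Icc (x - t) (x + t) := ⟨le_rfl, by linarith⟩
    have m2 : x + t ∈ Icc (x - t) (x + t) := ⟨by linarith, le_rfl⟩
    have c1 := (abs_le.1 (b2 _ m1)).2
    have c2 := (abs_le.1 (b2 _ m2)).2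
    have c3 := h0 _ (hsub m1)
    have c4 := h0 _ (hsub m2)
    rcases abs_cases (deriv g x) with ⟨h, -⟩ | ⟨h, -⟩ <;> rw [h] <;> nlinarith
  have hg0 := h0 x hx
  set S := √(g x) with hS
  have hS0 : 0 ≤ S := sqrt_nonneg _
  have hSg : S ^ 2 = g x := sq_sqrt hg0
  have hS1 : S ≤ 1 := sqrt_le_one.2 (h1 x hx)
  have hdσ : d ≤ σ := hdx.trans hx.2.le
  rcases le_or_gt (d / 2) S with h | h
  · have := key (d / 2) (by linarith) (by linarith)
    nlinarith
  · rcases eq_or_lt_of_le hS0 with hz | hz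
    · have hgz : g x = 0 := by rw [← hSg, ← hz]; norm_num
      have : |deriv g x| = 0 := by
        by_contra hne
        have hp : 0 < |deriv g x| := lt_of_le_of_ne (abs_nonneg _) (Ne.symm hne)
        have := key (min (d / 2) (|deriv g x| / 2)) (by positivity)
          ((min_le_left _ _).trans_lt (by linarith))
        rw [hgz, zero_add, sq] at this
        have h5 := le_of_mul_le_mul_left this (by positivity)
        linarith [min_le_right (d / 2) (|deriv g x| / 2)]
      rw [this, ← hz]
      simp
    · have := key S hz (by linarith)
      have h5 : S * |deriv g x| ≤ S * (2 * S) := by nlinarith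
      have h6 := le_of_mul_le_mul_left h5 hz
      nlinarith [mul_le_mul_of_nonneg_left h6 hd0.le]

lemma exists_euler_iterate_bound {N : ℕ} (ha : ContDiff ℝ N a) {K : Set (ℝ × ℝ)}
    (hK : IsCompact K) : ∃ C ≥ 1, ∀ i ≤ N, ∀ q ∈ K, |euler^[i] a q| ≤ C := by
  have key : ∀ i, i ≤ N → ∃ C, ∀ q ∈ K, |euler^[i] a q| ≤ C := fun i hi => by
    have hc : Continuous (euler^[i] a) := (contDiff_euler_iterate (n := 0) i
      (ha.of_le (by exact_mod_cast (by omega : 0 + i ≤ N)))).continuous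
    exact hK.exists_bound_of_continuousOn hc.continuousOn
  choose! C hC using key
  refine ⟨1 + ∑ i ∈ Finset.range (N + 1), |C i|, ?_, fun i hi q hq => ?_⟩
  · linarith [Finset.sum_nonneg fun i (_ : i ∈ Finset.range (N + 1)) => abs_nonneg (C i)]
  · have := Finset.single_le_sum (f := fun i => |C i|) (fun i _ => abs_nonneg (C i))
      (Finset.mem_range.2 (Nat.lt_succ_of_le hi))
    linarith [hC i hi q hq, le_abs_self (C i)]

/-- Bounds for the derivatives `∂_r^i ∂_θ^j` give bounds for the derivatives along `r ∂_r` and `∂_θ`. -/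
lemma BC.of_bound {ι : Type*} {U : ι → Set (ℝ × ℝ)} {N : ℕ} {f : ι → ℱ} {K : Set (ℝ × ℝ)}
    (hK : IsCompact K) (hU : ∀ i, U i ⊆ K) (cf : ∀ i, ContDiff ℝ N (f i)) {C : ℝ}
    (h : ∀ i s t, s + t ≤ N → ∀ q ∈ U i, |dr^[s] (dθ^[t] (f i)) q| ≤ C) : BC U N f := by
  induction N generalizing f with
  | zero => exact ⟨le_rfl, fun i => (cf i).contDiffOn, C, fun i q hq => h i 0 0 le_rfl q hq⟩
  | succ N ih =>
    refine .of_derivs cf ⟨C, fun i q hq => h i 0 0 (Nat.zero_le _) q hq⟩ ?_ ?_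
    · refine (of_contDiff hK hU contDiff_fst).mul (ih (f := fun i => dr (f i))
        (fun i => contDiff_dr (cf i)) fun i s t hst q hq => ?_)
      have e : ∀ t {F : ℱ}, ContDiff ℝ (t + 1 : ℕ) F → dθ^[t] (dr F) = dr (dθ^[t] F) := by
        intro t
        induction t with
        | zero => exact fun _ => rfl
        | succ t iht =>
          intro F hF
          rw [iterate_succ_apply, iterate_succ_apply,
            ← dr_dθ_comm (hF.of_le (by exact_mod_cast (by omega : 2 ≤ t + 1 + 1))), iht (contDiff_dθ hF)]
      rw [e t ((cf i).of_le (by exact_mod_cast (by omega : t + 1 ≤ N + 1))), ← iterate_succ_apply]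
      exact h i (s + 1) t (by omega) q hq
    · refine ih (fun i => contDiff_dθ (cf i)) fun i s t hst q hq => ?_
      rw [← iterate_succ_apply]
      exact h i s (t + 1) (by omega) q hq

/-- Coefficients, of class `C^(m+1)` and `C^m`, for which the boundary value problem is solvable if
`δ` is small: `k` is nonnegative, and a few derivatives are bounded by a fixed constant. -/
structure PolarCoef (m : ℕ) (σ δ : ℝ) (k b d : ℱ) : Prop where
  ck : ContDiff ℝ (m + 1 : ℕ) k
  cb : ContDiff ℝ m b
  cd : ContDiff ℝ m d
  k0 : ∀ q ∈ rect σ δ, 0 ≤ k q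
  bk : ∀ i j, i + j ≤ 2 → ∀ q ∈ rect σ δ, |dr^[i] (dθ^[j] k) q| ≤ 1
  bb : ∀ i j, i + j ≤ 1 → ∀ q ∈ rect σ δ, |dr^[i] (dθ^[j] b) q| ≤ 1
  bd : ∀ i j, i + j ≤ 1 → ∀ q ∈ rect σ δ, |dr^[i] (dθ^[j] d) q| ≤ 1

/-- The coefficient `Zk`. -/
def zCoef (φ τ k : ℱ) : ℱ := φ * euler k - τ * dθ k

/-- The coefficient `α` for the operator `r² sec² θ L`. -/
def αCoef (φ τ sc k b d : ℱ) : ℱ :=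
  k * (τ * τ) + 1 - dθ τ + Prod.fst * sc * (b + d * τ) - zCoef φ τ k - (k + τ * τ) * (φ + euler φ)

/-- The coefficient `β` for the operator `r² sec² θ L`. -/
def βCoef (φ τ sc k b d : ℱ) : ℱ :=
  φ * ((fun _ => 2) * (k - 1) * τ + Prod.fst * sc * (d - b * τ)) - k * τ * dθ τ + τ * zCoef φ τ k

section

variable {ι : Type*} {U : ι → Set (ℝ × ℝ)} {N : ℕ} {φ τ sc : ℱ} {k b d : ι → ℱ}
  {K : Set (ℝ × ℝ)}

lemma BC.zCoef (hK : IsCompact K) (hU : ∀ i, U i ⊆ K) (hφ : ContDiff ℝ N φ) (hτ : ContDiff ℝ N τ)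
    (hk : BC U (N + 1) k) : BC U N fun i => zCoef φ τ (k i) :=
  ((of_contDiff hK hU hφ).mul hk.euler).sub ((of_contDiff hK hU hτ).mul hk.dθ)

lemma BC.αCoef (hK : IsCompact K) (hU : ∀ i, U i ⊆ K) (hφ : ContDiff ℝ (N + 1 : ℕ) φ)
    (hτ : ContDiff ℝ (N + 1 : ℕ) τ) (hs : ContDiff ℝ N sc) (hk : BC U (N + 1) k) (hb : BC U N b)
    (hd : BC U N d) : BC U N fun i => αCoef φ τ sc (k i) (b i) (d i) := by
  have l := fun {F : ℱ} (h : ContDiff ℝ (N + 1 : ℕ) F) =>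
    h.of_le (m := (N : ℕ)) (by exact_mod_cast Nat.le_succ N)
  have T := of_contDiff (N := N) hK hU (l hτ)
  have c : ∀ {a : ℱ}, ContDiff ℝ N a → BC U N fun _ => a := fun h => of_contDiff hK hU h
  exact (((((hk.of_succ.mul (T.mul T)).add (c contDiff_const)).sub (c (contDiff_dθ hτ))).add
    (((c contDiff_fst).mul (c hs)).mul (hb.add (hd.mul T)))).sub (zCoef hK hU (l hφ) (l hτ) hk)).sub
    ((hk.of_succ.add (T.mul T)).mul ((c (l hφ)).add (c (contDiff_euler hφ))))

lemma BC.βCoef (hK : IsCompact K) (hU : ∀ i, U i ⊆ K) (hφ : ContDiff ℝ (N + 1 : ℕ) φ)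
    (hτ : ContDiff ℝ (N + 1 : ℕ) τ) (hs : ContDiff ℝ N sc) (hk : BC U (N + 1) k) (hb : BC U N b)
    (hd : BC U N d) : BC U N fun i => βCoef φ τ sc (k i) (b i) (d i) := by
  have l := fun {F : ℱ} (h : ContDiff ℝ (N + 1 : ℕ) F) =>
    h.of_le (m := (N : ℕ)) (by exact_mod_cast Nat.le_succ N)
  have T := of_contDiff (N := N) hK hU (l hτ)
  have c : ∀ {a : ℱ}, ContDiff ℝ N a → BC U N fun _ => a := fun h => of_contDiff hK hU h
  exact (((c (l hφ)).mul ((((c contDiff_const).mul (hk.of_succ.sub (c contDiff_const))).mul T).add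
    (((c contDiff_fst).mul (c hs)).mul (hd.sub (hb.mul T))))).sub
    ((hk.of_succ.mul T).mul (c (contDiff_dθ hτ)))).add (T.mul (zCoef hK hU (l hφ) (l hτ) hk))

/-- Single functions, as families on the empty set. -/
lemma BC.single : BC (fun _ : Unit => ∅) N (fun _ => f) ↔ ContDiff ℝ N f :=
  ⟨fun h => h.contDiff (), fun h => of_contDiff isCompact_empty (fun _ => le_rfl) h⟩

end

set_option maxHeartbeats 1000000 in
/-- The boundary value problem for the cut-off operator in polar coordinates is solvable if `δ` is
small, the bound for `δ` being independent of the coefficients. -/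
theorem exists_isWeakSolution {σ lam γ : ℝ} (hσ : 0 < σ) (hlam : 0 < lam) (hγ : 0 < γ) {m : ℕ}
    (hm : 1 ≤ m) {φ : ℝ → ℝ} (hφ : IsCutoff σ φ) :
    ∃ δ₀ > 0, ∀ δ, 0 < δ → δ < δ₀ → ∀ k b d, PolarCoef m σ δ k b d →
      ∀ k' b' d' : ℱ, (∀ q ∈ rect σ δ, k' q = k q) → (∀ q ∈ rect σ δ, b' q = b q) →
      (∀ q ∈ rect σ δ, d' q = d q) → ∀ f, MemH σ δ lam γ m 1 f →
      ∃ u, MemH σ δ lam γ m 1 u ∧ IsWeakSolution σ δ (polarOperator φ k' b' d') f u := by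
  obtain ⟨n, rfl⟩ : ∃ n, m = n + 1 := ⟨m - 1, by omega⟩
  obtain ⟨φ₀, cφ, φσ, hφ₀, Cφ, hCφ, bφ⟩ := exists_smooth_cutoff hσ hφ
  obtain ⟨τ₀, s₀, cτ, cs, hts⟩ := exists_smooth_tan
  have cφ' : ∀ N : ℕ, ContDiff ℝ N φ₀ := fun N => cφ.of_le (by exact_mod_cast le_top)
  have cτ' : ∀ N : ℕ, ContDiff ℝ N τ₀ := fun N => cτ.of_le (by exact_mod_cast le_top)
  have cs' : ∀ N : ℕ, ContDiff ℝ N s₀ := fun N => cs.of_le (by exact_mod_cast le_top)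
  let φq : ℱ := fun q => φ₀ q.1
  let τq : ℱ := fun q => τ₀ q.2
  let sq : ℱ := fun q => s₀ q.2
  have gφ : ∀ N : ℕ, ContDiff ℝ N φq := fun N => (cφ' N).comp contDiff_fst
  have gτ : ∀ N : ℕ, ContDiff ℝ N τq := fun N => (cτ' N).comp contDiff_snd
  have gs : ∀ N : ℕ, ContDiff ℝ N sq := fun N => (cs' N).comp contDiff_snd
  let B : Set (ℝ × ℝ) := Icc 0 σ ×ˢ Icc 0 1
  have hB : IsCompact B := isCompact_Icc.prod isCompact_Icc
  -- the constants have to be uniform in all the data, which serve as the index of a family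
  let ι := {i : ℝ × (ℱ) × (ℱ) × (ℱ) //
    i.1 ≤ 1 / 2 ∧ PolarCoef (n + 1) σ i.1 i.2.1 i.2.2.1 i.2.2.2}
  let U : ι → Set (ℝ × ℝ) := fun i => rect σ i.1.1
  have hU : ∀ i, U i ⊆ B := fun i q hq =>
    ⟨Ioo_subset_Icc_self hq.1, hq.2.1.le, by linarith [hq.2.2, i.2.1]⟩
  have Bk : BC U 2 fun i : ι => i.1.2.1 := BC.of_bound hB hU
    (fun i => i.2.2.ck.of_le (by exact_mod_cast (by omega : 2 ≤ n + 1 + 1))) fun i => i.2.2.bk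
  have Bb : BC U 1 fun i : ι => i.1.2.2.1 := BC.of_bound hB hU
    (fun i => i.2.2.cb.of_le (by exact_mod_cast (by omega : 1 ≤ n + 1))) fun i => i.2.2.bb
  have Bd : BC U 1 fun i : ι => i.1.2.2.2 := BC.of_bound hB hU
    (fun i => i.2.2.cd.of_le (by exact_mod_cast (by omega : 1 ≤ n + 1))) fun i => i.2.2.bd
  have Bα := BC.αCoef (sc := sq) hB hU (gφ 2) (gτ 2) (gs 1) Bk Bb Bd
  have Bβ := BC.βCoef (sc := sq) hB hU (gφ 2) (gτ 2) (gs 1) Bk Bb Bd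
  obtain ⟨C₁, hC₁, H₁⟩ := exists_euler_iterate_bound (gφ (n + 1)) hB
  obtain ⟨C₂, hC₂, H₂⟩ := Bk.euler.exists_bound
  obtain ⟨C₃, hC₃, H₃⟩ := Bk.euler.euler.exists_bound
  obtain ⟨C₄, hC₄, H₄⟩ := Bα.exists_bound
  obtain ⟨C₅, hC₅, H₅⟩ := Bα.euler.exists_bound
  obtain ⟨C₆, hC₆, H₆⟩ := Bβ.euler.exists_bound
  obtain ⟨C₇, hC₇, H₇⟩ := Bβ.dθ.exists_bound
  set C₈ := Cφ * (σ * (2 + 2 * σ)) with hC₈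
  have hC₈0 : 0 ≤ C₈ := by positivity
  obtain ⟨C, l₁, l₂, l₃, l₄, l₅, l₆, l₇, l₈⟩ : ∃ C, C₁ ≤ C ∧ C₂ ≤ C ∧ C₃ ≤ C ∧ C₄ ≤ C ∧ C₅ ≤ C ∧
      C₆ ≤ C ∧ C₇ ≤ C ∧ C₈ ≤ C :=
    ⟨C₁ + C₂ + C₃ + C₄ + C₅ + C₆ + C₇ + C₈, by linarith, by linarith, by linarith, by linarith,
      by linarith, by linarith, by linarith, by linarith⟩
  have hC1 : 1 ≤ C := hC₁.trans l₁
  obtain ⟨K, hK⟩ : ∃ K, K = 3 * 2 ^ (n + 1) * C + (|1 - γ| + 1) * C + n + 1 := ⟨_, rfl⟩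
  have hK0 : 0 < K := by
    rw [hK]
    positivity
  refine ⟨min (1 / 2) (1 / (4000 * K ^ 4)), by positivity, fun δ hδ hδ₀ k b d P k' b' d' ek eb ed f hf => ?_⟩
  have hδ1 : δ < 1 / 2 := hδ₀.trans_le (min_le_left _ _)
  have hδ2 : δ * K ^ 4 ≤ 1 / 4000 := by
    have h := (hδ₀.trans_le (min_le_right _ _)).le
    rw [le_div_iff₀ (by positivity)] at h
    linarith
  let i : ι := ⟨(δ, k, b, d), hδ1.le, P⟩
  have hα : ContDiff ℝ (n + 1 : ℕ) (αCoef φq τq sq k b d) :=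
    BC.single.1 (BC.αCoef isCompact_empty (fun _ => le_rfl) (gφ _) (gτ _) (gs _)
      (BC.single.2 P.ck) (BC.single.2 P.cb) (BC.single.2 P.cd))
  have hβ : ContDiff ℝ (n + 1 : ℕ) (βCoef φq τq sq k b d) :=
    BC.single.1 (BC.βCoef isCompact_empty (fun _ => le_rfl) (gφ _) (gτ _) (gs _)
      (BC.single.2 P.ck) (BC.single.2 P.cb) (BC.single.2 P.cd))
  have hγ0 := abs_nonneg (1 - γ)
  obtain ⟨ν₁, hν₁, N₁⟩ := exists_euler_iterate_bound P.ck hB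
  obtain ⟨ν₂, hν₂, N₂⟩ := exists_euler_iterate_bound hα hB
  obtain ⟨ν₃, hν₃, N₃⟩ := exists_euler_iterate_bound hβ hB
  have hθ : ∀ q ∈ rect σ δ, q.2 ∈ Ioo (0 : ℝ) (1 / 2) := fun q hq => ⟨hq.2.1, hq.2.2.trans hδ1⟩
  have hcos : ∀ q ∈ rect σ δ, 7 / 8 ≤ cos q.2 := fun q hq => seven_eighths_le_cos (hθ q hq)
  have bk1 : ∀ q ∈ rect σ δ, |k q| ≤ 1 := P.bk 0 0 (by norm_num)
  let E : DegenerateOperator :=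
    { S := ⟨σ, δ, γ, hσ, hδ⟩
      n := n, C := C, ν := ν₁ + ν₂ + ν₃ + |1 - γ|
      φ₀ := φ₀, τ₀ := τ₀, k := k, α := αCoef φq τq sq k b d, β := βCoef φq τq sq k b d
      hC := hC1
      hν := by linarith only [hν₁, hν₂, hν₃, hγ0]
      hγ := by
        change |1 - γ| ≤ _
        linarith only [hν₁, hν₂, hν₃]
      hφ := cφ', hτ := cτ', hk := P.ck, hα := hα, hβ := hβ, φσ := φσ
      bφ := fun j hj q hq => (H₁ j hj q (hU i hq)).trans l₁
      bτ := fun q hq => by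
        change |τ₀ q.2| ≤ 2 * δ
        have h1 := hcos q hq
        have h2 := sin_lt hq.2.1
        have h3 := sin_pos_of_pos_of_lt_pi hq.2.1 (by linarith [(hθ q hq).2, pi_gt_three])
        have h4 : q.2 < δ := hq.2.2
        rw [(hts _ (hθ q hq)).1, tan_eq_sin_div_cos, abs_of_pos (by positivity),
          div_le_iff₀ (by linarith)]
        nlinarith
      bδ := by
        change 2 * δ ≤ 1
        linarith
      bτ' := fun q hq => by
        have h1 := hcos q hq
        have e : deriv τ₀ q.2 = deriv tan q.2 := by
          refine EventuallyEq.deriv_eq ?_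
          filter_upwards [isOpen_Ioo.mem_nhds (hθ q hq)] with θ hθ using (hts θ hθ).1
        rw [e, deriv_tan, abs_of_pos (by positivity), div_le_iff₀ (by positivity)]
        nlinarith
      k0 := P.k0
      k1 := fun q hq => (le_abs_self _).trans (bk1 q hq)
      bk1 := fun q hq => (H₂ i q hq).trans l₂
      bk2 := fun q hq => (H₃ i q hq).trans l₃
      bks := fun q hq => by
        have hslice : ContDiff ℝ (2 : ℕ) fun r => k (r, q.2) :=
          (P.ck.of_le (by exact_mod_cast (by omega : 2 ≤ n + 1 + 1))).comp
            (contDiff_id.prodMk contDiff_const)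
        have h1 := dist_mul_abs_deriv_le (σ := σ) hslice (fun r hr => P.k0 (r, q.2) ⟨hr, hq.2⟩)
          (fun r hr => (le_abs_self _).trans (bk1 (r, q.2) ⟨hr, hq.2⟩))
          (fun r hr => P.bk 2 0 (by norm_num) (r, q.2) ⟨hr, hq.2⟩) hq.1
        have h2 := bφ q.1 hq.1
        have hr := hq.1.1
        have hr' : q.1 < σ := hq.1.2
        have h3 : (σ - q.1) * q.1 ≤ σ * min q.1 (σ - q.1) := by
          rcases min_cases q.1 (σ - q.1) with ⟨h, -⟩ | ⟨h, -⟩ <;> rw [h] <;> nlinarith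
        have h4 : |dr k q| = |deriv (fun r => k (r, q.2)) q.1| := rfl
        rw [← h4] at h1
        change |φ₀ q.1 * (q.1 * dr k q)| ≤ C * √(k q)
        have hs := sqrt_nonneg (k q)
        calc |φ₀ q.1 * (q.1 * dr k q)| = |φ₀ q.1| * (q.1 * |dr k q|) := by
              rw [abs_mul, abs_mul, abs_of_pos hr]
          _ ≤ (Cφ * (σ - q.1)) * (q.1 * |dr k q|) := mul_le_mul_of_nonneg_right h2 (by positivity)
          _ = Cφ * (((σ - q.1) * q.1) * |dr k q|) := by ring
          _ ≤ Cφ * ((σ * min q.1 (σ - q.1)) * |dr k q|) := by gcongr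
          _ = Cφ * (σ * (min q.1 (σ - q.1) * |dr k q|)) := by ring
          _ ≤ Cφ * (σ * ((2 + 2 * σ) * √(k q))) := by gcongr
          _ = C₈ * √(k q) := by rw [hC₈]; ring
          _ ≤ C * √(k q) := mul_le_mul_of_nonneg_right l₈ hs
      bα := fun q hq => (H₄ i q hq).trans l₄
      bα1 := fun q hq => (H₅ i q hq).trans l₅
      bβ1 := fun q hq => (H₆ i q hq).trans l₆
      bβθ := fun q hq => (H₇ i q hq).trans l₇
      bkν := fun j _ hj q hq => (N₁ j hj q (hU i hq)).trans (by linarith only [hν₁, hν₂, hν₃, hγ0])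
      bαν := fun j _ hj q hq => (N₂ j hj q (hU i hq)).trans (by linarith only [hν₁, hν₂, hν₃, hγ0])
      bβν := fun j _ hj q hq => (N₃ j hj q (hU i hq)).trans (by linarith only [hν₁, hν₂, hν₃, hγ0]) }
  have ha : ∀ N : ℕ, ContDiff ℝ N fun q : ℝ × ℝ => q.1 ^ 2 * s₀ q.2 ^ 2 := fun N =>
    (contDiff_fst.pow 2).mul ((gs N).pow 2)
  obtain ⟨u, hu, H⟩ := DegenerateOperator.exists_weak (E := E) (by rw [hK] at hδ2; exact hδ2) hγ hlam ha hf
  refine ⟨u, hu, fun v hv => ?_⟩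
  obtain ⟨v', sv, ev, zv⟩ := exists_SF_of_mem_CBar hv.1
  let V : ℱ := (fun q => cos q.2 ^ 2) * ((fun q => q.1 ^ (-2 : ℝ)) * v')
  have sV : SF V := SF.cmul (fun N => (contDiff_cos.comp contDiff_snd).pow 2) (SF_rpow_mul (-2) sv)
  have hvV : ∀ q ∈ rect σ δ, v q = q.1 ^ 2 * s₀ q.2 ^ 2 * V q := fun q hq => by
    have h1 := hcos q hq
    have h2 : cos q.2 ≠ 0 := by linarith
    have h3 : q.1 ^ (-2 : ℝ) = (q.1 ^ 2)⁻¹ := by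
      rw [rpow_neg hq.1.1.le]
      norm_cast
    have h4 := hq.1.1.ne'
    rw [ev q hq, (hts _ (hθ q hq)).2]
    simp only [V, Pi.mul_apply, h3]
    field_simp
  have sh : SF (E.rγ * V) := SF_rpow_mul γ sV
  have bh : DegenerateOperator.Bdry E (E.rγ * V) := fun r hr => by
    have := hv.2 r hr
    constructor
    · simp [V, zv r δ this.2, E]
    · simp [V, zv r 0 this.1]
  have hadj := DegenerateOperator.adjoint_eq (E := E) (φ := φ) (k := k') (b := b') (d := d') (sc := sq)
    (v := v) sV (fun q hq => hφ₀ q.1 hq.1) ek (fun q hq => (hts _ (hθ q hq)).1)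
    (fun q hq => (hts _ (hθ q hq)).2) (fun q hq => by linarith [hcos q hq] : _)
    (fun q hq => by rw [eb q hq, ed q hq]; rfl) (fun q hq => by rw [eb q hq, ed q hq]; rfl) hvV
  have e1 : ∫ q in rect σ δ, u q * (polarOperator φ k' b' d').adjoint v q
      = ∫ q in rect σ δ, q.1 ^ (-γ) * (u q * E.Mt (E.rγ * V) q) := by
    refine setIntegral_congr_fun (measurableSet_rect _ _) fun q hq => ?_
    simp only [hadj q hq]
    change u q * (q.1 ^ (-γ) * _) = _
    ring
  have e2 : ∫ q in rect σ δ, f q * v q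
      = ∫ q in rect σ δ, q.1 ^ (-γ) * (f q * ((q.1 ^ 2 * s₀ q.2 ^ 2) * (E.rγ * V) q)) := by
    refine setIntegral_congr_fun (measurableSet_rect _ _) fun q hq => ?_
    have h1 : q.1 ^ (-γ) * q.1 ^ γ = 1 := by
      rw [← rpow_add hq.1.1, neg_add_cancel, rpow_zero]
    have h2 : E.rγ q = q.1 ^ γ := rfl
    simp only [hvV q hq, Pi.mul_apply, h2]
    calc _ = (q.1 ^ (-γ) * q.1 ^ γ) * (f q * (q.1 ^ 2 * s₀ q.2 ^ 2 * V q)) := by rw [h1, one_mul]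
      _ = _ := by ring
  rw [e1, e2]
  exact H _ sh bh

/-! ### The flow of a scalar differential equation -/

lemma hasFDerivAt_of_partial {X g₁ g₂ : ℱ} (h₁ : Continuous g₁) (h₂ : Continuous g₂)
    (d₁ : ∀ q : ℝ × ℝ, HasDerivAt (fun t => X (t, q.2)) (g₁ q) q.1)
    (d₂ : ∀ q : ℝ × ℝ, HasDerivAt (fun p => X (q.1, p)) (g₂ q) q.2) (q : ℝ × ℝ) :
    HasFDerivAt X (g₁ q • ContinuousLinearMap.fst ℝ ℝ ℝ + g₂ q • ContinuousLinearMap.snd ℝ ℝ ℝ) q := by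
  have h := hasStrictFDerivAt_uncurry_coprod (𝕜 := ℝ) (u := q) (f := fun r θ => X (r, θ))
    (f₁ := fun r θ => ContinuousLinearMap.toSpanSingleton ℝ (g₁ (r, θ)))
    (f₂ := fun r θ => ContinuousLinearMap.toSpanSingleton ℝ (g₂ (r, θ)))
    (Eventually.of_forall fun v => (d₁ v).hasFDerivAt)
    (Eventually.of_forall fun v => (d₂ v).hasFDerivAt) ?_ ?_
  · refine h.hasFDerivAt.congr_fderiv ?_
    ext <;> simp [Function.HasUncurry.uncurry]
  · exact ((ContinuousLinearMap.toSpanSingletonCLE (𝕜 := ℝ) (E := ℝ)).continuous.comp h₁).continuousAt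
  · exact ((ContinuousLinearMap.toSpanSingletonCLE (𝕜 := ℝ) (E := ℝ)).continuous.comp h₂).continuousAt

/-- A function with partial derivatives of class `C^j` is of class `C^(j+1)`. -/
lemma contDiff_succ_of_partial {j : ℕ} {X g₁ g₂ : ℱ} (h₁ : ContDiff ℝ j g₁)
    (h₂ : ContDiff ℝ j g₂) (d₁ : ∀ q : ℝ × ℝ, HasDerivAt (fun t => X (t, q.2)) (g₁ q) q.1)
    (d₂ : ∀ q : ℝ × ℝ, HasDerivAt (fun p => X (q.1, p)) (g₂ q) q.2) : ContDiff ℝ (j + 1 : ℕ) X := by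
  have := (contDiff_succ_iff_hasFDerivAt).2
    ⟨_, (h₁.smul contDiff_const).add (h₂.smul contDiff_const),
      hasFDerivAt_of_partial h₁.continuous h₂.continuous d₁ d₂⟩
  exact_mod_cast this

/-- A bounded scalar vector field, depending on time and vanishing for large times. -/
structure FlowField (n : ℕ) (S : ℱ) (L : ℝ) : Prop where
  hn : 1 ≤ n
  cd : ContDiff ℝ n S
  half : ∀ z, |S z| ≤ 1 / 2
  zero : ∀ z : ℝ × ℝ, 1 ≤ |z.2| → S z = 0
  lip : ∀ z, |dr S z| ≤ L

namespace FlowField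

variable {n : ℕ} {S : ℱ} {L τ : ℝ}

lemma hasDerivAt (h : FlowField n S L) (z : ℝ × ℝ) : HasDerivAt (fun y => S (y, z.2)) (dr S z) z.1 :=
  hasDerivAt_dr (h.cd.diff h.hn z)

lemma continuous_dr (h : FlowField n S L) : Continuous (dr S) :=
  (contDiff_dr (h.cd.of_nat h.hn)).continuous

lemma exists_solution (h : FlowField n S L) (t₀ y₀ : ℝ) :
    ∃ y : ℝ → ℝ, y t₀ = y₀ ∧ ∀ t, HasDerivAt y (S (y t, t)) t := by
  have hL : 0 ≤ L := (abs_nonneg _).trans (h.lip 0)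
  have cS := h.cd.continuous
  set R := |t₀| + 1 with hR
  have hR1 : 1 ≤ R := by linarith [abs_nonneg t₀]
  have ht : t₀ ∈ Icc (-R) R := abs_le.1 (by linarith)
  have hp : IsPicardLindelof (fun t y => S (y, t)) (tmin := -R) (tmax := R) ⟨t₀, ht⟩ y₀
      (toNNReal R) 0 (1 / 2) (toNNReal L) := by
    refine ⟨fun t _ => ?_, fun x _ => by fun_prop, fun t _ x _ => ?_, ?_⟩
    · refine (lipschitzWith_of_nnnorm_deriv_le (fun y => (h.hasDerivAt (y, t)).differentiableAt)
        fun y => ?_).lipschitzOnWith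
      rw [(h.hasDerivAt (y, t)).deriv, ← NNReal.coe_le_coe, coe_toNNReal _ hL]
      exact h.lip _
    · simpa using h.half (x, t)
    · have h1 : max (R - t₀) (t₀ - -R) ≤ 2 * R := max_le (by linarith [ht.1]) (by linarith [ht.2])
      simp only [NNReal.coe_zero, sub_zero, coe_toNNReal _ (by linarith : 0 ≤ R)]
      push_cast
      linarith
  obtain ⟨α, hα0, hα⟩ := hp.exists_eq_forall_mem_Icc_hasDerivWithinAt₀
  have cα : ContinuousOn α (Icc (-R) R) := fun t ht => (hα t ht).continuousWithinAt
  have hle : -R ≤ R := by linarith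
  have cα' : Continuous fun t => S (α (projIcc (-R) R hle t), t) := by
    have : Continuous fun t => α (projIcc (-R) R hle t) :=
      (continuousOn_iff_continuous_domRestrict.1 cα).comp continuous_projIcc
    exact cS.comp (this.prodMk continuous_id)
  have hY : ∀ t, HasDerivAt (fun t => y₀ + ∫ u in t₀..t, S (α (projIcc (-R) R hle u), u))
      (S (α (projIcc (-R) R hle t), t)) t := fun t =>
    (intervalIntegral.integral_hasDerivAt_right (cα'.intervalIntegrable _ _)
      cα'.aestronglyMeasurable.stronglyMeasurableAtFilter cα'.continuousAt).const_add _
  refine ⟨fun t => y₀ + ∫ u in t₀..t, S (α (projIcc (-R) R hle u), u), by simp, fun t => ?_⟩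
  refine (hY t).congr_deriv ?_
  rcases le_or_gt |t| R with htR | htR
  · have htI : t ∈ Icc (-R) R := abs_le.1 htR
    have key := (convex_Icc (-R) R).norm_image_sub_le_of_norm_hasDerivWithin_le
      (f := fun t => α t - (y₀ + ∫ u in t₀..t, S (α (projIcc (-R) R hle u), u))) (C := 0)
      (fun u hu => (hα u hu).sub (hY u).hasDerivWithinAt) (fun u hu => by
        rw [projIcc_of_mem _ hu]
        simp) ht htI
    simp only [hα0, intervalIntegral.integral_same, add_zero, sub_self, zero_mul, sub_zero,
      norm_le_zero_iff, sub_eq_zero] at key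
    rw [projIcc_of_mem _ htI]
    exact congrArg (fun y => S (y, t)) key
  · rw [h.zero _ (by simpa using (hR1.trans htR.le)), h.zero _ (by simpa using (hR1.trans htR.le))]

/-- The flow `X(t, p)`, which passes through the diagonal at the time `τ p`. -/
def flow (h : FlowField n S L) (τ : ℝ) (q : ℝ × ℝ) : ℝ :=
  (h.exists_solution (τ * q.2) (τ * q.2)).choose q.1

variable (h : FlowField n S L)
include h

lemma flow_diag (p : ℝ) : h.flow τ (τ * p, p) = τ * p :=
  (h.exists_solution (τ * p) (τ * p)).choose_spec.1

lemma hasDerivAt_flow (q : ℝ × ℝ) :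
    HasDerivAt (fun t => h.flow τ (t, q.2)) (S (h.flow τ q, q.1)) q.1 :=
  (h.exists_solution (τ * q.2) (τ * q.2)).choose_spec.2 q.1

omit h
/-- The difference quotient `(S(y,t) - S(x,t)) / (y - x)`. -/
def quot (S : ℱ) (x y t : ℝ) : ℝ := ∫ θ in (0 : ℝ)..1, dr S (x + θ * (y - x), t)
include h

lemma quot_mul (x y t : ℝ) : quot S x y t * (y - x) = S (y, t) - S (x, t) := by
  have h1 : ∀ θ : ℝ, HasDerivAt (fun θ => S (x + θ * (y - x), t))
      (dr S (x + θ * (y - x), t) * (y - x)) θ := fun θ => by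
    have h0 : HasDerivAt (fun θ => x + θ * (y - x)) (y - x) θ := by
      simpa using ((hasDerivAt_id θ).mul_const (y - x)).const_add x
    exact HasDerivAt.comp (h₂ := fun y => S (y, t)) θ (h.hasDerivAt (x + θ * (y - x), t)) h0
  have c : Continuous fun θ : ℝ => dr S (x + θ * (y - x), t) := by
    have := h.continuous_dr
    fun_prop
  have := intervalIntegral.integral_eq_sub_of_hasDerivAt (a := 0) (b := 1) (fun θ _ => h1 θ)
    ((c.mul continuous_const).intervalIntegrable _ _)
  rw [intervalIntegral.integral_mul_const] at this
  simpa [quot] using this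

lemma continuous_quot : Continuous fun z : ℝ × ℝ × ℝ => quot S z.1 z.2.1 z.2.2 := by
  have := h.continuous_dr
  exact intervalIntegral.continuous_parametric_intervalIntegral_of_continuous' (by fun_prop) _ _

lemma abs_quot_le (x y t : ℝ) : |quot S x y t| ≤ L := by
  have := intervalIntegral.norm_integral_le_of_norm_le_const (a := 0) (b := 1)
    (f := fun θ => dr S (x + θ * (y - x), t)) (C := L) fun θ _ => h.lip _
  simpa [quot] using this

lemma continuous_flow_left (p : ℝ) : Continuous fun t => h.flow τ (t, p) :=
  continuous_iff_continuousAt.2 fun t => (h.hasDerivAt_flow (t, p)).continuousAt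

lemma flow_sub (t p p' : ℝ) : h.flow τ (t, p') - h.flow τ (t, p)
    = (τ * p' - h.flow τ (τ * p', p))
      * exp (∫ u in (τ * p')..t, quot S (h.flow τ (u, p)) (h.flow τ (u, p')) u) := by
  set Q : ℝ → ℝ := fun u => quot S (h.flow τ (u, p)) (h.flow τ (u, p')) u with hQ
  have cQ : Continuous Q := h.continuous_quot.comp
    ((h.continuous_flow_left p).prodMk ((h.continuous_flow_left p').prodMk continuous_id))
  have hA : ∀ t, HasDerivAt (fun t => ∫ u in (τ * p')..t, Q u) (Q t) t := fun t =>
    intervalIntegral.integral_hasDerivAt_right (cQ.intervalIntegrable _ _)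
      cQ.aestronglyMeasurable.stronglyMeasurableAtFilter cQ.continuousAt
  have hv : ∀ t, HasDerivAt (fun t => (h.flow τ (t, p') - h.flow τ (t, p))
      * exp (-∫ u in (τ * p')..t, Q u)) 0 t := fun t => by
    refine (((h.hasDerivAt_flow (t, p')).sub (h.hasDerivAt_flow (t, p))).mul
      (hA t).neg.exp).congr_deriv ?_
    have := h.quot_mul (h.flow τ (t, p)) (h.flow τ (t, p')) t
    simp only [hQ, Pi.neg_apply, Pi.sub_apply] at this ⊢
    rw [← this]
    ring
  have := is_const_of_deriv_eq_zero (fun t => (hv t).differentiableAt) (fun t => (hv t).deriv) t (τ * p')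
  simp only [intervalIntegral.integral_same, neg_zero, exp_zero, mul_one, flow_diag] at this
  rw [← this, mul_assoc, ← exp_add, neg_add_cancel, exp_zero, mul_one]

lemma continuous_flow : Continuous (h.flow τ) := by
  have lip : ∀ p, LipschitzWith (1 / 2) fun t => h.flow τ (t, p) := fun p =>
    lipschitzWith_of_nnnorm_deriv_le (fun t => (h.hasDerivAt_flow (t, p)).differentiableAt) fun t => by
      rw [(h.hasDerivAt_flow (t, p)).deriv, ← NNReal.coe_le_coe]
      simpa using h.half (h.flow τ (t, p), t)
  refine continuous_prod_of_continuous_lipschitzWith _ (1 / 2) (fun t => ?_) lip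
  refine continuous_iff_continuousAt.2 fun p => ?_
  rw [ContinuousAt, tendsto_iff_norm_sub_tendsto_zero]
  have c1 : Continuous fun p' => |τ * p' - h.flow τ (τ * p', p)| * exp (L * |t - τ * p'|) := by
    have := (h.continuous_flow_left (τ := τ) p).comp (continuous_const_mul τ)
    have : Continuous fun p' => h.flow τ (τ * p', p) := this
    fun_prop
  have c2 := c1.tendsto p
  simp only [flow_diag, sub_self, abs_zero, zero_mul] at c2
  refine squeeze_zero (fun _ => norm_nonneg _) (fun p' => ?_) c2
  rw [flow_sub, norm_eq_abs, abs_mul, abs_exp]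
  refine mul_le_mul_of_nonneg_left (exp_le_exp.2 ?_) (abs_nonneg _)
  have := intervalIntegral.norm_integral_le_of_norm_le_const (a := τ * p') (b := t) (C := L)
    (f := fun u => quot S (h.flow τ (u, p)) (h.flow τ (u, p')) u) fun u _ => h.abs_quot_le _ _ _
  exact (le_abs_self _).trans this

/-- The derivative of `S` along the flow. -/
lemma continuous_flowDeriv : Continuous fun q : ℝ × ℝ => dr S (h.flow τ q, q.1) :=
  h.continuous_dr.comp (h.continuous_flow.prodMk continuous_fst)

lemma hasDerivAt_flow_param (q : ℝ × ℝ) : HasDerivAt (fun p => h.flow τ (q.1, p))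
    (τ * (1 - S (τ * q.2, τ * q.2))
      * exp (∫ u in (τ * q.2)..q.1, dr S (h.flow τ (u, q.2), u))) q.2 := by
  obtain ⟨t, p⟩ := q
  have hg : HasDerivAt (fun p' => τ * p' - h.flow τ (τ * p', p)) (τ * (1 - S (τ * p, τ * p))) p := by
    have h1 := (h.hasDerivAt_flow (τ := τ) (τ * p, p)).comp p ((hasDerivAt_id p).const_mul τ)
    refine (((hasDerivAt_id p).const_mul τ).sub h1).congr_deriv ?_
    simp only [flow_diag]
    ring
  have cE : Continuous fun p' =>
      exp (∫ u in (τ * p')..t, quot S (h.flow τ (u, p)) (h.flow τ (u, p')) u) := by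
    have c1 : Continuous (fun p' u => quot S (h.flow τ (u, p)) (h.flow τ (u, p')) u).uncurry :=
      h.continuous_quot.comp (((h.continuous_flow_left p).comp continuous_snd).prodMk
        ((h.continuous_flow.comp continuous_swap).prodMk continuous_snd))
    have c2 := intervalIntegral.continuous_parametric_intervalIntegral_of_continuous (μ := volume)
      (a₀ := t) c1 (continuous_const_mul τ)
    refine continuous_exp.comp (c2.neg.congr fun p' => ?_)
    rw [intervalIntegral.integral_symm]
    simp
  rw [hasDerivAt_iff_tendsto_slope] at hg ⊢
  have h2 := hg.mul ((cE.tendsto p).mono_left nhdsWithin_le_nhds)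
  have e : ∀ x u, quot S x x u = dr S (x, u) := fun x u => by simp [quot]
  simp only [e] at h2
  refine h2.congr fun p' => ?_
  simp only [slope_def_field, flow_diag, sub_self, sub_zero]
  rw [h.flow_sub t p p']
  ring

lemma contDiff_flow : ContDiff ℝ n (h.flow τ) := by
  suffices H : ∀ j ≤ n, ContDiff ℝ j (h.flow τ) from H n le_rfl
  intro j
  induction j with
  | zero => exact fun _ => by exact_mod_cast contDiff_zero.2 h.continuous_flow
  | succ j ih =>
    intro hj
    have hX := ih (by omega)
    have hS : ContDiff ℝ (j + 1 : ℕ) S := h.cd.of_nat hj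
    have hF : ContDiff ℝ j fun q : ℝ × ℝ => dr S (h.flow τ q, q.1) :=
      (contDiff_dr hS).comp (hX.prodMk contDiff_fst)
    have hS' : ContDiff ℝ j S := hS.of_nat (Nat.le_succ j)
    have hP := contDiff_prim hF
    have hd : ContDiff ℝ j fun q : ℝ × ℝ => (τ * q.2, τ * q.2) :=
      (contDiff_const.mul contDiff_snd).prodMk (contDiff_const.mul contDiff_snd)
    have hd' : ContDiff ℝ j fun q : ℝ × ℝ => (τ * q.2, q.2) :=
      (contDiff_const.mul contDiff_snd).prodMk contDiff_snd
    refine contDiff_succ_of_partial (g₂ := fun q => τ * (1 - S (τ * q.2, τ * q.2))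
        * exp (prim (fun q => dr S (h.flow τ q, q.1)) q
          - prim (fun q => dr S (h.flow τ q, q.1)) (τ * q.2, q.2))) (hS'.comp (hX.prodMk contDiff_fst))
      ((contDiff_const.mul (contDiff_const.sub (hS'.comp hd))).mul (hP.sub (hP.comp hd')).exp)
      h.hasDerivAt_flow fun q => (h.hasDerivAt_flow_param q).congr_deriv ?_
    have c : Continuous fun u => dr S (h.flow τ (u, q.2), u) :=
      h.continuous_flowDeriv.comp (continuous_id.prodMk continuous_const)
    have := intervalIntegral.integral_interval_sub_left (μ := volume)
      (c.intervalIntegrable 0 q.1) (c.intervalIntegrable 0 (τ * q.2))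
    simp only [prim]
    rw [this]

end FlowField

/-! ### Construction of the coordinates `ξ` -/

/-- The linear map `(u, v) ↦ (J u + s v, v)`. -/
def shear (J s : ℝ) (hJ : J ≠ 0) : Plane ≃L[ℝ] Plane :=
  LinearEquiv.toContinuousLinearEquiv
    { toFun := fun u => ![J * u 0 + s * u 1, u 1]
      invFun := fun v => ![(v 0 - s * v 1) / J, v 1]
      map_add' := fun u v => by ext i; fin_cases i <;> simp; ring
      map_smul' := fun c u => by ext i; fin_cases i <;> simp; ring
      left_inv := fun u => by ext i; fin_cases i <;> simp; field_simp
      right_inv := fun u => by ext i; fin_cases i <;> simp; field_simp; ring }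

lemma shear_apply {J s : ℝ} (hJ : J ≠ 0) (u : Plane) : shear J s hJ u = ![J * u 0 + s * u 1, u 1] := rfl

lemma contDiff_pair {n : WithTop ℕ∞} {F : Type*} [NormedAddCommGroup F] [NormedSpace ℝ F] {f g : F → ℝ}
    (hf : ContDiff ℝ n f) (hg : ContDiff ℝ n g) : ContDiff ℝ n fun x => (![f x, g x] : Plane) :=
  contDiff_pi.2 fun i => by fin_cases i <;> simpa

lemma isOpen_unitDisc : IsOpen unitDisc := by
  have : Continuous fun x : Plane => x 0 ^ 2 + x 1 ^ 2 := by fun_prop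
  exact isOpen_lt this continuous_const

lemma exists_flowField {n : ℕ} (hn : 1 ≤ n) {s : Plane → ℝ} (hs : ContDiffOn ℝ n s unitDisc)
    (hb : ∀ x ∈ unitDisc, |s x| ≤ 1 / 2) : ∃ S L, FlowField n S L ∧
      ∀ x : Plane, |x 0| ≤ 1 / 4 → |x 1| ≤ 1 / 4 → S (x 0, x 1) = s x := by
  have hK : IsCompact (Icc (fun _ => -(1 / 4)) (fun _ => 1 / 4) : Set Plane) := isCompact_Icc
  obtain ⟨χ, cχ, h1, hχ, L, hL, hLV, h0⟩ := exists_cutoff hK isOpen_unitDisc fun x hx => by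
    have a0 := abs_le.2 ⟨hx.1 0, hx.2 0⟩
    have a1 := abs_le.2 ⟨hx.1 1, hx.2 1⟩
    change x 0 ^ 2 + x 1 ^ 2 < 1
    nlinarith [sq_abs (x 0), sq_abs (x 1), abs_nonneg (x 0), abs_nonneg (x 1)]
  have c1 := contDiff_cutoff_mul (cχ.of_le (by exact_mod_cast le_top)) isOpen_unitDisc hL hLV h0 hs
  have c2 : ContDiff ℝ n fun z : ℝ × ℝ => (χ * s) ![z.1, z.2] :=
    c1.comp (contDiff_pair contDiff_fst contDiff_snd)
  have z0 : ∀ z : ℝ × ℝ, 1 ≤ |z.1| ∨ 1 ≤ |z.2| → (χ * s) ![z.1, z.2] = 0 := fun z hz => by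
    rw [Pi.mul_apply, h0, zero_mul]
    intro hx
    have h2 : z.1 ^ 2 + z.2 ^ 2 < 1 := by simpa [unitDisc] using hLV hx
    rcases hz with hz | hz
    · nlinarith [sq_abs z.1, sq_nonneg z.2]
    · nlinarith [sq_abs z.2, sq_nonneg z.1]
  have cd : Continuous (dr fun z : ℝ × ℝ => (χ * s) ![z.1, z.2]) :=
    (contDiff_dr (c2.of_nat hn)).continuous
  obtain ⟨C, hC⟩ := (isCompact_Icc (a := (-1 : ℝ))).prod (isCompact_Icc (a := (-1 : ℝ)))
    |>.exists_bound_of_continuousOn cd.continuousOn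
  refine ⟨_, max C 0, ⟨hn, c2, fun z => ?_, fun z hz => z0 z (Or.inr hz), fun z => ?_⟩, fun x hx0 hx1 => ?_⟩
  · rw [Pi.mul_apply, abs_mul, abs_of_nonneg (hχ _).1]
    by_cases hz : (![z.1, z.2] : Plane) ∈ unitDisc
    · nlinarith [hb _ hz, (hχ ![z.1, z.2]).1, (hχ ![z.1, z.2]).2, abs_nonneg (s ![z.1, z.2])]
    · rw [h0 _ fun h => hz (hLV h)]
      norm_num
  · by_cases hz : z ∈ Icc (-1 : ℝ) 1 ×ˢ Icc (-1 : ℝ) 1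
    · exact (hC z hz).trans (le_max_left _ _)
    · have ho : IsOpen {z : ℝ × ℝ | 1 < |z.1| ∨ 1 < |z.2|} :=
        IsOpen.union (s₁ := {z : ℝ × ℝ | 1 < |z.1|}) (s₂ := {z : ℝ × ℝ | 1 < |z.2|})
          (isOpen_lt continuous_const (by fun_prop)) (isOpen_lt continuous_const (by fun_prop))
      have hz' : z ∈ {z : ℝ × ℝ | 1 < |z.1| ∨ 1 < |z.2|} := by
        by_contra hcon
        simp only [Set.mem_ofPred_eq, not_or, not_lt] at hcon
        exact hz ⟨abs_le.1 hcon.1, abs_le.1 hcon.2⟩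
      have := dr_congr_on ho (f := fun z : ℝ × ℝ => (χ * s) ![z.1, z.2]) (g := fun _ => 0)
        (fun z hz => z0 z (hz.imp le_of_lt le_of_lt)) z hz'
      rw [this]
      simp [dr]
  · have hx : x ∈ (Icc (fun _ => -(1 / 4)) (fun _ => 1 / 4) : Set Plane) := by
      constructor <;> intro i <;> fin_cases i
      exacts [(abs_le.1 hx0).1, (abs_le.1 hx1).1, (abs_le.1 hx0).2, (abs_le.1 hx1).2]
    have e : (![x 0, x 1] : Plane) = x := by ext i; fin_cases i <;> rfl
    have := h1.self_of_nhdsSet x hx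
    simp [e, this]

/-- Coordinates `ξ = (ξ¹(x), x²)` with `s ∂₁ξ¹ + ∂₂ξ¹ = 0`, given on the diagonal by
`ξ¹(t, t) = t / τ`. -/
theorem exists_chart {n : ℕ} (hn : 1 ≤ n) {s : Plane → ℝ} (hs : ContDiffOn ℝ n s unitDisc)
    (hb : ∀ x ∈ unitDisc, |s x| ≤ 1 / 2) {σ τ : ℝ} (hτ : 0 < τ) (hστ : σ * τ ≤ 1 / 10) :
    ∃ ξ : OpenPartialHomeomorph Plane Plane, ξ.source ⊆ unitDisc ∧
      ContDiffOn ℝ n ξ ξ.source ∧ ContDiffOn ℝ n ξ.symm ξ.target ∧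
      {q : Plane | 0 ≤ q 0 ∧ q 0 ≤ σ ∧ 0 ≤ q 1 ∧ q 1 ≤ q 0 * τ} ⊆ ξ.target ∧
      (∀ x ∈ ξ.source, ξ x 1 = x 1) ∧
      (∀ x ∈ ξ.source, s x * pd 0 (comp0 ξ) x + pd 1 (comp0 ξ) x = 0) ∧
      (∀ t ∈ Icc 0 (σ * τ), ![t, t] ∈ ξ.source ∧ ξ ![t, t] 0 = t / τ) := by
  obtain ⟨S, L, hF, hSs⟩ := exists_flowField hn hs hb
  let J : ℱ := fun q => τ * (1 - S (τ * q.2, τ * q.2))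
      * Real.exp (∫ u in (τ * q.2)..q.1, dr S (hF.flow τ (u, q.2), u))
  have J0 : ∀ q, 0 < J q := fun q => by
    have := (abs_le.1 (hF.half (τ * q.2, τ * q.2))).2
    have h1 : 0 < 1 - S (τ * q.2, τ * q.2) := by linarith
    positivity
  have cX : ContDiff ℝ n (hF.flow τ) := hF.contDiff_flow
  have cX1 : ContDiff ℝ (1 : ℕ) (hF.flow τ) := cX.of_nat hn
  have dX : ∀ z : ℝ × ℝ, HasFDerivAt (hF.flow τ) (S (hF.flow τ z, z.1) • ContinuousLinearMap.fst ℝ ℝ ℝ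
      + J z • ContinuousLinearMap.snd ℝ ℝ ℝ) z := by
    have e1 : dθ (hF.flow τ) = J := funext fun q => (hF.hasDerivAt_flow_param q).deriv
    refine hasFDerivAt_of_partial (hF.cd.continuous.comp (cX.continuous.prodMk continuous_fst)) ?_
      hF.hasDerivAt_flow hF.hasDerivAt_flow_param
    rw [← e1]
    exact (contDiff_dθ cX1).continuous
  let Ξ : Plane → Plane := fun q => ![hF.flow τ (q 1, q 0), q 1]
  have cΞ : ContDiff ℝ n Ξ :=
    contDiff_pair (cX.comp ((contDiff_apply ℝ ℝ 1).prodMk (contDiff_apply ℝ ℝ 0))) (contDiff_apply ℝ ℝ 1)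
  have dΞ : ∀ q, HasFDerivAt Ξ
      (shear (J (q 1, q 0)) (S (hF.flow τ (q 1, q 0), q 1)) (J0 _).ne' : Plane →L[ℝ] Plane) q := fun q => by
    refine hasFDerivAt_pi'.2 fun i => ?_
    have p0 := hasFDerivAt_apply (𝕜 := ℝ) (0 : Fin 2) q
    have p1 := hasFDerivAt_apply (𝕜 := ℝ) (1 : Fin 2) q
    fin_cases i
    · refine ((dX (q 1, q 0)).comp q (p1.prodMk p0)).congr_fderiv ?_
      ext u
      simp [shear_apply]
      ring
    · refine p1.congr_fderiv ?_
      ext u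
      simp [shear_apply]
  have sΞ : ∀ q, HasStrictFDerivAt Ξ
      (shear (J (q 1, q 0)) (S (hF.flow τ (q 1, q 0), q 1)) (J0 _).ne' : Plane →L[ℝ] Plane) q := fun q =>
    cΞ.contDiffAt.hasStrictFDerivAt' (dΞ q) (by exact_mod_cast (by omega : n ≠ 0))
  have inj : Function.Injective Ξ := fun q q' h => by
    have h1 : q 1 = q' 1 := congrFun h 1
    have h0 : hF.flow τ (q 1, q 0) = hF.flow τ (q' 1, q' 0) := congrFun h 0
    rw [← h1] at h0
    have hm : StrictMono fun p => hF.flow τ (q 1, p) := strictMono_of_deriv_pos fun p => by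
      rw [(hF.hasDerivAt_flow_param (q 1, p)).deriv]
      exact J0 _
    ext i
    fin_cases i
    exacts [hm.injective h0, h1]
  have emb : IsOpenEmbedding Ξ := .of_continuous_injective_isOpenMap cΞ.continuous inj
    (isOpenMap_of_hasStrictFDerivAt_equiv sΞ)
  let W : Set Plane := {x | |x 0| < 1 / 4 ∧ |x 1| < 1 / 4}
  have hW : IsOpen W := IsOpen.inter (s := {x : Plane | |x 0| < 1 / 4})
    (t := {x : Plane | |x 1| < 1 / 4}) (isOpen_lt (by fun_prop) continuous_const)
    (isOpen_lt (by fun_prop) continuous_const)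
  have hW' : IsOpen (Ξ ⁻¹' W) := hW.preimage cΞ.continuous
  have hWD : W ⊆ unitDisc := fun x hx => by
    change x 0 ^ 2 + x 1 ^ 2 < 1
    nlinarith [sq_abs (x 0), sq_abs (x 1), abs_nonneg (x 0), abs_nonneg (x 1), hx.1, hx.2]
  let ξ : OpenPartialHomeomorph Plane Plane := ((emb.toOpenPartialHomeomorph Ξ).restrOpen (Ξ ⁻¹' W) hW').symm
  have htar : ξ.target = Ξ ⁻¹' W := by simp [ξ]
  have hsymm : ∀ q, ξ.symm q = Ξ q := fun q => rfl
  have hinv : ∀ x ∈ ξ.source, Ξ (ξ x) = x := fun x hx => ξ.left_inv hx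
  have hmem : ∀ x ∈ ξ.source, x ∈ W := fun x hx => by
    have := ξ.map_source hx
    rw [htar, mem_preimage, hinv x hx] at this
    exact this
  have htri : {q : Plane | 0 ≤ q 0 ∧ q 0 ≤ σ ∧ 0 ≤ q 1 ∧ q 1 ≤ q 0 * τ} ⊆ ξ.target := fun q hq => by
    obtain ⟨h0, h1, h2, h3⟩ := hq
    have h4 : q 0 * τ ≤ 1 / 10 := (mul_le_mul_of_nonneg_right h1 hτ.le).trans hστ
    have key := convex_univ.norm_image_sub_le_of_norm_hasDerivWithin_le (C := 1 / 2)
      (f := fun t => hF.flow τ (t, q 0)) (fun t _ => (hF.hasDerivAt_flow (t, q 0)).hasDerivWithinAt)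
      (fun t _ => hF.half _) (mem_univ (τ * q 0)) (mem_univ (q 1))
    simp only [hF.flow_diag, Real.norm_eq_abs] at key
    have h5 : |q 1 - τ * q 0| ≤ 1 / 10 := abs_le.2 ⟨by linarith, by linarith⟩
    rw [htar]
    refine ⟨?_, ?_⟩
    · change |hF.flow τ (q 1, q 0)| < 1 / 4
      have h6 := abs_le.1 (key.trans (mul_le_mul_of_nonneg_left h5 (by norm_num)))
      have h7 : 0 ≤ τ * q 0 := by positivity
      exact abs_lt.2 ⟨by linarith [h6.1], by linarith [h6.2]⟩
    · change |q 1| < 1 / 4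
      exact abs_lt.2 ⟨by linarith, by linarith⟩
  have cξ : ContDiffOn ℝ n ξ ξ.source := fun x hx =>
    (OpenPartialHomeomorph.contDiffAt_symm ξ.symm (f₀' := shear _ _ (J0 _).ne') hx (dΞ (ξ x))
      cΞ.contDiffAt).contDiffWithinAt
  refine ⟨ξ, fun x hx => hWD (hmem x hx), cξ, cΞ.contDiffOn, htri, fun x hx => ?_, fun x hx => ?_,
    fun t ht => ?_⟩
  · exact congrFun (hinv x hx) 1
  · have hx' := hmem x hx
    set q := ξ x with hq
    have hqx : Ξ q = x := hinv x hx
    have hf : DifferentiableAt ℝ (comp0 ξ) x := by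
      have := ((cξ.contDiffAt (ξ.open_source.mem_nhds hx)).differentiableAt
        (by exact_mod_cast (by omega : n ≠ 0)))
      exact (differentiableAt_pi.1 this) 0
    have h1 : HasFDerivAt (comp0 ξ ∘ Ξ) _ q :=
      (show HasFDerivAt (comp0 ξ) (fderiv ℝ (comp0 ξ) x) (Ξ q) by rw [hqx]; exact hf.hasFDerivAt).comp q (dΞ q)
    have h2 : comp0 ξ ∘ Ξ =ᶠ[𝓝 q] fun q => q 0 := by
      filter_upwards [ξ.open_target.mem_nhds (ξ.map_source hx)] with p hp
      exact congrFun (ξ.right_inv hp) 0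
    have h3 := (h1.congr_of_eventuallyEq h2.symm).unique (hasFDerivAt_apply (0 : Fin 2) q)
    have h4 := DFunLike.congr_fun h3 (Pi.single 1 1)
    have e : shear (J (q 1, q 0)) (S (hF.flow τ (q 1, q 0), q 1)) (J0 _).ne' (Pi.single 1 1)
        = s x • Pi.single 0 1 + Pi.single 1 1 := by
      have h5 : S (hF.flow τ (q 1, q 0), q 1) = s x := by
        rw [← hSs x hx'.1.le hx'.2.le, ← hqx]
        rfl
      rw [shear_apply, h5]
      ext i
      fin_cases i <;> simp
    simp only [ContinuousLinearMap.comp_apply, ContinuousLinearEquiv.coe_coe, e, map_add, map_smul] at h4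
    simpa [pd] using h4
  · have hq : (![t / τ, t] : Plane) ∈ ξ.target := htri ⟨by simpa using div_nonneg ht.1 hτ.le,
      by simpa using (div_le_iff₀ hτ).2 ht.2, by simpa using ht.1, by simp [hτ.ne']⟩
    have hΞ : ξ.symm ![t / τ, t] = ![t, t] := by
      have := hF.flow_diag (τ := τ) (t / τ)
      rw [mul_div_cancel₀ _ hτ.ne'] at this
      simp [hsymm, Ξ, this]
    have h1 := ξ.map_target hq
    have h2 := ξ.right_inv hq
    rw [hΞ] at h1 h2
    exact ⟨h1, by rw [h2]; rfl⟩

/-! ### The geometric data near the origin -/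

lemma contDiffAt_pd {n : ℕ} {f : Plane → ℝ} {x : Plane} (hf : ContDiffAt ℝ (n + 1 : ℕ) f x) (i : Fin 2) :
    ContDiffAt ℝ n (pd i f) x :=
  (hf.fderiv_right (m := (n : ℕ)) (by norm_cast)).clm_apply contDiffAt_const

lemma pd_comm {f : Plane → ℝ} {x : Plane} (hf : ContDiffAt ℝ (2 : ℕ) f x) (i j : Fin 2) :
    pd i (pd j f) x = pd j (pd i f) x := by
  have h := hf.isSymmSndFDerivAt (by simp)
  have hd : DifferentiableAt ℝ (fderiv ℝ f) x :=
    (hf.fderiv_right (m := (1 : ℕ)) (by norm_cast)).differentiableAt (by norm_num)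
  have key : ∀ i j, pd i (pd j f) x = fderiv ℝ (fderiv ℝ f) x (Pi.single i 1) (Pi.single j 1) := by
    intro i j
    have := hd.hasFDerivAt.clm_apply (hasFDerivAt_const (Pi.single j 1 : Plane) x)
    change fderiv ℝ (fun y => fderiv ℝ f y (Pi.single j 1)) x (Pi.single i 1) = _
    rw [this.fderiv]
    simp
  rw [key, key]
  exact h _ _

lemma pd_congr {f g : Plane → ℝ} {x : Plane} (h : f =ᶠ[𝓝 x] g) (i : Fin 2) :
    pd i f =ᶠ[𝓝 x] pd i g := by
  filter_upwards [h.eventuallyEq_nhds] with y hy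
  simp only [pd, hy.fderiv_eq]

section Regularity

variable {n : ℕ} {g : Metric2} {x : Plane}

lemma contDiffAt_det (hg : ∀ i j, ContDiffAt ℝ n (fun y => g y i j) x) :
    ContDiffAt ℝ n (fun y => (g y).det) x := by
  simp only [Matrix.det_fin_two]
  exact ((hg 0 0).mul (hg 1 1)).sub ((hg 0 1).mul (hg 1 0))

lemma contDiffAt_inv (hg : ∀ i j, ContDiffAt ℝ n (fun y => g y i j) x) (h0 : (g x).det ≠ 0)
    (i j : Fin 2) : ContDiffAt ℝ n (fun y => (g y)⁻¹ i j) x := by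
  have h1 := (contDiffAt_det hg).inv h0
  have h2 : ContDiffAt ℝ n (fun y => (g y).adjugate i j) x := by
    fin_cases i <;> fin_cases j <;> simp only [Matrix.adjugate_fin_two] <;> simp <;>
      first | exact hg _ _ | exact (hg _ _).neg
  simp only [Matrix.inv_def, Ring.inverse_eq_inv', Matrix.smul_apply, smul_eq_mul]
  exact h1.mul h2

lemma contDiffAt_christoffel (hg : ∀ i j, ContDiffAt ℝ (n + 1 : ℕ) (fun y => g y i j) x)
    (h0 : (g x).det ≠ 0) (k i j : Fin 2) : ContDiffAt ℝ n (christoffel g k i j) x := by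
  unfold christoffel
  refine contDiffAt_const.mul (ContDiffAt.sum fun l _ => (contDiffAt_inv
    (fun i j => (hg i j).of_le (by norm_cast; omega)) h0 k l).mul ?_)
  exact ((contDiffAt_pd (hg j l) i).add (contDiffAt_pd (hg i l) j)).sub (contDiffAt_pd (hg i j) l)

lemma contDiffAt_gaussCurvature (hg : ∀ i j, ContDiffAt ℝ (n + 2 : ℕ) (fun y => g y i j) x)
    (h0 : (g x).det ≠ 0) : ContDiffAt ℝ n (gaussCurvature g) x := by
  have hg' : ∀ i j, ContDiffAt ℝ n (fun y => g y i j) x := fun i j => (hg i j).of_le (by norm_cast; omega)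
  have hc : ∀ k i j, ContDiffAt ℝ (n + 1 : ℕ) (christoffel g k i j) x :=
    contDiffAt_christoffel hg h0
  have hc' : ∀ k i j, ContDiffAt ℝ n (christoffel g k i j) x :=
    fun k i j => (hc k i j).of_le (by norm_cast; omega)
  unfold gaussCurvature
  refine (ContDiffAt.sum fun l _ => (hg' 0 l).mul ?_).div (contDiffAt_det hg') h0
  unfold riemann
  exact ((contDiffAt_pd (hc _ _ _) _).sub (contDiffAt_pd (hc _ _ _) _)).add
    (ContDiffAt.sum fun q _ => ((hc' _ _ _).mul (hc' _ _ _)).sub ((hc' _ _ _).mul (hc' _ _ _)))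

lemma contDiffAt_pullback {Ψ : Plane → Plane} (hΨ : ContDiffAt ℝ (n + 1 : ℕ) Ψ x)
    (hg : ∀ i j, ContDiffAt ℝ (n + 1 : ℕ) (fun y => g y i j) (Ψ x)) (i j : Fin 2) :
    ContDiffAt ℝ n (fun y => pullback Ψ g y i j) x := by
  have hΨ' : ∀ a, ContDiffAt ℝ (n + 1 : ℕ) (fun q => Ψ q a) x := fun a => contDiffAt_pi.1 hΨ a
  simp only [pullback, Matrix.of_apply]
  refine ContDiffAt.sum fun a _ => ContDiffAt.sum fun b _ =>
    (ContDiffAt.mul ?_ (contDiffAt_pd (hΨ' a) i)).mul (contDiffAt_pd (hΨ' b) j)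
  exact ((hg a b).comp x hΨ).of_le (by norm_cast; omega)

lemma det_pullback {Ψ : Plane → Plane} (hΨ : DifferentiableAt ℝ Ψ x) :
    (pullback Ψ g x).det = (fderiv ℝ Ψ x).det ^ 2 * (g (Ψ x)).det := by
  have hd : (fderiv ℝ Ψ x).det = pd 0 (fun q => Ψ q 0) x * pd 1 (fun q => Ψ q 1) x -
      pd 1 (fun q => Ψ q 0) x * pd 0 (fun q => Ψ q 1) x := by
    have h : ∀ i a, pd i (fun q => Ψ q a) x = fderiv ℝ Ψ x (Pi.single i 1) a := fun i a => by
      have := (hasFDerivAt_apply a (Ψ x)).comp x hΨ.hasFDerivAt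
      simp only [pd]
      rw [show (fun q => Ψ q a) = (fun y : Plane => y a) ∘ Ψ from rfl, this.fderiv]
      simp
    rw [ContinuousLinearMap.det, ← LinearMap.det_toMatrix', Matrix.det_fin_two]
    simp [LinearMap.toMatrix'_apply, h]
  rw [hd, Matrix.det_fin_two, Matrix.det_fin_two]
  simp only [pullback, Matrix.of_apply, Fin.sum_univ_two]
  ring

end Regularity

lemma hasFDerivAt_eval_mvPolynomial (p : MvPolynomial (Fin 2) ℝ) (y : Plane) :
    HasFDerivAt (fun y => MvPolynomial.eval y p)
      (∑ i, MvPolynomial.eval y (MvPolynomial.pderiv i p) •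
        ContinuousLinearMap.proj (R := ℝ) (φ := fun _ : Fin 2 => ℝ) i) y := by
  induction p using MvPolynomial.induction_on with
  | C c => simpa using hasFDerivAt_const c y
  | add p q hp hq =>
    simp only [map_add, add_smul, Finset.sum_add_distrib]
    exact hp.add hq
  | mul_X p j hp =>
    simp only [map_mul, MvPolynomial.eval_X]
    refine (hp.mul (hasFDerivAt_apply j y)).congr_fderiv ?_
    ext u
    fin_cases j <;> simp [MvPolynomial.pderiv_X, Pi.single_apply] <;> ring

lemma pd_eval_mvPolynomial (p : MvPolynomial (Fin 2) ℝ) (i : Fin 2) :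
    pd i (fun y => MvPolynomial.eval y p) = fun y => MvPolynomial.eval y (MvPolynomial.pderiv i p) := by
  funext y
  simp only [pd, (hasFDerivAt_eval_mvPolynomial p y).fderiv]
  fin_cases i <;> simp

lemma eval_zero_of_isHomogeneous {p : MvPolynomial (Fin 2) ℝ} {n : ℕ} (hp : p.IsHomogeneous n)
    (hn : n ≠ 0) : MvPolynomial.eval (0 : Plane) p = 0 := by
  rw [MvPolynomial.eval_zero, MvPolynomial.constantCoeff_eq]
  exact hp.coeff_eq_zero (by simpa using hn.symm)

/-- The approximate solution as a polynomial. -/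
def approxMvPolynomial (a : ℝ) (ms : ℕ) (p : ℕ → MvPolynomial (Fin 2) ℝ) : MvPolynomial (Fin 2) ℝ :=
  MvPolynomial.C (a / 2) * (MvPolynomial.X 0 * MvPolynomial.X 0) + ∑ n ∈ Finset.Icc 3 ms, p n

lemma approxPoly_eq (a : ℝ) (ms : ℕ) (p : ℕ → MvPolynomial (Fin 2) ℝ) :
    approxPoly a ms p = fun y => MvPolynomial.eval y (approxMvPolynomial a ms p) := by
  funext y
  simp [approxPoly, approxMvPolynomial, sq]

lemma contDiff_approxPoly (a : ℝ) (ms : ℕ) (p : ℕ → MvPolynomial (Fin 2) ℝ) (n : ℕ) :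
    ContDiff ℝ n (approxPoly a ms p) := by
  have : AnalyticOnNhd ℝ (approxPoly a ms p) univ := by
    rw [approxPoly_eq]
    exact AnalyticOnNhd.eval_mvPolynomial _
  exact contDiffOn_univ.1 this.contDiffOn_of_completeSpace

lemma pd_approxPoly_zero {a : ℝ} {ms : ℕ} {p : ℕ → MvPolynomial (Fin 2) ℝ}
    (hp : ∀ n, (p n).IsHomogeneous n) (i : Fin 2) : pd i (approxPoly a ms p) 0 = 0 := by
  rw [approxPoly_eq, pd_eval_mvPolynomial]
  simp only [approxMvPolynomial, map_add, map_sum]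
  rw [Finset.sum_eq_zero fun n hn => eval_zero_of_isHomogeneous (hp n).pderiv (by
    have := (Finset.mem_Icc.1 hn).1; omega)]
  fin_cases i <;> simp [MvPolynomial.pderiv_X]

lemma pd_pd_approxPoly_zero {a : ℝ} {ms : ℕ} {p : ℕ → MvPolynomial (Fin 2) ℝ}
    (hp : ∀ n, (p n).IsHomogeneous n) (i j : Fin 2) :
    pd i (pd j (approxPoly a ms p)) 0 = if i = 0 ∧ j = 0 then a else 0 := by
  rw [approxPoly_eq, pd_eval_mvPolynomial, pd_eval_mvPolynomial]
  simp only [approxMvPolynomial, map_add, map_sum]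
  rw [Finset.sum_eq_zero fun n hn => eval_zero_of_isHomogeneous (hp n).pderiv.pderiv (by
    have := (Finset.mem_Icc.1 hn).1; omega)]
  fin_cases i <;> fin_cases j <;> simp [MvPolynomial.pderiv_X]
  ring

/-- The properties, on a closed ball about the origin, of the curvature `κ`, the metric `G` and the
approximate solution `z₀` on which the analysis of the rescaled operator rests. -/
structure LocalGeometry (n : ℕ) (κ : Plane → ℝ) (G : Metric2) (z₀ : Plane → ℝ) (a ρ : ℝ)
    (V : Set Plane) : Prop where
  pos : 0 < ρ
  isOpen : IsOpen V
  ball : Metric.closedBall 0 ρ ⊆ V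
  cκ : ContDiffOn ℝ n κ V
  cdet : ContDiffOn ℝ n (fun y => (G y).det) V
  cinv : ∀ i j, ContDiffOn ℝ n (fun y => (G y)⁻¹ i j) V
  cΓ : ∀ k i j, ContDiffOn ℝ n (christoffel G k i j) V
  cz : ContDiff ℝ (n + 2 : ℕ) z₀
  det_pos : ∀ y ∈ V, 0 < (G y).det
  κ_zero : κ 0 = 0
  κ_nonneg : ∀ y ∈ V, 0 < y 1 → y 1 < y 0 → 0 ≤ κ y
  pd_zero : ∀ i, pd i z₀ 0 = 0
  pd_pd_zero : ∀ i j, pd i (pd j z₀) 0 = if i = 0 ∧ j = 0 then a else 0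

theorem exists_localGeometry {n : ℕ} {g : Metric2} (hg : IsMetricNearZero (n + 2) g)
    {Ψ : Plane → Plane} (hΨ : IsSectorChart (n + 2) g Ψ) {a : ℝ} {ms : ℕ}
    {p : ℕ → MvPolynomial (Fin 2) ℝ} (hp : ∀ n, (p n).IsHomogeneous n) :
    ∃ ρ V, LocalGeometry n (gaussCurvature g ∘ Ψ) (pullback Ψ g) (approxPoly a ms p) a ρ V := by
  obtain ⟨Ψ0, cΨ, dΨ, hpos, hray⟩ := hΨ
  have cΨ : ContDiffAt ℝ (n + 2 : ℕ) Ψ 0 := mod_cast cΨ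
  have hg1 : ∀ i j, ContDiffAt ℝ (n + 2 : ℕ) (fun y => g y i j) (Ψ 0) := by
    rw [Ψ0]; exact fun i j => mod_cast hg.1 i j
  have dg : 0 < (g (Ψ 0)).det := by rw [Ψ0]; exact hg.2.self_of_nhds.det_pos
  have cG : ∀ i j, ContDiffAt ℝ (n + 1 : ℕ) (fun y => pullback Ψ g y i j) 0 :=
    contDiffAt_pullback (n := n + 1) cΨ hg1
  have cG' : ∀ i j, ContDiffAt ℝ n (fun y => pullback Ψ g y i j) 0 :=
    fun i j => (cG i j).of_le (by norm_cast; omega)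
  have dG : 0 < (pullback Ψ g 0).det := by
    rw [det_pullback (cΨ.differentiableAt (by norm_cast))]
    positivity
  have cκ : ContDiffAt ℝ n (gaussCurvature g ∘ Ψ) 0 :=
    (contDiffAt_gaussCurvature hg1 dg.ne').comp 0 (cΨ.of_le (by norm_cast; omega))
  have hn : (n : WithTop ℕ∞) ≠ ∞ := by exact_mod_cast ENat.natCast_ne_top n
  have e2 := (contDiffAt_det cG').eventually hn
  have e5 : ∀ᶠ y in 𝓝 (0 : Plane), 0 < (pullback Ψ g y).det :=
    (contDiffAt_det cG').continuousAt.eventually_const_lt dG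
  have e3 : ∀ᶠ y in 𝓝 (0 : Plane), ∀ i j, ContDiffAt ℝ n (fun y => (pullback Ψ g y)⁻¹ i j) y := by
    simp only [eventually_all]
    exact fun i j => (contDiffAt_inv cG' dG.ne' i j).eventually hn
  have e4 : ∀ᶠ y in 𝓝 (0 : Plane), ∀ k i j, ContDiffAt ℝ n (christoffel (pullback Ψ g) k i j) y := by
    simp only [eventually_all]
    exact fun k i j => (contDiffAt_christoffel cG dG.ne' k i j).eventually hn
  obtain ⟨r, hr, hball⟩ := Metric.eventually_nhds_iff_ball.1
    (((cκ.eventually hn).and e2).and ((e3.and e4).and (e5.and hpos)))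
  refine ⟨r / 2, Metric.ball 0 r, by positivity, Metric.isOpen_ball,
    Metric.closedBall_subset_ball (by linarith), fun y hy => (hball y hy).1.1.contDiffWithinAt,
    fun y hy => (hball y hy).1.2.contDiffWithinAt,
    fun i j y hy => ((hball y hy).2.1.1 i j).contDiffWithinAt,
    fun k i j y hy => ((hball y hy).2.1.2 k i j).contDiffWithinAt, contDiff_approxPoly _ _ _ _,
    fun y hy => (hball y hy).2.2.1, hray.self_of_nhds le_rfl (Or.inl rfl),
    fun y hy h1 h2 => ((hball y hy).2.2.2 h1 h2).le, pd_approxPoly_zero hp, pd_pd_approxPoly_zero hp⟩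

/-! ### The rescaled coefficients as families of functions on the unit disc -/

lemma abs_le_one_of_mem_unitDisc {x : Plane} (hx : x ∈ unitDisc) : ‖x‖ ≤ 1 := by
  rw [pi_norm_le_iff_of_nonneg zero_le_one]
  intro i
  have hx' : x 0 ^ 2 + x 1 ^ 2 < 1 := hx
  rw [norm_eq_abs, ← sq_le_one_iff_abs_le_one]
  fin_cases i
  · change x 0 ^ 2 ≤ 1
    nlinarith [sq_nonneg (x 1)]
  · change x 1 ^ 2 ≤ 1
    nlinarith [sq_nonneg (x 0)]

/-- Families of functions on the unit disc, indexed by pairs `(ε, w)`. -/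
def discDom (S : Set (ℝ × (Plane → ℝ))) : Dom S Plane :=
  ⟨fun i _ => Pi.single i 1, fun _ => unitDisc, fun _ => unitDisc, fun _ _ => contDiff_const, fun _ => isOpen_unitDisc,
    fun _ => subset_rfl⟩

/-- The pairs `(ε, w)` with `0 < ε ≤ min 1 ρ` and `w` admissible. -/
def params (ρ : ℝ) : Set (ℝ × (Plane → ℝ)) :=
  {q | 0 < q.1 ∧ q.1 ≤ 1 ∧ q.1 ≤ ρ ∧ IsAdmissible q.2}

section Families

variable {n M N : ℕ} {κ : Plane → ℝ} {G : Metric2} {z₀ : Plane → ℝ} {a ρ : ℝ} {V : Set Plane}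
  {S : Set (ℝ × (Plane → ℝ))}

lemma params_abs_le (hS : S ⊆ params ρ) (i : S) : |i.1.1| ≤ 1 := by
  rw [abs_of_pos (hS i.2).1]
  exact (hS i.2).2.1

lemma params_ne_zero (hS : S ⊆ params ρ) (i : S) : i.1.1 ≠ 0 := (hS i.2).1.ne'

lemma mem_ball_of_params (hS : S ⊆ params ρ) (i : S) {x : Plane} (hx : x ∈ unitDisc) :
    i.1.1 ^ 2 • x ∈ Metric.closedBall (0 : Plane) ρ := by
  obtain ⟨h0, h1, h2, -⟩ := hS i.2
  rw [mem_closedBall_zero_iff, norm_smul, norm_eq_abs, abs_of_pos (by positivity)]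
  nlinarith [abs_le_one_of_mem_unitDisc hx, norm_nonneg x]

lemma hasFDerivAt_sq_smul (ε : ℝ) (x : Plane) :
    HasFDerivAt (fun x : Plane => ε ^ 2 • x) (ε ^ 2 • ContinuousLinearMap.id ℝ Plane) x :=
  (ε ^ 2 • ContinuousLinearMap.id ℝ Plane).hasFDerivAt

/-- Fixed functions of `y`, as functions of `x = y / ε²`. -/
lemma FC_scaled (hS : S ⊆ params ρ) (hV : IsOpen V) (hVρ : Metric.closedBall 0 ρ ⊆ V) {f : Plane → ℝ}
    (hf : ContDiffOn ℝ M f V) (hNM : N ≤ M) :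
    (discDom S).FC M N fun i x => f (i.1.1 ^ 2 • x) := by
  let A : Dom S Plane := ⟨fun i _ => Pi.single i 1, fun _ => V, fun _ => Metric.closedBall 0 ρ,
    fun _ _ => contDiff_const, fun _ => hV, fun _ => hVρ⟩
  have hA : A.FC M N fun _ => f :=
    .of_contDiffOn (isCompact_closedBall 0 ρ) hV hVρ hf hNM (fun _ => subset_rfl) fun _ => subset_rfl
  refine hA.comp (B := discDom S) (c := fun j l i _ => if j = l then i.1.1 ^ 2 else 0)
    (fun i => (contDiff_const_smul (i.1.1 ^ 2)).contDiffOn) (fun i x hx => hVρ (mem_ball_of_params hS i hx))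
    (fun i x hx => mem_ball_of_params hS i hx) (fun j l => ?_) fun _ j i x _ => ?_
  · refine .const (Nat.sub_le_sub_right hNM 1) (C := 1) fun i => ?_
    split_ifs
    · rw [abs_pow]
      exact pow_le_one₀ (abs_nonneg _) (params_abs_le hS i)
    · simp
  · rw [(hasFDerivAt_sq_smul _ x).fderiv]
    simp [discDom, A]

lemma pd_scaled {f : Plane → ℝ} {ε : ℝ} {x : Plane} (hf : DifferentiableAt ℝ f (ε ^ 2 • x)) (j : Fin 2) :
    pd j (fun x => f (ε ^ 2 • x)) x = ε ^ 2 * pd j f (ε ^ 2 • x) := by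
  simp only [pd]
  rw [show (fun x => f (ε ^ 2 • x)) = f ∘ fun x => ε ^ 2 • x from rfl,
    (hf.hasFDerivAt.comp x (hasFDerivAt_sq_smul ε x)).fderiv]
  simp

/-- Fixed functions of `y` vanishing at the origin are, as functions of `x`, of the size `ε`. -/
lemma FC_scaled_div (hS : S ⊆ params ρ) (hV : IsOpen V) (hVρ : Metric.closedBall 0 ρ ⊆ V)
    {f : Plane → ℝ} (hf : ContDiffOn ℝ (M + 1 : ℕ) f V) (hNM : N ≤ M) (f0 : f 0 = 0) :
    (discDom S).FC (M + 1) (N + 1) fun i x => i.1.1⁻¹ * f (i.1.1 ^ 2 • x) := by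
  have hdiff : ∀ y ∈ V, DifferentiableAt ℝ f y := fun y hy =>
    (hf.contDiffAt (hV.mem_nhds hy)).differentiableAt (by norm_cast)
  have hcd : ∀ i : S, ContDiffOn ℝ (M + 1 : ℕ) (fun x => i.1.1⁻¹ * f (i.1.1 ^ 2 • x)) unitDisc :=
    fun i => contDiffOn_const.mul (hf.comp (contDiff_const_smul _).contDiffOn
      fun x hx => hVρ (mem_ball_of_params hS i hx))
  obtain ⟨C, hC⟩ := (isCompact_closedBall (0 : Plane) ρ).exists_bound_of_continuousOn
    ((hf.continuousOn_fderiv_of_isOpen hV (by norm_cast; omega)).mono hVρ)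
  have h0 : (discDom S).FC (M + 1) 0 fun i x => i.1.1⁻¹ * f (i.1.1 ^ 2 • x) := by
    refine ⟨Nat.zero_le _, hcd, C, fun i x hx => ?_⟩
    obtain ⟨e0, e1, e2, -⟩ := hS i.2
    have hy := mem_ball_of_params hS i hx
    have h := (convex_closedBall (0 : Plane) ρ).norm_image_sub_le_of_norm_fderiv_le
      (fun y hy => hdiff y (hVρ hy)) hC (Metric.mem_closedBall_self (e0.le.trans e2)) hy
    rw [f0, sub_zero, sub_zero, norm_smul, norm_eq_abs, norm_eq_abs,
      abs_of_pos (pow_pos e0 2)] at h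
    have hC0 : 0 ≤ C := (norm_nonneg _).trans (hC _ hy)
    rw [abs_mul, abs_inv, abs_of_pos e0]
    calc i.1.1⁻¹ * |f (i.1.1 ^ 2 • x)| ≤ i.1.1⁻¹ * (C * (i.1.1 ^ 2 * 1)) := by
          gcongr
          exact h.trans (by gcongr; exact abs_le_one_of_mem_unitDisc hx)
      _ = C * i.1.1 := by field_simp
      _ ≤ C := by nlinarith
  refine h0.of_d (f' := fun j i x => i.1.1 * pd j f (i.1.1 ^ 2 • x)) (fun j => ?_) fun j i x hx => ?_
  · exact (Dom.FC.const hNM (params_abs_le hS)).mul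
      (FC_scaled hS hV hVρ (Dom.FC.contDiffOn_d (A := discDom S) hV hf j) hNM)
  · have hd := hdiff _ (hVρ (mem_ball_of_params hS i hx))
    have h1 := pd_scaled hd j
    have h2 : DifferentiableAt ℝ (fun x : Plane => f (i.1.1 ^ 2 • x)) x :=
      hd.comp x (hasFDerivAt_sq_smul _ x).differentiableAt
    change fderiv ℝ (fun x => i.1.1⁻¹ * f (i.1.1 ^ 2 • x)) x (Pi.single j 1) = _
    rw [fderiv_const_mul h2, _root_.smul_apply, smul_eq_mul]
    rw [show fderiv ℝ (fun x => f (i.1.1 ^ 2 • x)) x (Pi.single j 1) = _ from h1]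
    have := params_ne_zero hS i
    field_simp

lemma contDiffOn_pd_iterate {f : Plane → ℝ} (hf : ContDiffOn ℝ ∞ f unitDisc) (j : Fin 2) (k : ℕ) :
    ContDiffOn ℝ ∞ ((pd j)^[k] f) unitDisc := by
  induction k generalizing f with
  | zero => exact hf
  | succ k ih => exact ih ((hf.fderiv_of_isOpen isOpen_unitDisc (by simp)).clm_apply contDiffOn_const)

lemma pd_one_iterate_pd_zero {f : Plane → ℝ} (hf : ContDiffOn ℝ ∞ f unitDisc) (k : ℕ) :
    EqOn (pd 1 ((pd 0)^[k] f)) ((pd 0)^[k] (pd 1 f)) unitDisc := by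
  induction k with
  | zero => exact fun _ _ => rfl
  | succ k ih =>
    intro x hx
    simp only [iterate_succ', comp_apply]
    rw [pd_comm (((contDiffOn_pd_iterate hf 0 k).contDiffAt (isOpen_unitDisc.mem_nhds hx)).of_le
      (WithTop.coe_le_coe.2 le_top))]
    exact (pd_congr (ih.eventuallyEq_of_mem (isOpen_unitDisc.mem_nhds hx)) 0).self_of_nhds

lemma FC_admissible_aux (hS : S ⊆ params ρ) {N k l : ℕ} (h : N + (k + l) ≤ 4) (hNM : N ≤ M) :
    (discDom S).FC M N fun i => (pd 0)^[k] ((pd 1)^[l] i.1.2) := by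
  have cd : ∀ i : S, ContDiffOn ℝ ∞ ((pd 0)^[k] ((pd 1)^[l] i.1.2)) unitDisc := fun i =>
    contDiffOn_pd_iterate (contDiffOn_pd_iterate (hS i.2).2.2.2.1 1 l) 0 k
  refine ⟨hNM, fun i => (cd i).of_le (by exact_mod_cast le_top), ?_⟩
  have key : ∀ {k l : ℕ}, k + l ≤ 4 → ∃ C, ∀ i : S, ∀ x ∈ unitDisc,
      |((pd 0)^[k] ((pd 1)^[l] i.1.2)) x| ≤ C := fun {k l} hkl => ⟨1, fun i x hx => by
    obtain ⟨c, hc, h⟩ := (hS i.2).2.2.2.2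
    exact (h x hx k l hkl).trans hc.le⟩
  clear cd hNM
  induction N generalizing k l with
  | zero => exact key (by omega)
  | succ N ih =>
    refine ⟨key (by omega), fun j => ?_⟩
    fin_cases j
    · have h : (discDom S).FB N fun i => pd 0 ((pd 0)^[k] ((pd 1)^[l] i.1.2)) := by
        simpa only [iterate_succ', comp_apply] using
          ih (k := k + 1) (by omega)
      exact h
    · refine (ih (k := k) (l := l + 1) (by omega)).congr fun i x hx => ?_
      simp only [iterate_succ', comp_apply]
      exact pd_one_iterate_pd_zero (contDiffOn_pd_iterate (hS i.2).2.2.2.1 1 l) k hx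

lemma FC_w (hS : S ⊆ params ρ) (hM : 4 ≤ M) : (discDom S).FC M 4 fun i => i.1.2 :=
  FC_admissible_aux hS (k := 0) (l := 0) le_rfl hM

lemma FC_pd_w (hS : S ⊆ params ρ) (hM : 3 ≤ M) (j : Fin 2) : (discDom S).FC M 3 fun i => pd j i.1.2 :=
  (FC_w hS (Nat.succ_le_succ hM)).d j

lemma FC_pd_pd_w (hS : S ⊆ params ρ) (hM : 2 ≤ M) (j k : Fin 2) :
    (discDom S).FC M 2 fun i => pd j (pd k i.1.2) :=
  (FC_pd_w hS (Nat.succ_le_succ hM) k).d j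

/-- The function `z` of `y`, for `q = (ε, w)`. -/
abbrev zOf (z₀ : Plane → ℝ) (q : ℝ × (Plane → ℝ)) : Plane → ℝ := perturb q.1 z₀ q.2

lemma pd_perturb {ε : ℝ} {f : Plane → ℝ} {w : Plane → ℝ} {c : ℝ} {y : Plane}
    (hf : DifferentiableAt ℝ f y) (hw : DifferentiableAt ℝ w ((ε ^ 2)⁻¹ • y)) (j : Fin 2) :
    pd j (fun y => f y + c * w ((ε ^ 2)⁻¹ • y)) y = pd j f y + c / ε ^ 2 * pd j w ((ε ^ 2)⁻¹ • y) := by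
  have h1 : HasFDerivAt (fun y : Plane => (ε ^ 2)⁻¹ • y) ((ε ^ 2)⁻¹ • ContinuousLinearMap.id ℝ Plane) y :=
    ((ε ^ 2)⁻¹ • ContinuousLinearMap.id ℝ Plane).hasFDerivAt
  have h2 := hf.hasFDerivAt.add ((hw.hasFDerivAt.comp y h1).const_mul c)
  change fderiv ℝ (fun y => f y + c * w ((ε ^ 2)⁻¹ • y)) y _ = _
  rw [show (fun y => f y + c * w ((ε ^ 2)⁻¹ • y)) =
    (f + fun y => c * (w ∘ fun y => (ε ^ 2)⁻¹ • y) y) from rfl, h2.fderiv]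
  simp [pd]
  ring


end Families

variable {n M N : ℕ} {κ : Plane → ℝ} {G : Metric2} {z₀ : Plane → ℝ} {a ρ : ℝ} {V : Set Plane}
  {S : Set (ℝ × (Plane → ℝ))}

lemma pd_zOf_eventually (hz : ContDiff ℝ (n + 2 : ℕ) z₀) (hS : S ⊆ params ρ) (i : S) {x : Plane}
    (hx : x ∈ unitDisc) (j : Fin 2) : pd j (zOf z₀ i.1) =ᶠ[𝓝 (i.1.1 ^ 2 • x)]
      fun y => pd j z₀ y + i.1.1 ^ 3 * pd j i.1.2 ((i.1.1 ^ 2)⁻¹ • y) := by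
  have hε := params_ne_zero hS i
  have ho : IsOpen ((fun y : Plane => (i.1.1 ^ 2)⁻¹ • y) ⁻¹' unitDisc) :=
    isOpen_unitDisc.preimage (continuous_const_smul _)
  have hm : i.1.1 ^ 2 • x ∈ (fun y : Plane => (i.1.1 ^ 2)⁻¹ • y) ⁻¹' unitDisc := by
    rwa [mem_preimage, inv_smul_smul₀ (pow_ne_zero 2 hε)]
  filter_upwards [ho.mem_nhds hm] with y hy
  have hw : DifferentiableAt ℝ i.1.2 ((i.1.1 ^ 2)⁻¹ • y) :=
    ((hS i.2).2.2.2.1.contDiffAt (isOpen_unitDisc.mem_nhds hy)).differentiableAt (by simp)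
  change pd j (fun y => z₀ y + i.1.1 ^ 5 * i.1.2 ((i.1.1 ^ 2)⁻¹ • y)) y = _
  rw [pd_perturb (hz.differentiable (by norm_cast) y) hw]
  congr 2
  field_simp

lemma pd_zOf (hz : ContDiff ℝ (n + 2 : ℕ) z₀) (hS : S ⊆ params ρ) (i : S) {x : Plane}
    (hx : x ∈ unitDisc) (j : Fin 2) :
    pd j (zOf z₀ i.1) (i.1.1 ^ 2 • x) = pd j z₀ (i.1.1 ^ 2 • x) + i.1.1 ^ 3 * pd j i.1.2 x := by
  rw [(pd_zOf_eventually hz hS i hx j).self_of_nhds]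
  beta_reduce
  rw [inv_smul_smul₀ (pow_ne_zero 2 (params_ne_zero hS i))]

lemma pd_pd_zOf (hz : ContDiff ℝ (n + 2 : ℕ) z₀) (hS : S ⊆ params ρ) (i : S) {x : Plane}
    (hx : x ∈ unitDisc) (j k : Fin 2) : pd j (pd k (zOf z₀ i.1)) (i.1.1 ^ 2 • x) =
      pd j (pd k z₀) (i.1.1 ^ 2 • x) + i.1.1 * pd j (pd k i.1.2) x := by
  have hε := params_ne_zero hS i
  have hx' : (i.1.1 ^ 2)⁻¹ • i.1.1 ^ 2 • x = x := inv_smul_smul₀ (pow_ne_zero 2 hε) x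
  rw [(pd_congr (pd_zOf_eventually hz hS i hx k) j).self_of_nhds, pd_perturb, hx']
  · congr 2
    field_simp
  · exact (contDiffAt_pd (n := n + 1) hz.contDiffAt k).differentiableAt (by norm_cast)
  · rw [hx']
    exact ((contDiffOn_pd_iterate (hS i.2).2.2.2.1 k 1).contDiffAt
      (isOpen_unitDisc.mem_nhds hx)).differentiableAt (by simp)

/-- The entries of the covariant Hessian of `z`, as functions of `x`. -/
def hess (G : Metric2) (z₀ : Plane → ℝ) (j k : Fin 2) (q : ℝ × (Plane → ℝ)) (x : Plane) : ℝ :=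
  covHess G (zOf z₀ q) (q.1 ^ 2 • x) j k

/-- The Hessian of `z` up to the term with the second derivatives of `w`. -/
def hessLow (G : Metric2) (z₀ : Plane → ℝ) (j k : Fin 2) (q : ℝ × (Plane → ℝ)) (x : Plane) : ℝ :=
  pd j (pd k z₀) (q.1 ^ 2 • x) -
    ∑ l, christoffel G l j k (q.1 ^ 2 • x) * (pd l z₀ (q.1 ^ 2 • x) + q.1 ^ 3 * pd l q.2 x)

lemma hess_eq (hz : ContDiff ℝ (n + 2 : ℕ) z₀) (hS : S ⊆ params ρ) (j k : Fin 2) (i : S) :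
    EqOn (hess G z₀ j k i.1) (fun x => hessLow G z₀ j k i.1 x + i.1.1 * pd j (pd k i.1.2) x)
      unitDisc := fun x hx => by
  simp only [hess, covHess, Matrix.of_apply, hessLow, pd_pd_zOf hz hS i hx, pd_zOf hz hS i hx]
  ring

lemma cof_one_one (ε : ℝ) (z : Plane → ℝ) (x : Plane) :
    cof G ε z 1 1 x = covHess G z (ε ^ 2 • x) 0 0 := by simp [cof, Matrix.adjugate_fin_two]

lemma cof_zero_zero (ε : ℝ) (z : Plane → ℝ) (x : Plane) :
    cof G ε z 0 0 x = covHess G z (ε ^ 2 • x) 1 1 := by simp [cof, Matrix.adjugate_fin_two]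

lemma cof_zero_one (ε : ℝ) (z : Plane → ℝ) (x : Plane) :
    cof G ε z 0 1 x = -covHess G z (ε ^ 2 • x) 0 1 := by simp [cof, Matrix.adjugate_fin_two]

lemma cof_one_zero (ε : ℝ) (z : Plane → ℝ) (x : Plane) :
    cof G ε z 1 0 x = -covHess G z (ε ^ 2 • x) 1 0 := by simp [cof, Matrix.adjugate_fin_two]

lemma FC_eps (hS : S ⊆ params ρ) (hNM : N ≤ M) (k : ℕ) : (discDom S).FC M N fun i _ => i.1.1 ^ k :=
  .const hNM fun i => by
    rw [abs_pow]
    exact pow_le_one₀ (abs_nonneg _) (params_abs_le hS i)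

lemma FC_of_div (hS : S ⊆ params ρ) {f : S → Plane → ℝ} (hf : (discDom S).FC M N fun i x => i.1.1⁻¹ * f i x) :
    (discDom S).FC M N f := by
  refine ((FC_eps hS hf.le 1).mul hf).congr fun i x hx => ?_
  have := params_ne_zero hS i
  field_simp

namespace LocalGeometry

variable (LG : LocalGeometry n κ G z₀ a ρ V)
include LG

lemma contDiffOn_pd_z (j : Fin 2) : ContDiffOn ℝ (n + 1 : ℕ) (pd j z₀) V :=
  fun _ _ => (contDiffAt_pd (n := n + 1) LG.cz.contDiffAt j).contDiffWithinAt

lemma contDiffOn_pd_pd_z (j k : Fin 2) : ContDiffOn ℝ n (pd j (pd k z₀)) V :=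
  fun _ _ => (contDiffAt_pd (contDiffAt_pd (n := n + 1) LG.cz.contDiffAt k) j).contDiffWithinAt

variable (hS : S ⊆ params ρ)
include hS

lemma FC_hessLow (hn : 3 ≤ n) (j k : Fin 2) :
    (discDom S).FC n 3 fun i => hessLow G z₀ j k i.1 := by
  refine (FC_scaled hS LG.isOpen LG.ball (LG.contDiffOn_pd_pd_z j k) hn).sub
    (.sum fun l => (FC_scaled hS LG.isOpen LG.ball (LG.cΓ l j k) hn).mul
      ((FC_scaled hS LG.isOpen LG.ball ((LG.contDiffOn_pd_z l).of_le (by norm_cast; omega)) hn).add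
        ((FC_eps hS hn 3).mul (FC_pd_w hS hn l))))

lemma FC_hess (hn : 3 ≤ n) (j k : Fin 2) : (discDom S).FC n 2 fun i => hess G z₀ j k i.1 := by
  refine (((LG.FC_hessLow hS hn j k).of_le le_rfl (by omega) (by omega)).add
    ((FC_eps hS (by omega) 1).mul (FC_pd_pd_w hS (by omega) j k))).congr fun i x hx => ?_
  rw [hess_eq LG.cz hS j k i hx]
  simp

/-- `ε⁻¹ ∂_l z` is bounded. -/
lemma FC_grad (hn : 3 ≤ n) (l : Fin 2) :
    (discDom S).FC n 2 fun i x => i.1.1⁻¹ * pd l (zOf z₀ i.1) (i.1.1 ^ 2 • x) := by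
  obtain ⟨n, rfl⟩ : ∃ k, n = k + 1 := ⟨n - 1, by omega⟩
  refine ((FC_scaled_div hS LG.isOpen LG.ball
    ((LG.contDiffOn_pd_z l).of_le (by norm_cast; omega)) (by omega : 1 ≤ n) (LG.pd_zero l)).add
    ((FC_eps hS (by omega) 2).mul
      ((FC_pd_w hS hn l).of_le le_rfl (by omega) (by omega)))).congr fun i x hx => ?_
  have := params_ne_zero hS i
  change i.1.1⁻¹ * pd l (zOf z₀ i.1) (i.1.1 ^ 2 • x) = _
  rw [pd_zOf LG.cz hS i hx]
  field_simp

/-- The Hessian differs from its value at the origin by `O(ε)`. -/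
lemma FC_hess_sub (hn : 3 ≤ n) (j k : Fin 2) : (discDom S).FC n 2 fun i x =>
    i.1.1⁻¹ * (hess G z₀ j k i.1 x - if j = 0 ∧ k = 0 then a else 0) := by
  have hg := fun l => LG.FC_grad hS hn l
  obtain ⟨n, rfl⟩ : ∃ k, n = k + 1 := ⟨n - 1, by omega⟩
  have h1 := FC_scaled_div hS LG.isOpen LG.ball (N := 1) (M := n)
    (f := fun y => pd j (pd k z₀) y - if j = 0 ∧ k = 0 then a else 0)
    ((LG.contDiffOn_pd_pd_z j k).sub contDiffOn_const) (by omega) (by simp [LG.pd_pd_zero])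
  refine ((h1.add (FC_pd_pd_w hS (M := n + 1) (by omega) j k)).sub (.sum fun l =>
    (FC_scaled hS LG.isOpen LG.ball (LG.cΓ l j k) (by omega)).mul (hg l))).congr fun i x hx => ?_
  have := params_ne_zero hS i
  simp only [hess, covHess, Matrix.of_apply, pd_pd_zOf LG.cz hS i hx, Fin.sum_univ_two]
  field_simp
  ring

/-- The third derivatives of `w` cancel. -/
lemma FC_codazzi (hn : 3 ≤ n) : (discDom S).FC (n - 1) 2 fun i x =>
    pd 1 (hess G z₀ 0 0 i.1) x - pd 0 (hess G z₀ 0 1 i.1) x := by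
  obtain ⟨n, rfl⟩ : ∃ k, n = k + 1 := ⟨n - 1, by omega⟩
  refine (((LG.FC_hessLow hS hn 0 0).d 1).sub ((LG.FC_hessLow hS hn 0 1).d 0)).congr fun i x hx => ?_
  have hw := (hS i.2).2.2.2.1
  have key : ∀ j k l, pd l (hess G z₀ j k i.1) x =
      pd l (hessLow G z₀ j k i.1) x + i.1.1 * pd l (pd j (pd k i.1.2)) x := fun j k l => by
    have h1 := (LG.FC_hessLow hS hn j k).differentiableAt (by omega) (i := i) hx
    have h2 : DifferentiableAt ℝ (pd j (pd k i.1.2)) x :=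
      ((contDiffOn_pd_iterate (contDiffOn_pd_iterate hw k 1) j 1).contDiffAt
        (isOpen_unitDisc.mem_nhds hx)).differentiableAt (by simp)
    have h3 := (hess_eq (G := G) LG.cz hS j k i).eventuallyEq_of_mem (isOpen_unitDisc.mem_nhds hx)
    rw [(pd_congr h3 l).self_of_nhds]
    exact congrArg (· (Pi.single l 1)) (h1.hasFDerivAt.add (h2.hasFDerivAt.const_mul i.1.1)).fderiv
  have e1 : pd 1 (pd 0 (pd 0 i.1.2)) x = pd 0 (pd 0 (pd 1 i.1.2)) x :=
    pd_one_iterate_pd_zero hw 2 hx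
  rw [key, key, e1]
  simp only [Dom.d, discDom, pd]
  ring

lemma FC_κ (hn : 3 ≤ n) : (discDom S).FC n 2 fun i x => i.1.1⁻¹ * κ (i.1.1 ^ 2 • x) := by
  obtain ⟨n, rfl⟩ : ∃ k, n = k + 1 := ⟨n - 1, by omega⟩
  exact FC_scaled_div hS LG.isOpen LG.ball LG.cκ (by omega) LG.κ_zero

lemma FC_gradUp (hn : 3 ≤ n) (l : Fin 2) :
    (discDom S).FC n 2 fun i x => gradUp G (zOf z₀ i.1) l (i.1.1 ^ 2 • x) :=
  .sum fun k => (FC_scaled hS LG.isOpen LG.ball (LG.cinv l k) (by omega)).mul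
    (FC_of_div hS (LG.FC_grad hS hn k))

lemma FC_gradInner (hn : 3 ≤ n) : (discDom S).FC n 2 fun i x =>
    i.1.1⁻¹ * gradInner G (zOf z₀ i.1) (zOf z₀ i.1) (i.1.1 ^ 2 • x) := by
  refine (Dom.FC.sum fun l => (LG.FC_gradUp hS hn l).mul (LG.FC_grad hS hn l)).congr fun i x hx => ?_
  simp only [gradInner, Fin.sum_univ_two]
  ring

lemma FC_one_sub_gradInner (hn : 3 ≤ n) : (discDom S).FC n 2 fun i x =>
    1 - gradInner G (zOf z₀ i.1) (zOf z₀ i.1) (i.1.1 ^ 2 • x) :=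
  (Dom.FC.const (c := fun _ => 1) (by omega) fun _ => le_rfl).sub (FC_of_div hS (LG.FC_gradInner hS hn))

lemma FC_det (hn : 3 ≤ n) : (discDom S).FC n 2 fun i x => (G (i.1.1 ^ 2 • x)).det :=
  FC_scaled hS LG.isOpen LG.ball LG.cdet (by omega)

lemma FC_darboux (hn : 3 ≤ n) : (discDom S).FC n 2 fun i x =>
    darboux κ G (zOf z₀ i.1) (i.1.1 ^ 2 • x) := by
  have h := fun j k => LG.FC_hess hS hn j k
  refine ((((h 0 0).mul (h 1 1)).sub ((h 0 1).mul (h 1 0))).sub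
    (((FC_of_div hS (LG.FC_κ hS hn)).mul (LG.FC_det hS hn)).mul
      (LG.FC_one_sub_gradInner hS hn))).congr fun i x hx => ?_
  simp only [darboux, Matrix.det_fin_two, hess]

lemma FC_cof (hn : 3 ≤ n) (j k : Fin 2) : (discDom S).FC n 2 fun i => cof G i.1.1 (zOf z₀ i.1) j k := by
  have h := fun j k => LG.FC_hess hS hn j k
  fin_cases j <;> fin_cases k
  · exact (h 1 1).congr fun i x _ => cof_zero_zero _ _ _
  · exact (h 0 1).neg.congr fun i x _ => cof_zero_one _ _ _
  · exact (h 1 0).neg.congr fun i x _ => cof_one_zero _ _ _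
  · exact (h 0 0).congr fun i x _ => cof_one_one _ _ _

lemma FC_linFirst (hn : 3 ≤ n) (l : Fin 2) : (discDom S).FC n 2 fun i x =>
    i.1.1⁻¹ * linFirst κ G i.1.1 (zOf z₀ i.1) l x := by
  refine ((FC_eps hS (by omega) 1).neg.mul
    ((Dom.FC.sum fun j => Dom.FC.sum fun k => (LG.FC_cof hS hn j k).mul
      (FC_scaled hS LG.isOpen LG.ball (LG.cΓ l j k) (by omega))).sub
    ((((FC_of_div hS (LG.FC_κ hS hn)).smul 2).mul (LG.FC_det hS hn)).mul
      (LG.FC_gradUp hS hn l)))).congr fun i x hx => ?_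
  have := params_ne_zero hS i
  simp only [linFirst]
  field_simp

end LocalGeometry

variable {n M N : ℕ} {κ : Plane → ℝ} {G : Metric2} {z₀ : Plane → ℝ} {a ρ : ℝ} {V : Set Plane}
  {S : Set (ℝ × (Plane → ℝ))}

/-- A family of the size `ε` is uniformly small for small `ε`. -/
lemma exists_abs_le_of_FC_div (hS : S ⊆ params ρ) {f : S → Plane → ℝ}
    (hf : (discDom S).FC M N fun i x => i.1.1⁻¹ * f i x) {c : ℝ} (hc : 0 < c) :
    ∃ ε₁ > 0, ∀ i : S, i.1.1 < ε₁ → ∀ x ∈ unitDisc, |f i x| ≤ c := by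
  obtain ⟨C, hC⟩ := hf.fb.bdd
  refine ⟨c / (|C| + 1), by positivity, fun i hi x hx => ?_⟩
  have h0 := (hS i.2).1
  have h := hC i x hx
  rw [abs_mul, abs_inv, abs_of_pos h0, inv_mul_le_iff₀ h0] at h
  rw [lt_div_iff₀ (by positivity)] at hi
  nlinarith [le_abs_self C]

/-- The quotients `a^{jk} / a²²`. -/
def slope (G : Metric2) (z₀ : Plane → ℝ) (j k : Fin 2) (q : ℝ × (Plane → ℝ)) (x : Plane) : ℝ :=
  cof G q.1 (zOf z₀ q) j k x / cof G q.1 (zOf z₀ q) 1 1 x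

/-- The curvature term `K |g| (1 - |∇z|²) / (a²²)²` of the modified operator. -/
def curvTerm (κ : Plane → ℝ) (G : Metric2) (z₀ : Plane → ℝ) (q : ℝ × (Plane → ℝ)) (x : Plane) : ℝ :=
  κ (q.1 ^ 2 • x) * (G (q.1 ^ 2 • x)).det *
    (1 - gradInner G (zOf z₀ q) (zOf z₀ q) (q.1 ^ 2 • x)) / cof G q.1 (zOf z₀ q) 1 1 x ^ 2

lemma cof_one_one_zOf (q : ℝ × (Plane → ℝ)) : cof G q.1 (zOf z₀ q) 1 1 = hess G z₀ 0 0 q :=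
  funext fun _ => cof_one_one _ _ _

/-- A set of pairs `(ε, w)` for which the operator is controlled: the coefficient `a²²` is bounded
below, the characteristic direction `(a¹², a²²)` is transversal to the diagonal, and `|∇z| ≤ 1`. -/
structure IsGood (κ : Plane → ℝ) (G : Metric2) (z₀ : Plane → ℝ) (a ρ : ℝ)
    (S : Set (ℝ × (Plane → ℝ))) : Prop where
  a_pos : 0 < a
  params : S ⊆ params ρ
  hess_ge : ∀ i ∈ S, ∀ x ∈ unitDisc, a / 2 ≤ hess G z₀ 0 0 i x
  slope_le : ∀ i ∈ S, ∀ x ∈ unitDisc, |slope G z₀ 0 1 i x| ≤ 1 / 2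
  grad : ∀ i ∈ S, ∀ x ∈ unitDisc, gradInner G (zOf z₀ i) (zOf z₀ i) (i.1 ^ 2 • x) ≤ 1

theorem LocalGeometry.exists_isGood (LG : LocalGeometry n κ G z₀ a ρ V) (hn : 3 ≤ n) (ha : 0 < a) :
    ∃ ε₁ > 0, IsGood κ G z₀ a ρ {q ∈ params ρ | q.1 < ε₁} := by
  have hS : params ρ ⊆ params ρ := subset_rfl
  obtain ⟨e1, h1, H1⟩ := exists_abs_le_of_FC_div hS (LG.FC_hess_sub hS hn 0 0) (c := a / 4) (by positivity)
  obtain ⟨e2, h2, H2⟩ := exists_abs_le_of_FC_div hS (LG.FC_hess_sub hS hn 0 1) (c := a / 4) (by positivity)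
  obtain ⟨e3, h3, H3⟩ := exists_abs_le_of_FC_div hS (LG.FC_gradInner hS hn) one_pos
  have hh : ∀ i ∈ {q ∈ params ρ | q.1 < min e1 (min e2 e3)}, ∀ x ∈ unitDisc,
      a / 2 ≤ hess G z₀ 0 0 i x := fun i hi x hx => by
    have := H1 ⟨i, hi.1⟩ (lt_of_lt_of_le hi.2 (min_le_left _ _)) x hx
    simp only [and_self, if_true] at this
    linarith [(abs_le.1 this).1]
  refine ⟨min e1 (min e2 e3), by positivity, ha, fun i hi => hi.1, hh, fun i hi x hx => ?_,
    fun i hi x hx => ?_⟩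
  · have h := H2 ⟨i, hi.1⟩ (lt_of_lt_of_le hi.2 ((min_le_right _ _).trans (min_le_left _ _))) x hx
    have h0 := hh i hi x hx
    simp only [one_ne_zero, and_false, if_false, sub_zero] at h
    rw [slope, cof_one_one_zOf, cof_zero_one, abs_div, abs_neg, div_le_iff₀ (by
      rw [abs_of_pos (by linarith)]; linarith), abs_of_pos (by linarith : 0 < hess G z₀ 0 0 i x)]
    exact (show |covHess G (zOf z₀ i) (i.1 ^ 2 • x) 0 1| ≤ a / 4 from h).trans (by linarith)
  · exact (le_abs_self _).trans (H3 ⟨i, hi.1⟩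
      (lt_of_lt_of_le hi.2 ((min_le_right _ _).trans (min_le_right _ _))) x hx)

namespace IsGood

variable (hS : IsGood κ G z₀ a ρ S)
include hS

lemma hess_pos (i : S) {x : Plane} (hx : x ∈ unitDisc) : 0 < hess G z₀ 0 0 i.1 x := by
  linarith [hS.hess_ge i.1 i.2 x hx, hS.a_pos]

lemma curvTerm_nonneg (LG : LocalGeometry n κ G z₀ a ρ V) (i : S) {x : Plane} (hx : x ∈ unitDisc)
    (h1 : 0 < x 1) (h2 : x 1 < x 0) : 0 ≤ curvTerm κ G z₀ i.1 x := by
  have hV := LG.ball (mem_ball_of_params hS.params i hx)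
  have he : 0 < i.1.1 ^ 2 := pow_pos (hS.params i.2).1 2
  have hκ := LG.κ_nonneg _ hV (by simpa using mul_pos he h1) (by simpa using mul_lt_mul_of_pos_left h2 he)
  have hg := hS.grad i.1 i.2 x hx
  have hd := LG.det_pos _ hV
  unfold curvTerm
  have : 0 ≤ 1 - gradInner G (zOf z₀ i.1) (zOf z₀ i.1) (i.1.1 ^ 2 • x) := by linarith
  positivity

variable (LG : LocalGeometry n κ G z₀ a ρ V) (hn : 3 ≤ n)
include LG hn

lemma FC_inv_hess : (discDom S).FC n 2 fun i x => (hess G z₀ 0 0 i.1 x)⁻¹ :=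
  (LG.FC_hess hS.params hn 0 0).inv (half_pos hS.a_pos) (fun i _ hx => (hS.hess_pos i hx).ne')
    fun i x hx => (hS.hess_ge i.1 i.2 x hx).trans (le_abs_self _)

lemma FC_slope {j k : Fin 2} (hjk : j ≠ k) :
    (discDom S).FC n 2 fun i x => i.1.1⁻¹ * slope G z₀ j k i.1 x := by
  have key : ∀ j k : Fin 2, j ≠ k → (discDom S).FC n 2 fun i x =>
      i.1.1⁻¹ * cof G i.1.1 (zOf z₀ i.1) j k x := by
    intro j k hjk
    fin_cases j <;> fin_cases k <;> first | exact absurd rfl hjk | skip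
    · refine (LG.FC_hess_sub hS.params hn 0 1).neg.congr fun i x _ => ?_
      change i.1.1⁻¹ * cof G i.1.1 (zOf z₀ i.1) 0 1 x = _
      rw [cof_zero_one]
      simp [hess]
    · refine (LG.FC_hess_sub hS.params hn 1 0).neg.congr fun i x _ => ?_
      change i.1.1⁻¹ * cof G i.1.1 (zOf z₀ i.1) 1 0 x = _
      rw [cof_one_zero]
      simp [hess]
  refine ((key j k hjk).mul (hS.FC_inv_hess LG hn)).congr fun i x _ => ?_
  simp only [slope, cof_one_one_zOf, div_eq_mul_inv, mul_assoc]

lemma FC_curvTerm : (discDom S).FC n 2 fun i x => i.1.1⁻¹ * curvTerm κ G z₀ i.1 x := by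
  have h := hS.FC_inv_hess LG hn
  refine ((((LG.FC_κ hS.params hn).mul (LG.FC_det hS.params hn)).mul
    (LG.FC_one_sub_gradInner hS.params hn)).mul (h.mul h)).congr fun i x hx => ?_
  rw [curvTerm, cof_one_one_zOf]
  have := (hS.hess_pos i hx).ne'
  field_simp

/-- The logarithmic derivative in the modified operator is of the size `ε`. -/
lemma FC_pd_log : (discDom S).FC (n - 1) 1 fun i x => i.1.1⁻¹ * pd 0 (fun q =>
    log (cof G i.1.1 (zOf z₀ i.1) 1 1 q * √((G (i.1.1 ^ 2 • q)).det))) x := by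
  have h1 := (hS.FC_inv_hess LG hn).of_le (Nat.sub_le n 1) (by omega : 1 ≤ 2) (by omega)
  have h2 := LG.FC_hess_sub hS.params hn 0 0
  have h3 := LG.FC_hess hS.params hn 0 0
  obtain ⟨n, rfl⟩ : ∃ k, n = k + 1 := ⟨n - 1, by omega⟩
  have h4 : (discDom S).FC n 1 fun i x => pd 0 (fun y => (G y).det) (i.1.1 ^ 2 • x) :=
    FC_scaled hS.params LG.isOpen LG.ball (Dom.FC.contDiffOn_d (A := discDom S) LG.isOpen LG.cdet 0)
      (by omega)
  have h5 : (discDom S).FC n 1 fun i x => ((G (i.1.1 ^ 2 • x)).det)⁻¹ :=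
    FC_scaled hS.params LG.isOpen LG.ball (f := fun y => ((G y).det)⁻¹)
      ((LG.cdet.inv fun y hy => (LG.det_pos y hy).ne').of_le (by norm_cast; omega)) (by omega)
  refine (((h2.d 0).mul h1).add ((FC_eps hS.params (by omega) 1).mul
    ((h4.mul h5).smul (1 / 2)))).congr fun i x hx => ?_
  have hV := LG.ball (mem_ball_of_params hS.params i hx)
  have hh := hS.hess_pos i hx
  have hdet := LG.det_pos _ hV
  have d1 := (h3.differentiableAt (by omega) hx).hasFDerivAt
  have d2 : HasFDerivAt (fun x : Plane => (G (i.1.1 ^ 2 • x)).det) _ x :=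
    ((LG.cdet.contDiffAt (LG.isOpen.mem_nhds hV)).differentiableAt
      (by norm_cast)).hasFDerivAt.comp x (hasFDerivAt_sq_smul _ x)
  have d3 := (d1.log hh.ne').add ((d2.log hdet.ne').const_mul (1 / 2))
  have e : (fun q => log (cof G i.1.1 (zOf z₀ i.1) 1 1 q * √((G (i.1.1 ^ 2 • q)).det))) =ᶠ[𝓝 x]
      ((fun q => log (hess G z₀ 0 0 i.1 q)) + fun q =>
        1 / 2 * log (G (i.1.1 ^ 2 • q)).det) := by
    filter_upwards [isOpen_unitDisc.mem_nhds hx] with q hq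
    have hV := LG.det_pos _ (LG.ball (mem_ball_of_params hS.params i hq))
    rw [cof_one_one_zOf, log_mul (hS.hess_pos i hq).ne' (sqrt_pos.2 hV).ne', log_sqrt hV.le]
    simp only [Pi.add_apply]
    ring
  have d4 : (discDom S).d 0 (fun x => i.1.1⁻¹ * (hess G z₀ 0 0 i.1 x -
      if (0 : Fin 2) = 0 ∧ (0 : Fin 2) = 0 then a else 0)) x =
      i.1.1⁻¹ * fderiv ℝ (hess G z₀ 0 0 i.1) x (Pi.single 0 1) :=
    congrArg (· (Pi.single 0 1)) ((d1.sub_const _).const_mul i.1.1⁻¹).fderiv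
  beta_reduce
  rw [d4]
  simp only [pd, e.fderiv_eq, d3.fderiv]
  simp
  field_simp

lemma FC_opFirst (l : Fin 2) : (discDom S).FC (n - 1) 1 fun i x =>
    i.1.1⁻¹ * opFirst κ G i.1.1 (zOf z₀ i.1) l x := by
  have h1 := (hS.FC_inv_hess LG hn).of_le (Nat.sub_le n 1) (by omega : 1 ≤ 2) (by omega)
  have h2 := (LG.FC_linFirst hS.params hn l).of_le (Nat.sub_le n 1) (by omega : 1 ≤ 2) (by omega)
  have h3 := (LG.FC_darboux hS.params hn).of_le (Nat.sub_le n 1) (by omega : 1 ≤ 2) (by omega)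
  have h4 := hS.FC_pd_log LG hn
  have hc : (discDom S).FC (n - 1) 1 fun _ _ => if l = 0 then (1 : ℝ) else 0 :=
    .const (by omega) (C := 1) fun _ => by split_ifs <;> simp
  refine (h1.mul (h2.add (hc.mul ((h1.mul h3).mul h4)))).congr fun i x hx => ?_
  rw [opFirst, cof_one_one_zOf]
  split_ifs <;> ring

end IsGood

/-! ### The coefficients in the coordinates `ξ` -/

/-- The canonical charts, in terms of the slope `s = a¹² / a²²` and of `τ = tan δ`. -/
structure IsSlopeChart (n : ℕ) (σ τ : ℝ) (s : Plane → ℝ) (ξ : OpenPartialHomeomorph Plane Plane) :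
    Prop where
  source : ξ.source ⊆ unitDisc
  cd : ContDiffOn ℝ n ξ ξ.source
  cd_symm : ContDiffOn ℝ n ξ.symm ξ.target
  target : {q : Plane | 0 ≤ q 0 ∧ q 0 ≤ σ ∧ 0 ≤ q 1 ∧ q 1 ≤ q 0 * τ} ⊆ ξ.target
  snd : ∀ x ∈ ξ.source, ξ x 1 = x 1
  char : ∀ x ∈ ξ.source, s x * pd 0 (comp0 ξ) x + pd 1 (comp0 ξ) x = 0
  diag : ∀ t ∈ Icc 0 (σ * τ), ![t, t] ∈ ξ.source ∧ ξ ![t, t] 0 = t / τ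

section

variable {n : ℕ} {κ : Plane → ℝ} {G : Metric2} {z₀ : Plane → ℝ} {q : ℝ × (Plane → ℝ)} {σ δ : ℝ}
  {ξ : OpenPartialHomeomorph Plane Plane}

lemma isCanonicalChart_iff (h0 : ∀ x ∈ unitDisc, cof G q.1 (zOf z₀ q) 1 1 x ≠ 0) :
    IsCanonicalChart n σ δ G q.1 (zOf z₀ q) ξ ↔
      IsSlopeChart n σ (Real.tan δ) (slope G z₀ 0 1 q) ξ := by
  have key : ∀ x ∈ unitDisc,
      cof G q.1 (zOf z₀ q) 0 1 x * pd 0 (comp0 ξ) x + cof G q.1 (zOf z₀ q) 1 1 x * pd 1 (comp0 ξ) x = 0 ↔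
      slope G z₀ 0 1 q x * pd 0 (comp0 ξ) x + pd 1 (comp0 ξ) x = 0 := fun x hx => by
    have h := h0 x hx
    have e : cof G q.1 (zOf z₀ q) 0 1 x * pd 0 (comp0 ξ) x +
        cof G q.1 (zOf z₀ q) 1 1 x * pd 1 (comp0 ξ) x = cof G q.1 (zOf z₀ q) 1 1 x *
          (slope G z₀ 0 1 q x * pd 0 (comp0 ξ) x + pd 1 (comp0 ξ) x) := by
      rw [slope]
      field_simp
    rw [e, mul_eq_zero, or_iff_right h]
  constructor
  · rintro ⟨h1, h2, h3, h4, h5, h6, h7⟩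
    exact ⟨h1, mod_cast h2, mod_cast h3, h4, h5, fun x hx => (key x (h1 hx)).1 (h6 x hx), h7⟩
  · rintro ⟨h1, h2, h3, h4, h5, h6, h7⟩
    exact ⟨h1, mod_cast h2, mod_cast h3, h4, h5, fun x hx => (key x (h1 hx)).2 (h6 x hx), h7⟩

lemma IsSlopeChart.contDiffAt_comp0 {s : Plane → ℝ} {τ : ℝ} (hξ : IsSlopeChart n σ τ s ξ) {x : Plane}
    (hx : x ∈ ξ.source) : ContDiffAt ℝ n (comp0 ξ) x :=
  contDiffAt_pi.1 (hξ.cd.contDiffAt (ξ.open_source.mem_nhds hx)) 0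

lemma IsSlopeChart.pd_one_comp0 {s : Plane → ℝ} {τ : ℝ} (hξ : IsSlopeChart n σ τ s ξ) {x : Plane}
    (hx : x ∈ ξ.source) : pd 1 (comp0 ξ) x = -(s x * pd 0 (comp0 ξ) x) := by
  linarith [hξ.char x hx]

lemma IsSlopeChart.pd_pd_one_comp0 {s : Plane → ℝ} {τ : ℝ} (hξ : IsSlopeChart n σ τ s ξ) (hn : 2 ≤ n)
    {x : Plane} (hx : x ∈ ξ.source) (hs : DifferentiableAt ℝ s x) (j : Fin 2) :
    pd j (pd 1 (comp0 ξ)) x = -(pd j s x * pd 0 (comp0 ξ) x + s x * pd j (pd 0 (comp0 ξ)) x) := by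
  have e : pd 1 (comp0 ξ) =ᶠ[𝓝 x] -(s * pd 0 (comp0 ξ)) := by
    filter_upwards [ξ.open_source.mem_nhds hx] with y hy using hξ.pd_one_comp0 hy
  have d0 : DifferentiableAt ℝ (pd 0 (comp0 ξ)) x :=
    (contDiffAt_pd ((hξ.contDiffAt_comp0 hx).of_le (by exact_mod_cast hn)) 0).differentiableAt
      (by norm_num)
  have h := (hs.hasFDerivAt.mul d0.hasFDerivAt).neg.fderiv
  simp only [pd, e.fderiv_eq] at h ⊢
  rw [h]
  simp
  ring

lemma coefk_eq {s : Plane → ℝ} {τ : ℝ} (hs : s = slope G z₀ 0 1 q) (hξ : IsSlopeChart n σ τ s ξ)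
    {x : Plane} (hx : x ∈ ξ.source) (h0 : cof G q.1 (zOf z₀ q) 1 1 x ≠ 0) :
    coefk κ G q.1 (zOf z₀ q) ξ x = curvTerm κ G z₀ q x * pd 0 (comp0 ξ) x ^ 2 := by
  have h1 := hξ.pd_one_comp0 hx
  simp only [coefk, Fin.sum_univ_two, h1, hs, slope, curvTerm, opSecond, darboux, Matrix.det_fin_two]
  simp only [cof_one_one, cof_zero_zero, cof_zero_one, cof_one_zero] at h0 ⊢
  simp
  field_simp
  ring

lemma coefb_eq {s : Plane → ℝ} {τ : ℝ} (hs : s = slope G z₀ 0 1 q) (hξ : IsSlopeChart n σ τ s ξ)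
    (hn : 2 ≤ n) {x : Plane} (hx : x ∈ ξ.source) (hd : DifferentiableAt ℝ s x)
    (h0 : cof G q.1 (zOf z₀ q) 1 1 x ≠ 0) :
    coefb κ G q.1 (zOf z₀ q) ξ x = curvTerm κ G z₀ q x * pd 0 (pd 0 (comp0 ξ)) x +
      (opFirst κ G q.1 (zOf z₀ q) 0 x - (pd 1 s x + slope G z₀ 1 0 q x * pd 0 s x) -
        opFirst κ G q.1 (zOf z₀ q) 1 x * s x) * pd 0 (comp0 ξ) x := by
  have h1 := hξ.pd_one_comp0 hx
  have h2 := hξ.pd_pd_one_comp0 hn hx hd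
  have h3 : pd 1 (pd 0 (comp0 ξ)) x = pd 0 (pd 1 (comp0 ξ)) x :=
    pd_comm ((hξ.contDiffAt_comp0 hx).of_le (by exact_mod_cast hn)) 1 0
  have e : ∀ i j, opSecond κ G q.1 (zOf z₀ q) i j x =
      if i = 0 ∧ j = 0 then s x * slope G z₀ 1 0 q x + curvTerm κ G z₀ q x else
        slope G z₀ i j q x := fun i j => by
    simp only [hs, slope, curvTerm, opSecond, darboux, Matrix.det_fin_two]
    simp only [cof_one_one, cof_zero_one, cof_one_zero] at h0 ⊢
    fin_cases i <;> fin_cases j <;>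
      simp [cof_one_one, cof_zero_zero, cof_zero_one, cof_one_zero] <;> field_simp
    ring
  have e1 : slope G z₀ 1 1 q x = 1 := div_self h0
  simp only [coefb, Fin.sum_univ_two, e, h1, h2, h3]
  simp only [e1, ← hs]
  simp
  ring

end

/-! ### The inverse of the chart -/

lemma vec_eq (u v : ℝ) : (![u, v] : Plane) = u • Pi.single 0 1 + v • Pi.single 1 1 := by
  ext k
  fin_cases k <;> simp

namespace IsSlopeChart

variable {n : ℕ} {σ τ : ℝ} {s : Plane → ℝ} {ξ : OpenPartialHomeomorph Plane Plane}

/-- The partial derivative `∂x¹/∂ξ¹`. -/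
def jac (ξ : OpenPartialHomeomorph Plane Plane) : Plane → ℝ := pd 0 fun q => ξ.symm q 0

variable (hξ : IsSlopeChart n σ τ s ξ)
include hξ

lemma symm_mem {q : Plane} (hq : q ∈ ξ.target) : ξ.symm q ∈ unitDisc := hξ.source (ξ.map_target hq)

lemma symm_snd {q : Plane} (hq : q ∈ ξ.target) : ξ.symm q 1 = q 1 := by
  rw [← hξ.snd _ (ξ.map_target hq), ξ.right_inv hq]

lemma contDiffAt_symm {q : Plane} (hq : q ∈ ξ.target) : ContDiffAt ℝ n ξ.symm q :=
  hξ.cd_symm.contDiffAt (ξ.open_target.mem_nhds hq)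

lemma contDiffAt_symm_zero {q : Plane} (hq : q ∈ ξ.target) : ContDiffAt ℝ n (fun q => ξ.symm q 0) q :=
  contDiffAt_pi.1 (hξ.contDiffAt_symm hq) 0

lemma fderiv_symm_apply (hn : 1 ≤ n) {q : Plane} (hq : q ∈ ξ.target) (j : Fin 2) :
    fderiv ℝ ξ.symm q (Pi.single j 1) =
      ![pd j (fun q => ξ.symm q 0) q, (Pi.single j 1 : Plane) 1] := by
  have hd : HasFDerivAt ξ.symm (fderiv ℝ ξ.symm q) q :=
    ((hξ.contDiffAt_symm hq).differentiableAt (by exact_mod_cast (by omega : n ≠ 0))).hasFDerivAt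
  have hc := fun k : Fin 2 => (hasFDerivAt_apply k (ξ.symm q)).comp q hd
  have h1 : (fun q => ξ.symm q 1) =ᶠ[𝓝 q] fun q => q 1 := by
    filter_upwards [ξ.open_target.mem_nhds hq] with y hy using hξ.symm_snd hy
  ext k
  fin_cases k
  · exact (congrArg (· (Pi.single j 1)) (hc 0).fderiv).symm
  · exact congrArg (· (Pi.single j 1))
      (((hc 1).congr_of_eventuallyEq h1.symm).unique (hasFDerivAt_apply (1 : Fin 2) q))

lemma pd_mul_pd_symm (hn : 1 ≤ n) {q : Plane} (hq : q ∈ ξ.target) (j : Fin 2) :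
    pd 0 (comp0 ξ) (ξ.symm q) * pd j (fun q => ξ.symm q 0) q +
      pd 1 (comp0 ξ) (ξ.symm q) * (Pi.single j 1 : Plane) 1 = (Pi.single j 1 : Plane) 0 := by
  have hn' : (n : WithTop ℕ∞) ≠ 0 := by exact_mod_cast (by omega : n ≠ 0)
  have hd := ((hξ.contDiffAt_symm hq).differentiableAt hn').hasFDerivAt
  have hc := ((hξ.contDiffAt_comp0 (ξ.map_target hq)).differentiableAt hn').hasFDerivAt.comp q hd
  have e : comp0 ξ ∘ ξ.symm =ᶠ[𝓝 q] fun q => q 0 := by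
    filter_upwards [ξ.open_target.mem_nhds hq] with y hy
    simp [comp0, ξ.right_inv hy]
  have h := congrArg (· (Pi.single j 1))
    ((hc.congr_of_eventuallyEq e.symm).unique (hasFDerivAt_apply (0 : Fin 2) q))
  simp only [ContinuousLinearMap.comp_apply, hξ.fderiv_symm_apply hn hq j] at h
  rw [vec_eq, map_add, map_smul, map_smul] at h
  simp only [smul_eq_mul] at h
  rw [← show _ = (Pi.single j 1 : Plane) 0 from h]
  simp only [pd]
  ring

lemma pd_zero_comp0_mul_jac (hn : 1 ≤ n) {q : Plane} (hq : q ∈ ξ.target) :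
    pd 0 (comp0 ξ) (ξ.symm q) * jac ξ q = 1 := by
  simpa [jac] using hξ.pd_mul_pd_symm hn hq 0

lemma jac_ne_zero (hn : 1 ≤ n) {q : Plane} (hq : q ∈ ξ.target) : jac ξ q ≠ 0 :=
  right_ne_zero_of_mul_eq_one (hξ.pd_zero_comp0_mul_jac hn hq)

lemma pd_one_symm_zero (hn : 1 ≤ n) {q : Plane} (hq : q ∈ ξ.target) :
    pd 1 (fun q => ξ.symm q 0) q = s (ξ.symm q) := by
  have h := hξ.pd_mul_pd_symm hn hq 1
  have h1 := hξ.pd_one_comp0 (ξ.map_target hq)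
  have h2 := left_ne_zero_of_mul_eq_one (hξ.pd_zero_comp0_mul_jac hn hq)
  rw [h1] at h
  simp only [Pi.single_eq_same, mul_one] at h
  rw [Pi.single_eq_of_ne (by decide)] at h
  exact mul_left_cancel₀ h2 (by linarith)

/-- The chain rule for functions of `x`, in the coordinates `ξ`. -/
lemma pd_comp_symm (hn : 1 ≤ n) {q : Plane} (hq : q ∈ ξ.target) {f : Plane → ℝ}
    (hf : DifferentiableAt ℝ f (ξ.symm q)) :
    pd 0 (fun q => f (ξ.symm q)) q = jac ξ q * pd 0 f (ξ.symm q) ∧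
    pd 1 (fun q => f (ξ.symm q)) q = s (ξ.symm q) * pd 0 f (ξ.symm q) + pd 1 f (ξ.symm q) := by
  have hn' : (n : WithTop ℕ∞) ≠ 0 := by exact_mod_cast (by omega : n ≠ 0)
  have hd := ((hξ.contDiffAt_symm hq).differentiableAt hn').hasFDerivAt
  have hc := (hf.hasFDerivAt.comp q hd).fderiv
  have key : ∀ j, pd j (fun q => f (ξ.symm q)) q = pd j (fun q => ξ.symm q 0) q * pd 0 f (ξ.symm q) +
      (Pi.single j 1 : Plane) 1 * pd 1 f (ξ.symm q) := fun j => by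
    have h := congrArg (· (Pi.single j 1)) hc
    simp only [ContinuousLinearMap.comp_apply, hξ.fderiv_symm_apply hn hq j] at h
    rw [vec_eq, map_add, map_smul, map_smul] at h
    exact h
  constructor
  · simpa [jac] using key 0
  · simpa [hξ.pd_one_symm_zero hn hq] using key 1

lemma contDiffAt_jac {M : ℕ} (hM : M + 1 ≤ n) {q : Plane} (hq : q ∈ ξ.target) :
    ContDiffAt ℝ M (jac ξ) q :=
  contDiffAt_pd ((hξ.contDiffAt_symm_zero hq).of_le (by exact_mod_cast hM)) 0

lemma pd_one_jac (hn : 2 ≤ n) {q : Plane} (hq : q ∈ ξ.target) (hs : DifferentiableAt ℝ s (ξ.symm q)) :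
    pd 1 (jac ξ) q = jac ξ q * pd 0 s (ξ.symm q) := by
  rw [jac, pd_comm ((hξ.contDiffAt_symm_zero hq).of_le (by exact_mod_cast hn)), ← jac,
    ← (hξ.pd_comp_symm (by omega) hq hs).1]
  refine (pd_congr ?_ 0).self_of_nhds
  filter_upwards [ξ.open_target.mem_nhds hq] with y hy using hξ.pd_one_symm_zero (by omega) hy

lemma diag_mem (hτ : 0 < τ) {t : ℝ} (ht : t ∈ Ioo 0 σ) : (![t, t * τ] : Plane) ∈ ξ.target :=
  hξ.target ⟨ht.1.le, ht.2.le, by simpa using (mul_pos ht.1 hτ).le, by simp⟩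

lemma symm_diag (hτ : 0 < τ) {t : ℝ} (ht : t ∈ Ioo 0 σ) :
    ξ.symm ![t, t * τ] = ![t * τ, t * τ] := by
  obtain ⟨h1, h2⟩ := hξ.diag (t * τ) ⟨(mul_pos ht.1 hτ).le, by nlinarith [ht.2]⟩
  have : ξ ![t * τ, t * τ] = ![t, t * τ] := by
    ext k
    fin_cases k
    · simpa [hτ.ne'] using h2
    · simpa using hξ.snd _ h1
  rw [← this, ξ.left_inv h1]

/-- Differentiation of an identity along the diagonal `x¹ = x²`. -/
lemma diag_deriv (hτ : 0 < τ) {E f : Plane → ℝ}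
    (h : ∀ t ∈ Ioo 0 σ, E ![t, t * τ] = f ![t * τ, t * τ])
    (hE : ∀ t ∈ Ioo 0 σ, DifferentiableAt ℝ E ![t, t * τ])
    (hf : ∀ x ∈ unitDisc, DifferentiableAt ℝ f x) {t : ℝ} (ht : t ∈ Ioo 0 σ) :
    (pd 0 E + τ • pd 1 E) ![t, t * τ] = (τ • (pd 0 f + pd 1 f)) ![t * τ, t * τ] := by
  have hx : (![t * τ, t * τ] : Plane) ∈ unitDisc := by
    rw [← hξ.symm_diag hτ ht]; exact hξ.symm_mem (hξ.diag_mem hτ ht)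
  have c1 : HasDerivAt (fun t : ℝ => (![t, t * τ] : Plane)) ![1, τ] t := by
    rw [hasDerivAt_pi]
    intro k
    fin_cases k
    · exact hasDerivAt_id t
    · simpa using (hasDerivAt_id t).mul_const τ
  have c2 : HasDerivAt (fun t : ℝ => (![t * τ, t * τ] : Plane)) ![τ, τ] t := by
    rw [hasDerivAt_pi]
    intro k
    fin_cases k <;> simpa using (hasDerivAt_id t).mul_const τ
  have d1 := (hE t ht).hasFDerivAt.comp_hasDerivAt t c1
  have d2 := (hf _ hx).hasFDerivAt.comp_hasDerivAt t c2
  have e : (E ∘ fun t : ℝ => (![t, t * τ] : Plane)) =ᶠ[𝓝 t] f ∘ fun t : ℝ => (![t * τ, t * τ] : Plane) := by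
    filter_upwards [isOpen_Ioo.mem_nhds ht] with u hu using h u hu
  have h3 := d1.unique (d2.congr_of_eventuallyEq e)
  rw [vec_eq 1 τ, vec_eq τ τ, map_add, map_add, map_smul, map_smul, map_smul, map_smul] at h3
  simp only [smul_eq_mul, one_mul, ← mul_add] at h3
  simpa [pd] using h3

end IsSlopeChart

/-! ### Uniform bounds for the charts -/

lemma Dom.FC.log {ι E : Type*} [NormedAddCommGroup E] [NormedSpace ℝ E] {A : Dom ι E} {M N : ℕ}
    {f : ι → E → ℝ} (hf : A.FC M N f) {c : ℝ} (hc : 0 < c) (hl : ∀ i, ∀ x ∈ A.O i, c ≤ f i x) :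
    A.FC M N fun i x => log (f i x) := by
  have h0 : ∀ i, ∀ x ∈ A.O i, f i x ≠ 0 := fun i x hx => (hc.trans_le (hl i x hx)).ne'
  have hz : A.FC M 0 fun i x => Real.log (f i x) := by
    refine ⟨Nat.zero_le _, fun i => (hf.cd i).log (h0 i), ?_⟩
    obtain ⟨C, hC⟩ := hf.fb.bdd
    refine ⟨max (-Real.log c) (Real.log C), fun i x hx => abs_le'.2 ⟨?_, ?_⟩⟩
    · exact le_max_of_le_right (log_le_log (hc.trans_le (hl i x (A.hU i hx)))
        ((le_abs_self _).trans (hC i x hx)))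
    · exact le_max_of_le_left (neg_le_neg (log_le_log hc (hl i x (A.hU i hx))))
  cases N with
  | zero => exact hz
  | succ N =>
    obtain ⟨M, rfl⟩ : ∃ k, M = k + 1 := ⟨M - 1, by have := hf.le; omega⟩
    have hi := hf.inv hc h0 fun i x hx => (hl i x (A.hU i hx)).trans (le_abs_self _)
    refine hz.of_d (fun j => (hi.of_le (Nat.le_succ M) (Nat.le_succ N)
      (Nat.le_of_succ_le_succ hf.le)).mul (hf.d j)) fun j i x hx => ?_
    have := ((hf.differentiableAt (by omega) hx).hasFDerivAt.log (h0 i x hx)).fderiv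
    simp [Dom.d, this]

/-- The hypotheses on the slope `s`, the coefficient `H = a²²` and the function `P` with
`∂₁(sH) + ∂₂H = PH` under which the charts are bounded in `C³`. -/
structure SlopeData (n : ℕ) (S : Set (ℝ × (Plane → ℝ))) (s H P : S → Plane → ℝ) (c : ℝ) : Prop where
  four_le : 4 ≤ n
  fs : (discDom S).FC n 2 s
  fH : (discDom S).FC n 2 H
  fP : (discDom S).FC (n - 1) 2 P
  half : ∀ i, ∀ x ∈ unitDisc, |s i x| ≤ 1 / 2
  pos : 0 < c
  le : ∀ i, ∀ x ∈ unitDisc, c ≤ H i x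
  eq : ∀ i, ∀ x ∈ unitDisc, pd 0 (s i) x * H i x + s i x * pd 0 (H i) x + pd 1 (H i) x = H i x * P i x

/-- The charts for the slopes of a family. -/
abbrev ChartIdx (n : ℕ) (σ τ : ℝ) {S : Set (ℝ × (Plane → ℝ))} (s : S → Plane → ℝ) : Type :=
  {p : S × OpenPartialHomeomorph Plane Plane // IsSlopeChart n σ τ (s p.1) p.2}

/-- The triangle `0 < ξ¹ < σ`, `0 ≤ ξ² ≤ τ ξ¹`. -/
def tri (σ τ : ℝ) : Set Plane := {q | 0 < q 0 ∧ q 0 < σ ∧ 0 ≤ q 1 ∧ q 1 ≤ q 0 * τ}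

/-- Families of functions of `ξ`. -/
def chartDom (n : ℕ) (σ τ : ℝ) {S : Set (ℝ × (Plane → ℝ))} (s : S → Plane → ℝ) :
    Dom (ChartIdx n σ τ s) Plane :=
  ⟨fun i _ => Pi.single i 1, fun i => i.1.2.target, fun _ => tri σ τ, fun _ _ => contDiff_const, fun i => i.1.2.open_target,
    fun i _ hq => i.2.target ⟨hq.1.le, hq.2.1.le, hq.2.2⟩⟩

/-- A family of functions of `x`, in the coordinates `ξ`. -/
def pull {n : ℕ} {σ τ : ℝ} {S : Set (ℝ × (Plane → ℝ))} {s : S → Plane → ℝ} (f : S → Plane → ℝ)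
    (i : ChartIdx n σ τ s) (q : Plane) : ℝ := f i.1.1 (i.1.2.symm q)

section

variable {n M N : ℕ} {σ τ : ℝ} {S : Set (ℝ × (Plane → ℝ))} {s H P f : S → Plane → ℝ} {c : ℝ}

local notation "Ξ" => chartDom n σ τ s

lemma FC_pull_zero (hf : (discDom S).FC M 0 f) (hM : M ≤ n) : (Ξ).FC M 0 (pull f) := by
  refine ⟨Nat.zero_le _, fun i => (hf.cd _).comp (i.2.cd_symm.of_nat hM)
    fun q hq => i.2.symm_mem hq, ?_⟩
  obtain ⟨C, hC⟩ := hf.fb.bdd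
  exact ⟨C, fun i q hq => hC _ _ (i.2.symm_mem ((Ξ).hU i hq))⟩

lemma FC_pull_succ (hJ : (Ξ).FC M N fun i => IsSlopeChart.jac i.1.2)
    (hs : (Ξ).FC M N (pull s)) (hf : (discDom S).FC (M + 1) (N + 1) f) (hM : M + 1 ≤ n) :
    (Ξ).FC (M + 1) (N + 1) (pull f) := by
  refine (hf.reindex fun i : ChartIdx n σ τ s => i.1.1).comp (B := Ξ)
    (X := fun i => i.1.2.symm) (c := ![![fun i => IsSlopeChart.jac i.1.2, fun _ _ => 0],
      ![pull s, fun _ _ => 1]]) (fun i => i.2.cd_symm.of_nat hM)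
    (fun i q hq => i.2.symm_mem hq) (fun i q hq => i.2.symm_mem ((Ξ).hU i hq))
    (fun j l => ?_) fun _ j i q hq => ?_
  · have hc : ∀ c : ℝ, (Ξ).FC M N fun _ _ => c := fun c =>
      .const (c := fun _ => c) hJ.le fun _ => le_rfl
    fin_cases j <;> fin_cases l
    exacts [hJ, hc 0, hs, hc 1]
  · have h := i.2.fderiv_symm_apply (by omega) hq j
    change fderiv ℝ i.1.2.symm q (Pi.single j 1) = _
    rw [h]
    have h1 := i.2.pd_one_symm_zero (by omega) hq
    ext k
    fin_cases j <;> fin_cases k <;>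
      simp [discDom, IsSlopeChart.jac, pull, h1]

/-- Functions are bounded by means of their values on the diagonal `x¹ = x²` and their
derivatives along the lines `ξ¹ = const`. -/
lemma FC_zero_of_diag {f : ChartIdx n σ τ s → Plane → ℝ} (hM : 1 ≤ M) (hτ : 0 < τ)
    (hf : ∀ i, ContDiffOn ℝ M (f i) i.1.2.target)
    (h1 : ∃ C, ∀ i, ∀ q ∈ tri σ τ, |pd 1 (f i) q| ≤ C)
    (h2 : ∃ C, ∀ i, ∀ t ∈ Ioo 0 σ, |f i ![t, t * τ]| ≤ C) :
    (Ξ).FC M 0 f := by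
  refine ⟨Nat.zero_le _, hf, ?_⟩
  obtain ⟨A, hA⟩ := h1
  obtain ⟨B, hB⟩ := h2
  refine ⟨B + |A| * (σ * τ), fun i q hq => ?_⟩
  obtain ⟨q0, q1, q2, q3⟩ := hq
  have hseg : ∀ u ∈ Icc 0 (q 0 * τ), (![q 0, u] : Plane) ∈ tri σ τ := fun u hu =>
    ⟨q0, q1, hu.1, hu.2⟩
  have hd : ∀ u ∈ Icc 0 (q 0 * τ), HasDerivAt (fun u => f i ![q 0, u]) (pd 1 (f i) ![q 0, u]) u := by
    intro u hu
    have h1 : DifferentiableAt ℝ (f i) ![q 0, u] :=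
      ((hf i).contDiffAt (i.1.2.open_target.mem_nhds ((Ξ).hU i (hseg u hu)))).differentiableAt
        (by exact_mod_cast (by omega : M ≠ 0))
    have h2 : HasDerivAt (fun u : ℝ => (![q 0, u] : Plane)) (Pi.single 1 1) u := by
      rw [hasDerivAt_pi]
      intro k
      fin_cases k
      · simpa using hasDerivAt_const u (q 0)
      · exact hasDerivAt_id u
    exact h1.hasFDerivAt.comp_hasDerivAt u h2
  have h := (convex_Icc 0 (q 0 * τ)).norm_image_sub_le_of_norm_hasDerivWithin_le
    (fun u hu => (hd u hu).hasDerivWithinAt) (fun u hu => hA i _ (hseg u hu))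
    (right_mem_Icc.2 (mul_pos q0 hτ).le) ⟨q2, q3⟩
  have hq' : (![q 0, q 1] : Plane) = q := by ext k; fin_cases k <;> rfl
  rw [hq', norm_eq_abs, norm_eq_abs] at h
  have h4 : |q 1 - q 0 * τ| ≤ σ * τ := by
    rw [abs_le]
    constructor <;> nlinarith
  have h5 := hB i (q 0) ⟨q0, q1⟩
  have h6 : A * |q 1 - q 0 * τ| ≤ |A| * (σ * τ) :=
    mul_le_mul (le_abs_self A) h4 (abs_nonneg _) (abs_nonneg _)
  linarith [abs_sub_abs_le_abs_sub (f i q) (f i ![q 0, q 0 * τ])]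

/-- The product of `∂x¹/∂ξ¹` and `a²²`, whose logarithm has the derivative `P` in `ξ²`. -/
def jacH (H : S → Plane → ℝ) (i : ChartIdx n σ τ s) (q : Plane) : ℝ :=
  IsSlopeChart.jac i.1.2 q * pull H i q

/-- The logarithm of `jacH`. -/
abbrev logJac (H : S → Plane → ℝ) (i : ChartIdx n σ τ s) : Plane → ℝ :=
  fun q => log (jacH H i q)

namespace SlopeData

variable (D : SlopeData n S s H P c)
include D

lemma jacH_ne_zero (i : ChartIdx n σ τ s) {q : Plane} (hq : q ∈ i.1.2.target) : jacH H i q ≠ 0 :=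
  mul_ne_zero (i.2.jac_ne_zero (by have := D.four_le; omega) hq)
    (D.pos.trans_le (D.le _ _ (i.2.symm_mem hq))).ne'

lemma contDiffOn_jacH (i : ChartIdx n σ τ s) : ContDiffOn ℝ (n - 1 : ℕ) (jacH H i) i.1.2.target := by
  have := D.four_le
  exact ContDiffOn.mul (fun q hq => (i.2.contDiffAt_jac (by omega) hq).contDiffWithinAt)
    ((FC_pull_zero (D.fH.of_le le_rfl (by omega) (by omega)) le_rfl).of_le (by omega) le_rfl
      (by omega) |>.cd i)

lemma contDiffOn_log (i : ChartIdx n σ τ s) :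
    ContDiffOn ℝ (n - 1 : ℕ) (logJac H i) i.1.2.target :=
  (D.contDiffOn_jacH i).log fun _ hq => D.jacH_ne_zero i hq

lemma pd_log (i : ChartIdx n σ τ s) {q : Plane} (hq : q ∈ i.1.2.target) (j : Fin 2) :
    pd j (jacH H i) q = jacH H i q * pd j (logJac H i) q := by
  have hn := D.four_le
  have h := (((D.contDiffOn_jacH i).contDiffAt (i.1.2.open_target.mem_nhds hq)).differentiableAt
    (by exact_mod_cast (by omega : n - 1 ≠ 0))).hasFDerivAt.log (D.jacH_ne_zero i hq)
  simp only [pd, h.fderiv]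
  simp [D.jacH_ne_zero i hq]

lemma pd_one_log (i : ChartIdx n σ τ s) {q : Plane} (hq : q ∈ i.1.2.target) :
    pd 1 (logJac H i) q = pull P i q := by
  have hn := D.four_le
  have hx := i.2.symm_mem hq
  refine mul_left_cancel₀ (D.jacH_ne_zero i hq) ?_
  rw [← D.pd_log i hq]
  have dH := D.fH.differentiableAt (by omega) (i := i.1.1) hx
  have ds := D.fs.differentiableAt (by omega) (i := i.1.1) hx
  have d1 : DifferentiableAt ℝ (IsSlopeChart.jac i.1.2) q :=
    (i.2.contDiffAt_jac (M := 1) (by omega) hq).differentiableAt (by norm_num)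
  have d2 : DifferentiableAt ℝ (pull H i) q :=
    ((FC_pull_zero (n := n) (σ := σ) (τ := τ) (s := s)
      (D.fH.of_le le_rfl (by omega) (by omega)) le_rfl).differentiableAt (by omega) hq)
  have h1 : pd 1 (jacH H i) q = IsSlopeChart.jac i.1.2 q * pd 1 (pull H i) q +
      pull H i q * pd 1 (IsSlopeChart.jac i.1.2) q :=
    congrArg (· (Pi.single 1 1)) (d1.hasFDerivAt.mul d2.hasFDerivAt).fderiv
  rw [h1, i.2.pd_one_jac (by omega) hq ds, show pd 1 (pull H i) q = _ from
    (i.2.pd_comp_symm (by omega) hq dH).2]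
  have := D.eq i.1.1 _ hx
  simp only [jacH, pull] at this ⊢
  linear_combination IsSlopeChart.jac i.1.2 q * this

lemma FC_E (hτ : 0 < τ) : (discDom S).FC n 2 fun i x => log (τ * ((1 - s i x) * H i x)) := by
  have hn := D.four_le
  refine (((((Dom.FC.const (c := fun _ => 1) (by omega) fun _ => le_rfl).sub D.fs).mul D.fH).smul τ).log
    (c := τ * (1 / 2 * c)) (by have := D.pos; positivity)) fun i x hx => ?_
  have h1 := (abs_le.1 (D.half i x hx)).2
  have h2 := D.le i x hx
  have := D.pos
  gcongr <;> linarith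

lemma jac_diag (hτ : 0 < τ) (i : ChartIdx n σ τ s) {t : ℝ} (ht : t ∈ Ioo 0 σ) :
    IsSlopeChart.jac i.1.2 ![t, t * τ] = τ * (1 - s i.1.1 ![t * τ, t * τ]) := by
  have hn := D.four_le
  have h := i.2.diag_deriv hτ (E := fun q => i.1.2.symm q 0) (f := fun x => x 0)
    (fun t ht => by rw [i.2.symm_diag hτ ht])
    (fun t ht => (i.2.contDiffAt_symm_zero (i.2.diag_mem hτ ht)).differentiableAt
      (by exact_mod_cast (by omega : n ≠ 0)))
    (fun x _ => differentiableAt_apply 0 x) ht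
  have e : ∀ j x, pd j (fun x : Plane => x 0) x = (Pi.single j 1 : Plane) 0 := fun j x =>
    congrArg (· (Pi.single j 1)) (hasFDerivAt_apply (𝕜 := ℝ) (0 : Fin 2) x).fderiv
  simp only [Pi.add_apply, Pi.smul_apply, smul_eq_mul, e,
    i.2.pd_one_symm_zero (by omega) (i.2.diag_mem hτ ht), i.2.symm_diag hτ ht] at h
  simp at h
  rw [IsSlopeChart.jac]
  linarith

lemma log_diag (hτ : 0 < τ) (i : ChartIdx n σ τ s) {t : ℝ} (ht : t ∈ Ioo 0 σ) :
    log (jacH H i ![t, t * τ]) =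
      log (τ * ((1 - s i.1.1 ![t * τ, t * τ]) * H i.1.1 ![t * τ, t * τ])) := by
  rw [jacH, D.jac_diag hτ i ht, pull, i.2.symm_diag hτ ht, mul_assoc]

lemma FC_jacH_zero (hL : (Ξ).FC (n - 1) 0 (logJac H)) :
    (Ξ).FC (n - 1) 0 (jacH H) := by
  refine ⟨Nat.zero_le _, D.contDiffOn_jacH, ?_⟩
  obtain ⟨C, hC⟩ := hL.fb.bdd
  refine ⟨exp C, fun i q hq => ?_⟩
  rw [← exp_log_eq_abs (D.jacH_ne_zero i ((Ξ).hU i hq))]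
  exact exp_le_exp.2 ((le_abs_self _).trans (hC i q hq))

lemma FC_jacH_succ (hL : (Ξ).FC (n - 1) (N + 1) (logJac H))
    (hY : (Ξ).FC (n - 1) N (jacH H)) : (Ξ).FC (n - 1) (N + 1) (jacH H) := by
  have hle := hL.le
  have pl := fun i q hq j => D.pd_log (σ := σ) (τ := τ) i (q := q) hq j
  obtain ⟨k, hk⟩ : ∃ k, n - 1 = k + 1 := ⟨n - 2, by omega⟩
  rw [hk] at hL hY hle ⊢
  exact (hY.of_le le_rfl (Nat.zero_le _) (Nat.zero_le _)).of_d (fun j => (hY.of_le (Nat.le_succ k) le_rfl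
    (by omega)).mul (hL.d j)) fun j i q hq => pl i q hq j

lemma FC_inv_H : (discDom S).FC n 2 fun i x => (H i x)⁻¹ :=
  D.fH.inv D.pos (fun i x hx => (D.pos.trans_le (D.le i x hx)).ne')
    fun i x hx => (D.le i x hx).trans (le_abs_self _)

lemma FC_jac_of (hY : (Ξ).FC (n - 1) N (jacH H))
    (hH : (Ξ).FC (n - 1) N (pull fun i x => (H i x)⁻¹)) :
    (Ξ).FC (n - 1) N fun i => IsSlopeChart.jac i.1.2 :=
  (hY.mul hH).congr fun i q hq => by
    have := (D.pos.trans_le (D.le i.1.1 _ (i.2.symm_mem hq))).ne'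
    simp only [jacH, pull]
    field_simp

/-- The first bound: `∂x¹/∂ξ¹` is bounded above and below. -/
lemma FC_log_zero (hτ : 0 < τ) :
    (Ξ).FC (n - 1) 0 (logJac H) := by
  have hn := D.four_le
  refine FC_zero_of_diag (by omega) hτ D.contDiffOn_log ?_ ?_
  · obtain ⟨C, hC⟩ := D.fP.fb.bdd
    refine ⟨C, fun i q hq => ?_⟩
    have hq' := (Ξ).hU i hq
    rw [D.pd_one_log i hq']
    exact hC _ _ (i.2.symm_mem hq')
  · obtain ⟨C, hC⟩ := (D.FC_E hτ).fb.bdd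
    refine ⟨C, fun i t ht => ?_⟩
    rw [logJac, D.log_diag hτ i ht]
    refine hC i.1.1 _ ?_
    rw [← i.2.symm_diag hτ ht]
    exact i.2.symm_mem (i.2.diag_mem hτ ht)

lemma FC_jac_zero (hτ : 0 < τ) : (Ξ).FC (n - 1) 0 fun i => IsSlopeChart.jac i.1.2 :=
  D.FC_jac_of (D.FC_jacH_zero (D.FC_log_zero hτ))
    ((FC_pull_zero (D.FC_inv_H.of_le le_rfl (by omega) (by omega)) le_rfl).of_le (Nat.sub_le _ _) le_rfl
      (Nat.zero_le _))

lemma FC_pull_one (hτ : 0 < τ) {M : ℕ} (hM : 1 ≤ M) (hMn : M ≤ n) (hf : (discDom S).FC M 1 f) :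
    (Ξ).FC M 1 (pull f) := by
  obtain ⟨M, rfl⟩ : ∃ k, M = k + 1 := ⟨M - 1, by omega⟩
  exact FC_pull_succ ((D.FC_jac_zero hτ).of_le (by omega) le_rfl (Nat.zero_le _))
    ((FC_pull_zero (D.fs.of_le le_rfl (by omega) (by omega)) le_rfl).of_le (by omega) le_rfl (Nat.zero_le _))
    hf hMn

end SlopeData

end

lemma IsSlopeChart.diag_mem_unitDisc {n : ℕ} {σ τ : ℝ} {s : Plane → ℝ}
    {ξ : OpenPartialHomeomorph Plane Plane} (hξ : IsSlopeChart n σ τ s ξ) (hτ : 0 < τ) {t : ℝ}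
    (ht : t ∈ Ioo 0 σ) : (![t * τ, t * τ] : Plane) ∈ unitDisc := by
  rw [← hξ.symm_diag hτ ht]
  exact hξ.symm_mem (hξ.diag_mem hτ ht)

lemma diag_mem_tri {σ τ : ℝ} (hτ : 0 < τ) {t : ℝ} (ht : t ∈ Ioo 0 σ) :
    (![t, t * τ] : Plane) ∈ tri σ τ :=
  ⟨ht.1, ht.2, (mul_pos ht.1 hτ).le, le_rfl⟩

namespace SlopeData

variable {n M N : ℕ} {σ τ : ℝ} {S : Set (ℝ × (Plane → ℝ))} {s H P f : S → Plane → ℝ} {c : ℝ}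

variable (D : SlopeData n S s H P c) (hτ : 0 < τ)

local notation "Ξ" => chartDom n σ τ s
include D

/-- The mixed derivatives of the logarithm are derivatives of the pull-back of `P`. -/
lemma pd_one_pd_zero_log (i : ChartIdx n σ τ s) {q : Plane} (hq : q ∈ i.1.2.target) :
    pd 1 (pd 0 (logJac H i)) q = pd 0 (pull P i) q := by
  have hn := D.four_le
  have h : 2 ≤ n - 1 := by omega
  have ht := i.1.2.open_target.mem_nhds hq
  rw [pd_comm (((D.contDiffOn_log i).contDiffAt ht).of_le (by exact_mod_cast h)) 1 0]
  refine (pd_congr ?_ 0).self_of_nhds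
  filter_upwards [ht] with y hy using D.pd_one_log i hy

include hτ

/-- The logarithm of `jacH`, differentiated along the diagonal. -/
lemma pd_log_diag (i : ChartIdx n σ τ s) {t : ℝ} (ht : t ∈ Ioo 0 σ) :
    (pd 0 (logJac H i) + τ • pd 1 (logJac H i)) ![t, t * τ] =
      (τ • (pd 0 (fun x => log (τ * ((1 - s i.1.1 x) * H i.1.1 x))) +
        pd 1 (fun x => log (τ * ((1 - s i.1.1 x) * H i.1.1 x))))) ![t * τ, t * τ] := by
  have hn := D.four_le
  exact i.2.diag_deriv hτ (fun t ht => D.log_diag hτ i ht) (fun t ht =>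
    ((D.contDiffOn_log i).contDiffAt (i.1.2.open_target.mem_nhds (i.2.diag_mem hτ ht))).differentiableAt
      (by exact_mod_cast (by omega : n - 1 ≠ 0)))
    (fun x hx => (D.FC_E hτ).differentiableAt (by omega) hx) ht

/-- The right-hand side of the identity for the derivative along the diagonal. -/
lemma FC_pd_E : (discDom S).FC (n - 1) 1 fun i =>
    τ • (pd 0 (fun x => log (τ * ((1 - s i x) * H i x))) +
      pd 1 (fun x => log (τ * ((1 - s i x) * H i x)))) := by
  have hn := D.four_le
  have h := D.FC_E hτ
  obtain ⟨k, rfl⟩ : ∃ k, n = k + 1 := ⟨n - 1, by omega⟩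
  exact ((h.d 0).add (h.d 1)).smul τ

/-- `ξ¹`-derivative of the logarithm. -/
lemma FC_pd_log_zero : (Ξ).FC (n - 2) 0 fun i => pd 0 (logJac H i) := by
  have hn := D.four_le
  have cL := fun i => D.contDiffOn_log (σ := σ) (τ := τ) i
  have p1 := fun i q hq => D.pd_one_log (σ := σ) (τ := τ) i (q := q) hq
  have hdiag := fun i t ht => D.pd_log_diag hτ (σ := σ) i (t := t) ht
  obtain ⟨C, hC⟩ := (D.FC_pd_E hτ).fb.bdd
  have hP := D.FC_pull_one (σ := σ) hτ (by omega) (Nat.sub_le _ _)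
    (D.fP.of_le le_rfl (by omega : 1 ≤ 2) (by omega))
  obtain ⟨C', hC'⟩ := hP.fb.bdd
  obtain ⟨k, hk⟩ : ∃ k, n - 1 = k + 1 := ⟨n - 2, by omega⟩
  obtain ⟨C'', hC''⟩ := (hP.fb.2 0).bdd
  rw [show n - 2 = k by omega]
  rw [hk] at cL
  refine FC_zero_of_diag (by omega) hτ (fun i => Dom.FC.contDiffOn_d (A := Ξ)
    i.1.2.open_target (cL i) 0) ⟨C'', fun i q hq => ?_⟩ ⟨C + τ * C', fun i t ht => ?_⟩
  · have hq' := (Ξ).hU i hq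
    rw [D.pd_one_pd_zero_log i hq']
    exact hC'' i q hq
  · have h1 := hdiag i t ht
    rw [Pi.add_apply, Pi.smul_apply, p1 i _ (i.2.diag_mem hτ ht), smul_eq_mul] at h1
    rw [eq_sub_of_add_eq h1]
    refine (abs_sub _ _).trans (add_le_add (hC i.1.1 _ (i.2.diag_mem_unitDisc hτ ht)) ?_)
    rw [abs_mul, abs_of_pos hτ]
    exact mul_le_mul_of_nonneg_left (hC' i _ (diag_mem_tri hτ ht)) hτ.le

/-- A bound for the `ξ¹`-derivative of the logarithm bounds its whole differential. -/
lemma FC_log_succ (h0 : (Ξ).FC (n - 2) N fun i => pd 0 (logJac H i))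
    (hP : (Ξ).FC (n - 2) N (pull P)) :
    (Ξ).FC (n - 1) (N + 1) (logJac H) := by
  have hn := D.four_le
  have hL := D.FC_log_zero (σ := σ) hτ
  have p1 := fun i q hq => D.pd_one_log (σ := σ) (τ := τ) i (q := q) hq
  obtain ⟨k, hk⟩ : ∃ k, n - 1 = k + 1 := ⟨n - 2, by omega⟩
  rw [show n - 2 = k by omega] at h0 hP
  rw [hk] at hL ⊢
  refine hL.of_d (f' := ![fun i => pd 0 (logJac H i), pull P]) (fun j => ?_)
    fun j i q hq => ?_
  · fin_cases j
    exacts [h0, hP]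
  · fin_cases j
    exacts [rfl, p1 i q hq]

lemma FC_jac_one : (Ξ).FC (n - 1) 1 fun i => IsSlopeChart.jac i.1.2 := by
  have hn := D.four_le
  have hP := (FC_pull_zero (n := n) (σ := σ) (τ := τ) (s := s)
    (D.fP.of_le (Nat.sub_le_sub_left one_le_two n) (Nat.zero_le 2) (Nat.zero_le _)) (Nat.sub_le _ _))
  exact D.FC_jac_of (D.FC_jacH_succ (D.FC_log_succ hτ (D.FC_pd_log_zero hτ) hP)
    (D.FC_jacH_zero (D.FC_log_zero hτ)))
    (D.FC_pull_one hτ (by omega) (Nat.sub_le _ _) (D.FC_inv_H.of_le (Nat.sub_le _ _) (by omega) (by omega)))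

lemma FC_pull_two {M : ℕ} (hM : 2 ≤ M) (hMn : M ≤ n) (hf : (discDom S).FC M 2 f) :
    (Ξ).FC M 2 (pull f) := by
  obtain ⟨M, rfl⟩ : ∃ k, M = k + 1 := ⟨M - 1, by omega⟩
  exact FC_pull_succ ((D.FC_jac_one hτ).of_le (by omega) le_rfl (by omega))
    (D.FC_pull_one hτ (by omega) (by omega) (D.fs.of_le (by omega) (by omega) (by omega))) hf hMn

/-- The second `ξ¹`-derivative of the logarithm. -/
lemma FC_pd_pd_log_zero : (Ξ).FC (n - 3) 0 fun i =>
    pd 0 (pd 0 (logJac H i)) := by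
  have hn := D.four_le
  have cL := fun i => D.contDiffOn_log (σ := σ) (τ := τ) i
  have p1 := fun i q hq => D.pd_one_log (σ := σ) (τ := τ) i (q := q) hq
  have hdiag := fun i t ht => D.pd_log_diag hτ (σ := σ) i (t := t) ht
  have hE := D.FC_pd_E hτ
  have hP := D.FC_pull_two (σ := σ) hτ (by omega) (Nat.sub_le _ _) D.fP
  have hmem := fun (i : ChartIdx n σ τ s) t (ht : t ∈ Ioo 0 σ) => i.2.diag_mem_unitDisc hτ ht
  obtain ⟨k, hk⟩ : ∃ k, n - 1 = k + 2 := ⟨n - 3, by omega⟩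
  rw [show n - 3 = k by omega]
  rw [hk] at cL hE hP
  obtain ⟨C0, hC0⟩ := (hE.d 0).fb.bdd
  obtain ⟨C1, hC1⟩ := (hE.d 1).fb.bdd
  obtain ⟨B0, hB0⟩ := (hP.d 0).fb.bdd
  obtain ⟨B1, hB1⟩ := (hP.d 1).fb.bdd
  obtain ⟨B2, hB2⟩ := ((hP.d 0).d 0).fb.bdd
  have cL1 : ∀ i : ChartIdx n σ τ s, ContDiffOn ℝ (k + 1 : ℕ)
      (pd 0 (logJac H i)) i.1.2.target := fun i =>
    Dom.FC.contDiffOn_d (A := Ξ) i.1.2.open_target (cL i) 0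
  have mix : ∀ i : ChartIdx n σ τ s, ∀ q ∈ i.1.2.target,
      pd 1 (pd 0 (logJac H i)) q = pd 0 (pull P i) q := fun i q hq => D.pd_one_pd_zero_log i hq
  refine FC_zero_of_diag (by omega) hτ (fun i => Dom.FC.contDiffOn_d (A := Ξ)
    i.1.2.open_target (cL1 i) 0) ⟨B2, fun i q hq => ?_⟩
    ⟨τ * (C0 + C1) + 2 * τ * B0 + τ ^ 2 * B1, fun i t ht => ?_⟩
  · have hq' := (Ξ).hU i hq
    rw [pd_comm (((cL1 i).contDiffAt (i.1.2.open_target.mem_nhds hq')).of_le (by norm_cast; omega)) 1 0,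
      (pd_congr (show pd 1 (pd 0 (logJac H i)) =ᶠ[𝓝 q] pd 0 (pull P i) by
        filter_upwards [i.1.2.open_target.mem_nhds hq'] with y hy using mix i y hy) 0).self_of_nhds]
    exact hB2 i q hq
  · have hev : ∀ q ∈ i.1.2.target, (pd 0 (logJac H i) +
        τ • pd 1 (logJac H i)) =ᶠ[𝓝 q]
        (pd 0 (logJac H i) + τ • pull P i) := fun q hq => by
      filter_upwards [i.1.2.open_target.mem_nhds hq] with y hy
      rw [Pi.add_apply, Pi.smul_apply, p1 i y hy]
      rfl
    have d1 : ∀ q ∈ i.1.2.target, HasFDerivAt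
        (pd 0 (logJac H i) + τ • pd 1 (logJac H i))
        (fderiv ℝ (pd 0 (logJac H i)) q + τ • fderiv ℝ (pull P i) q) q :=
      fun q hq => (((((cL1 i).contDiffAt (i.1.2.open_target.mem_nhds hq)).differentiableAt
        (by norm_cast)).hasFDerivAt).add
        ((hP.differentiableAt (by omega) hq).hasFDerivAt.const_smul τ)).congr_of_eventuallyEq (hev q hq)
    have h1 := i.2.diag_deriv hτ (fun t ht => hdiag i t ht)
      (fun t ht => (d1 _ (i.2.diag_mem hτ ht)).differentiableAt)
      (fun x hx => hE.differentiableAt (by omega) hx) ht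
    have hq := i.2.diag_mem hτ ht
    have hq' := diag_mem_tri hτ ht
    have e : ∀ j, pd j (pd 0 (logJac H i) +
        τ • pd 1 (logJac H i)) ![t, t * τ] =
        pd j (pd 0 (logJac H i)) ![t, t * τ] + τ * pd j (pull P i) ![t, t * τ] :=
      fun j => congrArg (· (Pi.single j 1)) (d1 _ hq).fderiv
    rw [Pi.add_apply, Pi.smul_apply, e 0, e 1, mix i _ hq, Pi.smul_apply, Pi.add_apply] at h1
    simp only [smul_eq_mul] at h1
    have b0 := hB0 i _ hq'
    have b1 := hB1 i _ hq'
    have c0 := hC0 i.1.1 _ (hmem i t ht)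
    have c1 := hC1 i.1.1 _ (hmem i t ht)
    change |pd 0 (pull P i) _| ≤ _ at b0
    change |pd 1 (pull P i) _| ≤ _ at b1
    change |pd 0 _ _| ≤ _ at c0
    change |pd 1 _ _| ≤ _ at c1
    rw [eq_sub_of_add_eq (eq_sub_of_add_eq h1)]
    rw [abs_le] at b0 b1 c0 c1 ⊢
    constructor <;> nlinarith [mul_pos hτ hτ]

/-- The second bound: `∂x¹/∂ξ¹` is bounded in `C²`. -/
lemma FC_jac_two : (Ξ).FC (n - 1) 2 fun i => IsSlopeChart.jac i.1.2 := by
  have hn := D.four_le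
  have hP := D.FC_pull_two (σ := σ) hτ (by omega) (Nat.sub_le _ _) D.fP
  have h0 := D.FC_pd_log_zero (σ := σ) hτ
  have h00 := D.FC_pd_pd_log_zero (σ := σ) hτ
  have h1 : (Ξ).FC (n - 2) 1 fun i => pd 0 (logJac H i) := by
    obtain ⟨k, hk⟩ : ∃ k, n - 1 = k + 2 := ⟨n - 3, by omega⟩
    rw [show n - 3 = k by omega] at h00
    rw [show n - 2 = k + 1 by omega] at h0 ⊢
    rw [hk] at hP
    refine h0.of_d (f' := ![fun i => pd 0 (pd 0 (logJac H i)),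
      fun i => pd 0 (pull P i)]) (fun j => ?_) fun j i q hq => ?_
    · fin_cases j
      exacts [h00, (hP.d 0).of_le (by omega) (by omega) (by omega)]
    · fin_cases j
      · rfl
      · exact D.pd_one_pd_zero_log i hq
  have hL := D.FC_log_succ hτ h1 (hP.of_le (by omega) (by omega) (by omega))
  have hY := D.FC_jacH_succ (hL.of_le le_rfl (by omega : 0 + 1 ≤ 2) (by omega))
    (D.FC_jacH_zero (D.FC_log_zero hτ))
  exact D.FC_jac_of (D.FC_jacH_succ hL hY)
    (D.FC_pull_two hτ (by omega) (Nat.sub_le _ _) (D.FC_inv_H.of_le (Nat.sub_le _ _) le_rfl (by omega)))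

/-- `∂ξ¹/∂x¹`, in the coordinates `ξ`. -/
lemma FC_inv_jac : (Ξ).FC (n - 1) 2 fun i q => (IsSlopeChart.jac i.1.2 q)⁻¹ := by
  have hn := D.four_le
  obtain ⟨C, hC⟩ := (D.FC_log_zero hτ).fb.bdd
  obtain ⟨B, hB⟩ := D.fH.fb.bdd
  refine (D.FC_jac_two hτ).inv (c := exp (-C) / (|B| + 1)) (by positivity)
    (fun i q hq => i.2.jac_ne_zero (by omega) hq) fun i q hq => ?_
  have hq' := (Ξ).hU i hq
  have h1 : exp (-C) ≤ |jacH H i q| := by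
    rw [← exp_log_eq_abs (D.jacH_ne_zero i hq')]
    exact exp_le_exp.2 (abs_le.1 (hC i q hq)).1
  rw [jacH, abs_mul] at h1
  rw [div_le_iff₀ (by positivity)]
  have h2 : |pull H i q| ≤ B := hB i.1.1 _ (i.2.symm_mem hq')
  refine h1.trans (mul_le_mul_of_nonneg_left ?_ (abs_nonneg _))
  linarith [le_abs_self B]

end SlopeData

/-! ### Smallness of the coefficients -/

variable {n M N : ℕ} {κ : Plane → ℝ} {G : Metric2} {z₀ : Plane → ℝ} {a ρ : ℝ} {V : Set Plane}
  {S : Set (ℝ × (Plane → ℝ))} {σ τ : ℝ}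

lemma IsSlopeChart.lt_symm_zero {s : Plane → ℝ} {ξ : OpenPartialHomeomorph Plane Plane} (hn : 1 ≤ n)
    (hξ : IsSlopeChart n σ τ s ξ) (hτ : 0 < τ) (hs : ∀ x ∈ unitDisc, |s x| ≤ 1 / 2) {q : Plane}
    (h0 : q 0 ∈ Ioo 0 σ) (h1 : 0 ≤ q 1) (h2 : q 1 < q 0 * τ) : q 1 < ξ.symm q 0 := by
  have hmem : ∀ u ∈ Icc (q 1) (q 0 * τ), (![q 0, u] : Plane) ∈ ξ.target := fun u hu =>
    hξ.target ⟨h0.1.le, h0.2.le, h1.trans hu.1, hu.2⟩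
  have hd : ∀ u ∈ Icc (q 1) (q 0 * τ),
      HasDerivAt (fun u => ξ.symm ![q 0, u] 0 - u) (s (ξ.symm ![q 0, u]) - 1) u := by
    intro u hu
    have e1 := (hξ.contDiffAt_symm_zero (hmem u hu)).differentiableAt
      (by exact_mod_cast (by omega : n ≠ 0))
    have e2 : HasDerivAt (fun u : ℝ => (![q 0, u] : Plane)) (Pi.single 1 1) u := by
      rw [hasDerivAt_pi]
      intro k
      fin_cases k
      · simpa using hasDerivAt_const u (q 0)
      · exact hasDerivAt_id u
    have e3 := e1.hasFDerivAt.comp_hasDerivAt u e2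
    rw [show fderiv ℝ (fun q => ξ.symm q 0) ![q 0, u] (Pi.single 1 1) = s (ξ.symm ![q 0, u]) from
      hξ.pd_one_symm_zero hn (hmem u hu)] at e3
    exact e3.sub (hasDerivAt_id u)
  have hanti := strictAntiOn_of_deriv_neg (convex_Icc (q 1) (q 0 * τ))
    (fun u hu => (hd u hu).continuousAt.continuousWithinAt) (fun u hu => by
      have hu' := interior_subset hu
      rw [(hd u hu').deriv]
      linarith [(abs_le.1 (hs _ (hξ.symm_mem (hmem u hu')))).2])
  have h := hanti (left_mem_Icc.2 h2.le) (right_mem_Icc.2 h2.le) h2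
  have hq' : (![q 0, q 1] : Plane) = q := by ext k; fin_cases k <;> rfl
  simp only [hξ.symm_diag hτ h0, hq'] at h
  simp at h
  linarith

/-- The first two derivatives of `ξ¹` in `x¹`, in the coordinates `ξ`. -/
lemma IsSlopeChart.pd_pd_zero_comp0 {s : Plane → ℝ} {ξ : OpenPartialHomeomorph Plane Plane} (hn : 2 ≤ n)
    (hξ : IsSlopeChart n σ τ s ξ) {q : Plane} (hq : q ∈ ξ.target) :
    pd 0 (comp0 ξ) (ξ.symm q) = (jac ξ q)⁻¹ ∧
      pd 0 (pd 0 (comp0 ξ)) (ξ.symm q) = pd 0 (fun q => (jac ξ q)⁻¹) q * (jac ξ q)⁻¹ := by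
  have h0 : ∀ q ∈ ξ.target, pd 0 (comp0 ξ) (ξ.symm q) = (jac ξ q)⁻¹ := fun q hq =>
    eq_inv_of_mul_eq_one_left (hξ.pd_zero_comp0_mul_jac (by omega) hq)
  refine ⟨h0 q hq, ?_⟩
  have hd : DifferentiableAt ℝ (pd 0 (comp0 ξ)) (ξ.symm q) :=
    (contDiffAt_pd ((hξ.contDiffAt_comp0 (ξ.map_target hq)).of_le (by exact_mod_cast hn))
      0).differentiableAt (by norm_num)
  have h1 := (hξ.pd_comp_symm (by omega) hq hd).1
  rw [(pd_congr (show (fun q => pd 0 (comp0 ξ) (ξ.symm q)) =ᶠ[𝓝 q] fun q => (jac ξ q)⁻¹ by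
    filter_upwards [ξ.open_target.mem_nhds hq] with y hy using h0 y hy) 0).self_of_nhds] at h1
  rw [h1]
  have := hξ.jac_ne_zero (by omega) hq
  field_simp

lemma IsGood.cof_ne_zero (hS : IsGood κ G z₀ a ρ S) (i : S) : ∀ x ∈ unitDisc, cof G i.1.1 (zOf z₀ i.1) 1 1 x ≠ 0 := fun x hx => by
  rw [cof_one_one_zOf]
  exact (hS.hess_pos i hx).ne'

namespace IsGood

variable (hS : IsGood κ G z₀ a ρ S) (LG : LocalGeometry n κ G z₀ a ρ V) (hn : 4 ≤ n)
include hS LG hn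

lemma slopeData : SlopeData n S (fun i => slope G z₀ 0 1 i.1)
    (fun i => hess G z₀ 0 0 i.1)
    (fun i x => (pd 1 (hess G z₀ 0 0 i.1) x - pd 0 (hess G z₀ 0 1 i.1) x) *
      (hess G z₀ 0 0 i.1 x)⁻¹) (a / 2) := by
  have hs := FC_of_div hS.params (hS.FC_slope LG (by omega) (j := 0) (k := 1) (by decide))
  have hH := LG.FC_hess hS.params (by omega) 0 0
  refine ⟨hn, hs, hH, (LG.FC_codazzi hS.params (by omega)).mul
    ((hS.FC_inv_hess LG (by omega)).of_le (Nat.sub_le _ _) le_rfl (by omega)),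
    fun i x hx => hS.slope_le i.1 i.2 x hx, half_pos hS.a_pos, fun i x hx => hS.hess_ge i.1 i.2 x hx,
    fun i x hx => ?_⟩
  have e : (fun x => slope G z₀ 0 1 i.1 x * hess G z₀ 0 0 i.1 x) =ᶠ[𝓝 x]
      fun x => -hess G z₀ 0 1 i.1 x := by
    filter_upwards [isOpen_unitDisc.mem_nhds hx] with y hy
    rw [slope, cof_one_one_zOf, div_mul_cancel₀ _ (hS.hess_pos i hy).ne', cof_zero_one]
    rfl
  have h1 := (pd_congr e 0).self_of_nhds
  have h2 := congrArg (· (Pi.single 0 1)) ((hs.differentiableAt (by omega) (i := i) hx).hasFDerivAt.mul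
    (hH.differentiableAt (by omega) (i := i) hx).hasFDerivAt).fderiv
  have h3 := congrArg (· (Pi.single 0 1)) ((LG.FC_hess hS.params (by omega) 0 1).differentiableAt
    (by omega) (i := i) hx).hasFDerivAt.neg.fderiv
  rw [show pd 0 (fun x => slope G z₀ 0 1 i.1 x * hess G z₀ 0 0 i.1 x) x = _
    from h2, show pd 0 (fun x => -hess G z₀ 0 1 i.1 x) x = _ from h3] at h1
  have := (hS.hess_pos i hx).ne'
  simp at h1
  simp only [pd] at h1 ⊢
  field_simp
  linear_combination h1

variable (hτ : 0 < τ)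
include hτ

lemma FC_coefk : (chartDom n σ τ fun i : S => slope G z₀ 0 1 i.1).FC (n - 1) 2
    fun i q => i.1.1.1.1⁻¹ * coefk κ G i.1.1.1.1 (zOf z₀ i.1.1.1) i.1.2 (i.1.2.symm q) := by
  have D := hS.slopeData LG hn
  have hj := D.FC_inv_jac hτ (σ := σ)
  refine (((D.FC_pull_two hτ (by omega) le_rfl (hS.FC_curvTerm LG (by omega))).of_le (Nat.sub_le _ _)
    le_rfl (by omega)).mul (hj.mul hj)).congr fun i q hq => ?_
  rw [coefk_eq rfl i.2 (i.1.2.map_target hq) (hS.cof_ne_zero i.1.1 _ (i.2.symm_mem hq)),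
    (i.2.pd_pd_zero_comp0 (by omega) hq).1]
  simp only [pull]
  ring

lemma FC_coefd : (chartDom n σ τ fun i : S => slope G z₀ 0 1 i.1).FC (n - 1) 1
    fun i q => i.1.1.1.1⁻¹ * coefd κ G i.1.1.1.1 (zOf z₀ i.1.1.1) (i.1.2.symm q) :=
  (hS.slopeData LG hn).FC_pull_one hτ (by omega) (Nat.sub_le _ _) (hS.FC_opFirst LG (by omega) 1)

lemma FC_coefb : (chartDom n σ τ fun i : S => slope G z₀ 0 1 i.1).FC (n - 2) 1
    fun i q => i.1.1.1.1⁻¹ * coefb κ G i.1.1.1.1 (zOf z₀ i.1.1.1) i.1.2 (i.1.2.symm q) := by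
  have D := hS.slopeData LG hn
  have hs := hS.FC_slope LG (by omega) (j := 0) (k := 1) (by decide)
  have hs1 := FC_of_div hS.params hs
  have hs' := FC_of_div hS.params (hS.FC_slope LG (by omega) (j := 1) (k := 0) (by decide))
  have hF := hS.FC_opFirst LG (by omega)
  have hj := D.FC_inv_jac hτ (σ := σ)
  have hk := ((D.FC_pull_two hτ (σ := σ) (by omega) le_rfl (hS.FC_curvTerm LG (by omega))).of_le
    (Nat.sub_le n 2) (by omega : 1 ≤ 2) (by omega))
  -- The first order part, as a function of `x`.
  have hx : (discDom S).FC (n - 1) 1 fun i x => i.1.1⁻¹ * opFirst κ G i.1.1 (zOf z₀ i.1) 0 x -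
      (i.1.1⁻¹ * pd 1 (slope G z₀ 0 1 i.1) x + slope G z₀ 1 0 i.1 x *
        (i.1.1⁻¹ * pd 0 (slope G z₀ 0 1 i.1) x)) -
      i.1.1⁻¹ * opFirst κ G i.1.1 (zOf z₀ i.1) 1 x * slope G z₀ 0 1 i.1 x := by
    have hd : ∀ j, (discDom S).FC (n - 1) 1 fun i x =>
        i.1.1⁻¹ * pd j (slope G z₀ 0 1 i.1) x := fun j => by
      have hs := hs
      have hs1 := hs1
      obtain ⟨k, rfl⟩ : ∃ k, n = k + 1 := ⟨n - 1, by omega⟩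
      refine (hs.d j).congr fun i x hx => ?_
      exact (congrArg (· (Pi.single j 1))
        ((hs1.differentiableAt (by omega) hx).hasFDerivAt.const_mul i.1.1⁻¹).fderiv).symm
    have l := fun {f : S → Plane → ℝ} (h : (discDom S).FC n 2 f) =>
      h.of_le (Nat.sub_le n 1) (by omega : 1 ≤ 2) (by omega)
    exact ((hF 0).sub ((hd 1).add ((l hs').mul (hd 0)))).sub ((hF 1).mul (l hs1))
  have hx' := (D.FC_pull_one hτ (σ := σ) (by omega) (Nat.sub_le _ _) hx).of_le
    (by omega : n - 2 ≤ n - 1) le_rfl (by omega)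
  obtain ⟨k, hk'⟩ : ∃ k, n - 1 = k + 1 := ⟨n - 2, by omega⟩
  rw [hk'] at hj
  rw [show n - 2 = k by omega] at hk hx' ⊢
  have hj1 := hj.of_le (Nat.le_succ k) (by omega : 1 ≤ 2) (by omega)
  refine ((hk.mul ((hj.d 0).mul hj1)).add (hx'.mul hj1)).congr fun i q hq => ?_
  have hxq := i.2.symm_mem hq
  rw [coefb_eq rfl i.2 (by omega) (i.1.2.map_target hq) (hs1.differentiableAt (by omega) hxq)
    (hS.cof_ne_zero i.1.1 _ hxq), (i.2.pd_pd_zero_comp0 (by omega) hq).1,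
    (i.2.pd_pd_zero_comp0 (by omega) hq).2]
  simp only [pull, Dom.d, chartDom, pd]
  ring

end IsGood

/-! ### The coefficients in polar coordinates -/

/-- The point with given polar coordinates. -/
def polarMap (q : ℝ × ℝ) : Plane := ![q.1 * cos q.2, q.1 * sin q.2]

lemma contDiff_polarMap {n : WithTop ℕ∞} : ContDiff ℝ n polarMap :=
  contDiff_pair (contDiff_fst.mul (contDiff_cos.comp contDiff_snd))
    (contDiff_fst.mul (contDiff_sin.comp contDiff_snd))

lemma fderiv_polarMap (q v : ℝ × ℝ) : fderiv ℝ polarMap q v =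
    ![v.1 * cos q.2 - q.1 * sin q.2 * v.2, v.1 * sin q.2 + q.1 * cos q.2 * v.2] := by
  have h1 := (hasFDerivAt_fst (𝕜 := ℝ) (p := q)).mul
    ((hasDerivAt_cos q.2).comp_hasFDerivAt q (hasFDerivAt_snd (𝕜 := ℝ) (p := q)))
  have h2 := (hasFDerivAt_fst (𝕜 := ℝ) (p := q)).mul
    ((hasDerivAt_sin q.2).comp_hasFDerivAt q (hasFDerivAt_snd (𝕜 := ℝ) (p := q)))
  have hd := (contDiff_polarMap (n := 1)).differentiable (by norm_num) q
  have hc := fun k : Fin 2 => ((hasFDerivAt_apply (𝕜 := ℝ) k (polarMap q)).comp q hd.hasFDerivAt)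
  ext k
  fin_cases k
  · refine (congrArg (· v) ((hc 0).unique h1)).trans ?_
    simp
    ring
  · refine (congrArg (· v) ((hc 1).unique h2)).trans ?_
    simp
    ring

/-- Closed polar rectangles lie in the closed triangle. -/
lemma polarMap_mem {σ δ : ℝ} (hδ : δ < 1 / 2) {q : ℝ × ℝ} (hq : q ∈ Icc 0 σ ×ˢ Icc 0 δ) :
    polarMap q ∈ {q : Plane | 0 ≤ q 0 ∧ q 0 ≤ σ ∧ 0 ≤ q 1 ∧ q 1 ≤ q 0 * tan δ} := by
  obtain ⟨⟨h1, h2⟩, h3, h4⟩ := hq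
  have hπ := pi_gt_three
  have hcos : 0 < cos q.2 := cos_pos_of_mem_Ioo ⟨by linarith, by linarith⟩
  have hsin : 0 ≤ sin q.2 := sin_nonneg_of_nonneg_of_le_pi h3 (by linarith)
  have htan : tan q.2 ≤ tan δ :=
    strictMonoOn_tan.monotoneOn ⟨by linarith, by linarith⟩ ⟨by linarith, by linarith⟩ h4
  rw [tan_eq_sin_div_cos, div_le_iff₀ hcos] at htan
  refine ⟨mul_nonneg h1 hcos.le, ?_, mul_nonneg h1 hsin, ?_⟩
  · change q.1 * cos q.2 ≤ σ
    nlinarith [cos_le_one q.2]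
  · change q.1 * sin q.2 ≤ q.1 * cos q.2 * tan δ
    nlinarith

lemma polarMap_mem_tri {σ δ : ℝ} (hδ : δ < 1 / 2) {q : ℝ × ℝ} (hq : q ∈ rect σ δ) :
    0 < polarMap q 0 ∧ polarMap q 0 < σ ∧ 0 < polarMap q 1 ∧
      polarMap q 1 < polarMap q 0 * tan δ := by
  obtain ⟨⟨h1, h2⟩, h3, h4⟩ := hq
  have hπ := pi_gt_three
  have hcos : 0 < cos q.2 := cos_pos_of_mem_Ioo ⟨by linarith, by linarith⟩
  have hsin : 0 < sin q.2 := sin_pos_of_pos_of_lt_pi h3 (by linarith)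
  have htan : tan q.2 < tan δ :=
    strictMonoOn_tan ⟨by linarith, by linarith⟩ ⟨by linarith, by linarith⟩ h4
  rw [tan_eq_sin_div_cos, div_lt_iff₀ hcos] at htan
  refine ⟨mul_pos h1 hcos, ?_, mul_pos h1 hsin, ?_⟩
  · change q.1 * cos q.2 < σ
    nlinarith [cos_le_one q.2]
  · change q.1 * sin q.2 < q.1 * cos q.2 * tan δ
    nlinarith

/-- Families of functions of `(r, θ)` on the rectangle. -/
def rectDom (ι : Type*) (σ δ : ℝ) : Dom ι (ℝ × ℝ) :=
  ⟨![fun _ => (1, 0), fun _ => (0, 1)], fun _ => rect σ δ, fun _ => rect σ δ, fun j _ => by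
    fin_cases j <;> exact contDiff_const, fun _ => isOpen_rect σ δ, fun _ => subset_rfl⟩

lemma abs_dr_iterate_dθ_iterate_le {ι : Type*} {σ δ : ℝ} {N : ℕ} {f : ι → ℱ}
    (hf : (rectDom ι σ δ).FB N f) (hd : ∀ i, ContDiff ℝ N (f i)) :
    ∃ C, ∀ i, ∀ a b, a + b ≤ N → ∀ q ∈ rect σ δ, |dr^[a] (dθ^[b] (f i)) q| ≤ C := by
  induction N generalizing f with
  | zero =>
    obtain ⟨C, hC⟩ := hf
    refine ⟨C, fun i a b hab q hq => ?_⟩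
    obtain ⟨rfl, rfl⟩ : a = 0 ∧ b = 0 := by omega
    exact hC i q hq
  | succ N ih =>
    have hdiff : ∀ i, Differentiable ℝ (f i) := fun i => (hd i).diff (by omega)
    obtain ⟨C, hC⟩ := hf.1
    obtain ⟨C0, hC0⟩ := ih (f := fun i => dr (f i)) (by
      convert hf.2 0 using 2 with i
      exact dr_eq_fderiv_fun (hdiff i)) fun i => contDiff_dr (hd i)
    obtain ⟨C1, hC1⟩ := ih (f := fun i => dθ (f i)) (by
      convert hf.2 1 using 2 with i
      exact dθ_eq_fderiv_fun (hdiff i)) fun i => contDiff_dθ (hd i)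
    refine ⟨max C (max C0 C1), fun i a b hab q hq => ?_⟩
    rcases b with _ | b
    · rcases a with _ | a
      · exact (hC i q hq).trans (le_max_left _ _)
      · exact (hC0 i a 0 (by omega) q hq).trans ((le_max_left _ _).trans (le_max_right _ _))
    · exact (hC1 i a b (by omega) q hq).trans ((le_max_right _ _).trans (le_max_right _ _))

section

variable {n M N m : ℕ} {S : Set (ℝ × (Plane → ℝ))} {s : S → Plane → ℝ} {σ δ : ℝ}

/-- Families of functions of `ξ`, in polar coordinates. -/
lemma FC_polar (hδ : δ < 1 / 2) {f : ChartIdx n σ (tan δ) s → Plane → ℝ}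
    (hf : (chartDom n σ (tan δ) s).FC M N f) :
    (rectDom (ChartIdx n σ (tan δ) s) σ δ).FC M N fun i q => f i (polarMap q) := by
  have hmap : ∀ q ∈ rect σ δ, polarMap q ∈ tri σ (tan δ) := fun q hq => by
    obtain ⟨h1, h2, h3, h4⟩ := polarMap_mem_tri hδ hq
    exact ⟨h1, h2, h3.le, h4.le⟩
  refine hf.comp (B := rectDom _ σ δ) (X := fun _ => polarMap)
    (c := ![![fun _ q => cos q.2, fun _ q => sin q.2],
      ![fun _ q => -(q.1 * sin q.2), fun _ q => q.1 * cos q.2]])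
    (fun i => contDiff_polarMap.contDiffOn) (fun i q hq => (chartDom n σ (tan δ) s).hU i (hmap q hq))
    (fun i q hq => hmap q hq) (fun j l => ?_) fun _ j i q _ => ?_
  · have key : ∀ {g : ℱ}, ContDiff ℝ (M - 1 : ℕ) g →
        (rectDom (ChartIdx n σ (tan δ) s) σ δ).FC (M - 1) (N - 1) fun _ => g := fun hg =>
      .of_contDiffOn (isCompact_Icc.prod isCompact_Icc) isOpen_univ (subset_univ _) hg.contDiffOn
        (Nat.sub_le_sub_right hf.le 1) (fun _ => subset_univ _) fun _ => rect_subset σ δ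
    have hc : ContDiff ℝ (M - 1 : ℕ) fun q : ℝ × ℝ => cos q.2 := contDiff_cos.comp contDiff_snd
    have hs : ContDiff ℝ (M - 1 : ℕ) fun q : ℝ × ℝ => sin q.2 := contDiff_sin.comp contDiff_snd
    fin_cases j <;> fin_cases l
    exacts [key hc, key hs, key (contDiff_fst.mul hs).neg, key (contDiff_fst.mul hc)]
  · rw [fderiv_polarMap]
    ext k
    fin_cases j <;> fin_cases k <;> simp [rectDom, chartDom]

/-- Extension of a function of `(r, θ)` from the closed rectangle to the plane. -/
lemma exists_extension (hδ : δ < 1 / 2) {ξ : OpenPartialHomeomorph Plane Plane}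
    (hξ : {q : Plane | 0 ≤ q 0 ∧ q 0 ≤ σ ∧ 0 ≤ q 1 ∧ q 1 ≤ q 0 * tan δ} ⊆ ξ.target)
    {f : Plane → ℝ} (hf : ContDiffOn ℝ m f ξ.target) :
    ∃ F : ℱ, ContDiff ℝ m F ∧ EqOn F (fun q => f (polarMap q)) (rect σ δ) := by
  have hc : Continuous polarMap := (contDiff_polarMap (n := 0)).continuous
  have hV : IsOpen (polarMap ⁻¹' ξ.target) := ξ.open_target.preimage hc
  obtain ⟨χ, cχ, h1, -, L, hL, hLV, h0⟩ := exists_cutoff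
    ((isCompact_Icc (a := (0 : ℝ)) (b := σ)).prod (isCompact_Icc (a := (0 : ℝ)) (b := δ))) hV
    fun q hq => hξ (polarMap_mem hδ hq)
  refine ⟨_, contDiff_cutoff_mul (n := m) (cχ.of_le (by exact_mod_cast le_top)) hV hL hLV h0
    (hf.comp contDiff_polarMap.contDiffOn fun q hq => hq), fun q hq => ?_⟩
  have := h1.self_of_nhdsSet q (rect_subset σ δ hq)
  simp [this]

/-- A family of functions of `ξ` of the size `ε`, in polar coordinates: for small `ε` the derivatives
of order at most `N` are bounded by one. -/
lemma exists_small_extension (hδ : δ < 1 / 2) {ρ : ℝ} (hS : S ⊆ params ρ)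
    {f : ChartIdx n σ (tan δ) s → Plane → ℝ}
    (hf : (chartDom n σ (tan δ) s).FC M N fun i q => i.1.1.1.1⁻¹ * f i q) :
    ∃ ε₁ > 0, ∀ i : ChartIdx n σ (tan δ) s, i.1.1.1.1 < ε₁ →
      ∃ F : ℱ, ContDiff ℝ M F ∧ EqOn F (fun q => f i (polarMap q)) (rect σ δ) ∧
        ∀ a b, a + b ≤ N → ∀ q ∈ rect σ δ, |dr^[a] (dθ^[b] F) q| ≤ 1 := by
  have hcd : ∀ i : ChartIdx n σ (tan δ) s, ContDiffOn ℝ M (f i) i.1.2.target := fun i => by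
    refine (contDiffOn_const (c := i.1.1.1.1).mul (hf.cd i)).congr fun q _ => ?_
    have := params_ne_zero hS i.1.1
    field_simp
  choose F cF eF using fun i => exists_extension hδ i.2.target (hcd i)
  obtain ⟨C, hC⟩ := abs_dr_iterate_dθ_iterate_le (f := fun i => i.1.1.1.1⁻¹ • F i)
    ((FC_polar hδ hf).fb.congr fun i q hq => by
      simp only [Pi.smul_apply, smul_eq_mul]
      rw [eF i hq]) fun i =>
      show ContDiff ℝ N fun q => i.1.1.1.1⁻¹ * F i q from
        contDiff_const.mul ((cF i).of_nat hf.le)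
  refine ⟨1 / (|C| + 1), by positivity, fun i hi => ⟨F i, cF i, eF i, fun a b hab q hq => ?_⟩⟩
  have h := hC i a b hab q hq
  have h0 := (hS i.1.1.2).1
  rw [dθ_iterate_smul, dr_iterate_smul, Pi.smul_apply, smul_eq_mul, abs_mul, abs_inv, abs_of_pos h0,
    inv_mul_le_iff₀ h0] at h
  rw [lt_div_iff₀ (by positivity)] at hi
  nlinarith [le_abs_self C]

end

/-! ### The boundary value problem -/

/-- For `ε` small, the canonical charts exist, and the coefficients in polar coordinates satisfy
the hypotheses under which the boundary value problem is solvable. -/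
theorem exists_polarCoef {n m : ℕ} {κ : Plane → ℝ} {G : Metric2} {z₀ : Plane → ℝ} {a ρ : ℝ}
    {V : Set Plane} (LG : LocalGeometry n κ G z₀ a ρ V) (ha : 0 < a) (hn : 4 ≤ n) (hm : m + 2 ≤ n)
    {σ δ : ℝ} (hδ0 : 0 < δ) (hδ : δ < 1 / 2) (hσδ : σ * tan δ ≤ 1 / 10) :
    ∃ ε₀ > 0, ∀ ε : ℝ, 0 < ε → ε < ε₀ → ∀ w : Plane → ℝ, IsAdmissible w →
      (∃ ξ, IsCanonicalChart n σ δ G ε (perturb ε z₀ w) ξ) ∧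
      ∀ ξ, IsCanonicalChart n σ δ G ε (perturb ε z₀ w) ξ →
        ∃ k b d, PolarCoef m σ δ k b d ∧
          EqOn (fun q => coefk κ G ε (perturb ε z₀ w) ξ (polarPoint ξ q)) k (rect σ δ) ∧
          EqOn (fun q => coefb κ G ε (perturb ε z₀ w) ξ (polarPoint ξ q)) b (rect σ δ) ∧
          EqOn (fun q => coefd κ G ε (perturb ε z₀ w) (polarPoint ξ q)) d (rect σ δ) := by
  have hτ : 0 < tan δ := tan_pos_of_pos_of_lt_pi_div_two hδ0 (by linarith [pi_gt_three])
  obtain ⟨ε₁, hε₁, hS⟩ := LG.exists_isGood (by omega) ha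
  obtain ⟨e2, he2, H2⟩ := exists_small_extension hδ hS.params (hS.FC_coefk LG hn hτ)
  obtain ⟨e3, he3, H3⟩ := exists_small_extension hδ hS.params (hS.FC_coefb LG hn hτ)
  obtain ⟨e4, he4, H4⟩ := exists_small_extension hδ hS.params (hS.FC_coefd LG hn hτ)
  refine ⟨min (min 1 ρ) (min (min ε₁ e2) (min e3 e4)), by have := LG.pos; positivity,
    fun ε hε0 hε w hw => ?_⟩
  simp only [lt_min_iff] at hε
  obtain ⟨⟨h1, h2⟩, ⟨h3, h4⟩, h5, h6⟩ := hε
  let i : {q ∈ params ρ | q.1 < ε₁} := ⟨(ε, w), ⟨hε0, h1.le, h2.le, hw⟩, h3⟩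
  have hiff : ∀ ξ, IsCanonicalChart n σ δ G ε (perturb ε z₀ w) ξ ↔
      IsSlopeChart n σ (tan δ) (slope G z₀ 0 1 (ε, w)) ξ := fun ξ =>
    isCanonicalChart_iff (q := (ε, w)) (hS.cof_ne_zero i)
  have hD := hS.slopeData LG hn
  refine ⟨?_, fun ξ hξ => ?_⟩
  · obtain ⟨ξ, g1, g2, g3, g4, g5, g6, g7⟩ :=
      exists_chart (by omega : 1 ≤ n) (hD.fs.cd i) (hD.half i) hτ hσδ
    exact ⟨ξ, (hiff ξ).2 ⟨g1, g2, g3, g4, g5, g6, g7⟩⟩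
  · have hξ' := (hiff ξ).1 hξ
    let j : ChartIdx n σ (tan δ) fun i : {q ∈ params ρ | q.1 < ε₁} => slope G z₀ 0 1 i.1 :=
      ⟨(i, ξ), hξ'⟩
    obtain ⟨k, ck, ek, bk⟩ := H2 j h4
    obtain ⟨b, cb, eb, bb⟩ := H3 j h5
    obtain ⟨d, cd, ed, bd⟩ := H4 j h6
    refine ⟨k, b, d, ⟨ck.of_nat (by omega),
      cb.of_nat (by omega),
      cd.of_nat (by omega), fun q hq => ?_, bk, bb, bd⟩,
      fun q hq => (ek hq).symm, fun q hq => (eb hq).symm, fun q hq => (ed hq).symm⟩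
    rw [ek hq]
    have ht := hξ'.target (polarMap_mem hδ (rect_subset σ δ hq))
    obtain ⟨q0, q1, q2, q3⟩ := polarMap_mem_tri hδ hq
    have hx := hξ'.symm_mem ht
    change 0 ≤ coefk κ G ε (zOf z₀ (ε, w)) ξ (ξ.symm (polarMap q))
    rw [coefk_eq (q := (ε, w)) rfl hξ' (ξ.map_target ht) (hS.cof_ne_zero i _ hx)]
    refine mul_nonneg (hS.curvTerm_nonneg LG i hx ?_ ?_) (sq_nonneg _)
    · rwa [hξ'.symm_snd ht]
    · rw [hξ'.symm_snd ht]
      exact hξ'.lt_symm_zero (by omega) hτ (hD.half i) ⟨q0, q1⟩ q2.le q3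

end EllipticSector

end

open EllipticSector in
theorem theorem3p1
    (N ms : ℕ) (hms : 36 * (N + 10) ≤ ms)
    (g : Metric2) (hg : IsMetricNearZero ms g)
    (hN : VanishesToOrder N (gaussCurvature g))
    (Ψ : Plane → Plane) (hΨ : IsSectorChart ms g Ψ)
    (a : ℝ) (p : ℕ → MvPolynomial (Fin 2) ℝ)
    (hz : IsApproxSolution (gaussCurvature g ∘ Ψ) (pullback Ψ g) a ms p)
    (σ lam γ : ℝ) (hσ : 0 < σ) (hlam : 0 < lam) (hγ : 0 < γ)
    (φ : ℝ → ℝ) (hφ : IsCutoff σ φ)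
    (m : ℕ) (hm1 : 1 ≤ m) (hm : m + 4 ≤ ms) :
    ∃ δ₀ > 0, ∀ δ : ℝ, 0 < δ → δ < δ₀ →
      ∃ ε₀ > 0, ∀ ε : ℝ, 0 < ε → ε < ε₀ →
        ∀ w : Plane → ℝ, IsAdmissible w →
          (∃ ξ, IsCanonicalChart (ms - 2) σ δ (pullback Ψ g) ε
            (perturb ε (approxPoly a ms p) w) ξ) ∧
          ∀ ξ, IsCanonicalChart (ms - 2) σ δ (pullback Ψ g) ε
              (perturb ε (approxPoly a ms p) w) ξ →
            ∀ f, MemH σ δ lam γ m 1 f →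
              ∃ u, MemH σ δ lam γ m 1 u ∧
                IsWeakSolution σ δ
                  (theOperator φ (gaussCurvature g ∘ Ψ) (pullback Ψ g) ε
                    (perturb ε (approxPoly a ms p) w) ξ) f u := by
  obtain ⟨n, rfl⟩ : ∃ n, ms = n + 2 := ⟨ms - 2, by omega⟩
  obtain ⟨ρ, V, LG⟩ := exists_localGeometry hg hΨ (a := a) (ms := n + 2) hz.2.1
  obtain ⟨δ₁, hδ₁, H⟩ := exists_isWeakSolution hσ hlam hγ hm1 hφ
  have htan : ∀ᶠ δ in 𝓝 (0 : ℝ), σ * Real.tan δ < 1 / 10 := by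
    have hc : ContinuousAt (fun δ => σ * Real.tan δ) 0 :=
      continuousAt_const.mul (Real.continuousAt_tan.2 (by simp))
    exact hc.eventually_lt_const (by simp)
  obtain ⟨δ₂, hδ₂, h₂⟩ := Metric.eventually_nhds_iff.1 htan
  refine ⟨min δ₁ (min δ₂ (1 / 2)), by positivity, fun δ hδ0 hδ => ?_⟩
  simp only [lt_min_iff] at hδ
  have hσδ := (h₂ (y := δ) (by rw [Real.dist_eq, sub_zero, abs_of_pos hδ0]; exact hδ.2.1)).le
  obtain ⟨ε₀, hε₀, hε⟩ := exists_polarCoef LG hz.1 (by omega) (by omega : m + 2 ≤ n) hδ0 hδ.2.2 hσδ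
  refine ⟨ε₀, hε₀, fun ε hε1 hε2 w hw => ⟨(hε ε hε1 hε2 w hw).1, fun ξ hξ f hf => ?_⟩⟩
  obtain ⟨k, b, d, hP, hk, hb, hd⟩ := (hε ε hε1 hε2 w hw).2 ξ hξ
  exact H δ hδ0 hδ.1 k b d hP _ _ _ (fun q hq => hk hq) (fun q hq => hb hq) (fun q hq => hd hq) f hf
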